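/- **Setting.** Let $T=(V,E,w)$ be a rooted tree with $n=|V|$ vertices and vertex weights $w:V\to\mathbb R_{\ge 0}$, normalized so that $\max_v w(v)=1$, and satisfying the star condition $w(v)\le\sum_{u\in N(v)}w(u)$ for all $v\in V$ (so $n\ge 2$). $T_v$ denotes the subtree rooted at $v$. A hidden target $x\in V$ is sought by queries: a query to $v$ costs $w(v)$ and reports either $x=v$ or the neighbour of $v$ closer to $x$. For a set $U\not\ni x$ of queried vertices, $T\langle U,x\rangle$ is the component of $T\setminus U$ containing $x$, and $r(\cdot)$ is the root of a subtree (its vertex closest to the root of $T$). A search strategy is an adaptive decision tree $\mathcal A$ that, for each target $x$, performs a finite query sequence $Q_{\mathcal A}(T,x)$ after which $x$ has been queried or $T\langle U,x\rangle=\{x\}$. Let $\mathrm{COST}_{\mathcal A}(T,x)$ be the total weight of $Q_{\mathcal A}(T,x)$, let $\mathrm{COST}_{\mathcal A}(T)=\max_x \mathrm{COST}_{\mathcal A}(T,x)$, and let $\mathrm{OPT}(T)$ be the minimum of $\mathrm{COST}_{\mathcal A}(T)$ over all search strategies. For $\omega>0$ and $c\in\mathbb N$ let $d_x$ be the number of queried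 vertices $v$ in $Q_{\mathcal A}(T,x)$ with $w(v)<c\omega$ and $x\in V(T_v)$ (light down queries), and put $$\mathrm{COST}^{(\omega,c)}_{\mathcal A}(T)=\max_{x\in V}\bigl(\mathrm{COST}_{\mathcal A}(T,x)-(2c+1)\,\omega\, d_x\bigr).$$ A query sequence assignment is a map $S:V\to V^*$. It induces $\mathcal A_S$: start with $v=r(T)$ and $U=\emptyset$; while the target has not been hit and $|T\langle U,x\rangle|>1$, query the first vertex $u$ of $S(v)$ lying in $T\langle U,x\rangle$, add $u$ to $U$, and if then $v\ne r(T\langle U,x\rangle)$, set $v\gets r(T\langle U,x\rangle)$. The assignment $S$ is *stable* if $\mathcal A_S$ locates every target and if, whenever the last step is replaced by $v\gets v''$ for arbitrary vertices $v''$ on the path from $r(T\langle U,x\rangle)$ to $x$, the search still locates $x$ and its query sequence is a (not necessarily strict) subsequence of $Q_{\mathcal A_S}(T,x)$. **Proposition.** There are an algorithm (on a real RAM: a machine with unit-cost addition and truncated subtraction of natural numbers, unit-cost field operations and comparisons of reals, no rounding from reals to integers, and no real constants other than natural numbers) and an absolute constant $\gamma$ such that for all integers $c,L\ge 1$ and every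 tree $T$ as above with $n$ vertices, the algorithm, given $c$, $L$ and $T$, halts within $(cn)^{\gamma L}$ steps and outputs a stable query sequence assignment $S$ for $T$ and a real number $\omega>0$ with $$\omega\le\frac1L\,\mathrm{COST}^{(\omega,c)}_{\mathcal A_S}(T)\qquad\text{and}\qquad \mathrm{COST}^{(\omega,c)}_{\mathcal A_S}(T)\le\Bigl(1+\frac{12}{c}\Bigr)\mathrm{OPT}(T).$$ -/

import Mathlib

/-! ## Weighted rooted trees -/

/-- A rooted tree with vertex set `Fin n` and non-negative vertex weights (query times). -/
structure WTree (n : ℕ) where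
  graph : SimpleGraph (Fin n)
  isTree : graph.IsTree
  root : Fin n
  weight : Fin n → ℝ
  weight_nonneg : ∀ v, 0 ≤ weight v

namespace WTree

variable {n : ℕ}

/-- The path between two vertices of the tree. -/
noncomputable def path (T : WTree n) (u v : Fin n) : T.graph.Walk u v :=
  (T.isTree.existsUnique_path u v).exists.choose

/-- `T.towards v x` is the neighbour of `v` that lies closer to `x` (and `v` itself if `x = v`). -/
noncomputable def towards (T : WTree n) (v x : Fin n) : Fin n := (T.path v x).snd

/-- The parent of `v`; by convention the parent of the root is the root. -/
noncomputable def parent (T : WTree n) (v : Fin n) : Fin n := T.towards v T.root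

/-- `x` is a vertex of the subtree rooted at `v`: the path from the root to `x` visits `v`. -/
def InSubtree (T : WTree n) (v x : Fin n) : Prop := v ∈ (T.path T.root x).support

/-- The maximum weight is `1`. -/
def Normalized (T : WTree n) : Prop := (∀ v, T.weight v ≤ 1) ∧ ∃ v, T.weight v = 1

open Classical in
/-- The star condition: no vertex weighs more than all its neighbours together. -/
def StarCondition (T : WTree n) : Prop :=
  ∀ v, T.weight v ≤ ∑ u with T.graph.Adj v u, T.weight u

open Classical in
/-- The vertex set of the component of `T ∖ U` that contains `x` (empty if `x ∈ U`). -/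
noncomputable def comp (T : WTree n) (U : Finset (Fin n)) (x : Fin n) : Finset (Fin n) :=
  {y | ∃ p : T.graph.Walk x y, ∀ z ∈ p.support, z ∉ U}

open Classical in
/-- The root of the subtree with vertex set `C`: the vertex of `C` that is closest to the root
of `T` (the root of `T` if `C` is empty). -/
noncomputable def subtreeRoot (T : WTree n) (C : Finset (Fin n)) : Fin n :=
  if h : C.Nonempty then (C.exists_min_image (T.graph.dist T.root) h).choose else T.root

end WTree

/-! ## Search strategies and their cost -/

/-- An adaptive search strategy, as a decision tree: either stop, or query a vertex and go on
according to the neighbour that is returned. (The search stops at once if the reply is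
"the queried vertex is the target".) -/
inductive Strategy (n : ℕ) where
  | done : Strategy n
  | query (v : Fin n) (next : Fin n → Strategy n) : Strategy n

/-- The sequence of queries performed for target `x`. -/
noncomputable def Strategy.queries {n : ℕ} (T : WTree n) : Strategy n → Fin n → List (Fin n)
  | .done, _ => []
  | .query v next, x => v :: if x = v then [] else (next (T.towards v x)).queries T x

namespace WTree

variable {n : ℕ}

/-- The query sequence `q` locates the target `x`: either `x` has been queried, or the component
containing the target has been reduced to the single vertex `x`. -/
def Locates (T : WTree n) (x : Fin n) (q : List (Fin n)) : Prop :=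
  x ∈ q ∨ T.comp q.toFinset x = {x}

/-- The decision tree `A` is a search strategy for `T`. -/
def IsSearchStrategy (T : WTree n) (A : Strategy n) : Prop :=
  ∀ x, T.Locates x (A.queries T x)

/-- The total weight of the vertices in a query sequence. -/
def totalWeight (T : WTree n) (q : List (Fin n)) : ℝ := (q.map T.weight).sum

/-- The cost of a strategy, given through its query sequences `Q x` for the targets `x`. -/
noncomputable def cost (T : WTree n) (Q : Fin n → List (Fin n)) : ℝ := ⨆ x, T.totalWeight (Q x)

/-- The minimum cost of a search strategy for `T`. -/
noncomputable def opt (T : WTree n) : ℝ :=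
  sInf {r | ∃ A : Strategy n, T.IsSearchStrategy A ∧ r = T.cost (A.queries T)}

open Classical in
/-- The number of light down queries in the query sequence `q` for target `x`. -/
noncomputable def lightDown (T : WTree n) (ω : ℝ) (c : ℕ) (q : List (Fin n)) (x : Fin n) : ℕ :=
  q.countP fun v => T.weight v < c * ω ∧ T.InSubtree v x

/-- The modified cost of a strategy, given through its query sequences. -/
noncomputable def modCost (T : WTree n) (ω : ℝ) (c : ℕ) (Q : Fin n → List (Fin n)) : ℝ :=
  ⨆ x, (T.totalWeight (Q x) - (2 * c + 1) * ω * T.lightDown ω c (Q x) x)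

/-! ## Query sequence assignments -/

open Classical in
/-- The search for target `x` that is directed by a query sequence assignment `S`.
Here `v` is the vertex whose sequence is currently processed and `q` lists the queries performed
so far. As long as the component `C` of the target is not a single vertex (and the target was not
hit), the first vertex of `S v` that lies in `C` is queried. If afterwards `v` is not the root of
the remaining component, `v` is replaced by `jump q'`, where `q'` is the new list of queries.
The value is `none` if no vertex of `S v` lies in `C` (then the search goes on forever without
further queries) or if the bound on the number of rounds is exceeded. -/
noncomputable def search (T : WTree n) (S : Fin n → List (Fin n)) (x : Fin n)
    (jump : List (Fin n) → Fin n) : ℕ → Fin n → List (Fin n) → Option (List (Fin n))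
  | 0, _, _ => none
  | k + 1, v, q =>
    if x ∈ q ∨ (T.comp q.toFinset x).card ≤ 1 then some q
    else
      match (S v).find? (fun u => u ∈ T.comp q.toFinset x) with
      | none => none
      | some u =>
        if v = T.subtreeRoot (T.comp (q ++ [u]).toFinset x) then T.search S x jump k v (q ++ [u])
        else T.search S x jump k (jump (q ++ [u])) (q ++ [u])

/-- The search with replacement rule `jump`, started at the root of `T`. Every query removes a
vertex from the component, so `n` rounds always suffice unless the search is stuck. -/
noncomputable def runWith (T : WTree n) (S : Fin n → List (Fin n)) (x : Fin n)
    (jump : List (Fin n) → Fin n) : Option (List (Fin n)) :=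
  T.search S x jump n T.root []

/-- The search strategy induced by `S`: the current vertex is always the root of the remaining
component. -/
noncomputable def run (T : WTree n) (S : Fin n → List (Fin n)) (x : Fin n) :
    Option (List (Fin n)) :=
  T.runWith S x fun q => T.subtreeRoot (T.comp q.toFinset x)

/-- The query sequences of the strategy induced by `S` (empty where the search is stuck). -/
noncomputable def inducedQueries (T : WTree n) (S : Fin n → List (Fin n)) (x : Fin n) :
    List (Fin n) :=
  (T.run S x).getD []

/-- `S` is stable: if the assignment "current vertex := root of the remaining component" is
replaced by any rule that yields some vertex on the path from that root to the target, then the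
search still succeeds, and it performs a subsequence of the queries of the strategy induced by
`S` (which itself succeeds for every target). -/
def IsStable (T : WTree n) (S : Fin n → List (Fin n)) : Prop :=
  ∀ x, ∃ q, T.run S x = some q ∧
    ∀ jump : List (Fin n) → Fin n,
      (∀ h : List (Fin n), x ∉ h →
        jump h ∈ (T.path (T.subtreeRoot (T.comp h.toFinset x)) x).support) →
      ∃ q', T.runWith S x jump = some q' ∧ q'.Sublist q

end WTree

/-! ## Algorithms: a real random access machine

Programs of a small imperative language over two memories with indirect addressing: one of
natural numbers (unit-cost addition and truncated subtraction) and one of reals (unit-cost field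
operations and comparison). Programs contain no real constants except casts of natural numbers,
and there is no rounding from reals to natural numbers. Every operation costs one unit of time. -/

namespace RAM

structure State where
  nats : ℕ → ℕ
  reals : ℕ → ℝ

inductive NExp where
  | lit (k : ℕ)
  | get (addr : NExp)
  | add (a b : NExp)
  | sub (a b : NExp)

namespace NExp

def eval (s : State) : NExp → ℕ
  | lit k => k
  | get a => s.nats (a.eval s)
  | add a b => a.eval s + b.eval s
  | sub a b => a.eval s - b.eval s

def time : NExp → ℕ
  | lit _ => 1
  | get a => a.time + 1
  | add a b => a.time + b.time + 1
  | sub a b => a.time + b.time + 1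

end NExp

inductive RExp where
  | cast (a : NExp)
  | get (addr : NExp)
  | add (a b : RExp)
  | sub (a b : RExp)
  | mul (a b : RExp)
  | div (a b : RExp)

namespace RExp

noncomputable def eval (s : State) : RExp → ℝ
  | cast a => (a.eval s : ℝ)
  | get a => s.reals (a.eval s)
  | add a b => a.eval s + b.eval s
  | sub a b => a.eval s - b.eval s
  | mul a b => a.eval s * b.eval s
  | div a b => a.eval s / b.eval s

def time : RExp → ℕ
  | cast a => a.time + 1
  | get a => a.time + 1
  | add a b => a.time + b.time + 1
  | sub a b => a.time + b.time + 1
  | mul a b => a.time + b.time + 1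
  | div a b => a.time + b.time + 1

end RExp

inductive BExp where
  | nlt (a b : NExp)
  | rlt (a b : RExp)
  | not (a : BExp)
  | and (a b : BExp)

namespace BExp

def Holds (s : State) : BExp → Prop
  | nlt a b => a.eval s < b.eval s
  | rlt a b => a.eval s < b.eval s
  | not a => ¬ a.Holds s
  | and a b => a.Holds s ∧ b.Holds s

def time : BExp → ℕ
  | nlt a b => a.time + b.time + 1
  | rlt a b => a.time + b.time + 1
  | not a => a.time + 1
  | and a b => a.time + b.time + 1

end BExp

inductive Cmd where
  | skip
  | nset (addr val : NExp)
  | rset (addr : NExp) (val : RExp)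
  | seq (p q : Cmd)
  | ite (b : BExp) (p q : Cmd)
  | loop (b : BExp) (p : Cmd)

/-- `Runs p s t s'`: started in state `s`, the program `p` halts in state `s'` after exactly `t`
units of time. (`loop b p` repeats `p` while `b` holds.) -/
inductive Runs : Cmd → State → ℕ → State → Prop
  | skip (s : State) : Runs .skip s 1 s
  | nset (s : State) (a e : NExp) :
      Runs (.nset a e) s (a.time + e.time + 1)
        { s with nats := Function.update s.nats (a.eval s) (e.eval s) }
  | rset (s : State) (a : NExp) (e : RExp) :
      Runs (.rset a e) s (a.time + e.time + 1)
        { s with reals := Function.update s.reals (a.eval s) (e.eval s) }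
  | seq {p q : Cmd} {s s' s'' : State} {t t' : ℕ} :
      Runs p s t s' → Runs q s' t' s'' → Runs (.seq p q) s (t + t') s''
  | ite_true {b : BExp} {p q : Cmd} {s s' : State} {t : ℕ} :
      b.Holds s → Runs p s t s' → Runs (.ite b p q) s (b.time + 1 + t) s'
  | ite_false {b : BExp} {p q : Cmd} {s s' : State} {t : ℕ} :
      ¬ b.Holds s → Runs q s t s' → Runs (.ite b p q) s (b.time + 1 + t) s'
  | loop_false {b : BExp} {p : Cmd} {s : State} :
      ¬ b.Holds s → Runs (.loop b p) s (b.time + 1) s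
  | loop_true {b : BExp} {p : Cmd} {s s' s'' : State} {t t' : ℕ} :
      b.Holds s → Runs p s t s' → Runs (.loop b p) s' t' s'' →
        Runs (.loop b p) s (b.time + 1 + t + t') s''

/-- The input: `n`, `c`, `L` and the root in the natural-number cells `0`, `1`, `2`, `3`, the
parents of the vertices `0, …, n - 1` in the cells from `4` on, and the weights of the vertices in
the real cells `0, …, n - 1`. All other cells hold `0`. -/
noncomputable def input (c L : ℕ) {n : ℕ} (T : WTree n) : State where
  nats i :=
    match i with
    | 0 => n
    | 1 => c
    | 2 => L
    | 3 => T.root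
    | v + 4 => if h : v < n then (T.parent ⟨v, h⟩ : ℕ) else 0
  reals v := if h : v < n then T.weight ⟨v, h⟩ else 0

/-- The list `l` is stored at address `a`: its length, followed by its entries. -/
def State.ListAt (s : State) (a : ℕ) (l : List ℕ) : Prop :=
  s.nats a = l.length ∧ ∀ (i : ℕ) (h : i < l.length), s.nats (a + 1 + i) = l[i]

/-- The output: `ω` in the real cell `0`, and in the natural-number cell `v`, for `v < n`, the
address at which the sequence `S v` is stored. -/
def State.Outputs (s : State) {n : ℕ} (S : Fin n → List (Fin n)) (ω : ℝ) : Prop :=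
  s.reals 0 = ω ∧ ∀ v : Fin n, s.ListAt (s.nats v) ((S v).map Fin.val)

end RAM

/-! A single linear order of the vertices suffices. If every `S v` is the same list, the vertex
whose sequence is being processed has no influence on the search, so stability is automatic
(`isStable_const`). For a target x exactly those q are queried that come first on the path from q to
x, and x itself only if some neighbour comes later (`exists_run_eq`). What remains is to find, in
time (cn)^O(L), an order and an ω such that the modified cost lies between Lω and (1 + 12/c) OPT.

Upper bound. Weights are rounded to durations d(v) = ⌊w(v)cn⌋ + 1, which costs at most n units, that
is 1/c, per search. Label each vertex with the time at which a given strategy queries it when it is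
the target, or with H ("late") if it is not queried then. Cut the time up to H into D = 192L windows
of width W, and call v light if d(v) < W. Of the labels, the order keeps only the window, light
before heavy within a window, then top-down, late vertices last. A subtree interacts with the rest
of the tree only through the vertices visible from its root, and of these only through three digits
per window. `IsGood` collects conditions on the digits that can be checked edge by edge. The labels
coming from a strategy satisfy them (`IsTiming.isGood`), because vertices visible from a common
vertex occupy disjoint time intervals. Conversely, good labels yield an order of modified cost at
most H/(cn) (`IsGood.sum_le`). Follow the path down to x: after a heavy query the clock shows its
exact end; after a light query the clock is set back to the beginning of its window. This loses at
most 2(W-1) units, and the discount (2c+1)ω for a light down query pays for them. The least H that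
admits good labels is at most the duration of every strategy, so H/(cn) ≤ OPT + 1/c (`horizon_le`).

Lower bound. For short windows take cω = (W-1)/(cn) + 1/(16L); then Lω is a small multiple of OPT/c.
If the order of the keys already costs Lω, it is used as it is. If not, and Lω ≤ 1/4, the subtree at
a vertex of weight 1 or at its parent is moved to the front; by the star condition the search for
that vertex then pays at least 1 - (2c+1)ω, while the other costs grow by O(Lω + 1/c)
(`rankCost_promoted_le`). If Lω > 1/4, then OPT is larger than 18c, and a set of vertices of total
weight about (L+2c+1)ω + 1 is put first; its weight is absorbed by the term 12 OPT/c. For long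
windows ω = 2/c makes all vertices light, and such a set followed by a top-down order does
(`bounds_of_not_short`).

Algorithm. Good labels are found by dynamic programming over the tree (`Mem.table`), whose states
contain the digits as one number; there are (cn)^O(L) such codes. The machine level is hidden behind
a class of functions (`Cmp`) that is closed under calls, bounded recursion, sums, quantifiers and
search. Its running times are powers of `Mem.lim`, which is (cn)^(20000L). -/

/-! ### Memory layout and the basic class of computable functions. -/

namespace RAM

/-- The abstract content of the memory: the input and two unbounded arrays. -/
structure Mem where
  n : ℕ
  c : ℕ
  L : ℕ
  root : ℕ
  par : ℕ → ℕ
  w : ℕ → ℝ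
  arr : ℕ → ℕ → ℕ

namespace Mem

/-- The inputs under consideration. -/
structure WF (m : Mem) : Prop where
  one_le_c : 1 ≤ m.c
  one_le_L : 1 ≤ m.L
  two_le_n : 2 ≤ m.n
  par_eq_zero : ∀ v, m.n ≤ v → m.par v = 0

/-- The universal bound for the number of iterations of a loop. -/
def lim (m : Mem) : ℕ := (m.c * m.n) ^ (20000 * m.L)

theorem WF.two_le {m : Mem} (h : m.WF) : 2 ≤ m.c * m.n :=
  le_trans h.two_le_n (Nat.le_mul_of_pos_left _ h.one_le_c)

theorem WF.pow_le_lim {m : Mem} (h : m.WF) {a : ℕ} (ha : a ≤ 20000 * m.L) :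
    (m.c * m.n) ^ a ≤ m.lim :=
  Nat.pow_le_pow_right (by have := h.two_le; omega) ha

theorem WF.two_le_lim {m : Mem} (h : m.WF) : 2 ≤ m.lim := by
  have := h.pow_le_lim (a := 1) (by have := h.one_le_L; omega)
  rw [pow_one] at this
  exact le_trans h.two_le this

end Mem

/-- The machine state `s` represents the memory `m` and the values `ρ` of the variables. -/
structure Rep (m : Mem) (ρ : ℕ → ℕ) (s : State) : Prop where
  n : s.nats 0 = m.n
  c : s.nats 1 = m.c
  L : s.nats 2 = m.L
  root : s.nats 3 = m.root
  par : ∀ v < m.n, s.nats (v + 4) = m.par v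
  var : ∀ i, s.nats (m.n + (4 + 2 * i)) = ρ i
  arr : ∀ j < 2, ∀ i, s.nats (m.n + (5 + 2 * j) + 4 * i) = m.arr j i
  w : ∀ v, s.reals v = m.w v

/-- The address of a variable. -/
def vaddr (i : ℕ) : NExp := .add (.get (.lit 0)) (.lit (4 + 2 * i))

/-- The value of a variable. -/
def vget (i : ℕ) : NExp := .get (vaddr i)

/-- Assignment to a variable. -/
def vset (i : ℕ) (e : NExp) : Cmd := .nset (vaddr i) e

theorem eval_vaddr {m : Mem} {ρ : ℕ → ℕ} {s : State} (h : Rep m ρ s) (i : ℕ) :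
    (vaddr i).eval s = m.n + (4 + 2 * i) := by
  simp [vaddr, NExp.eval, h.n]

theorem eval_vget {m : Mem} {ρ : ℕ → ℕ} {s : State} (h : Rep m ρ s) (i : ℕ) :
    (vget i).eval s = ρ i := by
  rw [vget, NExp.eval, eval_vaddr h, h.var]

/-- Variables occupy the even offsets from `n`, array `0` the offsets congruent to 1 and array `1`
those congruent to 3 modulo 4. So these regions are disjoint from each other and from the input
below `n + 4`. -/
theorem Rep.update_var {m : Mem} {ρ : ℕ → ℕ} {s : State} (h : Rep m ρ s) (hm : 2 ≤ m.n)
    (i x : ℕ) :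
    Rep m (Function.update ρ i x)
      { s with nats := Function.update s.nats (m.n + (4 + 2 * i)) x } := by
  have key : ∀ a, a ≠ m.n + (4 + 2 * i) →
      Function.update s.nats (m.n + (4 + 2 * i)) x a = s.nats a :=
    fun a ha => Function.update_of_ne ha _ _
  refine ⟨?_, ?_, ?_, ?_, ?_, ?_, ?_, h.w⟩
  · exact (key _ (by omega)).trans h.n
  · exact (key _ (by omega)).trans h.c
  · exact (key _ (by omega)).trans h.L
  · exact (key _ (by omega)).trans h.root
  · intro v hv
    exact (key _ (by omega)).trans (h.par v hv)
  · intro j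
    by_cases hj : j = i
    · subst hj; simp
    · rw [Function.update_of_ne hj]
      exact (key _ (by omega)).trans (h.var j)
  · intro j hj v
    exact (key _ (by omega)).trans (h.arr j hj v)

/-- `Ends p s B Q`: from `s`, the program `p` halts within `B` steps in a state with `Q`. -/
def Ends (p : Cmd) (s : State) (B : ℕ) (Q : State → Prop) : Prop :=
  ∃ t s', Runs p s t s' ∧ t ≤ B ∧ Q s'

theorem Ends.mono {p : Cmd} {s : State} {B B' : ℕ} {Q Q' : State → Prop} (h : Ends p s B Q)
    (hB : B ≤ B') (hQ : ∀ s, Q s → Q' s) : Ends p s B' Q' := by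
  obtain ⟨t, s', h1, h2, h3⟩ := h
  exact ⟨t, s', h1, h2.trans hB, hQ _ h3⟩

theorem Ends.seq {p q : Cmd} {s : State} {B B' : ℕ} {Q Q' : State → Prop} (h : Ends p s B Q)
    (h' : ∀ s, Q s → Ends q s B' Q') : Ends (.seq p q) s (B + B') Q' := by
  obtain ⟨t, s', h1, h2, h3⟩ := h
  obtain ⟨t', s'', h1', h2', h3'⟩ := h' _ h3
  exact ⟨_, s'', .seq h1 h1', by omega, h3'⟩

theorem Ends.vset {m : Mem} {ρ : ℕ → ℕ} {s : State} (h : Rep m ρ s) (hm : 2 ≤ m.n) (i : ℕ)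
    (e : NExp) : Ends (vset i e) s (e.time + 5) (Rep m (Function.update ρ i (e.eval s))) := by
  refine ⟨_, _, .nset _ _ _, ?_, ?_⟩
  · simp [vaddr, NExp.time]; omega
  · rw [eval_vaddr h]
    exact h.update_var hm _ _

theorem Ends.ite {b : BExp} {p q : Cmd} {s : State} {B : ℕ} {Q : State → Prop}
    (hp : b.Holds s → Ends p s B Q) (hq : ¬ b.Holds s → Ends q s B Q) :
    Ends (.ite b p q) s (b.time + 1 + B) Q := by
  by_cases hb : b.Holds s
  · obtain ⟨t, s', h1, h2, h3⟩ := hp hb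
    exact ⟨_, s', .ite_true hb h1, by omega, h3⟩
  · obtain ⟨t, s', h1, h2, h3⟩ := hq hb
    exact ⟨_, s', .ite_false hb h1, by omega, h3⟩

/-- A loop with invariant `I i` after `i` rounds, which stops after exactly `N` rounds. -/
theorem Ends.loop {b : BExp} {p : Cmd} {B N : ℕ} (I : ℕ → State → Prop)
    (hb : ∀ i ≤ N, ∀ s, I i s → (b.Holds s ↔ i < N))
    (hp : ∀ i < N, ∀ s, I i s → Ends p s B (I (i + 1))) {s : State} (h0 : I 0 s) :
    Ends (.loop b p) s ((N + 1) * (b.time + 1 + B)) (I N) := by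
  have main : ∀ d i, i + d = N → ∀ s, I i s →
      Ends (.loop b p) s ((d + 1) * (b.time + 1 + B)) (I N) := by
    intro d
    induction d with
    | zero =>
      intro i hi s hs
      have hi' : i = N := by omega
      subst hi'
      refine ⟨_, s, .loop_false ?_, ?_, hs⟩
      · rw [hb _ le_rfl s hs]; omega
      · simp
    | succ d ih =>
      intro i hi s hs
      obtain ⟨t, s', h1, h2, h3⟩ := hp i (by omega) s hs
      obtain ⟨t', s'', h1', h2', h3'⟩ := ih (i + 1) (by omega) s' h3
      refine ⟨_, s'', .loop_true ((hb i (by omega) s hs).2 (by omega)) h1 h1', ?_, h3'⟩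
      calc b.time + 1 + t + t' ≤ b.time + 1 + B + (d + 1) * (b.time + 1 + B) := by omega
        _ = _ := by ring
  exact main N 0 (by omega) s h0

/-- Tuples of natural numbers, stored in variables. -/
class Ctx (α : Type) where
  len : ℕ
  enc : α → List ℕ
  enc_length : ∀ a, (enc a).length = len

instance : Ctx Unit := ⟨0, fun _ => [], fun _ => rfl⟩

instance {α : Type} [Ctx α] : Ctx (α × ℕ) :=
  ⟨Ctx.len α + 1, fun p => Ctx.enc p.1 ++ [p.2], fun p => by simp [Ctx.enc_length]⟩

/-- The program `p` stores `f m a` in the variable `k`, within `m.lim ^ K` steps, when the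
arguments `a` are stored in the variables `pos`; the variables below `k` are preserved. -/
def Evals {α : Type} [Ctx α] (f : Mem → α → ℕ) (pos : List ℕ) (k : ℕ) (p : Cmd) (K : ℕ) : Prop :=
  ∀ (m : Mem) (ρ : ℕ → ℕ) (s : State) (a : α), m.WF → Rep m ρ s → Ctx.enc a = pos.map ρ →
    Ends p s (m.lim ^ K) fun s' => ∃ ρ', Rep m ρ' s' ∧ (∀ i < k, ρ' i = ρ i) ∧ ρ' k = f m a

/-- `f` is computable in polynomial time (in the bound `Mem.lim`). -/
def Cmp {α : Type} [Ctx α] (f : Mem → α → ℕ) : Prop :=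
  ∀ (pos : List ℕ) (k : ℕ), pos.length = Ctx.len α → (∀ x ∈ pos, x < k) → ∃ p K, Evals f pos k p K

/-- Time bounds are kept in the form `lim ^ K`: since the base is at least 2, composing two programs
only changes the exponent, and a fixed number of steps is absorbed by `const_le_pow`. -/
theorem pow_add_pow_le {B a b : ℕ} (hB : 2 ≤ B) : B ^ a + B ^ b ≤ B ^ (a + b + 1) := by
  have h1 : B ^ a ≤ B ^ (a + b) := Nat.pow_le_pow_right (by omega) (by omega)
  have h2 : B ^ b ≤ B ^ (a + b) := Nat.pow_le_pow_right (by omega) (by omega)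
  calc B ^ a + B ^ b ≤ B ^ (a + b) * 2 := by omega
    _ ≤ B ^ (a + b) * B := Nat.mul_le_mul_left _ hB
    _ = _ := by rw [pow_succ]

theorem const_le_pow {B : ℕ} (hB : 2 ≤ B) (a : ℕ) : a ≤ B ^ a :=
  (Nat.lt_two_pow_self).le.trans (Nat.pow_le_pow_left hB a)

section Closure

variable {α : Type} [Ctx α]

/-- Evaluation of a simple expression. -/
theorem Evals.of_exp {f : Mem → α → ℕ} {pos : List ℕ} {k : ℕ} (e : NExp)
    (he : ∀ (m : Mem) (ρ : ℕ → ℕ) (s : State) (a : α), m.WF → Rep m ρ s → Ctx.enc a = pos.map ρ →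
      e.eval s = f m a) : Evals f pos k (vset k e) (e.time + 5) := by
  intro m ρ s a hm hs ha
  refine (Ends.vset hs hm.two_le_n k e).mono (const_le_pow hm.two_le_lim _) ?_
  intro s' hs'
  refine ⟨_, hs', fun i hi => Function.update_of_ne (by omega) _ _, ?_⟩
  rw [Function.update_self, he m ρ s a hm hs ha]

theorem Evals.map_eq {pos : List ℕ} {k : ℕ} (hpos : ∀ x ∈ pos, x < k) {ρ ρ' : ℕ → ℕ}
    (h : ∀ i < k, ρ' i = ρ i) : pos.map ρ' = pos.map ρ :=
  List.map_congr_left fun x hx => h x (hpos x hx)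

theorem Cmp.lit (a : ℕ) : Cmp (fun (_ : Mem) (_ : α) => a) := fun _ _ _ _ =>
  ⟨_, _, Evals.of_exp (.lit a) fun _ _ _ _ _ _ _ => rfl⟩

theorem Cmp.n : Cmp (fun (m : Mem) (_ : α) => m.n) := fun _ _ _ _ =>
  ⟨_, _, Evals.of_exp (.get (.lit 0)) fun _ _ _ _ _ h _ => h.n⟩

theorem Cmp.c : Cmp (fun (m : Mem) (_ : α) => m.c) := fun _ _ _ _ =>
  ⟨_, _, Evals.of_exp (.get (.lit 1)) fun _ _ _ _ _ h _ => h.c⟩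

theorem Cmp.L : Cmp (fun (m : Mem) (_ : α) => m.L) := fun _ _ _ _ =>
  ⟨_, _, Evals.of_exp (.get (.lit 2)) fun _ _ _ _ _ h _ => h.L⟩

theorem Cmp.root : Cmp (fun (m : Mem) (_ : α) => m.root) := fun _ _ _ _ =>
  ⟨_, _, Evals.of_exp (.get (.lit 3)) fun _ _ _ _ _ h _ => h.root⟩

theorem Cmp.congr {f g : Mem → α → ℕ} (hf : Cmp f) (h : ∀ m a, m.WF → f m a = g m a) : Cmp g := by
  intro pos k h1 h2
  obtain ⟨p, K, hp⟩ := hf pos k h1 h2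
  refine ⟨p, K, fun m ρ s a hm hs ha => ?_⟩
  rw [← h m a hm]
  exact hp m ρ s a hm hs ha

/-- The last component of the context. -/
theorem Cmp.last : Cmp (fun (_ : Mem) (a : α × ℕ) => a.2) := by
  intro pos k h1 h2
  have hne : pos ≠ [] := by
    rintro rfl
    simp [Ctx.len] at h1
  refine ⟨_, _, Evals.of_exp (vget (pos.getLast hne)) fun m ρ s a hm hs ha => ?_⟩
  rw [eval_vget hs]
  have : (Ctx.enc a).getLast? = (pos.map ρ).getLast? := by rw [ha]
  simp only [Ctx.enc, List.getLast?_append, List.getLast?_singleton, List.getLast?_map,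
    List.getLast?_eq_some_getLast hne] at this
  simpa using this.symm

/-- Functions that do not use the last component of the context. -/
theorem Cmp.weaken {f : Mem → α → ℕ} (hf : Cmp f) : Cmp (fun m (a : α × ℕ) => f m a.1) := by
  intro pos k h1 h2
  obtain ⟨p, K, hp⟩ := hf pos.dropLast k (by simp [h1, Ctx.len])
    fun x hx => h2 x (List.dropLast_subset _ hx)
  refine ⟨p, K, fun m ρ s a hm hs ha => hp m ρ s a.1 hm hs ?_⟩
  have : (Ctx.enc a).dropLast = (pos.map ρ).dropLast := by rw [ha]
  simpa [Ctx.enc, List.map_dropLast] using this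

/-- Combination of two values by a simple program. -/
theorem Cmp.binary {f g h : Mem → α → ℕ} (hf : Cmp f) (hg : Cmp g) (q : ℕ → Cmd) (K' : ℕ)
    (hq : ∀ (k : ℕ) (m : Mem) (ρ : ℕ → ℕ) (s : State) (a : α), m.WF → Rep m ρ s →
      ρ k = f m a → ρ (k + 1) = g m a → Ends (q k) s (m.lim ^ K') (Rep m (Function.update ρ k (h m a)))) :
    Cmp h := by
  intro pos k h1 h2
  obtain ⟨p1, K1, hp1⟩ := hf pos k h1 h2
  -- The second value is computed above `k`, so that the first one survives.
  obtain ⟨p2, K2, hp2⟩ := hg pos (k + 1) h1 fun x hx => (h2 x hx).trans (by omega)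
  refine ⟨.seq p1 (.seq p2 (q k)), K1 + (K2 + K' + 1) + 1, ?_⟩
  intro m ρ s a hm hs ha
  refine ((hp1 m ρ s a hm hs ha).seq (B' := m.lim ^ (K2 + K' + 1))
    (Q' := fun s' => ∃ ρ', Rep m ρ' s' ∧ (∀ i < k, ρ' i = ρ i) ∧ ρ' k = h m a) ?_).mono
    (pow_add_pow_le hm.two_le_lim) fun _ h => h
  rintro s1 ⟨ρ1, hs1, h3, h4⟩
  refine ((hp2 m ρ1 s1 a hm hs1 ((Evals.map_eq h2 h3).trans ha.symm).symm).seq (B' := m.lim ^ K')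
    (Q' := fun s' => ∃ ρ', Rep m ρ' s' ∧ (∀ i < k, ρ' i = ρ i) ∧ ρ' k = h m a) ?_).mono
    (pow_add_pow_le hm.two_le_lim) fun _ h => h
  rintro s2 ⟨ρ2, hs2, h5, h6⟩
  refine (hq k m ρ2 s2 a hm hs2 ((h5 k (by omega)).trans h4) h6).mono le_rfl ?_
  intro s3 hs3
  refine ⟨_, hs3, fun i hi => ?_, Function.update_self ..⟩
  rw [Function.update_of_ne (by omega), h5 i (by omega), h3 i hi]

theorem Cmp.binary_exp {f g h : Mem → α → ℕ} (hf : Cmp f) (hg : Cmp g) (e : ℕ → NExp) (K' : ℕ)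
    (ht : ∀ k, (e k).time ≤ K')
    (he : ∀ (k : ℕ) (m : Mem) (ρ : ℕ → ℕ) (s : State) (a : α), m.WF → Rep m ρ s →
      ρ k = f m a → ρ (k + 1) = g m a → (e k).eval s = h m a) : Cmp h := by
  refine Cmp.binary hf hg (fun k => vset k (e k)) (K' + 5) ?_
  intro k m ρ s a hm hs h1 h2
  rw [← he k m ρ s a hm hs h1 h2]
  refine (Ends.vset hs hm.two_le_n k _).mono ?_ fun _ h => h
  exact le_trans (by have := ht k; omega) (const_le_pow hm.two_le_lim _)

theorem Cmp.add {f g : Mem → α → ℕ} (hf : Cmp f) (hg : Cmp g) : Cmp (fun m a => f m a + g m a) :=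
  Cmp.binary_exp hf hg (fun k => .add (vget k) (vget (k + 1))) 20
    (fun k => by simp [vget, vaddr, NExp.time]) fun k m ρ s a _ hs h1 h2 => by
      simp [NExp.eval, eval_vget hs, h1, h2]

theorem Cmp.sub {f g : Mem → α → ℕ} (hf : Cmp f) (hg : Cmp g) : Cmp (fun m a => f m a - g m a) :=
  Cmp.binary_exp hf hg (fun k => .sub (vget k) (vget (k + 1))) 20
    (fun k => by simp [vget, vaddr, NExp.time]) fun k m ρ s a _ hs h1 h2 => by
      simp [NExp.eval, eval_vget hs, h1, h2]

theorem Cmp.unary_exp {f h : Mem → α → ℕ} (hf : Cmp f) (e : ℕ → NExp) (K' : ℕ)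
    (ht : ∀ k, (e k).time ≤ K')
    (he : ∀ (k : ℕ) (m : Mem) (ρ : ℕ → ℕ) (s : State) (a : α), m.WF → Rep m ρ s →
      ρ k = f m a → (e k).eval s = h m a) : Cmp h :=
  Cmp.binary_exp hf hf e K' ht fun k m ρ s a hm hs h1 _ => he k m ρ s a hm hs h1

/-- The machine cannot multiply naturals, so the stride 4 of an array is formed by three additions.
-/
theorem Cmp.arr {f : Mem → α → ℕ} (hf : Cmp f) (j : ℕ) (hj : j < 2) :
    Cmp (fun m a => m.arr j (f m a)) := by
  refine Cmp.unary_exp hf (fun k => .get (.add (.add (.get (.lit 0)) (.lit (5 + 2 * j)))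
    (.add (.add (vget k) (vget k)) (.add (vget k) (vget k))))) 40
    (fun k => by simp [vget, vaddr, NExp.time]) fun k m ρ s a _ hs h1 => ?_
  simp only [NExp.eval, eval_vget hs, h1, hs.n]
  rw [← hs.arr j hj]
  congr 1
  omega

/-- Behind the parents of the `n` vertices the memory holds variables and arrays. The test avoids
reading those, and `WF.par_eq_zero` makes 0 the correct value. -/
theorem Cmp.par {f : Mem → α → ℕ} (hf : Cmp f) : Cmp (fun m a => m.par (f m a)) := by
  refine Cmp.binary hf hf (fun k => .ite (.nlt (vget k) (.get (.lit 0)))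
    (vset k (.get (.add (vget k) (.lit 4)))) (vset k (.lit 0))) 40 ?_
  intro k m ρ s a hm hs h1 _
  refine Ends.mono (B := 9 + 1 + 13) (Q := Rep m (Function.update ρ k (m.par (f m a)))) ?_
    (le_trans (by norm_num) (const_le_pow hm.two_le_lim 40)) fun _ h => h
  refine Ends.mono (Ends.ite (B := 13) (Q := Rep m (Function.update ρ k (m.par (f m a)))) ?_ ?_)
    ?_ fun _ h => h
  · intro hlt
    simp only [BExp.Holds, eval_vget hs, NExp.eval, hs.n, h1] at hlt
    have := Ends.vset hs hm.two_le_n k (.get (.add (vget k) (.lit 4)))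
    simp only [NExp.eval, eval_vget hs, h1, hs.par _ hlt] at this
    exact this.mono (by simp [vget, vaddr, NExp.time]) fun _ h => h
  · intro hlt
    simp only [BExp.Holds, eval_vget hs, NExp.eval, hs.n, h1] at hlt
    have := Ends.vset hs hm.two_le_n k (.lit 0)
    rw [hm.par_eq_zero _ (by omega)]
    simp only [NExp.eval] at this
    exact this.mono (by simp [NExp.time]) fun _ h => h
  · simp [vget, vaddr, NExp.time, BExp.time]

open Classical in
/-- Computable predicates. -/
def CmpP (P : Mem → α → Prop) : Prop := Cmp fun m a => if P m a then 1 else 0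

theorem CmpP.ite {P : Mem → α → Prop} [∀ m a, Decidable (P m a)] {f g : Mem → α → ℕ}
    (hP : CmpP P) (hf : Cmp f) (hg : Cmp g) : Cmp (fun m a => if P m a then f m a else g m a) := by
  intro pos k h1 h2
  obtain ⟨p0, K0, hp0⟩ := hP pos k h1 h2
  obtain ⟨p1, K1, hp1⟩ := hf pos k h1 h2
  obtain ⟨p2, K2, hp2⟩ := hg pos k h1 h2
  refine ⟨.seq p0 (.ite (.nlt (.lit 0) (vget k)) p1 p2), K0 + (10 + (K1 + K2 + 1) + 1) + 1, ?_⟩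
  intro m ρ s a hm hs ha
  refine ((hp0 m ρ s a hm hs ha).seq (B' := m.lim ^ (10 + (K1 + K2 + 1) + 1))
    (Q' := fun s' => ∃ ρ', Rep m ρ' s' ∧ (∀ i < k, ρ' i = ρ i) ∧
      ρ' k = if P m a then f m a else g m a) ?_).mono
    (pow_add_pow_le hm.two_le_lim) fun _ h => h
  rintro s1 ⟨ρ1, hs1, h3, h4⟩
  have ha1 : Ctx.enc a = pos.map ρ1 := ((Evals.map_eq h2 h3).trans ha.symm).symm
  refine (Ends.ite (B := m.lim ^ (K1 + K2 + 1))
    (Q := fun s' => ∃ ρ', Rep m ρ' s' ∧ (∀ i < k, ρ' i = ρ i) ∧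
      ρ' k = if P m a then f m a else g m a) ?_ ?_).mono ?_ fun _ h => h
  · intro hb
    simp only [BExp.Holds, NExp.eval, eval_vget hs1, h4] at hb
    have hPa : P m a := by by_contra hn; simp [hn] at hb
    refine (hp1 m ρ1 s1 a hm hs1 ha1).mono
      (Nat.pow_le_pow_right (by have := hm.two_le_lim; omega) (by omega)) ?_
    rintro s2 ⟨ρ2, hs2, h5, h6⟩
    exact ⟨ρ2, hs2, fun i hi => (h5 i hi).trans (h3 i hi), by rw [h6, if_pos hPa]⟩
  · intro hb
    simp only [BExp.Holds, NExp.eval, eval_vget hs1, h4] at hb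
    have hPa : ¬ P m a := by intro hn; simp [hn] at hb
    refine (hp2 m ρ1 s1 a hm hs1 ha1).mono
      (Nat.pow_le_pow_right (by have := hm.two_le_lim; omega) (by omega)) ?_
    rintro s2 ⟨ρ2, hs2, h5, h6⟩
    exact ⟨ρ2, hs2, fun i hi => (h5 i hi).trans (h3 i hi), by rw [h6, if_neg hPa]⟩
  · have : (BExp.nlt (.lit 0) (vget k)).time + 1 ≤ 10 := by
      simp [vget, vaddr, NExp.time, BExp.time]
    exact le_trans (Nat.add_le_add_right (this.trans (const_le_pow hm.two_le_lim 10)) _)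
      (pow_add_pow_le hm.two_le_lim)

theorem CmpP.congr {P Q : Mem → α → Prop} (hP : CmpP P) (h : ∀ m a, m.WF → (P m a ↔ Q m a)) :
    CmpP Q := by
  unfold CmpP at *
  refine Cmp.congr hP fun m a hm => ?_
  by_cases hp : P m a
  · rw [if_pos hp, if_pos ((h m a hm).1 hp)]
  · rw [if_neg hp, if_neg (mt (h m a hm).2 hp)]

theorem CmpP.of_ite {P : Mem → α → Prop} [∀ m a, Decidable (P m a)]
    (h : Cmp fun m a => if P m a then 1 else 0) : CmpP P :=
  Cmp.congr h fun m a _ => by split_ifs <;> rfl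

theorem CmpP.not {P : Mem → α → Prop} (hP : CmpP P) : CmpP (fun m a => ¬ P m a) := by
  classical
  exact CmpP.of_ite (Cmp.congr (CmpP.ite hP (Cmp.lit 0) (Cmp.lit 1)) fun m a _ => by simp)

theorem CmpP.and {P Q : Mem → α → Prop} (hP : CmpP P) (hQ : CmpP Q) :
    CmpP (fun m a => P m a ∧ Q m a) := by
  classical
  refine CmpP.of_ite (Cmp.congr (CmpP.ite hP hQ (Cmp.lit 0)) fun m a _ => ?_)
  by_cases h : P m a <;> simp [h]

theorem CmpP.or {P Q : Mem → α → Prop} (hP : CmpP P) (hQ : CmpP Q) :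
    CmpP (fun m a => P m a ∨ Q m a) :=
  CmpP.congr ((hP.not.and hQ.not).not) fun m a _ => by tauto

theorem CmpP.imp {P Q : Mem → α → Prop} (hP : CmpP P) (hQ : CmpP Q) :
    CmpP (fun m a => P m a → Q m a) :=
  CmpP.congr (hP.not.or hQ) fun m a _ => by tauto

theorem CmpP.lt {f g : Mem → α → ℕ} (hf : Cmp f) (hg : Cmp g) : CmpP (fun m a => f m a < g m a) := by
  classical
  -- With truncated subtraction, `1 - (1 - (g - f))` is the indicator of `f < g`.
  refine CmpP.of_ite (Cmp.congr (((Cmp.lit 1).sub ((Cmp.lit 1).sub (hg.sub hf)))) fun m a _ => ?_)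
  split_ifs <;> omega

theorem CmpP.le {f g : Mem → α → ℕ} (hf : Cmp f) (hg : Cmp g) : CmpP (fun m a => f m a ≤ g m a) :=
  CmpP.congr (CmpP.lt hg hf).not fun m a _ => by simp

theorem CmpP.eq {f g : Mem → α → ℕ} (hf : Cmp f) (hg : Cmp g) : CmpP (fun m a => f m a = g m a) :=
  CmpP.congr ((CmpP.le hf hg).and (CmpP.le hg hf)) fun m a _ => by omega

/-- Comparison of a rational multiple of a weight with a natural number. -/
theorem CmpP.weight_lt {f g h : Mem → α → ℕ} (hf : Cmp f) (hg : Cmp g) (hh : Cmp h) :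
    CmpP (fun m a => m.w (f m a) * (g m a : ℝ) < (h m a : ℝ)) := by
  intro pos k h1 h2
  obtain ⟨p1, K1, hp1⟩ := hf pos k h1 h2
  obtain ⟨p2, K2, hp2⟩ := hg pos (k + 1) h1 fun x hx => (h2 x hx).trans (by omega)
  obtain ⟨p3, K3, hp3⟩ := hh pos (k + 2) h1 fun x hx => (h2 x hx).trans (by omega)
  let b : BExp := .rlt (.mul (.get (vget k)) (.cast (vget (k + 1)))) (.cast (vget (k + 2)))
  refine ⟨.seq p1 (.seq p2 (.seq p3 (.ite b (vset k (.lit 1)) (vset k (.lit 0))))),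
    K1 + (K2 + (K3 + 40 + 1) + 1) + 1, ?_⟩
  intro m ρ s a hm hs ha
  set R := fun s' => ∃ ρ', Rep m ρ' s' ∧ (∀ i < k, ρ' i = ρ i) ∧
    ρ' k = @_root_.ite _ (m.w (f m a) * (g m a : ℝ) < (h m a : ℝ)) (Classical.propDecidable _) 1 0 with hR
  refine ((hp1 m ρ s a hm hs ha).seq (B' := m.lim ^ (K2 + (K3 + 40 + 1) + 1)) (Q' := R) ?_).mono
    (pow_add_pow_le hm.two_le_lim) fun _ h => h
  rintro s1 ⟨ρ1, hs1, h3, h4⟩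
  have ha1 : Ctx.enc a = pos.map ρ1 := ((Evals.map_eq h2 h3).trans ha.symm).symm
  refine ((hp2 m ρ1 s1 a hm hs1 ha1).seq (B' := m.lim ^ (K3 + 40 + 1)) (Q' := R) ?_).mono
    (pow_add_pow_le hm.two_le_lim) fun _ h => h
  rintro s2 ⟨ρ2, hs2, h5, h6⟩
  have ha2 : Ctx.enc a = pos.map ρ2 :=
    ((Evals.map_eq h2 fun i hi => h5 i (by omega)).trans ha1.symm).symm
  refine ((hp3 m ρ2 s2 a hm hs2 ha2).seq (B' := m.lim ^ 40) (Q' := R) ?_).mono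
    (pow_add_pow_le hm.two_le_lim) fun _ h => h
  rintro s3 ⟨ρ3, hs3, h7, h8⟩
  have e0 : ρ3 k = f m a := by rw [h7 k (by omega), h5 k (by omega), h4]
  have e1 : ρ3 (k + 1) = g m a := by rw [h7 _ (by omega), h6]
  have hpres : ∀ i < k, ρ3 i = ρ i := fun i hi => by
    rw [h7 i (by omega), h5 i (by omega), h3 i hi]
  have hb : b.Holds s3 ↔ m.w (f m a) * (g m a : ℝ) < (h m a : ℝ) := by
    simp only [b, BExp.Holds, RExp.eval, eval_vget hs3, e0, e1, h8, hs3.w]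
  refine Ends.mono (Ends.ite (B := 6) (Q := R) ?_ ?_) ?_ fun _ h => h
  · intro hb'
    refine (Ends.vset hs3 hm.two_le_n k (.lit 1)).mono (by simp [NExp.time]) fun s' hs' => ?_
    refine ⟨_, hs', fun i hi => ?_, ?_⟩
    · rw [Function.update_of_ne (by omega), hpres i hi]
    · simp [NExp.eval, hb.1 hb']
  · intro hb'
    refine (Ends.vset hs3 hm.two_le_n k (.lit 0)).mono (by simp [NExp.time]) fun s' hs' => ?_
    refine ⟨_, hs', fun i hi => ?_, ?_⟩
    · rw [Function.update_of_ne (by omega), hpres i hi]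
    · have := mt hb.2 hb'
      simp [NExp.eval, this]
  · refine le_trans ?_ (const_le_pow hm.two_le_lim 40)
    simp [b, vget, vaddr, NExp.time, BExp.time, RExp.time]

end Closure

end RAM


/-! ### Bounded recursion, calls, sums, quantifiers and search. -/

namespace RAM

section Closure

variable {α : Type} [Ctx α]

/-- A loop of at most `lim` rounds again costs a power of `lim`; for this reason every number of
rounds must be bounded by `Mem.lim`. -/
theorem loop_time_le {B N t K : ℕ} (hB : 2 ≤ B) (hN : N ≤ B) :
    (N + 1) * (t + 1 + B ^ K) ≤ B ^ (2 + (t + 1 + K + 1)) := by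
  have h1 : N + 1 ≤ B ^ 2 := by nlinarith
  have h2 : t + 1 + B ^ K ≤ B ^ (t + 1 + K + 1) :=
    le_trans (Nat.add_le_add_right (const_le_pow hB (t + 1)) _) (pow_add_pow_le hB)
  rw [pow_add]
  exact Nat.mul_le_mul h1 h2

/-- Primitive recursion with a bounded number of rounds. -/
theorem Cmp.natRec {b init : Mem → α → ℕ} {step : Mem → α → ℕ → ℕ → ℕ} (hb : Cmp b)
    (hlim : ∀ m a, m.WF → b m a ≤ m.lim) (hi : Cmp init)
    (hs : Cmp fun m (p : (α × ℕ) × ℕ) => step m p.1.1 p.1.2 p.2) :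
    Cmp fun m a => Nat.rec (init m a) (fun i acc => step m a i acc) (b m a) := by
  intro pos k h1 h2
  have h2' : ∀ l, k ≤ l → ∀ x ∈ pos, x < l := fun l hl x hx => (h2 x hx).trans_le hl
  obtain ⟨p1, K1, hp1⟩ := hb pos k h1 h2
  obtain ⟨p2, K2, hp2⟩ := hi pos (k + 2) h1 (h2' _ (by omega))
  obtain ⟨p3, K3, hp3⟩ := hs (pos ++ [k + 1] ++ [k + 2]) (k + 3) (by simp [h1, Ctx.len])
    (by
      intro x hx
      simp only [List.mem_append, List.mem_singleton] at hx
      rcases hx with (hx | hx) | hx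
      · exact h2' _ (by omega) x hx
      · omega
      · omega)
  -- Variables `k`, `k + 1` and `k + 2` hold the number of rounds, the current round and the
  -- accumulator; `k + 3` receives the new accumulator while the old one is still being read.
  let body : Cmd := .seq p3 (.seq (vset (k + 2) (vget (k + 3)))
    (vset (k + 1) (.add (vget (k + 1)) (.lit 1))))
  let g : BExp := .nlt (vget (k + 1)) (vget k)
  refine ⟨.seq p1 (.seq p2 (.seq (vset (k + 1) (.lit 0)) (.seq (.loop g body)
    (vset k (vget (k + 2)))))), K1 + (K2 + (6 + ((2 + (g.time + 1 + (K3 + 30 + 1) + 1)) + 20 + 1) + 1) + 1) + 1, ?_⟩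
  intro m ρ s a hm hrep ha
  have hB := hm.two_le_lim
  have hn := hm.two_le_n
  set val : ℕ → ℕ := fun j => Nat.rec (init m a) (fun i acc => step m a i acc) j with hval
  set R := fun s' => ∃ ρ', Rep m ρ' s' ∧ (∀ i < k, ρ' i = ρ i) ∧ ρ' k = val (b m a) with hR
  have enc_of : ∀ ρ' : ℕ → ℕ, (∀ i < k, ρ' i = ρ i) → Ctx.enc a = pos.map ρ' := fun ρ' h => by
    rw [ha]
    exact (List.map_congr_left fun x hx => h x (h2 x hx)).symm
  refine ((hp1 m ρ s a hm hrep ha).seq (B' := m.lim ^ (K2 + (6 + ((2 + (g.time + 1 + (K3 + 30 + 1) + 1)) + 20 + 1) + 1) + 1))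
    (Q' := R) ?_).mono (pow_add_pow_le hB) fun _ h => h
  rintro s1 ⟨ρ1, hs1, h3, h4⟩
  refine ((hp2 m ρ1 s1 a hm hs1 (enc_of _ h3)).seq
    (B' := m.lim ^ (6 + ((2 + (g.time + 1 + (K3 + 30 + 1) + 1)) + 20 + 1) + 1))
    (Q' := R) ?_).mono (pow_add_pow_le hB) fun _ h => h
  rintro s2 ⟨ρ2, hs2, h5, h6⟩
  refine (((Ends.vset hs2 hn (k + 1) (.lit 0)).mono (B' := m.lim ^ 6) (const_le_pow hB 6)
    fun _ h => h).seq
    (B' := m.lim ^ ((2 + (g.time + 1 + (K3 + 30 + 1) + 1)) + 20 + 1))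
    (Q' := R) ?_).mono (pow_add_pow_le hB) fun _ h => h
  intro s3 hs3
  let I : ℕ → State → Prop := fun i s' => ∃ ρ', Rep m ρ' s' ∧ (∀ i < k, ρ' i = ρ i) ∧
    ρ' k = b m a ∧ ρ' (k + 1) = i ∧ ρ' (k + 2) = val i
  have hloop := Ends.loop (b := g) (p := body) (B := m.lim ^ (K3 + 30 + 1)) (N := b m a) I ?_ ?_
    (s := s3) ?_
  rotate_left
  · rintro i - s' ⟨ρ', hs', _, e1, e2, _⟩
    simp only [g, BExp.Holds, eval_vget hs', e1, e2]
  · rintro i hi s' ⟨ρ', hs', e0, e1, e2, e3⟩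
    have henc : Ctx.enc ((a, i), val i) = (pos ++ [k + 1] ++ [k + 2]).map ρ' := by
      simp [Ctx.enc, enc_of ρ' e0, e2, e3]
    refine ((hp3 m ρ' s' ((a, i), val i) hm hs' henc).seq (B' := m.lim ^ 30)
      (Q' := I (i + 1)) ?_).mono (pow_add_pow_le hB) fun _ h => h
    rintro s4 ⟨ρ4, hs4, f1, f2⟩
    refine Ends.mono (B := 15 + 15) (Q := I (i + 1)) ?_ (const_le_pow hB 30) fun _ h => h
    refine Ends.seq ((Ends.vset hs4 hn (k + 2) (vget (k + 3))).mono (B' := 15)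
      (by simp [vget, vaddr, NExp.time]) fun _ h => h) fun s5 hs5 => ?_
    refine (Ends.vset hs5 hn (k + 1) (.add (vget (k + 1)) (.lit 1))).mono
      (by simp [vget, vaddr, NExp.time]) fun s6 hs6 => ?_
    refine ⟨_, hs6, fun j hj => ?_, ?_, ?_, ?_⟩
    · rw [Function.update_of_ne (by omega), Function.update_of_ne (by omega), f1 _ (by omega),
        e0 j hj]
    · rw [Function.update_of_ne (by omega), Function.update_of_ne (by omega), f1 _ (by omega), e1]
    · rw [Function.update_self, NExp.eval, eval_vget hs5, Function.update_of_ne (by omega),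
        f1 _ (by omega), e2, NExp.eval]
    · rw [Function.update_of_ne (by omega), Function.update_self, eval_vget hs4, f2]
  · refine ⟨_, hs3, fun j hj => ?_, ?_, ?_, ?_⟩
    · rw [Function.update_of_ne (by omega), h5 _ (by omega), h3 j hj]
    · rw [Function.update_of_ne (by omega), h5 _ (by omega), h4]
    · rw [Function.update_self, NExp.eval]
    · exact (Function.update_of_ne (by omega) _ _).trans h6
  refine ((hloop.mono (loop_time_le hB (hlim m a hm)) fun _ h => h).seq (B' := m.lim ^ 20)
    (Q' := R) ?_).mono (pow_add_pow_le hB) fun _ h => h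
  rintro s7 ⟨ρ7, hs7, e0, e1, e2, e3⟩
  refine (Ends.vset hs7 hn k (vget (k + 2))).mono
    (le_trans (by simp [vget, vaddr, NExp.time]) (const_le_pow hB 20)) fun s8 hs8 => ?_
  refine ⟨_, hs8, fun j hj => ?_, ?_⟩
  · rw [Function.update_of_ne (by omega), e0 j hj]
  · rw [Function.update_self, eval_vget hs7, e3]

/-- Tuples of computable functions. -/
def CmpT {γ : Type} [Ctx γ] (g : Mem → α → γ) : Prop :=
  ∀ (pos : List ℕ) (k : ℕ), pos.length = Ctx.len α → (∀ x ∈ pos, x < k) →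
    ∃ p K l, ∃ pos' : List ℕ, k ≤ l ∧ pos'.length = Ctx.len γ ∧ (∀ x ∈ pos', x < l) ∧
      ∀ (m : Mem) (ρ : ℕ → ℕ) (s : State) (a : α), m.WF → Rep m ρ s → Ctx.enc a = pos.map ρ →
        Ends p s (m.lim ^ K) fun s' =>
          ∃ ρ', Rep m ρ' s' ∧ (∀ i < k, ρ' i = ρ i) ∧ Ctx.enc (g m a) = pos'.map ρ'

theorem CmpT.id : CmpT fun (_ : Mem) (a : α) => a := fun pos k h1 h2 =>
  ⟨.skip, 0, k, pos, le_rfl, h1, h2, fun _ ρ s _ _ hs ha =>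
    ⟨1, s, .skip s, by simp, ρ, hs, fun _ _ => rfl, ha⟩⟩

theorem CmpT.weaken {γ : Type} [Ctx γ] {g : Mem → α → γ} (hg : CmpT g) :
    CmpT fun m (a : α × ℕ) => g m a.1 := by
  intro pos k h1 h2
  obtain ⟨p, K, l, pos', hl, g1, g2, hp⟩ := hg pos.dropLast k (by simp [h1, Ctx.len])
    fun x hx => h2 x (List.dropLast_subset _ hx)
  refine ⟨p, K, l, pos', hl, g1, g2, fun m ρ s a hm hs ha => hp m ρ s a.1 hm hs ?_⟩
  have : (Ctx.enc a).dropLast = (pos.map ρ).dropLast := by rw [ha]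
  simpa [Ctx.enc, List.map_dropLast] using this

theorem CmpT.pair {γ : Type} [Ctx γ] {g : Mem → α → γ} (hg : CmpT g) {x : Mem → α → ℕ}
    (hx : Cmp x) : CmpT fun m a => (g m a, x m a) := by
  intro pos k h1 h2
  obtain ⟨p1, K1, l, pos', hl, g1, g2, hp1⟩ := hg pos k h1 h2
  obtain ⟨p2, K2, hp2⟩ := hx pos l h1 fun y hy => (h2 y hy).trans_le hl
  refine ⟨.seq p1 p2, K1 + K2 + 1, l + 1, pos' ++ [l], by omega, by simp [Ctx.len, g1], ?_, ?_⟩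
  · intro y hy
    simp only [List.mem_append, List.mem_singleton] at hy
    rcases hy with hy | hy
    · have := g2 y hy; omega
    · omega
  intro m ρ s a hm hrep ha
  refine ((hp1 m ρ s a hm hrep ha).seq ?_).mono (pow_add_pow_le hm.two_le_lim) fun _ h => h
  rintro s1 ⟨ρ1, hs1, h3, h4⟩
  refine (hp2 m ρ1 s1 a hm hs1
    (ha.trans (List.map_congr_left fun x hx => h3 x (h2 x hx)).symm)).mono le_rfl ?_
  rintro s2 ⟨ρ2, hs2, h5, h6⟩
  refine ⟨ρ2, hs2, fun i hi => (h5 i (by omega)).trans (h3 i hi), ?_⟩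
  simp only [Ctx.enc, List.map_append, List.map_cons, List.map_nil, h6, h4]
  congr 1
  exact (List.map_congr_left fun x hx => h5 x (g2 x hx)).symm

/-- Function calls. -/
theorem Cmp.comp {γ : Type} [Ctx γ] {f : Mem → γ → ℕ} (hf : Cmp f) {g : Mem → α → γ}
    (hg : CmpT g) : Cmp fun m a => f m (g m a) := by
  intro pos k h1 h2
  obtain ⟨p1, K1, l, pos', hl, g1, g2, hp1⟩ := hg pos (k + 1) h1 fun x hx =>
    (h2 x hx).trans (by omega)
  obtain ⟨p2, K2, hp2⟩ := hf pos' l g1 g2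
  refine ⟨.seq p1 (.seq p2 (vset k (vget l))), K1 + (K2 + 20 + 1) + 1, ?_⟩
  intro m ρ s a hm hrep ha
  have hB := hm.two_le_lim
  have hn := hm.two_le_n
  set R := fun s' => ∃ ρ', Rep m ρ' s' ∧ (∀ i < k, ρ' i = ρ i) ∧ ρ' k = f m (g m a) with hR
  refine ((hp1 m ρ s a hm hrep ha).seq (B' := m.lim ^ (K2 + 20 + 1)) (Q' := R) ?_).mono
    (pow_add_pow_le hB) fun _ h => h
  rintro s1 ⟨ρ1, hs1, h3, h4⟩
  refine ((hp2 m ρ1 s1 (g m a) hm hs1 h4).seq (B' := m.lim ^ 20)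
    (Q' := R) ?_).mono (pow_add_pow_le hB) fun _ h => h
  rintro s2 ⟨ρ2, hs2, h5, h6⟩
  refine (Ends.vset hs2 hn k (vget l)).mono
    (le_trans (by simp [vget, vaddr, NExp.time]) (const_le_pow hB 20)) fun s8 hs8 => ?_
  refine ⟨_, hs8, fun j hj => ?_, ?_⟩
  · rw [Function.update_of_ne (by omega), h5 _ (by omega), h3 j (by omega)]
  · rw [Function.update_self, eval_vget hs2, h6]

theorem CmpP.comp {γ : Type} [Ctx γ] {f : Mem → γ → Prop} (hf : CmpP f) {g : Mem → α → γ}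
    (hg : CmpT g) : CmpP fun m a => f m (g m a) := Cmp.comp hf hg

/-- Sums with a bounded number of terms. -/
theorem Cmp.sum {b : Mem → α → ℕ} {f : Mem → α → ℕ → ℕ} (hb : Cmp b)
    (hlim : ∀ m a, m.WF → b m a ≤ m.lim) (hf : Cmp fun m (p : α × ℕ) => f m p.1 p.2) :
    Cmp fun m a => ∑ i ∈ Finset.range (b m a), f m a i := by
  have hstep : Cmp fun m (p : (α × ℕ) × ℕ) => p.2 + f m p.1.1 p.1.2 :=
    Cmp.last.add (Cmp.weaken hf)
  refine (Cmp.natRec (step := fun m a i acc => acc + f m a i) hb hlim (Cmp.lit 0) hstep).congr ?_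
  intro m a _
  induction b m a with
  | zero => rfl
  | succ k ih => rw [Finset.sum_range_succ, ← ih]

/-- Bounded existential quantification. -/
theorem CmpP.exists_lt {b : Mem → α → ℕ} {P : Mem → α → ℕ → Prop} (hb : Cmp b)
    (hlim : ∀ m a, m.WF → b m a ≤ m.lim) (hP : CmpP fun m (p : α × ℕ) => P m p.1 p.2) :
    CmpP fun m a => ∃ i < b m a, P m a i := by
  classical
  have h := CmpP.lt (Cmp.lit 0) (Cmp.sum (f := fun m a i => if P m a i then 1 else 0) hb hlim
    (Cmp.congr hP fun m p _ => by congr))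
  refine CmpP.congr h fun m a _ => ?_
  rw [Finset.sum_pos_iff]
  simp only [Finset.mem_range]
  refine exists_congr fun i => and_congr_right fun _ => ?_
  split_ifs <;> simp_all

/-- Bounded universal quantification. -/
theorem CmpP.forall_lt {b : Mem → α → ℕ} {P : Mem → α → ℕ → Prop} (hb : Cmp b)
    (hlim : ∀ m a, m.WF → b m a ≤ m.lim) (hP : CmpP fun m (p : α × ℕ) => P m p.1 p.2) :
    CmpP fun m a => ∀ i < b m a, P m a i :=
  CmpP.congr (CmpP.exists_lt (P := fun m a i => ¬ P m a i) hb hlim hP.not).not fun m a _ => by push Not; rfl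

/-- Multiplication by a bounded number. -/
theorem Cmp.mul {f g : Mem → α → ℕ} (hf : Cmp f) (hlim : ∀ m a, m.WF → f m a ≤ m.lim)
    (hg : Cmp g) : Cmp fun m a => f m a * g m a :=
  (Cmp.sum (f := fun m a _ => g m a) hf hlim hg.weaken).congr fun m a _ => by simp

open Classical in
/-- The least `i < b` with `P i`, and `b` if there is none. -/
noncomputable def least (b : ℕ) (P : ℕ → Prop) : ℕ :=
  ∑ i ∈ Finset.range b, if ∀ j < i + 1, ¬ P j then 1 else 0

theorem least_le (b : ℕ) (P : ℕ → Prop) : least b P ≤ b := by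
  refine (Finset.sum_le_card_nsmul _ _ 1 fun i _ => ?_).trans (by simp)
  split_ifs <;> simp

theorem least_eq {b : ℕ} {P : ℕ → Prop} {a : ℕ} (ha : a ≤ b) (h : ∀ j < a, ¬ P j)
    (h' : a < b → P a) : least b P = a := by
  classical
  have : least b P = ∑ i ∈ Finset.range b, if i < a then 1 else 0 := by
    refine Finset.sum_congr rfl fun i hi => ?_
    rw [Finset.mem_range] at hi
    congr 1
    refine propext ⟨fun hP => ?_, fun hlt j hj => h j (by omega)⟩
    by_contra hn
    exact hP a (by omega) (h' (by omega))
  rw [this, Finset.sum_boole]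
  have e : Finset.filter (fun i => i < a) (Finset.range b) = Finset.range a := by
    ext i; simp; omega
  simp [e]

theorem least_spec {b : ℕ} {P : ℕ → Prop} (h : ∃ i < b, P i) :
    least b P < b ∧ P (least b P) ∧ ∀ j < least b P, ¬ P j := by
  classical
  obtain ⟨i, hi, hP⟩ := h
  have hex : ∃ i, P i := ⟨i, hP⟩
  have h1 : Nat.find hex ≤ i := Nat.find_min' hex hP
  have e := least_eq (b := b) (P := P) (a := Nat.find hex) (by omega)
    (fun j hj => Nat.find_min hex hj) fun _ => Nat.find_spec hex
  rw [e]
  exact ⟨by omega, Nat.find_spec hex, fun j hj => Nat.find_min hex hj⟩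

theorem least_eq_bound {b : ℕ} {P : ℕ → Prop} (h : ∀ i < b, ¬ P i) : least b P = b :=
  least_eq le_rfl h fun h => absurd h (lt_irrefl _)

/-- The inner quantifier of `least` has the bound `i + 1`, which on its own is not bounded by `lim`.
Taking the minimum with `b` repairs this and changes nothing, because only `i < b` occurs. -/
theorem Cmp.least {b : Mem → α → ℕ} {P : Mem → α → ℕ → Prop} (hb : Cmp b)
    (hlim : ∀ m a, m.WF → b m a ≤ m.lim) (hP : CmpP fun m (p : α × ℕ) => P m p.1 p.2) :
    Cmp fun m a => least (b m a) (P m a) := by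
  classical
  have h1 : CmpP fun m (p : α × ℕ) => ∀ j < min (p.2 + 1) (b m p.1), ¬ P m p.1 j := by
    refine CmpP.forall_lt (P := fun m (p : α × ℕ) j => ¬ P m p.1 j) ?_
      (fun m p hm => (min_le_right _ _).trans (hlim m p.1 hm)) ?_
    · exact (CmpP.ite (CmpP.le (Cmp.last.add (Cmp.lit 1)) hb.weaken)
        (Cmp.last.add (Cmp.lit 1)) hb.weaken).congr fun m a _ => by
          rw [min_def]
    · exact CmpP.not (CmpP.comp hP (g := fun _ (q : (α × ℕ) × ℕ) => (q.1.1, q.2))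
        (CmpT.id.weaken.weaken.pair Cmp.last))
  refine (Cmp.sum (f := fun m a i => if ∀ j < min (i + 1) (b m a), ¬ P m a j then 1 else 0) hb hlim
    (Cmp.congr h1 fun m p _ => by congr)).congr fun m a _ => ?_
  refine Finset.sum_congr rfl fun i hi => ?_
  rw [Finset.mem_range] at hi
  rw [min_eq_left (by omega)]

end Closure

end RAM


/-! ### Filling arrays and writing the output. -/

namespace RAM

theorem update_eq_of_ne {f : ℕ → ℕ} {a b v x : ℕ} (h : f b = x) (hne : b ≠ a) :
    Function.update f a v b = x := (Function.update_of_ne hne _ _).trans h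

/-- Memory with the array `j` replaced. -/
def Mem.setArr (m : Mem) (j : ℕ) (a : ℕ → ℕ) : Mem := { m with arr := Function.update m.arr j a }

theorem Mem.WF.setArr {m : Mem} (h : m.WF) (j : ℕ) (a : ℕ → ℕ) : (m.setArr j a).WF :=
  ⟨h.one_le_c, h.one_le_L, h.two_le_n, h.par_eq_zero⟩

theorem Mem.setArr_self (m : Mem) (j : ℕ) : m.setArr j (m.arr j) = m := by
  simp [Mem.setArr]

theorem Rep.update_arr {m : Mem} {ρ : ℕ → ℕ} {s : State} (h : Rep m ρ s) (hm : 2 ≤ m.n)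
    {j : ℕ} (hj : j < 2) (i x : ℕ) :
    Rep (m.setArr j (Function.update (m.arr j) i x)) ρ
      { s with nats := Function.update s.nats (m.n + (5 + 2 * j) + 4 * i) x } := by
  have key : ∀ a, a ≠ m.n + (5 + 2 * j) + 4 * i →
      Function.update s.nats (m.n + (5 + 2 * j) + 4 * i) x a = s.nats a :=
    fun a ha => Function.update_of_ne ha _ _
  refine ⟨?_, ?_, ?_, ?_, ?_, ?_, ?_, h.w⟩
  · exact (key _ (by omega)).trans h.n
  · exact (key _ (by omega)).trans h.c
  · exact (key _ (by omega)).trans h.L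
  · exact (key _ (by omega)).trans h.root
  · intro v hv
    replace hv : v < m.n := hv
    exact (key _ (by omega)).trans (h.par v hv)
  · intro k
    exact (key _ (by simp only [Mem.setArr]; omega)).trans (h.var k)
  · intro k hk v
    by_cases hkj : k = j
    · subst hkj
      by_cases hv : v = i
      · subst hv; simp [Mem.setArr]
      · refine (key _ (by simp only [Mem.setArr]; omega)).trans ((h.arr k hk v).trans ?_)
        simp [Mem.setArr, hv]
    · refine (key _ (by simp only [Mem.setArr]; omega)).trans ((h.arr k hk v).trans ?_)
      simp [Mem.setArr, hkj]

/-- Filling an array by course-of-values recursion. -/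
theorem exists_fill {j : ℕ} (hj : j < 2) {b : Mem → Unit → ℕ} {f : Mem → Unit × ℕ → ℕ}
    {g : Mem → ℕ → ℕ} (hb : Cmp b) (hlim : ∀ m, m.WF → b m () ≤ m.lim) (hf : Cmp f)
    (hg : ∀ m, m.WF → ∀ i < b m (), ∀ a : ℕ → ℕ, (∀ k < i, a k = g m k) →
      f (m.setArr j a) ((), i) = g m i) :
    ∃ p K, ∀ m ρ s, m.WF → Rep m ρ s → Ends p s (m.lim ^ K) fun s' =>
      ∃ ρ' a, Rep (m.setArr j a) ρ' s' ∧ ∀ k < b m (), a k = g m k := by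
  obtain ⟨p1, K1, hp1⟩ := hb [] 0 rfl (by simp)
  obtain ⟨p2, K2, hp2⟩ := hf [1] 2 rfl (by simp)
  let addr : NExp := .add (.add (.get (.lit 0)) (.lit (5 + 2 * j)))
    (.add (.add (vget 1) (vget 1)) (.add (vget 1) (vget 1)))
  let body : Cmd := .seq p2 (.seq (.nset addr (vget 2)) (vset 1 (.add (vget 1) (.lit 1))))
  let t : BExp := .nlt (vget 1) (vget 0)
  refine ⟨.seq p1 (.seq (vset 1 (.lit 0)) (.loop t body)),
    K1 + (6 + (2 + (t.time + 1 + (K2 + 60 + 1) + 1)) + 1) + 1, ?_⟩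
  intro m ρ s hm hrep
  have hB := hm.two_le_lim
  have hn := hm.two_le_n
  set R := fun s' => ∃ ρ' a, Rep (m.setArr j a) ρ' s' ∧ ∀ k < b m (), a k = g m k with hR
  refine ((hp1 m ρ s () hm hrep rfl).seq
    (B' := m.lim ^ (6 + (2 + (t.time + 1 + (K2 + 60 + 1) + 1)) + 1))
    (Q' := R) ?_).mono (pow_add_pow_le hB) fun _ h => h
  rintro s1 ⟨ρ1, hs1, h3, h4⟩
  refine (((Ends.vset hs1 hn 1 (.lit 0)).mono (B' := m.lim ^ 6) (const_le_pow hB 6)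
    fun _ h => h).seq
    (B' := m.lim ^ (2 + (t.time + 1 + (K2 + 60 + 1) + 1)))
    (Q' := R) ?_).mono (pow_add_pow_le hB) fun _ h => h
  intro s2 hs2
  let I : ℕ → State → Prop := fun i s' => ∃ ρ' a, Rep (m.setArr j a) ρ' s' ∧ ρ' 0 = b m () ∧
    ρ' 1 = i ∧ ∀ k < i, a k = g m k
  have hloop := Ends.loop (b := t) (p := body) (B := m.lim ^ (K2 + 60 + 1)) (N := b m ()) I ?_ ?_
    (s := s2) ?_
  rotate_left
  · rintro i - s' ⟨ρ', a, hs', e1, e2, _⟩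
    simp only [t, BExp.Holds, eval_vget hs', e1, e2]
  · rintro i hi s' ⟨ρ', a, hs', e1, e2, e3⟩
    have hm' := hm.setArr j a
    refine ((hp2 _ ρ' s' ((), i) hm' hs' (by simp [Ctx.enc, e2])).seq (B' := m.lim ^ 60)
      (Q' := I (i + 1)) ?_).mono (pow_add_pow_le hB) fun _ h => h
    rintro s4 ⟨ρ4, hs4, f1, f2⟩
    have g1 : ρ4 1 = i := (f1 1 (by omega)).trans e2
    refine Ends.mono (B := 40 + 20) (Q := I (i + 1)) ?_ (const_le_pow hB 60) fun _ h => h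
    refine Ends.seq (Q := Rep (m.setArr j (Function.update a i (g m i))) ρ4) ?_ ?_
    · refine ⟨_, _, .nset _ _ _, by simp [addr, vget, vaddr, NExp.time], ?_⟩
      have ea : addr.eval s4 = m.n + (5 + 2 * j) + 4 * i := by
        simp only [addr, NExp.eval, eval_vget hs4, g1, hs4.n, Mem.setArr]
        omega
      have := hs4.update_arr hn hj i (g m i)
      rw [ea, eval_vget hs4, f2, hg m hm i hi a e3]
      simpa [Mem.setArr] using this
    · intro s5 hs5
      refine (Ends.vset hs5 hn 1 (.add (vget 1) (.lit 1))).mono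
        (by simp [vget, vaddr, NExp.time]) fun s6 hs6 => ?_
      refine ⟨_, _, hs6, ?_, ?_, ?_⟩
      · rw [Function.update_of_ne (by omega), f1 _ (by omega), e1]
      · rw [Function.update_self, NExp.eval, eval_vget hs5, g1, NExp.eval]
      · intro k hk
        by_cases hki : k = i
        · subst hki; simp
        · rw [Function.update_of_ne hki, e3 k (by omega)]
  · refine ⟨_, m.arr j, by rw [Mem.setArr_self]; exact hs2, ?_, ?_, by simp⟩
    · rw [Function.update_of_ne (by omega), h4]
    · rw [Function.update_self, NExp.eval]
  refine hloop.mono (loop_time_le hB (hlim m hm)) ?_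
  rintro s7 ⟨ρ7, a, hs7, e1, e2, e3⟩
  exact ⟨ρ7, a, hs7, e3⟩

theorem Ends.nset (s : State) (a e : NExp) :
    Ends (.nset a e) s (a.time + e.time + 1)
      (· = { s with nats := Function.update s.nats (a.eval s) (e.eval s) }) :=
  ⟨_, _, .nset s a e, le_rfl, rfl⟩

/-- The address of the output list. -/
def outAddr : NExp :=
  .add (.add (.add (.add (.get (.lit 0)) (.get (.lit 0))) (.add (.get (.lit 0)) (.get (.lit 0))))
    (.get (.lit 0))) (.lit 20)

theorem eval_outAddr {s : State} {n : ℕ} (h : s.nats 0 = n) : outAddr.eval s = 5 * n + 20 := by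
  simp only [outAddr, NExp.eval, h]; omega

/-- Writing the output. -/
theorem exists_output {num den : Mem → Unit → ℕ} (hnum : Cmp num) (hden : Cmp den) :
    ∃ p K, ∀ m ρ s, m.WF → Rep m ρ s → Ends p s (m.lim ^ K) fun s' =>
      s'.reals 0 = (num m () : ℝ) / (den m () : ℝ) ∧
      ∀ v < m.n, s'.ListAt (s'.nats v) ((List.range m.n).map (m.arr 1)) := by
  obtain ⟨p1, K1, hp1⟩ := hnum [] 0 rfl (by simp)
  obtain ⟨p2, K2, hp2⟩ := hden [] 1 rfl (by simp)
  let t1 : BExp := .nlt (vget 0) (.get (.lit 0))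
  let src : NExp := .get (.add (.add (.get (.lit 0)) (.lit 7))
    (.add (.add (vget 0) (vget 0)) (.add (vget 0) (vget 0))))
  let body1 : Cmd := .seq (.nset (.add (.add outAddr (.lit 1)) (vget 0)) src)
    (vset 0 (.add (vget 0) (.lit 1)))
  let body2 : Cmd := .seq (.nset (vget 0) outAddr) (vset 0 (.add (vget 0) (.lit 1)))
  -- All addresses are computed from `n` in cell 0, so that cell is overwritten last and the loop
  -- over the other pointers starts at 1. The list begins at `5 * n + 20`, behind the `n` relevant
  -- entries of array `1`, which end below `5 * n + 7`; all pointers refer to this one list.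
  refine ⟨.seq p1 (.seq p2 (.seq (.rset (.lit 0) (.div (.cast (vget 0)) (.cast (vget 1))))
    (.seq (vset 0 (.lit 0)) (.seq (.loop t1 body1) (.seq (.nset outAddr (.get (.lit 0)))
    (.seq (vset 0 (.lit 1)) (.seq (.loop t1 body2) (.nset (.lit 0) outAddr)))))))),
    K1 + (K2 + (20 + (6 + ((2 + (t1.time + 1 + 150 + 1)) + (50 + (6 + ((2 + (t1.time + 1 + 150 + 1))
      + 50 + 1) + 1) + 1) + 1) + 1) + 1) + 1) + 1, ?_⟩
  intro m ρ s hm hrep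
  have hB := hm.two_le_lim
  have hn := hm.two_le_n
  have hnlim : m.n ≤ m.lim := by
    refine le_trans ?_ (hm.pow_le_lim (a := 1) (by have := hm.one_le_L; omega))
    rw [pow_one]
    exact Nat.le_mul_of_pos_left _ hm.one_le_c
  set r : ℝ := (num m () : ℝ) / (den m () : ℝ) with hr
  set R : State → Prop := fun s' => s'.reals 0 = r ∧
      ∀ v < m.n, s'.ListAt (s'.nats v) ((List.range m.n).map (m.arr 1)) with hR
  have step : ∀ {p q : Cmd} {s : State} {a b : ℕ} {Q : State → Prop}, Ends p s (m.lim ^ a) Q →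
      (∀ s', Q s' → Ends q s' (m.lim ^ b) R) → Ends (.seq p q) s (m.lim ^ (a + b + 1)) R :=
    fun h1 h2 => (h1.seq h2).mono (pow_add_pow_le hB) fun _ h => h
  refine step (hp1 m ρ s () hm hrep rfl) ?_
  rintro s1 ⟨ρ1, hs1, -, h4⟩
  refine step (hp2 m ρ1 s1 () hm hs1 rfl) ?_
  rintro s2 ⟨ρ2, hs2, h5, h6⟩
  have h7 : ρ2 0 = num m () := (h5 0 (by omega)).trans h4
  -- the property that is preserved from now on
  let J : State → Prop := fun s' => s'.nats 0 = m.n ∧ s'.reals 0 = r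
  let J1 : State → Prop := fun s' => J s' ∧ ∀ k < m.n, s'.nats (m.n + 7 + 4 * k) = m.arr 1 k
  have ev : ∀ {s' : State}, s'.nats 0 = m.n → (vget 0).eval s' = s'.nats (m.n + 4) := by
    intro s' h
    simp [vget, vaddr, NExp.eval, h]
  have eva : ∀ {s' : State}, s'.nats 0 = m.n → (vaddr 0).eval s' = m.n + 4 := by
    intro s' h
    simp [vaddr, NExp.eval, h]
  refine step (Q := J1) (a := 20) ?_ ?_
  · refine ⟨_, _, .rset _ _ _, le_trans ?_ (const_le_pow hB 20), ⟨hs2.n, ?_⟩, fun k hk => ?_⟩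
    · simp [vget, vaddr, NExp.time, RExp.time]
    · simp [NExp.eval, RExp.eval, eval_vget hs2, h6, h7, hr]
    · exact hs2.arr 1 (by omega) k
  rintro s3 ⟨⟨hs3n, hs3r⟩, hs3a⟩
  let I1 : ℕ → State → Prop := fun i s' => J1 s' ∧ s'.nats (m.n + 4) = i ∧
    ∀ k < i, s'.nats (5 * m.n + 21 + k) = m.arr 1 k
  refine step (Q := I1 0) (a := 6) ?_ ?_
  · refine (Ends.nset s3 (vaddr 0) (.lit 0)).mono
      (le_trans (by simp [vaddr, NExp.time]) (const_le_pow hB 6)) ?_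
    rintro s' rfl
    rw [eva hs3n]
    refine ⟨⟨⟨?_, hs3r⟩, fun k hk => ?_⟩, ?_, by simp⟩
    · dsimp only; exact update_eq_of_ne hs3n (by omega)
    · exact update_eq_of_ne (hs3a k hk) (by omega)
    · simp [NExp.eval]
  intro s4 hs4
  have hcond : ∀ {s' : State}, s'.nats 0 = m.n → (t1.Holds s' ↔ s'.nats (m.n + 4) < m.n) := by
    intro s' h
    simp only [t1, BExp.Holds, ev h]
    simp [NExp.eval, h]
  have hloop1 := Ends.loop (b := t1) (p := body1) (B := m.lim ^ 150) (N := m.n) I1 ?_ ?_ hs4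
  rotate_left
  · rintro i - s' ⟨⟨⟨e0, -⟩, -⟩, e1, -⟩
    rw [hcond e0, e1]
  · rintro i hi s' ⟨⟨⟨e0, e4⟩, e5⟩, e1, e2⟩
    refine Ends.mono (B := 100 + 50) (Q := I1 (i + 1)) ?_ (const_le_pow hB 150) fun _ h => h
    refine Ends.seq (Q := fun s' => J1 s' ∧ s'.nats (m.n + 4) = i ∧
      ∀ k < i + 1, s'.nats (5 * m.n + 21 + k) = m.arr 1 k) ?_ ?_
    · refine (Ends.nset s' _ src).mono
        (by simp [src, outAddr, vget, vaddr, NExp.time]) ?_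
      rintro s5 rfl
      have a1 : (NExp.add (.add outAddr (.lit 1)) (vget 0)).eval s' = 5 * m.n + 21 + i := by
        rw [NExp.eval, NExp.eval, eval_outAddr e0, ev e0, e1, NExp.eval]
      have a2 : src.eval s' = m.arr 1 i := by
        simp only [src, NExp.eval, ev e0, e1, e0]
        rw [← e5 i hi]
        congr 1
        omega
      rw [a1, a2]
      refine ⟨⟨⟨?_, e4⟩, fun k hk => ?_⟩, ?_, fun k hk => ?_⟩
      · exact update_eq_of_ne e0 (by omega)
      · exact update_eq_of_ne (e5 k hk) (by omega)
      · exact update_eq_of_ne e1 (by omega)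
      · by_cases hki : k = i
        · subst hki; simp
        · exact update_eq_of_ne (e2 k (by omega)) (by omega)
    · rintro s5 ⟨⟨⟨e0, e4⟩, e5⟩, e1, e2⟩
      refine (Ends.nset s5 (vaddr 0) (.add (vget 0) (.lit 1))).mono
        (by simp [vget, vaddr, NExp.time]) ?_
      rintro s6 rfl
      rw [eva e0, NExp.eval, ev e0, e1, NExp.eval]
      refine ⟨⟨⟨?_, e4⟩, fun k hk => ?_⟩, ?_, fun k hk => ?_⟩
      · dsimp only; exact update_eq_of_ne e0 (by omega)
      · exact update_eq_of_ne (e5 k hk) (by omega)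
      · simp
      · exact update_eq_of_ne (e2 k hk) (by omega)
  refine step (hloop1.mono (loop_time_le hB hnlim) fun _ h => h) ?_
  rintro s5 ⟨⟨⟨e0, e4⟩, -⟩, -, e2⟩
  let J2 : State → Prop := fun s' => J s' ∧ s'.ListAt (5 * m.n + 20) ((List.range m.n).map (m.arr 1))
  have listAt : ∀ {s' : State}, s'.nats (5 * m.n + 20) = m.n →
      (∀ k < m.n, s'.nats (5 * m.n + 21 + k) = m.arr 1 k) →
      s'.ListAt (5 * m.n + 20) ((List.range m.n).map (m.arr 1)) := by
    intro s' h1 h2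
    refine ⟨by simpa using h1, fun i hi => ?_⟩
    simp only [List.length_map, List.length_range] at hi
    simpa using h2 i hi
  have ofListAt : ∀ {s' : State},
      s'.ListAt (5 * m.n + 20) ((List.range m.n).map (m.arr 1)) →
      s'.nats (5 * m.n + 20) = m.n ∧ (∀ k < m.n, s'.nats (5 * m.n + 21 + k) = m.arr 1 k) := by
    rintro s' ⟨h1, h2⟩
    refine ⟨by simpa using h1, fun k hk => ?_⟩
    have := h2 k (by simpa using hk)
    simpa using this
  refine step (Q := J2) (a := 50) ?_ ?_
  · refine (Ends.nset s5 outAddr (.get (.lit 0))).mono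
      (le_trans (by simp [outAddr, NExp.time]) (const_le_pow hB 50)) ?_
    rintro s6 rfl
    rw [eval_outAddr e0]
    refine ⟨⟨?_, e4⟩, listAt ?_ fun k hk => ?_⟩
    · dsimp only; exact update_eq_of_ne e0 (by omega)
    · simp [NExp.eval, e0]
    · exact update_eq_of_ne (e2 k hk) (by omega)
  rintro s6 ⟨⟨e0, e4⟩, e5⟩
  let I2 : ℕ → State → Prop := fun i s' => J2 s' ∧ s'.nats (m.n + 4) = i + 1 ∧
    ∀ k, 1 ≤ k → k < i + 1 → s'.nats k = 5 * m.n + 20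
  refine step (Q := I2 0) (a := 6) ?_ ?_
  · refine (Ends.nset s6 (vaddr 0) (.lit 1)).mono
      (le_trans (by simp [vaddr, NExp.time]) (const_le_pow hB 6)) ?_
    rintro s7 rfl
    rw [eva e0]
    obtain ⟨l1, l2⟩ := ofListAt e5
    refine ⟨⟨⟨?_, e4⟩, listAt ?_ fun k hk => ?_⟩, ?_, fun k h1 h2 => by omega⟩
    · dsimp only; exact update_eq_of_ne e0 (by omega)
    · exact update_eq_of_ne l1 (by omega)
    · exact update_eq_of_ne (l2 k hk) (by omega)
    · simp [NExp.eval]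
  intro s7 hs7
  have hloop2 := Ends.loop (b := t1) (p := body2) (B := m.lim ^ 150) (N := m.n - 1) I2 ?_ ?_ hs7
  rotate_left
  · rintro i hi s' ⟨⟨⟨e0, -⟩, -⟩, e1, -⟩
    rw [hcond e0, e1]
    omega
  · rintro i hi s' ⟨⟨⟨e0, e4⟩, e5⟩, e1, e2⟩
    obtain ⟨l1, l2⟩ := ofListAt e5
    refine Ends.mono (B := 100 + 50) (Q := I2 (i + 1)) ?_ (const_le_pow hB 150) fun _ h => h
    refine Ends.seq (Q := fun s' => J2 s' ∧ s'.nats (m.n + 4) = i + 1 ∧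
      ∀ k, 1 ≤ k → k < i + 2 → s'.nats k = 5 * m.n + 20) ?_ ?_
    · refine (Ends.nset s' (vget 0) outAddr).mono
        (by simp [outAddr, vget, vaddr, NExp.time]) ?_
      rintro s8 rfl
      rw [ev e0, e1, eval_outAddr e0]
      refine ⟨⟨⟨?_, e4⟩, listAt ?_ fun k hk => ?_⟩, ?_, fun k h1 h2 => ?_⟩
      · dsimp only; exact update_eq_of_ne e0 (by omega)
      · exact update_eq_of_ne l1 (by omega)
      · exact update_eq_of_ne (l2 k hk) (by omega)
      · exact update_eq_of_ne e1 (by omega)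
      · by_cases hki : k = i + 1
        · subst hki; simp
        · exact update_eq_of_ne (e2 k h1 (by omega)) (by omega)
    · rintro s8 ⟨⟨⟨e0, e4⟩, e5⟩, e1, e2⟩
      obtain ⟨l1, l2⟩ := ofListAt e5
      refine (Ends.nset s8 (vaddr 0) (.add (vget 0) (.lit 1))).mono
        (by simp [vget, vaddr, NExp.time]) ?_
      rintro s9 rfl
      rw [eva e0, NExp.eval, ev e0, e1, NExp.eval]
      refine ⟨⟨⟨?_, e4⟩, listAt ?_ fun k hk => ?_⟩, ?_, fun k h1 h2 => ?_⟩
      · dsimp only; exact update_eq_of_ne e0 (by omega)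
      · exact update_eq_of_ne l1 (by omega)
      · exact update_eq_of_ne (l2 k hk) (by omega)
      · simp
      · exact update_eq_of_ne (e2 k h1 (by omega)) (by omega)
  refine step (hloop2.mono (loop_time_le hB (by omega)) fun _ h => h) ?_
  rintro s8 ⟨⟨⟨e0, e4⟩, e5⟩, e1, e2⟩
  obtain ⟨l1, l2⟩ := ofListAt e5
  refine (Ends.nset s8 (.lit 0) outAddr).mono
    (le_trans (by simp [outAddr, NExp.time]) (const_le_pow hB 50)) ?_
  rintro s9 rfl
  rw [eval_outAddr e0]
  refine ⟨e4, fun v hv => ?_⟩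
  have hv' : (Function.update s8.nats 0 (5 * m.n + 20)) v = 5 * m.n + 20 := by
    by_cases hv0 : v = 0
    · subst hv0; simp
    · rw [Function.update_of_ne hv0, e2 v (by omega) (by omega)]
  simp only [NExp.eval]
  rw [hv']
  refine listAt ?_ fun k hk => ?_
  · dsimp only; exact update_eq_of_ne l1 (by omega)
  · exact update_eq_of_ne (l2 k hk) (by omega)

end RAM


/-! ### Betweenness and the ancestor order in a tree. -/

namespace WTree

variable {n : ℕ} (T : WTree n)

/-- `y` lies on the path between `u` and `x`. -/
abbrev Btw (u y x : Fin n) : Prop := y ∈ (T.path u x).support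

variable {T}

theorem isPath_path (u v : Fin n) : (T.path u v).IsPath :=
  (T.isTree.existsUnique_path u v).exists.choose_spec

theorem path_eq {u v : Fin n} {p : T.graph.Walk u v} (hp : p.IsPath) : p = T.path u v :=
  (T.isTree.existsUnique_path u v).unique hp (isPath_path u v)

/-- Cutting the detours off a walk leaves a path, and paths in a tree are unique. -/
theorem Btw.mem_support {u y x : Fin n} (h : T.Btw u y x) (p : T.graph.Walk u x) :
    y ∈ p.support := by
  classical
  rw [Btw, ← path_eq p.bypass_isPath] at h
  exact p.support_bypass_subset_support h

theorem btw_left (u x : Fin n) : T.Btw u u x := (T.path u x).start_mem_support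

theorem btw_right (u x : Fin n) : T.Btw u x x := (T.path u x).end_mem_support

theorem Btw.symm {u y x : Fin n} (h : T.Btw u y x) : T.Btw x y u := by
  have := h.mem_support (T.path x u).reverse
  simpa [Btw] using this

theorem btw_comm {u y x : Fin n} : T.Btw u y x ↔ T.Btw x y u := ⟨Btw.symm, Btw.symm⟩

/-- The paths from `u` to `v` and from `v` to `x` form a walk, which covers the path from `u` to
`x`. Most path arguments below are reduced to this fact. -/
theorem Btw.or {u y x : Fin n} (h : T.Btw u y x) (v : Fin n) : T.Btw u y v ∨ T.Btw v y x := by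
  have := h.mem_support ((T.path u v).append (T.path v x))
  rwa [SimpleGraph.Walk.mem_support_append_iff] at this

theorem path_take {u y x : Fin n} (h : T.Btw u y x) :
    (T.path u x).takeUntil y h = T.path u y := path_eq ((isPath_path u x).takeUntil h)

theorem path_drop {u y x : Fin n} (h : T.Btw u y x) :
    (T.path u x).dropUntil y h = T.path y x := path_eq ((isPath_path u x).dropUntil h)

theorem Btw.of_left {u y z x : Fin n} (h : T.Btw u y x) (hz : T.Btw u z y) : T.Btw u z x := by
  rw [Btw, ← path_take h] at hz
  exact SimpleGraph.Walk.support_takeUntil_subset_support _ h hz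

theorem Btw.of_right {u y z x : Fin n} (h : T.Btw u y x) (hz : T.Btw y z x) : T.Btw u z x :=
  (h.symm.of_left hz.symm).symm

/-- If `z` is between `r` and `u`, and `y` is between `z` and `u`, then `z` is between `r`, `y`. -/
theorem Btw.transit {r z u y : Fin n} (h : T.Btw r z u) (hy : T.Btw z y u) : T.Btw r z y := by
  have h1 := (T.path r u).take_spec h
  rw [path_drop h] at h1
  have h2 := (T.path z u).take_spec hy
  rw [← h2, SimpleGraph.Walk.append_assoc] at h1
  have h3 := isPath_path (T := T) r u
  rw [← h1] at h3
  have h4 := path_eq h3.of_append_left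
  rw [Btw, ← h4, SimpleGraph.Walk.mem_support_append_iff]
  exact Or.inl (SimpleGraph.Walk.end_mem_support _)

theorem Btw.antisymm {r z y : Fin n} (h : T.Btw r z y) (h' : T.Btw r y z) : z = y := by
  have h1 := congrArg SimpleGraph.Walk.length ((T.path r y).take_spec h)
  have h2 := congrArg SimpleGraph.Walk.length ((T.path r z).take_spec h')
  rw [path_take, SimpleGraph.Walk.length_append] at h1 h2
  exact SimpleGraph.Walk.eq_of_length_eq_zero (p := (T.path r y).dropUntil z h) (by omega)

theorem btw_self_iff {u y : Fin n} : T.Btw u y u ↔ y = u :=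
  ⟨fun h => (btw_left u y).antisymm h |>.symm, fun h => h ▸ btw_left _ _⟩

theorem path_self (u : Fin n) : T.path u u = .nil := (path_eq SimpleGraph.Walk.IsPath.nil).symm

theorem towards_self (u : Fin n) : T.towards u u = u := by
  rw [towards, path_self, SimpleGraph.Walk.snd, SimpleGraph.Walk.getVert_nil]

theorem not_nil_path {v x : Fin n} (h : v ≠ x) : ¬ (T.path v x).Nil :=
  SimpleGraph.Walk.not_nil_of_ne h

theorem adj_towards {v x : Fin n} (h : v ≠ x) : T.graph.Adj v (T.towards v x) :=
  SimpleGraph.Walk.adj_snd (not_nil_path h)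

theorem path_cons {v x : Fin n} (h : v ≠ x) :
    T.path v x = .cons (adj_towards h) (T.path (T.towards v x) x) := by
  have h1 := (SimpleGraph.Walk.cons_tail_eq (T.path v x) (not_nil_path h))
  have h2 : (T.path v x).tail.IsPath := (isPath_path v x).tail
  conv_lhs => rw [← h1]
  congr 1
  exact path_eq h2

theorem towards_eq_of_adj {v y x : Fin n} (h : T.graph.Adj v y) (h' : ¬ T.Btw y v x) :
    T.towards v x = y := by
  have : (SimpleGraph.Walk.cons h (T.path y x)).IsPath :=
    (SimpleGraph.Walk.cons_isPath_iff _ _).2 ⟨isPath_path _ _, h'⟩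
  rw [towards, ← path_eq this]
  simp

theorem not_btw_towards {v x : Fin n} (h : v ≠ x) : ¬ T.Btw (T.towards v x) v x := by
  have := isPath_path (T := T) v x
  rw [path_cons h, SimpleGraph.Walk.cons_isPath_iff] at this
  exact this.2

theorem btw_towards {v x : Fin n} : T.Btw v (T.towards v x) x := by
  rcases eq_or_ne v x with rfl | h
  · rw [towards_self]; exact btw_left _ _
  · rw [Btw, path_cons h]; simp

theorem btw_iff_towards {v y x : Fin n} (h : v ≠ x) :
    T.Btw v y x ↔ y = v ∨ T.Btw (T.towards v x) y x := by
  rw [Btw, path_cons h]; simp [Btw]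

/-- Stepping from `v` towards `x'` and going on to `x` does not return to `v`, so this step also
leads towards `x`. Hence a query cannot tell apart two targets that it does not separate, which is
what makes decision trees share prefixes in `queries_prefix`. -/
theorem towards_eq {v x x' : Fin n} (h : ¬ T.Btw x v x') : T.towards v x = T.towards v x' := by
  have hx : v ≠ x := fun e => h (e ▸ btw_left _ _)
  refine (towards_eq_of_adj (adj_towards hx) fun h' => ?_).symm
  rcases h'.or x with h1 | h1
  · exact not_btw_towards hx h1
  · exact h h1

/-! ### Ancestors -/

theorem InSubtree.refl (v : Fin n) : T.InSubtree v v := btw_right _ _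

theorem InSubtree.root (v : Fin n) : T.InSubtree T.root v := btw_left _ _

theorem InSubtree.trans {a b v : Fin n} (h : T.InSubtree a b) (h' : T.InSubtree b v) :
    T.InSubtree a v := Btw.of_left h' h

theorem InSubtree.antisymm {a b : Fin n} (h : T.InSubtree a b) (h' : T.InSubtree b a) : a = b :=
  Btw.antisymm h h'

theorem InSubtree.total {a b v : Fin n} (h : T.InSubtree a v) (h' : T.InSubtree b v) :
    T.InSubtree a b ∨ T.InSubtree b a := by
  rcases Btw.or h' a with h1 | h1
  · exact Or.inr h1
  · exact Or.inl (Btw.transit h h1)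

theorem inSubtree_root_iff {a : Fin n} : T.InSubtree a T.root ↔ a = T.root :=
  ⟨fun h => h.antisymm (.root _), fun h => h ▸ .refl _⟩

theorem parent_root : T.parent T.root = T.root := towards_self _

theorem inSubtree_iff_parent {a v : Fin n} (hv : v ≠ T.root) :
    T.InSubtree a v ↔ a = v ∨ T.InSubtree a (T.parent v) := by
  have := btw_iff_towards (T := T) (y := a) hv
  rwa [btw_comm, btw_comm (u := T.towards _ _)] at this

theorem parent_inSubtree (v : Fin n) : T.InSubtree (T.parent v) v :=
  (btw_towards (T := T) (v := v) (x := T.root)).symm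

theorem not_inSubtree_parent {v : Fin n} (hv : v ≠ T.root) : ¬ T.InSubtree v (T.parent v) :=
  fun h => not_btw_towards hv (Btw.symm h)

theorem adj_parent {v : Fin n} (hv : v ≠ T.root) : T.graph.Adj v (T.parent v) := adj_towards hv

theorem parent_ne {v : Fin n} (hv : v ≠ T.root) : T.parent v ≠ v := (adj_parent hv).ne'

theorem adj_iff {u v : Fin n} :
    T.graph.Adj u v ↔ (u ≠ T.root ∧ T.parent u = v) ∨ (v ≠ T.root ∧ T.parent v = u) := by
  constructor
  · intro h
    by_cases h1 : T.Btw v u T.root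
    · right
      have hv : v ≠ T.root := by
        rintro rfl
        rw [btw_self_iff] at h1
        exact h.ne h1
      refine ⟨hv, towards_eq_of_adj h.symm fun h2 => ?_⟩
      exact h.ne (h1.symm.antisymm h2.symm)
    · left
      refine ⟨?_, towards_eq_of_adj h h1⟩
      rintro rfl
      exact h1 (btw_right _ _)
  · rintro (⟨h, rfl⟩ | ⟨h, rfl⟩)
    · exact adj_parent h
    · exact (adj_parent h).symm

/-- A path climbs from one end to the lowest common ancestor and then descends to the other end.
This form mentions ancestors only, which the machine can determine from the parents (`Mem.IsBtw`).
-/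
theorem btw_iff {u y x : Fin n} : T.Btw u y x ↔
    (T.InSubtree y u ∨ T.InSubtree y x) ∧
      ∀ z, T.InSubtree z u → T.InSubtree z x → T.InSubtree z y := by
  constructor
  · intro h
    refine ⟨(h.or T.root).imp Btw.symm fun h => h, fun z hu hx => ?_⟩
    rcases h.or z with h1 | h1
    · exact Btw.transit hu h1.symm
    · exact Btw.transit hx h1
  · rintro ⟨h1, h2⟩
    by_contra h
    -- Off the path, `y` would be an ancestor of both ends, and the next vertex from `y` towards `u`
    -- would be a common ancestor strictly below `y`.
    have h3 : T.InSubtree y u ∧ T.InSubtree y x := by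
      rcases h1 with h1 | h1
      · exact ⟨h1, Btw.symm ((Btw.or (Btw.symm h1) x).resolve_left h).symm.symm⟩
      · exact ⟨Btw.symm ((Btw.or (Btw.symm h1) u).resolve_left fun h' => h h'.symm), h1⟩
    have hu : y ≠ u := fun e => h (e ▸ btw_left _ _)
    have h4 : T.InSubtree (T.towards y u) u := Btw.of_right h3.1 btw_towards
    have h5 : T.InSubtree (T.towards y u) x := by
      rw [towards_eq h]
      exact Btw.of_right h3.2 btw_towards
    have h6 := h2 _ h4 h5
    have h7 : T.InSubtree y (T.towards y u) := Btw.transit h3.1 btw_towards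
    exact (adj_towards (T := T) hu).ne (h7.antisymm h6)

theorem btw_of_adj {u x y : Fin n} (h : T.graph.Adj u x) : T.Btw u y x ↔ y = u ∨ y = x := by
  have : (SimpleGraph.Walk.cons h .nil).IsPath := by simp [h.ne]
  rw [Btw, ← path_eq this]; simp

theorem inSubtree_of_btw {v u x y : Fin n} (hu : T.InSubtree v u) (hx : T.InSubtree v x)
    (h : T.Btw u y x) : T.InSubtree v y := (btw_iff.1 h).2 v hu hx

theorem not_inSubtree_of_btw {v u x y : Fin n} (hu : ¬ T.InSubtree v u) (hx : ¬ T.InSubtree v x)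
    (h : T.Btw u y x) : ¬ T.InSubtree v y := by
  intro hy
  rcases (btw_iff.1 h).1 with h1 | h1
  · exact hu (hy.trans h1)
  · exact hx (hy.trans h1)

theorem btw_of_inSubtree {v u x : Fin n} (hu : T.InSubtree v u) (hx : ¬ T.InSubtree v x) :
    T.Btw u v x := by
  refine btw_iff.2 ⟨Or.inl hu, fun z h1 h2 => ?_⟩
  rcases hu.total h1 with h | h
  · exact absurd (h.trans h2) hx
  · exact h

theorem btw_iff_of_inSubtree {v y u : Fin n} (h : T.InSubtree v u) :
    T.Btw u y v ↔ T.InSubtree y u ∧ T.InSubtree v y := by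
  rw [btw_iff]
  constructor
  · rintro ⟨h1 | h1, h2⟩
    · exact ⟨h1, h2 v h (.refl _)⟩
    · exact ⟨h1.trans h, h2 v h (.refl _)⟩
  · rintro ⟨h1, h2⟩
    exact ⟨Or.inl h1, fun z _ h3 => h3.trans h2⟩

/-! ### Children and depth -/

variable (T) in
/-- `y` is a child of `p`. -/
def IsChild (p y : Fin n) : Prop := y ≠ T.root ∧ T.parent y = p

theorem IsChild.inSubtree {p y : Fin n} (h : T.IsChild p y) : T.InSubtree p y :=
  h.2 ▸ parent_inSubtree y

theorem IsChild.not_inSubtree {p y : Fin n} (h : T.IsChild p y) : ¬ T.InSubtree y p :=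
  h.2 ▸ not_inSubtree_parent h.1

theorem IsChild.inSubtree_iff {p y a : Fin n} (h : T.IsChild p y) :
    T.InSubtree a y ↔ a = y ∨ T.InSubtree a p := by
  rw [inSubtree_iff_parent h.1, h.2]

theorem IsChild.adj {p y : Fin n} (h : T.IsChild p y) : T.graph.Adj p y :=
  h.2 ▸ (adj_parent h.1).symm

theorem adj_iff_isChild {u v : Fin n} : T.graph.Adj u v ↔ T.IsChild v u ∨ T.IsChild u v := adj_iff

/-- The child of `u` towards a proper descendant `x`. -/
theorem exists_child {u x : Fin n} (h : T.InSubtree u x) (hne : u ≠ x) :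
    ∃ y, T.IsChild u y ∧ T.InSubtree y x := by
  have h1 : T.InSubtree (T.towards u x) x := Btw.of_right h btw_towards
  have h2 : T.InSubtree u (T.towards u x) := Btw.transit h btw_towards
  refine ⟨_, ?_, h1⟩
  rcases adj_iff_isChild.1 (adj_towards (T := T) hne) with h3 | h3
  · exact absurd h2 h3.not_inSubtree
  · exact h3

theorem IsChild.eq_of_inSubtree {p y y' u : Fin n} (h : T.IsChild p y) (h' : T.IsChild p y')
    (hu : T.InSubtree y u) (hu' : T.InSubtree y' u) : y = y' := by
  rcases hu.total hu' with h1 | h1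
  · exact ((h'.inSubtree_iff.1 h1).resolve_right h.not_inSubtree)
  · exact ((h.inSubtree_iff.1 h1).resolve_right h'.not_inSubtree).symm

theorem IsChild.btw_of_not {u y x q : Fin n} (h : T.IsChild u y) (hx : T.InSubtree y x)
    (hq : ¬ T.InSubtree y q) : T.Btw q u x := by
  refine WTree.btw_iff.2 ⟨Or.inr (h.inSubtree.trans hx), fun z hzq hzx => ?_⟩
  rcases hx.total hzx with h1 | h1
  · exact absurd (h1.trans hzq) hq
  · rcases h.inSubtree_iff.1 h1 with rfl | h2
    · exact absurd hzq hq
    · exact h2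

theorem IsChild.btw_iff {p y u a : Fin n} (h : T.IsChild p y) (hu : T.InSubtree y u) :
    T.Btw u a p ↔ a = p ∨ T.Btw u a y := by
  rw [btw_iff_of_inSubtree (h.inSubtree.trans hu), btw_iff_of_inSubtree hu]
  constructor
  · rintro ⟨h1, h2⟩
    rcases h1.total hu with h3 | h3
    · rcases h.inSubtree_iff.1 h3 with rfl | h4
      · exact Or.inr ⟨h1, h3⟩
      · exact Or.inl (h4.antisymm h2)
    · exact Or.inr ⟨h1, h3⟩
  · rintro (rfl | ⟨h1, h2⟩)
    · exact ⟨h.inSubtree.trans hu, .refl _⟩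
    · exact ⟨h1, h.inSubtree.trans h2⟩

variable (T) in
open Classical in
/-- The number of ancestors of `v`, including `v`. -/
noncomputable def depth (v : Fin n) : ℕ := (Finset.univ.filter fun a => T.InSubtree a v).card

theorem IsChild.depth_eq {p y : Fin n} (h : T.IsChild p y) : T.depth y = T.depth p + 1 := by
  classical
  rw [depth, depth, ← Finset.card_insert_of_notMem (a := y)]
  · congr 1
    ext a
    simp [h.inSubtree_iff]
  · simpa using h.not_inSubtree

theorem depth_lt {a v : Fin n} (h : T.InSubtree a v) (hne : a ≠ v) : T.depth a < T.depth v := by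
  classical
  refine Finset.card_lt_card ⟨fun b hb => ?_, fun hs => hne (h.antisymm ?_)⟩
  · simp only [Finset.mem_filter, Finset.mem_univ, true_and] at hb ⊢
    exact hb.trans h
  · have : v ∈ Finset.univ.filter fun b => T.InSubtree b v := by simp [InSubtree.refl]
    simpa using hs this

theorem depth_pos (v : Fin n) : 0 < T.depth v := by
  classical
  exact Finset.card_pos.2 ⟨v, by simp [InSubtree.refl]⟩

theorem depth_le (v : Fin n) : T.depth v ≤ n := by
  classical
  exact (Finset.card_le_univ _).trans (by simp)

/-- The components of the tree after removal of `U`. -/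
theorem mem_comp {U : Finset (Fin n)} {x y : Fin n} :
    y ∈ T.comp U x ↔ ∀ z, T.Btw x z y → z ∉ U := by
  classical
  simp only [comp, Finset.mem_filter, Finset.mem_univ, true_and]
  exact ⟨fun ⟨p, hp⟩ z hz => hp z (hz.mem_support p), fun h => ⟨T.path x y, h⟩⟩

end WTree


/-! ### Queries made in a fixed order, and prefixes shared by decision trees. -/

namespace WTree

variable {n : ℕ} {T : WTree n}

/-! ### Searches directed by a linear order -/

variable (T) in
/-- `q` comes first among the vertices between `q` and `x`. -/
def RankMin (rk : Fin n → ℕ) (x q : Fin n) : Prop := ∀ y, T.Btw q y x → rk q ≤ rk y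

variable (T) in
/-- `q` is queried when `x` is searched by querying, in the order of the ranks, all vertices of the
remaining component. -/
def Queried (rk : Fin n → ℕ) (x q : Fin n) : Prop :=
  T.RankMin rk x q ∧ (q = x → ∃ u, T.graph.Adj x u ∧ rk x < rk u)

theorem find_eq_of_pairwise {rk : Fin n → ℕ} {l : List (Fin n)}
    (hl : l.Pairwise fun a b => rk a < rk b) {p : Fin n → Bool} {x : Fin n} (hx : x ∈ l)
    (hp : p x) : ∃ u, l.find? p = some u ∧ p u ∧ ∀ y ∈ l, p y → rk u ≤ rk y := by
  obtain ⟨u, hu⟩ := Option.isSome_iff_exists.1 (List.find?_isSome.2 ⟨x, hx, hp⟩)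
  refine ⟨u, hu, ?_⟩
  obtain ⟨h1, as, bs, rfl, h2⟩ := List.find?_eq_some_iff_append.1 hu
  refine ⟨h1, fun y hy hpy => ?_⟩
  rw [List.mem_append, List.mem_cons] at hy
  rcases hy with h | rfl | h
  · exact absurd hpy (by simpa using h2 y h)
  · exact le_rfl
  · exact ((List.pairwise_cons.1 (List.pairwise_append.1 hl).2.1).1 y h).le

/-- Invariants: all queries so far are of the described kind, they precede everything in the current
component, and a vertex that comes first on its path to `x` has been queried or is still in the
component. All lists being equal, neither `v` nor `jump` matters. -/
theorem search_eq {rk : Fin n → ℕ} (hrk : Function.Injective rk) {l : List (Fin n)}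
    (hl : l.Pairwise fun a b => rk a < rk b) (hmem : ∀ v, v ∈ l) (x : Fin n) (k : ℕ) :
    ∀ q : List (Fin n), q.Nodup → q.length + k = n → 0 < k →
      (∀ u ∈ q, T.Queried rk x u) →
      (∀ u ∈ q, ∀ y ∈ T.comp q.toFinset x, rk u < rk y) →
      (∀ u, T.RankMin rk x u → u ∈ q ∨ u ∈ T.comp q.toFinset x) →
      ∃ q', (∀ v jump, T.search (fun _ => l) x jump k v q = some q') ∧ q'.Nodup ∧
        ∀ u, u ∈ q' ↔ T.Queried rk x u := by
  classical
  induction k with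
  | zero => intro q _ _ h; omega
  | succ k ih =>
    intro q hnd hlen _ hb hc hd
    by_cases hsmall : x ∈ q ∨ (T.comp q.toFinset x).card ≤ 1
    · refine ⟨q, fun v jump => by rw [search, if_pos hsmall], hnd, fun u => ⟨hb u, fun hu => ?_⟩⟩
      refine (hd u hu.1).resolve_right fun hcomp => ?_
      rw [mem_comp] at hcomp
      by_cases hx : x ∈ q
      · exact hcomp x (btw_left _ _) (by simpa using hx)
      · have hxc : x ∈ T.comp q.toFinset x := mem_comp.2 fun z hz => by
          rw [btw_self_iff] at hz
          simpa [hz] using hx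
        -- The component is `{x}`. If `x` had a neighbour of larger rank, that neighbour would have
        -- been queried already, although all earlier queries precede `x`.
        have hux : u = x := Finset.card_le_one.1 (hsmall.resolve_left hx) _ (mem_comp.2 hcomp) _ hxc
        obtain ⟨u', h1, h2⟩ := hu.2 hux
        have hu' : u' ∈ q := by
          by_contra hu'
          have : u' ∈ T.comp q.toFinset x := mem_comp.2 fun z hz => by
            rw [btw_of_adj h1] at hz
            rcases hz with rfl | rfl <;> simpa
          exact h1.ne (Finset.card_le_one.1 (hsmall.resolve_left hx) _ hxc _ this)
        exact absurd (hc u' hu' x hxc) (by omega)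
    · push Not at hsmall
      obtain ⟨hx, hcard⟩ := hsmall
      have hxc : x ∈ T.comp q.toFinset x := mem_comp.2 fun z hz => by
        rw [btw_self_iff] at hz
        simpa [hz] using hx
      obtain ⟨u, h1, h2, h3⟩ := find_eq_of_pairwise hl
        (p := fun u => decide (u ∈ T.comp q.toFinset x)) (hmem x) (by simpa using hxc)
      simp only [decide_eq_true_eq] at h2
      replace h3 : ∀ y ∈ T.comp q.toFinset x, rk u ≤ rk y := fun y hy =>
        h3 y (hmem y) (by simpa using hy)
      have huq : u ∉ q := by
        have := mem_comp.1 h2 u (btw_right _ _)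
        simpa using this
      have hsub : ∀ y, y ∈ T.comp (q ++ [u]).toFinset x ↔ y ∈ T.comp q.toFinset x ∧ ¬ T.Btw x u y := by
        intro y
        simp only [mem_comp, List.toFinset_append, Finset.mem_union, not_or, List.mem_toFinset,
          List.mem_singleton]
        constructor
        · exact fun h => ⟨fun z hz => (h z hz).1, fun h' => (h u h').2 rfl⟩
        · rintro ⟨h4, h5⟩ z hz
          exact ⟨h4 z hz, fun e => h5 (e ▸ hz)⟩
      have hq : (q ++ [u]).Nodup := by
        rw [List.nodup_append]
        simp only [List.nodup_singleton, List.mem_singleton, true_and]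
        exact ⟨hnd, fun a ha b hb e => huq (hb ▸ e ▸ ha)⟩
      have hcle : (T.comp q.toFinset x).card ≤ n - q.length := by
        have : Disjoint (T.comp q.toFinset x) q.toFinset := Finset.disjoint_left.2 fun y hy hy' =>
          mem_comp.1 hy y (btw_right _ _) hy'
        have h := Finset.card_le_univ (T.comp q.toFinset x ∪ q.toFinset)
        rw [Finset.card_union_of_disjoint this, List.toFinset_card_of_nodup hnd,
          Fintype.card_fin] at h
        omega
      suffices h : _ ∧ _ ∧ _ by
        obtain ⟨q', e1, e2, e3⟩ := ih (q ++ [u]) hq (by simp; omega) (by omega) h.1 h.2.1 h.2.2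
        refine ⟨q', fun v jump => ?_, e2, e3⟩
        rw [search, if_neg (by simp [hx, hcard]), h1]
        dsimp only
        split_ifs <;> exact e1 _ _
      refine ⟨?_, ?_, ?_⟩
      · intro y hy
        rw [List.mem_append, List.mem_singleton] at hy
        rcases hy with hy | rfl
        · exact hb y hy
        · refine ⟨fun z hz => h3 z (mem_comp.2 fun z' hz' => ?_), ?_⟩
          · exact mem_comp.1 h2 z' (Btw.of_left hz.symm hz')
          · rintro rfl
            obtain ⟨z, hz, hne⟩ := Finset.exists_mem_ne hcard y
            have hadj := adj_towards (T := T) hne.symm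
            refine ⟨_, hadj, lt_of_le_of_ne (h3 _ ?_) fun e => hadj.ne (hrk e)⟩
            exact mem_comp.2 fun z' hz' => mem_comp.1 hz z' (Btw.of_left btw_towards hz')
      · intro y hy z hz
        rw [hsub] at hz
        rw [List.mem_append, List.mem_singleton] at hy
        rcases hy with hy | rfl
        · exact hc y hy z hz.1
        · exact lt_of_le_of_ne (h3 z hz.1) fun e => hz.2 (hrk e ▸ btw_right _ _)
      · intro y hy
        rw [hsub, List.mem_append, List.mem_singleton]
        by_cases hyu : y = u
        · exact Or.inl (Or.inr hyu)
        rcases hd y hy with h | h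
        · exact Or.inl (Or.inl h)
        · refine Or.inr ⟨h, fun h' => hyu (hrk ?_)⟩
          exact le_antisymm (hy u h'.symm) (h3 y h)

theorem exists_run_eq {rk : Fin n → ℕ} (hrk : Function.Injective rk) {l : List (Fin n)}
    (hl : l.Pairwise fun a b => rk a < rk b) (hmem : ∀ v, v ∈ l) (x : Fin n) :
    ∃ q, (∀ jump, T.runWith (fun _ => l) x jump = some q) ∧ q.Nodup ∧
      ∀ u, u ∈ q ↔ T.Queried rk x u := by
  obtain ⟨q, h1, h2, h3⟩ := search_eq (T := T) hrk hl hmem x n [] (by simp) (by simp) x.pos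
    (by simp) (by simp) fun u _ => Or.inr (mem_comp.2 (by simp))
  exact ⟨q, fun jump => h1 _ _, h2, h3⟩

/-- A different choice of the next vertex only selects another copy of the same list. -/
theorem isStable_const {rk : Fin n → ℕ} (hrk : Function.Injective rk) {l : List (Fin n)}
    (hl : l.Pairwise fun a b => rk a < rk b) (hmem : ∀ v, v ∈ l) : T.IsStable fun _ => l := by
  intro x
  obtain ⟨q, h1, -⟩ := exists_run_eq (T := T) hrk hl hmem x
  exact ⟨q, h1 _, fun jump _ => ⟨q, h1 _, .refl _⟩⟩

variable (T) in
open Classical in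
/-- The contribution of a query to `q` to the modified cost for the target `x`. -/
noncomputable def gain (ω : ℝ) (c : ℕ) (x q : Fin n) : ℝ :=
  T.weight q - if T.weight q < c * ω ∧ T.InSubtree q x then (2 * c + 1) * ω else 0

variable (T) in
open Classical in
/-- The vertices that are queried when `x` is searched in the order of the ranks. -/
noncomputable def querySet (rk : Fin n → ℕ) (x : Fin n) : Finset (Fin n) :=
  Finset.univ.filter fun q => T.Queried rk x q

theorem mem_querySet {rk : Fin n → ℕ} {x q : Fin n} : q ∈ T.querySet rk x ↔ T.Queried rk x q := by
  classical
  simp [querySet]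

variable (T) in
/-- The modified cost for the target `x` of the search in the order of the ranks. -/
noncomputable def rankCost (rk : Fin n → ℕ) (ω : ℝ) (c : ℕ) (x : Fin n) : ℝ :=
  ∑ q ∈ T.querySet rk x, T.gain ω c x q

/-- The queries for one target are distinct, so their weights and the number of discounts combine to
one finite sum over a set. -/
theorem modCost_const {rk : Fin n → ℕ} (hrk : Function.Injective rk) {l : List (Fin n)}
    (hl : l.Pairwise fun a b => rk a < rk b) (hmem : ∀ v, v ∈ l) (ω : ℝ) (c : ℕ) :
    T.modCost ω c (T.inducedQueries fun _ => l) = ⨆ x, T.rankCost rk ω c x := by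
  classical
  rw [modCost]
  congr 1
  ext x
  obtain ⟨q, h1, h2, h3⟩ := exists_run_eq (T := T) hrk hl hmem x
  have h4 : T.inducedQueries (fun _ => l) x = q := by
    rw [inducedQueries, run, h1]; rfl
  have h5 : q.toFinset = T.querySet rk x := by
    ext u; simp [h3, mem_querySet]
  simp only [rankCost, gain]
  rw [h4, ← h5, Finset.sum_sub_distrib, totalWeight, lightDown, List.sum_toFinset _ h2]
  congr 1
  rw [← Finset.sum_filter, Finset.sum_const, nsmul_eq_mul, mul_comm]
  congr 2
  rw [List.countP_eq_length_filter, ← List.toFinset_card_of_nodup (h2.filter _)]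
  congr 1
  ext u
  simp

/-! ### Strategies -/

/-- Until a query hits the path between `x` and `x'`, all targets on this path receive the same
replies. The first query `y` that hits it is therefore preceded by the same list for all of them. -/
theorem queries_prefix (A : Strategy n) (x x' : Fin n) :
    (∀ q ∈ A.queries T x, ¬ T.Btw x q x') ∨
      ∃ l y r, A.queries T x = l ++ y :: r ∧ T.Btw x y x' ∧ (∀ q ∈ l, ¬ T.Btw x q x') ∧
        ∀ z, T.Btw x z x' → ∃ r', A.queries T z = l ++ y :: r' := by
  induction A with
  | done => exact Or.inl (by simp [Strategy.queries])
  | query v next ih =>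
    by_cases hv : T.Btw x v x'
    · refine Or.inr ⟨[], v, _, by rw [Strategy.queries, List.nil_append], hv, by simp,
        fun z _ => ⟨_, by rw [Strategy.queries, List.nil_append]⟩⟩
    · have hvx : x ≠ v := fun e => hv (e ▸ btw_left _ _)
      rw [Strategy.queries, if_neg hvx]
      rcases ih (T.towards v x) with h | ⟨l, y, r, h1, h2, h3, h4⟩
      · refine Or.inl fun q hq => ?_
        rcases List.mem_cons.1 hq with rfl | hq
        exacts [hv, h q hq]
      · refine Or.inr ⟨v :: l, y, r, by rw [h1, List.cons_append], h2, fun q hq => ?_,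
          fun z hz => ?_⟩
        · rcases List.mem_cons.1 hq with rfl | hq
          exacts [hv, h3 q hq]
        · obtain ⟨r', h5⟩ := h4 z hz
          refine ⟨r', ?_⟩
          have hvz : z ≠ v := fun e => hv (e ▸ hz)
          rw [Strategy.queries, if_neg hvz, ← towards_eq (T := T) (x := x) (x' := z)
            (fun h => hv (Btw.of_left hz h)), h5, List.cons_append]

/-- The strategy that queries the vertices of a list until it hits the target. -/
def listStrategy : List (Fin n) → Strategy n
  | [] => .done
  | v :: l => .query v fun _ => listStrategy l

theorem listStrategy_queries (l : List (Fin n)) (x : Fin n) :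
    ((listStrategy l).queries T x).Sublist l ∧ (x ∈ l → x ∈ (listStrategy l).queries T x) := by
  induction l with
  | nil => simp [listStrategy, Strategy.queries]
  | cons v l ih =>
    rw [listStrategy, Strategy.queries]
    split_ifs with h
    · simp [h]
    · refine ⟨ih.1.cons_cons v, fun hx => ?_⟩
      rcases List.mem_cons.1 hx with rfl | hx
      · simp
      · exact List.mem_cons_of_mem _ (ih.2 hx)

end WTree


/-! ### Windows and digits

Time is divided into `D` windows of width `W`, up to the horizon `H`. A vertex of duration `d`
is light if `d < W` and heavy otherwise. It carries a label `l ≤ H`; label `H` means late.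
Digits `3 k`, `3 k + 1` and `3 k + 2` of a family of vertices collect, for the vertices with a
label in window `k`, the durations of the light ones, the label (plus one) of the heavy one, and
its duration. -/

namespace Schedule

/-- The contribution of a vertex with duration `d` and label `l` to the digit `i`. -/
def item (H W d l i : ℕ) : ℕ :=
  if l = H ∨ l / W ≠ i / 3 then 0
  else if i % 3 = 0 then (if d < W then d else 0)
  else if W ≤ d then (if i % 3 = 1 then l + 1 else d) else 0

/-- The total duration of the light vertices in the windows `j, …, j'` and of the heavy vertices
in the windows `j, …, j' - 1`. -/
def load (D : ℕ) (g : ℕ → ℕ) (j j' : ℕ) : ℕ :=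
  ∑ k ∈ Finset.range D, ((if j ≤ k ∧ k ≤ j' then g (3 * k) else 0) +
    (if j ≤ k ∧ k < j' then g (3 * k + 2) else 0))

/-- The vertices with digits `g` and windows from `j` on can be scheduled from the time `τ` on. -/
def Start (H W D : ℕ) (g : ℕ → ℕ) (τ j : ℕ) : Prop :=
  (∀ j' < D, j ≤ j' →
    (g (3 * j' + 1) ≠ 0 → τ + load D g j j' + 1 ≤ g (3 * j' + 1)) ∧
    (g (3 * j') ≠ 0 → τ + load D g j j' + 2 ≤ (j' + 2) * W)) ∧
  τ + load D g j D ≤ H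

/-- The conditions at a vertex with duration `d`, label `l` and digits `g`. -/
def Node (H W D d l : ℕ) (g : ℕ → ℕ) : Prop :=
  (l = H ∨ l + d ≤ H) ∧ ∀ i < D, i * W ≤ H → Start H W D g (i * W) i

/-- The conditions at a vertex with label `l` and digits `g`, whose parent has duration `dp` and
label `lp`. -/
def Edge (H W D dp lp l : ℕ) (g : ℕ → ℕ) : Prop :=
  (lp = H → l ≠ H) ∧
    (lp ≠ H → W ≤ dp → Start H W D g (lp + dp) (lp / W + 1) ∧ g (3 * (lp / W) + 1) = 0)

/-- A vertex of duration `d` and label `l` does not hide the vertices of the digit `i`. -/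
def Keep (H W d l i : ℕ) : Prop :=
  l = H ∨ (i / 3 + 1) * W ≤ l ∨ (i % 3 = 0 ∧ W ≤ d ∧ i / 3 * W ≤ l)

open Classical in
/-- The part of the digits `g` that is not hidden. -/
noncomputable def kept (H W d l : ℕ) (g : ℕ → ℕ) (i : ℕ) : ℕ := if Keep H W d l i then g i else 0

/-- There are no two heavy vertices in the same window. -/
def Merge (D : ℕ) (g g' : ℕ → ℕ) : Prop := ∀ k < D, g (3 * k + 1) = 0 ∨ g' (3 * k + 1) = 0

/-- The key according to which the vertices are ordered. -/
def key (n H W D d l depth : ℕ) : ℕ :=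
  if l = H then 2 * D * (n + 1) + depth
  else (2 * (l / W) + if W ≤ d then 1 else 0) * (n + 1) + depth

end Schedule

open Schedule

/-- A tree with durations and labels. -/
structure Labeling (n : ℕ) where
  T : WTree n
  d : Fin n → ℕ
  H : ℕ
  W : ℕ
  D : ℕ
  lab : Fin n → ℕ
  d_pos : ∀ v, 1 ≤ d v
  lab_le : ∀ v, lab v ≤ H
  H_le : H ≤ D * W

namespace Labeling

variable {n : ℕ} (P : Labeling n)

/-- The window of a vertex. -/
def win (v : Fin n) : ℕ := P.lab v / P.W

/-- Lexicographic: first the window with light before heavy, then the depth, late vertices last. The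
factor `n + 1` exceeds every depth, so an ancestor precedes its descendants of the same window and
kind. -/
noncomputable def key (v : Fin n) : ℕ :=
  Schedule.key n P.H P.W P.D (P.d v) (P.lab v) (P.T.depth v)

/-- `u` is visible from its ancestor `v`. -/
def Vis (v u : Fin n) : Prop :=
  P.T.InSubtree v u ∧ ∀ y, P.T.Btw u y v → y ≠ u → P.key u < P.key y

open Classical in
/-- The digits of the vertices visible from `v`. -/
noncomputable def dg (v : Fin n) (i : ℕ) : ℕ :=
  ∑ u with P.Vis v u, item P.H P.W (P.d u) (P.lab u) i

open Classical in
/-- The digits of the vertices below the children `y < j` of `p` that are visible from `p`. -/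
noncomputable def acc (p : Fin n) (j i : ℕ) : ℕ :=
  ∑ y with P.T.IsChild p y ∧ y.1 < j, kept P.H P.W (P.d p) (P.lab p) (P.dg y) i

/-- The labels describe a feasible schedule. -/
structure IsGood : Prop where
  node : ∀ v, Node P.H P.W P.D (P.d v) (P.lab v) (P.dg v)
  edge : ∀ p y, P.T.IsChild p y → Edge P.H P.W P.D (P.d p) (P.lab p) (P.lab y) (P.dg y)
  merge : ∀ p y, P.T.IsChild p y →
    Merge P.D (P.acc p y) (kept P.H P.W (P.d p) (P.lab p) (P.dg y))

variable {P}

theorem W_pos {v : Fin n} (h : P.lab v ≠ P.H) : 0 < P.W := by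
  have h1 := P.lab_le v
  have h2 := P.H_le
  rcases Nat.eq_zero_or_pos P.W with h3 | h3
  · rw [h3, mul_zero] at h2; omega
  · exact h3

theorem win_lt {v : Fin n} (h : P.lab v ≠ P.H) : P.win v < P.D := by
  have h1 := P.lab_le v
  have h2 := P.H_le
  exact (Nat.div_lt_iff_lt_mul (W_pos h)).2 (by omega)

theorem win_mul_le (v : Fin n) : P.win v * P.W ≤ P.lab v := Nat.div_mul_le_self _ _

theorem key_of_late {v : Fin n} (h : P.lab v = P.H) : P.key v = 2 * P.D * (n + 1) + P.T.depth v :=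
  if_pos h

theorem key_of_not_late {v : Fin n} (h : P.lab v ≠ P.H) :
    P.key v = (2 * P.win v + if P.W ≤ P.d v then 1 else 0) * (n + 1) + P.T.depth v :=
  if_neg h

theorem le_of_mul_add_le {N A B a b : ℕ} (hb : b ≤ N)
    (h : A * (N + 1) + a ≤ B * (N + 1) + b) : A ≤ B := by
  by_contra hlt
  have : (B + 1) * (N + 1) ≤ A * (N + 1) := Nat.mul_le_mul_right _ (by omega)
  rw [Nat.succ_mul] at this
  omega

/-- Twice the window of a vertex, plus one if it is heavy. -/
noncomputable def pos (P : Labeling n) (v : Fin n) : ℕ :=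
  if P.lab v = P.H then 2 * P.D else 2 * P.win v + if P.W ≤ P.d v then 1 else 0

theorem key_eq (v : Fin n) : P.key v = P.pos v * (n + 1) + P.T.depth v := by
  rw [pos]
  split_ifs with h h1
  · rw [key_of_late h]
  · rw [key_of_not_late h, if_pos h1]
  · rw [key_of_not_late h, if_neg h1]

theorem pos_le_of_key_le {a b : Fin n} (h : P.key a ≤ P.key b) : P.pos a ≤ P.pos b := by
  rw [key_eq, key_eq] at h
  exact le_of_mul_add_le (WTree.depth_le _) h

theorem depth_eq_of_key_eq {a b : Fin n} (h : P.key a = P.key b) : P.T.depth a = P.T.depth b := by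
  have h1 := le_antisymm (pos_le_of_key_le h.le) (pos_le_of_key_le h.ge)
  rw [key_eq, key_eq, h1] at h
  omega

theorem key_lt_of_pos_lt {a b : Fin n} (h : P.pos a < P.pos b) : P.key a < P.key b := by
  by_contra h1
  exact absurd (pos_le_of_key_le (not_lt.1 h1)) (by omega)

theorem pos_of_late {v : Fin n} (h : P.lab v = P.H) : P.pos v = 2 * P.D := if_pos h

theorem pos_of_heavy {v : Fin n} (h : P.lab v ≠ P.H) (h' : P.W ≤ P.d v) :
    P.pos v = 2 * P.win v + 1 := by rw [pos, if_neg h, if_pos h']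

theorem pos_of_light {v : Fin n} (h : P.lab v ≠ P.H) (h' : P.d v < P.W) :
    P.pos v = 2 * P.win v := by rw [pos, if_neg h, if_neg (by omega), add_zero]

theorem pos_lt {v : Fin n} (h : P.lab v ≠ P.H) : P.pos v < 2 * P.D := by
  have := win_lt h
  rw [pos, if_neg h]
  split_ifs <;> omega

theorem not_late_of_key_le {a b : Fin n} (h : P.key a ≤ P.key b) (hb : P.lab b ≠ P.H) :
    P.lab a ≠ P.H := fun ha => by
  have h1 := pos_le_of_key_le h
  rw [pos_of_late ha] at h1
  have := pos_lt hb
  omega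

theorem win_le_of_key_le {a b : Fin n} (h : P.key a ≤ P.key b) (hb : P.lab b ≠ P.H) :
    P.win a ≤ P.win b := by
  have ha := not_late_of_key_le h hb
  have h1 := pos_le_of_key_le h
  rw [pos, pos, if_neg ha, if_neg hb] at h1
  split_ifs at h1 <;> omega

/-- Equal keys imply equal depths, and a proper ancestor has smaller depth; so weak inequalities on
the way up are automatically strict. -/
theorem vis_of_le {v u : Fin n} (h : P.T.InSubtree v u)
    (h' : ∀ y, P.T.Btw u y v → P.key u ≤ P.key y) : P.Vis v u := by
  refine ⟨h, fun y hy hne => lt_of_le_of_ne (h' y hy) fun e => ?_⟩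
  have h1 := ((WTree.btw_iff_of_inSubtree h).1 hy).1
  exact absurd (depth_eq_of_key_eq e) (WTree.depth_lt h1 hne).ne'

theorem vis_self (v : Fin n) : P.Vis v v :=
  vis_of_le (.refl v) fun y hy => by rw [WTree.btw_self_iff.1 hy]

theorem vis_iff_child {p y u : Fin n} (h : P.T.IsChild p y) (hu : P.T.InSubtree y u) :
    P.Vis p u ↔ P.Vis y u ∧ P.key u < P.key p := by
  have hpu : p ≠ u := fun e => h.not_inSubtree (e ▸ hu)
  constructor
  · exact fun h1 => ⟨⟨hu, fun a ha => h1.2 a ((h.btw_iff hu).2 (Or.inr ha))⟩,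
      h1.2 p (WTree.btw_right _ _) hpu⟩
  · rintro ⟨h1, h2⟩
    refine ⟨h.inSubtree.trans hu, fun a ha hne => ?_⟩
    rcases (h.btw_iff hu).1 ha with rfl | h3
    · exact h2
    · exact h1.2 a h3 hne

theorem item_eq_zero_of_late {v : Fin n} (h : P.lab v = P.H) (i : ℕ) :
    item P.H P.W (P.d v) (P.lab v) i = 0 := by rw [item, if_pos (Or.inl h)]

theorem item_light {v : Fin n} (h : P.lab v ≠ P.H) (k : ℕ) :
    item P.H P.W (P.d v) (P.lab v) (3 * k) = if P.win v = k ∧ P.d v < P.W then P.d v else 0 := by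
  have e1 : 3 * k / 3 = k := by omega
  have e2 : 3 * k % 3 = 0 := by omega
  rw [item, e1, e2]
  by_cases hk : P.win v = k
  · have : P.lab v / P.W = k := hk
    simp [h, this, hk]
  · have : P.lab v / P.W ≠ k := hk
    simp [this, hk]

theorem item_head {v : Fin n} (h : P.lab v ≠ P.H) (k : ℕ) :
    item P.H P.W (P.d v) (P.lab v) (3 * k + 1) =
      if P.win v = k ∧ P.W ≤ P.d v then P.lab v + 1 else 0 := by
  have e1 : (3 * k + 1) / 3 = k := by omega
  have e2 : (3 * k + 1) % 3 = 1 := by omega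
  rw [item, e1, e2]
  by_cases hk : P.win v = k
  · have : P.lab v / P.W = k := hk
    simp [h, this, hk]
  · have : P.lab v / P.W ≠ k := hk
    simp [this, hk]

theorem item_heavy {v : Fin n} (h : P.lab v ≠ P.H) (k : ℕ) :
    item P.H P.W (P.d v) (P.lab v) (3 * k + 2) =
      if P.win v = k ∧ P.W ≤ P.d v then P.d v else 0 := by
  have e1 : (3 * k + 2) / 3 = k := by omega
  have e2 : (3 * k + 2) % 3 = 2 := by omega
  rw [item, e1, e2]
  by_cases hk : P.win v = k
  · have : P.lab v / P.W = k := hk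
    simp [h, this, hk]
  · have : P.lab v / P.W ≠ k := hk
    simp [this, hk]

/-- For an ancestor `p` of `u` ties are decided in favour of `p`, so only window and kind are
compared, and those of `u` can be read off from a digit to which it contributes. Thus whether `p`
hides `u` depends on the digit alone, and whole digits can be kept or dropped. -/
theorem key_lt_iff_keep {p u : Fin n} (hd : P.T.depth p < P.T.depth u) {i : ℕ}
    (hi : item P.H P.W (P.d u) (P.lab u) i ≠ 0) :
    P.key u < P.key p ↔ Keep P.H P.W (P.d p) (P.lab p) i := by
  have hu : P.lab u ≠ P.H := fun h => hi (item_eq_zero_of_late h i)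
  have hW := W_pos hu
  have hk : P.win u = i / 3 := by
    by_contra h
    have : P.lab u / P.W ≠ i / 3 := h
    exact hi (by rw [item, if_pos (Or.inr this)])
  have hl : i % 3 = 0 ↔ P.d u < P.W := by
    by_contra h
    apply hi
    rw [item]
    split_ifs <;> simp_all
  have hpos : P.key u < P.key p ↔ P.pos u < P.pos p := by
    refine ⟨fun h => lt_of_le_of_ne (pos_le_of_key_le h.le) fun e => ?_, key_lt_of_pos_lt⟩
    rw [key_eq, key_eq, e] at h
    omega
  rw [hpos, Keep]
  by_cases hp : P.lab p = P.H
  · rw [pos_of_late hp]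
    exact ⟨fun _ => Or.inl hp, fun _ => pos_lt hu⟩
  · rw [← Nat.le_div_iff_mul_le hW, ← Nat.le_div_iff_mul_le hW, ← hk, hl]
    change _ ↔ _ ∨ _ ≤ P.win p ∨ _ ∧ _ ∧ _ ≤ P.win p
    rcases lt_or_ge (P.d u) P.W with h1 | h1 <;> rcases lt_or_ge (P.d p) P.W with h2 | h2
    · rw [pos_of_light hu h1, pos_of_light hp h2]; omega
    · rw [pos_of_light hu h1, pos_of_heavy hp h2]; omega
    · rw [pos_of_heavy hu h1, pos_of_light hp h2]; omega
    · rw [pos_of_heavy hu h1, pos_of_heavy hp h2]; omega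

/-- A vertex below the child `y` is visible from `p` if it is visible from `y` and precedes `p`; by
`key_lt_iff_keep` the second condition is a condition on the digit. So the digits of `p` depend on
the digits of its children only. This is the recursion behind the table. -/
theorem dg_eq (p : Fin n) (i : ℕ) :
    P.dg p i = P.acc p n i + item P.H P.W (P.d p) (P.lab p) i := by
  classical
  have h1 : (Finset.univ.filter fun u => P.Vis p u) =
      insert p ((Finset.univ.filter fun y => P.T.IsChild p y ∧ y.1 < n).biUnion fun y =>
        Finset.univ.filter fun u => P.Vis y u ∧ P.key u < P.key p) := by
    ext u
    simp only [Finset.mem_filter, Finset.mem_univ, true_and, Finset.mem_insert, Finset.mem_biUnion]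
    constructor
    · intro hu
      by_cases hpu : u = p
      · exact Or.inl hpu
      · obtain ⟨y, hy, hyu⟩ := WTree.exists_child hu.1 (Ne.symm hpu)
        exact Or.inr ⟨y, ⟨hy, y.2⟩, (vis_iff_child hy hyu).1 hu⟩
    · rintro (rfl | ⟨y, ⟨hy, -⟩, h⟩)
      · exact vis_self _
      · exact (vis_iff_child hy h.1.1).2 h
  rw [dg, h1, Finset.sum_insert, Finset.sum_biUnion, add_comm, acc]
  · congr 1
    refine Finset.sum_congr rfl fun y hy => ?_
    simp only [Finset.mem_filter, Finset.mem_univ, true_and] at hy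
    have h2 : ∀ u, P.Vis y u → item P.H P.W (P.d u) (P.lab u) i ≠ 0 →
        (P.key u < P.key p ↔ Keep P.H P.W (P.d p) (P.lab p) i) := fun u hu hi =>
      key_lt_iff_keep (WTree.depth_lt (hy.1.inSubtree.trans hu.1)
        fun e => hy.1.not_inSubtree (e ▸ hu.1)) hi
    rw [kept, dg]
    by_cases hk : Keep P.H P.W (P.d p) (P.lab p) i
    · rw [if_pos hk]
      refine Finset.sum_subset (fun u hu => ?_) fun u hu hu' => ?_
      · simp only [Finset.mem_filter, Finset.mem_univ, true_and] at hu ⊢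
        exact hu.1
      · simp only [Finset.mem_filter, Finset.mem_univ, true_and] at hu hu'
        by_contra hi
        exact hu' ⟨hu, (h2 u hu hi).2 hk⟩
    · rw [if_neg hk]
      refine Finset.sum_eq_zero fun u hu => ?_
      simp only [Finset.mem_filter, Finset.mem_univ, true_and] at hu
      by_contra hi
      exact hk ((h2 u hu.1 hi).1 hu.2)
  · intro y hy y' hy' hne
    refine Finset.disjoint_left.2 fun u hu hu' => hne ?_
    simp only [Finset.mem_coe, Finset.mem_filter, Finset.mem_univ, true_and] at hy hy' hu hu'
    exact hy.1.eq_of_inSubtree hy'.1 hu.1.1 hu'.1.1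
  · simp only [Finset.mem_biUnion, Finset.mem_filter, Finset.mem_univ, true_and, not_exists, not_and]
    exact fun y hy hp => absurd hp.1 hy.1.not_inSubtree

theorem dg_head_ne_zero {v u : Fin n} (h : P.Vis v u) (hl : P.lab u ≠ P.H) (hh : P.W ≤ P.d u) :
    P.lab u + 1 ≤ P.dg v (3 * P.win u + 1) := by
  classical
  have := Finset.single_le_sum (f := fun u' => item P.H P.W (P.d u') (P.lab u') (3 * P.win u + 1))
    (s := Finset.univ.filter fun u' => P.Vis v u') (fun _ _ => Nat.zero_le _)
    (Finset.mem_filter.2 ⟨Finset.mem_univ u, h⟩)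
  rwa [item_head hl, if_pos ⟨rfl, hh⟩] at this

theorem dg_light_ne_zero {v u : Fin n} (h : P.Vis v u) (hl : P.lab u ≠ P.H) (hh : P.d u < P.W) :
    P.d u ≤ P.dg v (3 * P.win u) := by
  classical
  have := Finset.single_le_sum (f := fun u' => item P.H P.W (P.d u') (P.lab u') (3 * P.win u))
    (s := Finset.univ.filter fun u' => P.Vis v u') (fun _ _ => Nat.zero_le _)
    (Finset.mem_filter.2 ⟨Finset.mem_univ u, h⟩)
  rwa [item_light hl, if_pos ⟨rfl, hh⟩] at this

theorem exists_of_dg_ne_zero {v : Fin n} {i : ℕ} (h : P.dg v i ≠ 0) :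
    ∃ u, P.Vis v u ∧ P.lab u ≠ P.H ∧ item P.H P.W (P.d u) (P.lab u) i ≠ 0 := by
  classical
  obtain ⟨u, hu, hi⟩ := Finset.exists_ne_zero_of_sum_ne_zero h
  exact ⟨u, (Finset.mem_filter.1 hu).2, fun h => hi (item_eq_zero_of_late h i), hi⟩

open Classical in
theorem load_dg (v : Fin n) (j j' : ℕ) :
    load P.D (P.dg v) j j' = ∑ u with P.Vis v u ∧ P.lab u ≠ P.H ∧ j ≤ P.win u ∧
      (P.d u < P.W ∧ P.win u ≤ j' ∨ P.W ≤ P.d u ∧ P.win u < j'), P.d u := by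
  have h1 : ∀ k, ((if j ≤ k ∧ k ≤ j' then P.dg v (3 * k) else 0) +
      (if j ≤ k ∧ k < j' then P.dg v (3 * k + 2) else 0)) =
      ∑ u with P.Vis v u, ((if j ≤ k ∧ k ≤ j' then item P.H P.W (P.d u) (P.lab u) (3 * k) else 0) +
        (if j ≤ k ∧ k < j' then item P.H P.W (P.d u) (P.lab u) (3 * k + 2) else 0)) := by
    intro k
    rw [Finset.sum_add_distrib, dg, dg]
    split_ifs <;> simp
  rw [load, Finset.sum_congr rfl fun k _ => h1 k, Finset.sum_comm, ← Finset.filter_filter,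
    Finset.sum_filter (s := Finset.univ.filter fun u => P.Vis v u)]
  refine Finset.sum_congr rfl fun u _ => ?_
  by_cases hl : P.lab u = P.H
  · simp only [item_eq_zero_of_late hl, ite_self, add_zero, Finset.sum_const_zero]
    simp [hl]
  · rw [Finset.sum_eq_single (P.win u)]
    · rw [item_light hl, item_heavy hl]
      rcases lt_or_ge (P.d u) P.W with h | h
      · simp [h, hl, not_le.2 h]
      · simp [h, hl, not_lt.2 h]
    · intro k _ hk
      rw [item_light hl, item_heavy hl]
      simp [Ne.symm hk]
    · intro h
      exact absurd (Finset.mem_range.2 (win_lt hl)) h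

theorem sum_le_load {v : Fin n} {j j' : ℕ} {Y : Finset (Fin n)}
    (hY : ∀ u ∈ Y, P.Vis v u ∧ P.lab u ≠ P.H ∧ j ≤ P.win u ∧
      (P.d u < P.W ∧ P.win u ≤ j' ∨ P.W ≤ P.d u ∧ P.win u < j')) :
    ∑ u ∈ Y, P.d u ≤ load P.D (P.dg v) j j' := by
  classical
  rw [load_dg]
  exact Finset.sum_le_sum_of_subset fun u hu => by simpa using hY u hu

/-- Adding up labels would make no sense, but `merge` and `edge` leave at most one nonzero summand
at every level of `dg_eq`. So the digit carries the label of the only visible heavy vertex of its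
window. -/
theorem IsGood.head_eq (hP : P.IsGood) {v u : Fin n} (h : P.Vis v u) (hl : P.lab u ≠ P.H)
    (hh : P.W ≤ P.d u) : P.dg v (3 * P.win u + 1) = P.lab u + 1 := by
  classical
  obtain ⟨k, hk⟩ : ∃ k, P.T.depth u < P.T.depth v + k := ⟨P.T.depth u + 1, by omega⟩
  induction k generalizing v with
  | zero =>
    rcases eq_or_ne v u with rfl | hne
    · omega
    · have := WTree.depth_lt h.1 hne
      omega
  | succ k ih =>
    rw [dg_eq]
    by_cases hvu : v = u
    · subst hvu
      rw [item_head hl, if_pos ⟨rfl, hh⟩]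
      refine Nat.add_eq_right.2 (Finset.sum_eq_zero fun y hy => ?_)
      have hy' := (Finset.mem_filter.1 hy).2.1
      have h0 : P.dg y (3 * P.win v + 1) = 0 := ((hP.edge v y hy').2 hl hh).2
      rw [kept, h0, ite_self]
    · obtain ⟨y, hy, hyu⟩ := WTree.exists_child h.1 hvu
      obtain ⟨h1, h2⟩ := (vis_iff_child hy hyu).1 h
      have h3 := ih h1 (by rw [hy.depth_eq]; omega)
      have hd := WTree.depth_lt h.1 hvu
      have h4 : Keep P.H P.W (P.d v) (P.lab v) (3 * P.win u + 1) := by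
        refine (key_lt_iff_keep hd ?_).1 h2
        rw [item_head hl, if_pos ⟨rfl, hh⟩]
        omega
      have h5 : kept P.H P.W (P.d v) (P.lab v) (P.dg y) (3 * P.win u + 1) = P.lab u + 1 := by
        rw [kept, if_pos h4, h3]
      have h6 : ∀ y', P.T.IsChild v y' → y' ≠ y →
          kept P.H P.W (P.d v) (P.lab v) (P.dg y') (3 * P.win u + 1) = 0 := by
        intro y' hy' hne
        have key : ∀ a b, P.T.IsChild v a → P.T.IsChild v b → a < b →
            kept P.H P.W (P.d v) (P.lab v) (P.dg a) (3 * P.win u + 1) = 0 ∨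
            kept P.H P.W (P.d v) (P.lab v) (P.dg b) (3 * P.win u + 1) = 0 := by
          intro a b ha hb hab
          refine (hP.merge v b hb _ (win_lt hl)).imp_left fun h0 => ?_
          exact Finset.sum_eq_zero_iff.1 h0 a (by simp [ha, hab])
        rcases lt_or_gt_of_ne hne with hlt | hlt
        · exact (key _ _ hy' hy hlt).resolve_right (by omega)
        · exact (key _ _ hy hy' hlt).resolve_left (by omega)
      have h7 : P.acc v n (3 * P.win u + 1) = P.lab u + 1 := by
        rw [acc, Finset.sum_eq_single y, h5]
        · intro y' hy' hne
          exact h6 y' (Finset.mem_filter.1 hy').2.1 hne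
        · intro hy'
          simp [hy] at hy'
      rw [h7, Nat.add_eq_left]
      by_cases hv : P.lab v = P.H
      · exact item_eq_zero_of_late hv _
      · rw [item_head hv, if_neg]
        rintro ⟨h8, h9⟩
        have := ((hP.edge v y hy).2 hv h9).2
        rw [show P.lab v / P.W = P.win u from h8, h3] at this
        omega

/-- Two such vertices would both contribute to the same head digit, which by `head_eq` consists of
one contribution. -/
theorem IsGood.heavy_unique (hP : P.IsGood) {v u u' : Fin n} (h : P.Vis v u) (hl : P.lab u ≠ P.H)
    (hh : P.W ≤ P.d u) (h' : P.Vis v u') (hl' : P.lab u' ≠ P.H) (hh' : P.W ≤ P.d u')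
    (hw : P.win u = P.win u') : u = u' := by
  classical
  by_contra hne
  have h1 : ∑ a ∈ {u, u'}, item P.H P.W (P.d a) (P.lab a) (3 * P.win u + 1) ≤
      P.dg v (3 * P.win u + 1) :=
    Finset.sum_le_sum_of_subset fun a ha => by
      rcases Finset.mem_insert.1 ha with rfl | ha
      · simpa using h
      · rw [Finset.mem_singleton.1 ha]; simpa using h'
  rw [Finset.sum_pair hne, hP.head_eq h hl hh, item_head hl, item_head hl', if_pos ⟨rfl, hh⟩,
    if_pos ⟨hw.symm, hh'⟩] at h1
  omega

end Labeling


/-! ### Good labels bound the modified cost. -/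

open Schedule

namespace Labeling

variable {n : ℕ} {P : Labeling n}

/-- A ranking that is consistent with the keys. -/
structure IsRank (P : Labeling n) (rk : Fin n → ℕ) : Prop where
  inj : Function.Injective rk
  key_le : ∀ a b, rk a ≤ rk b → P.key a ≤ P.key b

theorem exists_rankMin (T : WTree n) (rk : Fin n → ℕ) (v x : Fin n) :
    ∃ u, T.Btw v u x ∧ ∀ p, T.Btw v p x → rk u ≤ rk p := by
  classical
  obtain ⟨u, hu, h⟩ := Finset.exists_min_image (Finset.univ.filter fun p => T.Btw v p x) rk
    ⟨v, by simp⟩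
  exact ⟨u, (Finset.mem_filter.1 hu).2, fun p hp => h p (by simpa using hp)⟩

/-- Think of `τ` as a clock when the search has been narrowed to the subtree of `v`. Let `u` be the
first vertex in the order on the path from `v` to `x`. The queries before `u` are visible from `v`,
so `Start` limits their total duration; the later ones lie below the child `y` of `u` towards `x`,
where induction applies. If `u` is heavy, the earlier queries end by the label of `u` and the clock
continues at `lab u + d u`. If `u` is light, everything up to and including `u` ends by `(win u + 2)
* W - 2`, while the clock continues at `win u * W`; the difference `2 * (W - 1)` is covered by the
discount `Δ` of the down query `u`. -/
theorem IsGood.sum_le (hP : P.IsGood) {rk : Fin n → ℕ} (hrk : P.IsRank rk) {σ Δ : ℝ} (hσ : 0 ≤ σ)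
    (hΔ : 2 * ((P.W : ℝ) - 1) * σ ≤ Δ) {x : Fin n} {f : Fin n → ℝ}
    (hf : ∀ q, f q ≤ σ * P.d q)
    (hf' : ∀ q, P.d q < P.W → P.T.InSubtree q x → f q ≤ σ * P.d q - Δ) {v : Fin n} {τ j : ℕ}
    (hv : P.T.InSubtree v x) (hs : Start P.H P.W P.D (P.dg v) τ j)
    (hj : ∀ p, P.T.Btw v p x → P.lab p ≠ P.H → j ≤ P.win p) {X : Finset (Fin n)}
    (hX : ∀ q ∈ X, P.T.InSubtree v q ∧ P.lab q ≠ P.H ∧ j ≤ P.win q ∧ P.T.RankMin rk x q)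
    (hX' : ∀ q, P.T.Btw v q x → q ≠ x → P.lab q ≠ P.H → P.T.RankMin rk x q → q ∈ X) :
    ∑ q ∈ X, f q ≤ σ * ((P.H : ℝ) - τ) := by
  classical
  obtain ⟨k, hk⟩ : ∃ k, P.T.depth x < P.T.depth v + k := ⟨P.T.depth x + 1, by omega⟩
  induction k generalizing v τ j X with
  | zero =>
    rcases eq_or_ne v x with rfl | hne
    · omega
    · have := WTree.depth_lt hv hne
      omega
  | succ k ih =>
    have hsum : ∀ Y : Finset (Fin n), ∑ q ∈ Y, f q ≤ σ * ((∑ q ∈ Y, P.d q : ℕ) : ℝ) := fun Y => by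
      rw [Nat.cast_sum, Finset.mul_sum]
      exact Finset.sum_le_sum fun q _ => hf q
    obtain ⟨u, hu, humin⟩ := exists_rankMin P.T rk v x
    have huR : P.T.RankMin rk x u := fun y hy => humin y (WTree.Btw.of_right hu hy)
    have hvu : P.T.InSubtree v u := WTree.inSubtree_of_btw (.refl v) hv hu
    have hux : P.T.InSubtree u x := ((WTree.btw_iff_of_inSubtree hv).1 hu.symm).1
    have hvis : ∀ q ∈ X, rk q ≤ rk u → P.Vis v q := by
      intro q hq hle
      refine vis_of_le (hX q hq).1 fun y hy => hrk.key_le _ _ ?_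
      rcases hy.or x with h | h
      · exact (hX q hq).2.2.2 y h
      · exact hle.trans (humin y h.symm)
    have huvis : P.Vis v u := vis_of_le hvu fun y hy =>
      hrk.key_le _ _ (humin y (WTree.Btw.of_left hu hy.symm))
    by_cases hxu : u = x
    · subst hxu
      -- No member of `X` comes after `x`, so all of them are visible from `v`, and the last
      -- condition of `Start` is enough.
      have h1 : ∑ q ∈ X, P.d q ≤ load P.D (P.dg v) j P.D := sum_le_load fun q hq => by
        obtain ⟨h1, h2, h3, h4⟩ := hX q hq
        have h5 := win_lt h2
        exact ⟨hvis q hq (h4 u (WTree.btw_right _ _)), h2, h3, by omega⟩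
      refine (hsum X).trans (mul_le_mul_of_nonneg_left ?_ hσ)
      rw [le_sub_iff_add_le']
      exact_mod_cast (Nat.add_le_add_left h1 τ).trans hs.2
    obtain ⟨y, hy, hyx⟩ := WTree.exists_child hux hxu
    have hyv : P.T.InSubtree v y := hvu.trans hy.inSubtree
    have hyP : ∀ p, P.T.Btw y p x → P.T.Btw v p x ∧ rk u < rk p := by
      intro p hp
      have h1 := (WTree.btw_iff_of_inSubtree hyx).1 hp.symm
      have h2 : P.T.Btw v p x := ((WTree.btw_iff_of_inSubtree hv).2 ⟨h1.1, hyv.trans h1.2⟩).symm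
      refine ⟨h2, lt_of_le_of_ne (humin p h2) fun e => ?_⟩
      rw [← hrk.inj e] at h1
      exact hy.not_inSubtree h1.2
    -- The child `y` of a late vertex `u` would not be late, hence would precede `u` on the path.
    have hul : P.lab u ≠ P.H := by
      intro hul
      refine (hP.edge u y hy).1 hul ?_
      by_contra h
      exact not_late_of_key_le (hrk.key_le _ _ (hyP y (WTree.btw_left _ _)).2.le) h hul
    have huX : u ∈ X := hX' u hu hxu hul huR
    -- From outside the subtree of `y` the path to `x` passes `u`, so a vertex after `u` cannot come
    -- first on it.
    have hXy : ∀ q ∈ X, rk u < rk q → P.T.InSubtree y q := by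
      intro q hq hlt
      by_contra h
      exact absurd ((hX q hq).2.2.2 u (hy.btw_of_not hyx h)) (by omega)
    have hpos : ∀ q, rk u < rk q → P.pos u ≤ P.pos q := fun q hq =>
      pos_le_of_key_le (hrk.key_le _ _ hq.le)
    have hdep : P.T.depth x < P.T.depth y + k := by
      have h1 := hy.depth_eq
      have h2 : P.T.depth v ≤ P.T.depth u := by
        rcases eq_or_ne v u with h | h
        · rw [h]
        · exact (WTree.depth_lt hvu h).le
      omega
    have hX2 : ∀ q, P.T.Btw y q x → q ≠ x → P.lab q ≠ P.H → P.T.RankMin rk x q →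
        q ∈ X.filter fun q => rk u < rk q := fun q h1 h2 h3 h4 =>
      Finset.mem_filter.2 ⟨hX' q (hyP q h1).1 h2 h3 h4, (hyP q h1).2⟩
    have hsplit : ∑ q ∈ X, f q = ∑ q ∈ X with rk q < rk u, f q + f u +
        ∑ q ∈ X with rk u < rk q, f q := by
      rw [← Finset.sum_filter_add_sum_filter_not X (fun q => rk q < rk u), add_assoc]
      congr 1
      rw [← Finset.sum_filter_add_sum_filter_not _ (fun q => rk q = rk u), Finset.filter_filter,
        Finset.filter_filter]
      congr 1
      · rw [Finset.sum_eq_single u]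
        · intro q hq hne
          exact absurd (hrk.inj (Finset.mem_filter.1 hq).2.2) hne
        · intro h
          simp [huX] at h
      · refine Finset.sum_congr (Finset.filter_congr fun q _ => ?_) fun _ _ => rfl
        omega
    rw [hsplit]
    rcases lt_or_ge (P.d u) P.W with hlt | hge
    · have h1 : ∑ q ∈ insert u (X.filter fun q => rk q < rk u), P.d q ≤
          load P.D (P.dg v) j (P.win u) := by
        refine sum_le_load fun q hq => ?_
        rcases Finset.mem_insert.1 hq with rfl | hq
        · exact ⟨huvis, hul, hj _ hu hul, Or.inl ⟨hlt, le_rfl⟩⟩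
        · obtain ⟨hq, hqu⟩ := Finset.mem_filter.1 hq
          obtain ⟨h1, h2, h3, h4⟩ := hX q hq
          refine ⟨hvis q hq hqu.le, h2, h3, ?_⟩
          have h5 := pos_le_of_key_le (hrk.key_le _ _ hqu.le)
          rw [pos_of_light hul hlt] at h5
          rcases lt_or_ge (P.d q) P.W with h6 | h6
          · rw [pos_of_light h2 h6] at h5
            omega
          · rw [pos_of_heavy h2 h6] at h5
            omega
      rw [Finset.sum_insert (by simp)] at h1
      have hiH : P.win u * P.W ≤ P.H := (win_mul_le u).trans (P.lab_le u)
      have h2 := ih (v := y) (τ := P.win u * P.W) (j := P.win u)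
        -- The conditions at a vertex allow a restart at the beginning of every window, whatever
        -- happened above.
        (X := X.filter fun q => rk u < rk q) hyx ((hP.node y).2 _ (win_lt hul) hiH) ?_ ?_ hX2 hdep
      · have h3 := ((hs.1 _ (win_lt hul) (hj _ hu hul)).2
          (by have := dg_light_ne_zero huvis hul hlt; have := P.d_pos u; omega))
        have h4 := hsum (X.filter fun q => rk q < rk u)
        have h5 := hf' u hlt hux
        have h6 : ((P.d u : ℝ) + (∑ q ∈ X with rk q < rk u, P.d q : ℕ)) + τ + 2 ≤
            ((P.win u : ℝ) + 2) * P.W := by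
          exact_mod_cast (by omega :
            P.d u + (∑ q ∈ X with rk q < rk u, P.d q) + τ + 2 ≤ (P.win u + 2) * P.W)
        push_cast at h2
        nlinarith [mul_le_mul_of_nonneg_left h6 hσ]
      · exact fun p hp hl => win_le_of_key_le (hrk.key_le _ _ (hyP p hp).2.le) hl
      · intro q hq
        obtain ⟨hq, hqu⟩ := Finset.mem_filter.1 hq
        exact ⟨hXy q hq hqu, (hX q hq).2.1, win_le_of_key_le (hrk.key_le _ _ hqu.le) (hX q hq).2.1,
          (hX q hq).2.2.2⟩
    · have h1 : ∑ q ∈ X with rk q < rk u, P.d q ≤ load P.D (P.dg v) j (P.win u) := by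
        refine sum_le_load fun q hq => ?_
        obtain ⟨hq, hqu⟩ := Finset.mem_filter.1 hq
        obtain ⟨h1, h2, h3, h4⟩ := hX q hq
        refine ⟨hvis q hq hqu.le, h2, h3, ?_⟩
        have h5 := win_le_of_key_le (hrk.key_le _ _ hqu.le) hul
        rcases lt_or_ge (P.d q) P.W with h6 | h6
        · exact Or.inl ⟨h6, h5⟩
        · refine Or.inr ⟨h6, lt_of_le_of_ne h5 fun e => ?_⟩
          rw [hP.heavy_unique (hvis q hq hqu.le) h2 h6 huvis hul hge e] at hqu
          exact lt_irrefl _ hqu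
      obtain ⟨hE1, hE2⟩ := (hP.edge u y hy).2 hul hge
      have hheavy : ∀ q, rk u < rk q → P.lab q ≠ P.H → P.win q ≤ P.win u →
          P.win q = P.win u ∧ P.W ≤ P.d q := by
        intro q hq hl hw
        have h2 := hpos q hq
        rw [pos_of_heavy hul hge, pos, if_neg hl] at h2
        split_ifs at h2 with h3
        · exact ⟨by omega, h3⟩
        · omega
      have hnovis : ∀ q, P.Vis y q → P.lab q ≠ P.H → P.win q = P.win u → ¬ P.W ≤ P.d q := by
        intro q h2 h3 h4 h5
        have := dg_head_ne_zero h2 h3 h5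
        rw [h4] at this
        change P.dg y (3 * P.win u + 1) = 0 at hE2
        omega
      -- Otherwise the first vertex of the remaining path would be in the window of `u`. Coming
      -- after `u` it would be heavy, and it is visible from `y`, which `edge` excludes.
      have hPy : ∀ p, P.T.Btw y p x → P.lab p ≠ P.H → P.win u + 1 ≤ P.win p := by
        intro p hp hl
        by_contra hlt
        obtain ⟨a, ha, hamin⟩ := exists_rankMin P.T rk y x
        have h2 := hrk.key_le _ _ (hamin p hp)
        have hal := not_late_of_key_le h2 hl
        obtain ⟨h3, h4⟩ := hheavy a (hyP a ha).2 hal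
          ((win_le_of_key_le h2 hl).trans (by omega))
        refine hnovis a (vis_of_le (WTree.inSubtree_of_btw (.refl y) hyx ha) fun b hb =>
          hrk.key_le _ _ (hamin b (WTree.Btw.of_left ha hb.symm))) hal h3 h4
      have h2 := ih (v := y) (τ := P.lab u + P.d u) (j := P.win u + 1)
        (X := X.filter fun q => rk u < rk q) hyx hE1 hPy ?_ hX2 hdep
      · have h3 := ((hs.1 _ (win_lt hul) (hj _ hu hul)).1
          (by have := dg_head_ne_zero huvis hul hge; omega))
        rw [hP.head_eq huvis hul hge] at h3
        have h4 := hsum (X.filter fun q => rk q < rk u)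
        have h5 := hf u
        have h6 : ((∑ q ∈ X with rk q < rk u, P.d q : ℕ) : ℝ) + τ ≤ P.lab u := by
          exact_mod_cast (by omega : (∑ q ∈ X with rk q < rk u, P.d q) + τ ≤ P.lab u)
        push_cast at h2
        nlinarith [mul_le_mul_of_nonneg_left h6 hσ]
      · intro q hq
        obtain ⟨hq, hqu⟩ := Finset.mem_filter.1 hq
        refine ⟨hXy q hq hqu, (hX q hq).2.1, ?_, (hX q hq).2.2.2⟩
        by_contra hlt
        have hql := (hX q hq).2.1
        obtain ⟨h3, h4⟩ := hheavy q hqu hql (by omega)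
        refine hnovis q (vis_of_le (hXy q hq hqu) fun b hb => ?_) hql h3 h4
        rcases hb.or x with h5 | h5
        · exact hrk.key_le _ _ ((hX q hq).2.2.2 b h5)
        · by_cases hbl : P.lab b = P.H
          · refine (key_lt_of_pos_lt ?_).le
            rw [pos_of_late hbl]
            exact pos_lt hql
          · have h6 := hPy b h5.symm hbl
            refine (key_lt_of_pos_lt ?_).le
            rw [pos, pos, if_neg hql, if_neg hbl]
            split_ifs <;> omega

end Labeling


/-! ### The query times of a strategy are good labels. -/

open Schedule

namespace Labeling

variable {n : ℕ} {P : Labeling n}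

/-- The labels are the times at which a search strategy queries the vertices. -/
structure IsTiming (P : Labeling n) : Prop where
  add_le : ∀ v, P.lab v = P.H ∨ P.lab v + P.d v ≤ P.H
  sep : ∀ u u', u ≠ u' → P.lab u ≠ P.H → (∀ y, P.T.Btw u y u' → P.lab u ≤ P.lab y) →
    P.lab u + P.d u ≤ P.lab u'
  adj : ∀ u u', P.T.graph.Adj u u' → P.lab u = P.H → P.lab u' ≠ P.H

theorem win_mono {a b : Fin n} (h : P.lab a ≤ P.lab b) : P.win a ≤ P.win b := Nat.div_le_div_right h

theorem win_lt_of_heavy {a b : Fin n} (hW : 0 < P.W) (h : P.lab a + P.d a ≤ P.lab b)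
    (ha : P.W ≤ P.d a) : P.win a < P.win b := by
  rw [win, win, Nat.lt_iff_add_one_le, Nat.le_div_iff_mul_le hW, add_mul, one_mul]
  have := Nat.div_mul_le_self (P.lab a) P.W
  omega

theorem lab_lt (hW : 0 < P.W) (a : Fin n) : P.lab a < (P.win a + 1) * P.W :=
  Nat.lt_mul_of_div_lt (Nat.lt_succ_self _) hW

theorem not_late_of_lab_le {a b : Fin n} (h : P.lab a ≤ P.lab b) (hb : P.lab b ≠ P.H) :
    P.lab a ≠ P.H := fun e => hb (le_antisymm (P.lab_le b) (e ▸ h))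

/-- A proper ancestor `m` of `a` whose label is least between them would have the smaller key and
hide `a`: if `m` is heavy, `a` lies in a later window; if `m` is light, its window is no later than
that of `a`, and ties favour the ancestor. -/
theorem IsTiming.not_min (hP : P.IsTiming) {v a m : Fin n} (ha : P.Vis v a)
    (hal : P.lab a ≠ P.H) (hm : P.T.Btw a m v) (hne : m ≠ a)
    (hmin : ∀ y, P.T.Btw m y a → P.lab m ≤ P.lab y) : False := by
  have hle : P.lab m ≤ P.lab a := hmin a (WTree.btw_right _ _)
  have hml := not_late_of_lab_le hle hal
  have hkey := ha.2 m hm hne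
  have hpos := pos_le_of_key_le hkey.le
  have hw := win_mono hle
  rcases lt_or_ge (P.d m) P.W with h | h
  · rw [pos_of_light hml h] at hpos
    have h1 : P.pos a = P.pos m := by
      rw [pos_of_light hml h]
      refine le_antisymm hpos ?_
      rw [pos, if_neg hal]
      omega
    rw [key_eq, key_eq, h1] at hkey
    have := WTree.depth_lt ((WTree.btw_iff_of_inSubtree ha.1).1 hm).1 hne
    omega
  · have h1 := win_lt_of_heavy (W_pos hml) (hP.sep m a hne hml hmin) h
    rw [pos_of_heavy hml h, pos, if_neg hal] at hpos
    omega

theorem exists_lab_min (u u' : Fin n) :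
    ∃ m, P.T.Btw u m u' ∧ ∀ y, P.T.Btw u y u' → P.lab m ≤ P.lab y := exists_rankMin _ _ _ _

/-- The vertex of least label between `a` and `b` lies between one of them and `v`. By `not_min` it
is `a` or `b`, and its interval ends before the other one begins. -/
theorem IsTiming.disjoint (hP : P.IsTiming) {v a b : Fin n} (ha : P.Vis v a) (hb : P.Vis v b)
    (hal : P.lab a ≠ P.H) (hbl : P.lab b ≠ P.H) (hne : a ≠ b) :
    P.lab a + P.d a ≤ P.lab b ∨ P.lab b + P.d b ≤ P.lab a := by
  obtain ⟨m, hm, hmin⟩ := exists_lab_min (P := P) a b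
  by_cases hma : m = a
  · subst hma
    exact Or.inl (hP.sep _ _ hne hal hmin)
  by_cases hmb : m = b
  · subst hmb
    exact Or.inr (hP.sep _ _ hne.symm hbl fun y hy => hmin y hy.symm)
  exfalso
  rcases hm.or v with h | h
  · exact hP.not_min ha hal h hma fun y hy => hmin y (hm.of_left hy.symm)
  · exact hP.not_min hb hbl h.symm hmb fun y hy => hmin y (hm.of_right hy)

/-- The intervals `[lab a, lab a + d a)` are disjoint parts of `[τ, e)`; count the integers. -/
theorem sum_le_of_disjoint {Y : Finset (Fin n)} {τ e : ℕ}
    (hd : ∀ a ∈ Y, ∀ b ∈ Y, a ≠ b → P.lab a + P.d a ≤ P.lab b ∨ P.lab b + P.d b ≤ P.lab a)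
    (h1 : ∀ a ∈ Y, τ ≤ P.lab a) (h2 : ∀ a ∈ Y, P.lab a + P.d a ≤ e) (hτ : τ ≤ e) :
    τ + ∑ a ∈ Y, P.d a ≤ e := by
  have h3 : ∑ a ∈ Y, P.d a = (Y.biUnion fun a => Finset.Ico (P.lab a) (P.lab a + P.d a)).card := by
    rw [Finset.card_biUnion]
    · simp
    · intro a ha b hb hne
      refine Finset.disjoint_left.2 fun i hi hi' => ?_
      rw [Finset.mem_Ico] at hi hi'
      have := hd a ha b hb hne
      omega
  have h4 : (Y.biUnion fun a => Finset.Ico (P.lab a) (P.lab a + P.d a)) ⊆ Finset.Ico τ e := by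
    intro i hi
    obtain ⟨a, ha, hi⟩ := Finset.mem_biUnion.1 hi
    rw [Finset.mem_Ico] at hi ⊢
    have := h1 a ha
    have := h2 a ha
    omega
  have h5 := Finset.card_le_card h4
  rw [← h3, Nat.card_Ico] at h5
  omega

theorem head_of_item {u : Fin n} {k : ℕ} (hl : P.lab u ≠ P.H)
    (h : item P.H P.W (P.d u) (P.lab u) (3 * k + 1) ≠ 0) : P.win u = k ∧ P.W ≤ P.d u := by
  rw [item_head hl] at h
  by_contra h'
  exact h (if_neg h')

theorem light_of_item {u : Fin n} {k : ℕ} (hl : P.lab u ≠ P.H)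
    (h : item P.H P.W (P.d u) (P.lab u) (3 * k) ≠ 0) : P.win u = k ∧ P.d u < P.W := by
  rw [item_light hl] at h
  by_contra h'
  exact h (if_neg h')

/-- Each condition of `Start` says that certain visible vertices fit between `τ` and a deadline.
Since their intervals are disjoint, it suffices that each begins no earlier than `τ` and ends in
time. -/
theorem IsTiming.start (hP : P.IsTiming) {v : Fin n} {τ j : ℕ} (hτ : τ ≤ P.H)
    (h : ∀ u, P.Vis v u → P.lab u ≠ P.H → j ≤ P.win u → τ ≤ P.lab u) :
    Start P.H P.W P.D (P.dg v) τ j := by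
  classical
  have hpack : ∀ j' e : ℕ, τ ≤ e → (∀ u, P.Vis v u → P.lab u ≠ P.H → j ≤ P.win u →
      (P.d u < P.W ∧ P.win u ≤ j' ∨ P.W ≤ P.d u ∧ P.win u < j') → P.lab u + P.d u ≤ e) →
      τ + load P.D (P.dg v) j j' ≤ e := by
    intro j' e hτe he
    rw [load_dg]
    refine sum_le_of_disjoint (fun a ha b hb hne => ?_) (fun a ha => ?_) (fun a ha => ?_) hτe
    · obtain ⟨-, ha1, ha2, -⟩ := Finset.mem_filter.1 ha
      obtain ⟨-, hb1, hb2, -⟩ := Finset.mem_filter.1 hb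
      exact hP.disjoint ha1 hb1 ha2 hb2 hne
    · obtain ⟨-, h1, h2, h3, -⟩ := Finset.mem_filter.1 ha
      exact h a h1 h2 h3
    · obtain ⟨-, h1, h2, h3, h4⟩ := Finset.mem_filter.1 ha
      exact he a h1 h2 h3 h4
  refine ⟨fun j' _ hjj' => ⟨fun h0 => ?_, fun h0 => ?_⟩, hpack _ _ hτ fun u _ hl _ _ =>
    (hP.add_le u).resolve_left hl⟩
  · obtain ⟨u, hu, hl, hi⟩ := exists_of_dg_ne_zero h0
    obtain ⟨rfl, hh⟩ := head_of_item hl hi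
    have h1 := hpack (P.win u) (P.lab u) (h u hu hl hjj') fun a ha hal _ hor => by
      have hne : a ≠ u := by rintro rfl; omega
      refine (hP.disjoint ha hu hal hl hne).resolve_right fun h2 => ?_
      have := win_lt_of_heavy (W_pos hl) h2 hh
      omega
    have := dg_head_ne_zero hu hl hh
    omega
  · obtain ⟨u, hu, hl, hi⟩ := exists_of_dg_ne_zero h0
    obtain ⟨rfl, hh⟩ := light_of_item hl hi
    have h2 := lab_lt (W_pos hl) u
    have hd := P.d_pos u
    have h4 : (P.win u + 2) * P.W = (P.win u + 1) * P.W + P.W := by ring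
    have h3 := h u hu hl hjj'
    -- A light vertex of window at most `win u` starts by `(win u + 1) * W - 1` and lasts at most `W
    -- - 1`. A heavy one of an earlier window ends before `u` starts.
    have h1 := hpack (P.win u) ((P.win u + 2) * P.W - 2) (by omega)
      fun a ha hal _ hor => by
        rcases hor with ⟨h5, h6⟩ | ⟨h5, h6⟩
        · have h7 := lab_lt (W_pos hal) a
          have : (P.win a + 1) * P.W ≤ (P.win u + 1) * P.W := Nat.mul_le_mul_right _ (by omega)
          omega
        · have hne : a ≠ u := by rintro rfl; omega
          have := (hP.disjoint ha hu hal hl hne).resolve_right fun h7 => by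
            have := win_mono (P := P) (a := u) (b := a) (by omega)
            omega
          omega
    omega

/-- A heavy interval is at least as long as a window, so heavy vertices with disjoint intervals
start in different windows; this gives the exclusions in `edge` and `merge`. In `edge` the parent
itself need not see the vertices visible from its child, but the argument of `disjoint` still
applies to it. -/
theorem IsTiming.isGood (hP : P.IsTiming) : P.IsGood where
  node v := ⟨hP.add_le v, fun i _ hi => hP.start hi fun u _ _ hu =>
    (Nat.mul_le_mul_right _ hu).trans (win_mul_le u)⟩
  edge p y hy := by
    refine ⟨hP.adj p y hy.adj, fun hl hh => ?_⟩
    have hW := W_pos hl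
    have key : ∀ u, P.Vis y u → P.lab u ≠ P.H →
        P.lab p + P.d p ≤ P.lab u ∨ P.lab u + P.d u ≤ P.lab p := by
      intro u hu hul
      have hpu : p ≠ u := fun e => hy.not_inSubtree (e ▸ hu.1)
      obtain ⟨m, hm, hmin⟩ := exists_lab_min (P := P) p u
      by_cases hmp : m = p
      · subst hmp
        exact Or.inl (hP.sep _ _ hpu hl hmin)
      by_cases hmu : m = u
      · subst hmu
        exact Or.inr (hP.sep _ _ hpu.symm hul fun a ha => hmin a ha.symm)
      exfalso
      have h1 := ((hy.btw_iff hu.1).1 hm.symm).resolve_left hmp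
      exact hP.not_min hu hul h1 hmu fun a ha => hmin a (hm.of_right ha)
    refine ⟨hP.start ((hP.add_le p).resolve_left hl) fun u hu hul hw => ?_, ?_⟩
    · refine (key u hu hul).resolve_right fun h => ?_
      have h1 := win_mono (P := P) (a := u) (b := p) (by omega)
      have h2 : P.win p + 1 ≤ P.win u := hw
      omega
    · by_contra h
      obtain ⟨u, hu, hul, hi⟩ := exists_of_dg_ne_zero h
      obtain ⟨h1, h2⟩ := head_of_item hul hi
      have h3 : P.win u = P.win p := h1
      rcases key u hu hul with h | h
      · have := win_lt_of_heavy hW h hh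
        omega
      · have := win_lt_of_heavy hW h h2
        omega
  merge p y hy k _ := by
    classical
    have key : ∀ y, P.T.IsChild p y → kept P.H P.W (P.d p) (P.lab p) (P.dg y) (3 * k + 1) ≠ 0 →
        ∃ u, P.T.InSubtree y u ∧ P.Vis p u ∧ P.lab u ≠ P.H ∧ P.win u = k ∧ P.W ≤ P.d u := by
      intro y hy h
      rw [kept] at h
      split_ifs at h with hk
      · obtain ⟨u, hu, hl, hi⟩ := exists_of_dg_ne_zero h
        have hpu : p ≠ u := fun e => hy.not_inSubtree (e ▸ hu.1)
        refine ⟨u, hu.1, ?_, hl, head_of_item hl hi⟩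
        exact (vis_iff_child hy hu.1).2 ⟨hu, (key_lt_iff_keep (WTree.depth_lt
          (hy.inSubtree.trans hu.1) hpu) hi).2 hk⟩
      · exact absurd rfl h
    by_contra! h
    obtain ⟨y', hy', h1⟩ := Finset.exists_ne_zero_of_sum_ne_zero h.1
    obtain ⟨-, hy', hlt⟩ := Finset.mem_filter.1 hy'
    obtain ⟨u, hu1, hu2, hu3, hu4, hu5⟩ := key y hy h.2
    obtain ⟨u', hv1, hv2, hv3, hv4, hv5⟩ := key y' hy' h1
    have hne : u ≠ u' := by
      rintro rfl
      have := hy.eq_of_inSubtree hy' hu1 hv1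
      subst this
      exact lt_irrefl _ hlt
    have hW := W_pos hu3
    rcases hP.disjoint hu2 hv2 hu3 hv3 hne with h | h
    · have := win_lt_of_heavy hW h hu5
      omega
    · have := win_lt_of_heavy hW h hv5
      omega

end Labeling

namespace WTree

variable {n : ℕ} (T : WTree n) (d : Fin n → ℕ)

/-- The total duration of the different queries in a list. -/
def duration (l : List (Fin n)) : ℕ := ∑ q ∈ l.toFinset, d q

/-- The time at which `A` queries the target `u`, and `H` if it does not. -/
noncomputable def timing (A : Strategy n) (H : ℕ) (u : Fin n) : ℕ :=
  if u ∈ A.queries T u then duration d ((A.queries T u).takeWhile fun q => q ≠ u) else H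

variable {T d}

theorem duration_mono {l l' : List (Fin n)} (h : ∀ q ∈ l, q ∈ l') : duration d l ≤ duration d l' :=
  Finset.sum_le_sum_of_subset fun q hq => by simpa using h q (by simpa using hq)

theorem duration_concat {l l' : List (Fin n)} {u : Fin n} (hu : u ∉ l) (h : ∀ q ∈ l, q ∈ l')
    (hu' : u ∈ l') : duration d l + d u ≤ duration d l' := by
  have h1 : duration d (u :: l) = duration d l + d u := by
    rw [duration, List.toFinset_cons, Finset.sum_insert (by simpa), add_comm, duration]
  rw [← h1]
  exact duration_mono fun q hq => by
    rcases List.mem_cons.1 hq with rfl | hq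
    exacts [hu', h q hq]

theorem takeWhile_ne_append {l r : List (Fin n)} {u y : Fin n} (hu : u ∉ l) (hy : y ≠ u) :
    (∀ q ∈ l, q ∈ (l ++ y :: r).takeWhile fun q => q ≠ u) ∧
      y ∈ (l ++ y :: r).takeWhile fun q => q ≠ u := by
  have : (l ++ y :: r).takeWhile (fun q => q ≠ u) = l ++ y :: r.takeWhile (fun q => q ≠ u) := by
    rw [List.takeWhile_append_of_pos, List.takeWhile_cons_of_pos (by simpa using hy)]
    intro q hq
    simpa using ne_of_mem_of_not_mem hq hu
  rw [this]
  exact ⟨fun q hq => by simp [hq], by simp⟩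

theorem takeWhile_ne_self {l r : List (Fin n)} {u : Fin n} (hu : u ∉ l) :
    (l ++ u :: r).takeWhile (fun q => q ≠ u) = l := by
  rw [List.takeWhile_append_of_pos, List.takeWhile_cons_of_neg (by simp), List.append_nil]
  intro q hq
  simpa using ne_of_mem_of_not_mem hq hu

/-- The labeling of the tree by the times of the queries of a strategy. -/
noncomputable def timingLabeling (T : WTree n) (d : Fin n → ℕ) (hd : ∀ v, 1 ≤ d v)
    (A : Strategy n) {H W D : ℕ} (hH : ∀ x, duration d (A.queries T x) ≤ H) (hD : H ≤ D * W) :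
    Labeling n where
  T := T
  d := d
  H := H
  W := W
  D := D
  lab := T.timing d A H
  d_pos := hd
  lab_le v := by
    rw [timing]
    split_ifs
    · exact (duration_mono fun q hq => List.takeWhile_subset _ hq).trans (hH v)
    · exact le_rfl
  H_le := hD

theorem timing_add_le {A : Strategy n} {H : ℕ} (hH : ∀ x, duration d (A.queries T x) ≤ H)
    {u : Fin n} (hu : u ∈ A.queries T u) : T.timing d A H u + d u ≤ H := by
  rw [timing, if_pos hu]
  refine le_trans (duration_concat (fun h => ?_) (fun q hq => List.takeWhile_subset _ hq) hu) (hH u)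
  simpa using List.mem_takeWhile_imp h

/-- All targets between `u` and `u'` share the queries up to the first query `y` on this path, so
the label of `y` is the duration of this prefix and the other labels are larger by at least the
duration of `y`. If `u` has the least label, then `y = u`. Two neighbours cannot both be late,
because a strategy that queries neither does not separate them. -/
theorem isTiming {A : Strategy n} (hA : T.IsSearchStrategy A) (hd : ∀ v, 1 ≤ d v) {H W D : ℕ}
    (hH : ∀ x, duration d (A.queries T x) ≤ H) (hD : H ≤ D * W) :
    (T.timingLabeling d hd A hH hD).IsTiming where
  add_le v := by
    by_cases hv : v ∈ A.queries T v
    · exact Or.inr (timing_add_le hH hv)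
    · exact Or.inl (if_neg hv)
  sep u u' hne hl hmin := by
    change T.timing d A H u ≠ H at hl
    change ∀ y, T.Btw u y u' → T.timing d A H u ≤ T.timing d A H y at hmin
    change T.timing d A H u + d u ≤ T.timing d A H u'
    have hu : u ∈ A.queries T u := by
      by_contra hu
      exact hl (if_neg hu)
    rcases queries_prefix (T := T) A u u' with h | ⟨l, y, r, h1, h2, h3, h4⟩
    · exact absurd (btw_left _ _) (h u hu)
    have hul : u ∉ l := fun h => h3 u h (btw_left _ _)
    have hyl : y ∉ l := fun h => h3 y h h2
    have hty : T.timing d A H y = duration d l := by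
      obtain ⟨r', h5⟩ := h4 y h2
      rw [timing, if_pos (by rw [h5]; simp), h5, takeWhile_ne_self hyl]
    obtain rfl : y = u := by
      by_contra hyu
      obtain ⟨h5, h6⟩ := takeWhile_ne_append (r := r) hul hyu
      have h7 := duration_concat (d := d) hyl h5 h6
      have h8 := hmin y h2
      rw [hty, timing, if_pos hu, h1] at h8
      have := hd y
      omega
    by_cases hu' : u' ∈ A.queries T u'
    · obtain ⟨r', h5⟩ := h4 u' (btw_right _ _)
      have hul' : u' ∉ l := fun h => h3 u' h (btw_right _ _)
      obtain ⟨h6, h7⟩ := takeWhile_ne_append (r := r') hul' hne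
      rw [hty, timing, if_pos hu', h5]
      exact duration_concat hyl h6 h7
    · rw [show T.timing d A H u' = H from if_neg hu']
      exact timing_add_le hH hu
  adj u u' hadj hl := by
    change T.timing d A H u = H at hl
    change T.timing d A H u' ≠ H
    have hu : u ∉ A.queries T u := fun hu => by
      have := timing_add_le (d := d) hH hu
      have := hd u
      omega
    have hu' : u' ∈ A.queries T u := by
      by_contra h
      have h1 : u' ∈ T.comp (A.queries T u).toFinset u := mem_comp.2 fun z hz => by
        rcases (btw_of_adj hadj).1 hz with rfl | rfl <;> simpa
      rw [(hA u).resolve_left hu, Finset.mem_singleton] at h1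
      exact hadj.ne h1.symm
    rcases queries_prefix (T := T) A u u' with h | ⟨l, y, r, h1, h2, h3, h4⟩
    · exact absurd (btw_right _ _) (h u' hu')
    rcases (btw_of_adj hadj).1 h2 with rfl | rfl
    · exact absurd (by rw [h1]; simp) hu
    · obtain ⟨r', h5⟩ := h4 y (btw_right _ _)
      have := timing_add_le (d := d) hH (u := y) (by rw [h5]; simp)
      have := hd y
      omega

end WTree


/-! ### Elementary bounds for the optimum, and the cost of the order of the keys. -/

open Schedule

namespace WTree

variable {n : ℕ} {T : WTree n}

theorem gain_le (ω : ℝ) (hω : 0 < ω) (c : ℕ) (x q : Fin n) : T.gain ω c x q ≤ T.weight q := by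
  rw [gain]
  split_ifs
  · have : (0 : ℝ) ≤ (2 * c + 1) * ω := by positivity
    linarith
  · linarith

theorem le_gain (ω : ℝ) (hω : 0 < ω) (c : ℕ) (x q : Fin n) :
    - ((2 * c + 1) * ω) ≤ T.gain ω c x q := by
  have h := T.weight_nonneg q
  have : (0 : ℝ) ≤ (2 * c + 1) * ω := by positivity
  rw [gain]
  split_ifs <;> linarith

theorem gain_eq_of_not_inSubtree {ω : ℝ} {c : ℕ} {x q : Fin n} (h : ¬ T.InSubtree q x) :
    T.gain ω c x q = T.weight q := by
  rw [gain, if_neg fun h' => h h'.2, sub_zero]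

/-- Only the query to `y` can receive a discount, so at most one discount is lost. -/
theorem sum_gain_ge {ω : ℝ} (hω : 0 < ω) {c : ℕ} {x y : Fin n} {X : Finset (Fin n)}
    (h : ∀ q ∈ X, q ≠ y → T.weight q < c * ω → ¬ T.InSubtree q x) :
    ∑ q ∈ X, T.weight q - (2 * c + 1) * ω ≤ ∑ q ∈ X, T.gain ω c x q := by
  classical
  have hΔ : (0 : ℝ) ≤ (2 * c + 1) * ω := by positivity
  simp only [gain]
  rw [Finset.sum_sub_distrib]
  refine sub_le_sub_left ?_ _
  calc _ ≤ ∑ q ∈ X, if q = y then (2 * c + 1) * ω else 0 := by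
        refine Finset.sum_le_sum fun q hq => ?_
        by_cases hqy : q = y
        · rw [if_pos hqy]
          split_ifs
          exacts [le_rfl, hΔ]
        · rw [if_neg fun h' => h q hq hqy h'.1 h'.2, if_neg hqy]
    _ ≤ _ := by
        rw [Finset.sum_ite_eq']
        split_ifs
        exacts [le_rfl, hΔ]

/-! ### The optimum -/

theorem totalWeight_le_cost (Q : Fin n → List (Fin n)) (x : Fin n) :
    T.totalWeight (Q x) ≤ T.cost Q := le_ciSup (f := fun x => T.totalWeight (Q x))
  (Set.finite_range _).bddAbove x

theorem sum_toFinset_le_totalWeight (l : List (Fin n)) :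
    ∑ q ∈ l.toFinset, T.weight q ≤ T.totalWeight l := by
  rw [totalWeight]
  induction l with
  | nil => simp
  | cons v l ih =>
    rw [List.toFinset_cons, List.map_cons, List.sum_cons]
    by_cases hv : v ∈ l
    · rw [Finset.insert_eq_of_mem (by simpa)]
      have := T.weight_nonneg v
      linarith
    · rw [Finset.sum_insert (by simpa)]
      linarith

theorem totalWeight_nonneg (l : List (Fin n)) : 0 ≤ T.totalWeight l :=
  List.sum_nonneg fun x hx => by
    obtain ⟨v, -, rfl⟩ := List.mem_map.1 hx
    exact T.weight_nonneg v

theorem isSearchStrategy_list {l : List (Fin n)} (hl : ∀ v, v ∈ l) :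
    T.IsSearchStrategy (listStrategy l) := fun x => Or.inl ((listStrategy_queries l x).2 (hl x))

theorem bddBelow_costs :
    BddBelow {r | ∃ A : Strategy n, T.IsSearchStrategy A ∧ r = T.cost (A.queries T)} := by
  refine ⟨0, ?_⟩
  rintro r ⟨A, -, rfl⟩
  exact (totalWeight_nonneg _).trans (totalWeight_le_cost _ T.root)

theorem opt_le_sum : T.opt ≤ ∑ v, T.weight v := by
  have h : T.opt ≤ T.cost ((listStrategy (List.finRange n)).queries T) :=
    csInf_le bddBelow_costs ⟨_, isSearchStrategy_list (by simp), rfl⟩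
  refine h.trans ?_
  have : Nonempty (Fin n) := ⟨T.root⟩
  refine ciSup_le fun x => ?_
  have h1 := ((listStrategy_queries (T := T) (List.finRange n) x).1.map T.weight).sum_le_sum
    fun w hw => by
      obtain ⟨v, -, rfl⟩ := List.mem_map.1 hw
      exact T.weight_nonneg v
  refine h1.trans (le_of_eq ?_)
  rw [← List.ofFn_eq_map, List.sum_ofFn]

theorem le_opt {r : ℝ} (h : ∀ A : Strategy n, T.IsSearchStrategy A → r ≤ T.cost (A.queries T)) :
    r ≤ T.opt := by
  refine le_csInf ⟨_, _, isSearchStrategy_list (l := List.finRange n) (by simp), rfl⟩ ?_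
  rintro r ⟨A, hA, rfl⟩
  exact h A hA

/-- For a target `z` of weight 1 every strategy queries `z` or all its neighbours, and by the star
condition the latter weigh at least as much. -/
theorem one_le_opt (hN : T.Normalized) (hS : T.StarCondition) : 1 ≤ T.opt := by
  classical
  obtain ⟨z, hz⟩ := hN.2
  refine le_opt fun A hA => ?_
  refine le_trans ?_ ((sum_toFinset_le_totalWeight _).trans (totalWeight_le_cost _ z))
  rw [← hz]
  rcases hA z with h | h
  · exact Finset.single_le_sum (f := T.weight) (fun q _ => T.weight_nonneg q) (by simpa using h)
  · refine (hS z).trans (Finset.sum_le_sum_of_subset_of_nonneg (fun u hu => ?_)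
      fun q _ _ => T.weight_nonneg q)
    have hadj : T.graph.Adj z u := by simpa using hu
    by_contra h'
    have hu' : u ∉ T.comp (A.queries T z).toFinset z := by
      rw [h, Finset.mem_singleton]
      exact hadj.ne'
    refine hu' (mem_comp.2 fun y hy => ?_)
    rcases (btw_of_adj hadj).1 hy with rfl | rfl
    · have : y ∈ T.comp (A.queries T y).toFinset y := by rw [h]; simp
      exact mem_comp.1 this y (btw_left _ _)
    · exact h'

/-- `H` is at most the largest duration of every strategy. A duration exceeds the scaled weight by
at most 1 and each vertex is counted once, so the rounding contributes at most `n`. -/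
theorem horizon_le {d : Fin n → ℕ} {c H : ℕ}
    (hd : ∀ v, (d v : ℝ) ≤ T.weight v * (c * n) + 1) (hc : 1 ≤ c)
    (h : ∀ A : Strategy n, T.IsSearchStrategy A → ∀ H' : ℕ,
      (∀ x, duration d (A.queries T x) ≤ H') → H ≤ H') : (H : ℝ) ≤ c * n * T.opt + n := by
  have hn : 0 < n := T.root.pos
  have hcn : (0 : ℝ) < c * n := by positivity
  rw [← sub_le_iff_le_add, ← div_le_iff₀' hcn]
  refine le_opt fun A hA => ?_
  rw [div_le_iff₀' hcn, sub_le_iff_le_add]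
  have : Nonempty (Fin n) := ⟨T.root⟩
  obtain ⟨x, hx⟩ := Finite.exists_max fun x => duration d (A.queries T x)
  have h1 : (H : ℝ) ≤ duration d (A.queries T x) := by exact_mod_cast h A hA _ hx
  refine h1.trans ?_
  rw [duration, Nat.cast_sum]
  refine (Finset.sum_le_sum fun q _ => hd q).trans ?_
  rw [Finset.sum_add_distrib, ← Finset.sum_mul, Finset.sum_const, nsmul_eq_mul, mul_one, mul_comm]
  refine add_le_add (mul_le_mul_of_nonneg_left ?_ hcn.le) ?_
  · exact (sum_toFinset_le_totalWeight _).trans (totalWeight_le_cost _ x)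
  · exact_mod_cast (Finset.card_le_univ _).trans (by simp)

end WTree

/-- A good labeling whose durations round up the weights of the tree, together with a value of
`ω` for which the vertices that are light for the labeling are light. -/
structure GoodLabeling (n c : ℕ) (ω : ℝ) extends Labeling n where
  one_le_c : 1 ≤ c
  le_d : ∀ v, T.weight v * (c * n) ≤ d v
  good : toLabeling.IsGood
  D_pos : 0 < D
  ω_pos : 0 < ω
  light : ∀ v, d v < W → T.weight v < c * ω
  window_le : 2 * ((W : ℝ) - 1) ≤ (2 * c + 1) * ω * (c * n)

namespace GoodLabeling

open Labeling

variable {n c : ℕ} {ω : ℝ} (P : GoodLabeling n c ω)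

theorem not_late_of_adj {u u' : Fin n} (h : P.T.graph.Adj u u') (hu : P.lab u = P.H) :
    P.lab u' ≠ P.H := by
  rcases WTree.adj_iff_isChild.1 h with h | h
  · exact fun h' => (P.good.edge _ _ h).1 h' hu
  · exact (P.good.edge _ _ h).1 hu

theorem cn_pos (P : GoodLabeling n c ω) : (0 : ℝ) < c * n := by
  have := P.T.root.pos
  have := P.one_le_c
  positivity

theorem start (v : Fin n) : Start P.H P.W P.D (P.dg v) 0 0 := by
  simpa using (P.good.node v).2 0 P.D_pos (by simp)

theorem weight_le (v : Fin n) : P.T.weight v ≤ 1 / (c * n) * P.d v := by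
  rw [one_div_mul_eq_div, le_div_iff₀ P.cn_pos]
  exact P.le_d v

variable {P}

/-- If `q` were late, its neighbour towards `x` would not be late and would have a smaller key. -/
theorem not_late_of_key_min {x q : Fin n} (hq : q ≠ x)
    (h : ∀ y, P.T.Btw q y x → P.key q ≤ P.key y) : P.lab q ≠ P.H := by
  intro hl
  refine P.not_late_of_adj (WTree.adj_towards hq) hl ?_
  by_contra h'
  exact not_late_of_key_le (h _ WTree.btw_towards) h' hl

/-- This is `IsGood.sum_le` started at time 0, with `σ = 1 / (c n)` converting durations to weights
and `Δ` equal to the discount `(2c + 1) ω`; the field `window_le` ensures that this discount pays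
for two windows. -/
theorem sum_gain_le {rk : Fin n → ℕ} (hrk : P.IsRank rk) {v x : Fin n} (hv : P.T.InSubtree v x)
    {X : Finset (Fin n)}
    (hX : ∀ q ∈ X, P.T.InSubtree v q ∧ P.lab q ≠ P.H ∧ P.T.RankMin rk x q)
    (hX' : ∀ q, P.T.Btw v q x → q ≠ x → P.lab q ≠ P.H → P.T.RankMin rk x q → q ∈ X) :
    ∑ q ∈ X, P.T.gain ω c x q ≤ P.H / (c * n) := by
  have hcn := P.cn_pos
  have hσ : (0 : ℝ) ≤ 1 / (c * n) := by positivity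
  have hΔ : 2 * ((P.W : ℝ) - 1) * (1 / (c * n)) ≤ (2 * c + 1) * ω := by
    rw [mul_one_div, div_le_iff₀ hcn]
    exact P.window_le
  refine (P.good.sum_le hrk hσ hΔ (fun q => ?_) (fun q h1 h2 => ?_) hv (P.start v)
    (fun _ _ _ => Nat.zero_le _) (fun q hq => ⟨(hX q hq).1, (hX q hq).2.1, Nat.zero_le _,
      (hX q hq).2.2⟩) hX').trans ?_
  · exact (WTree.gain_le ω P.ω_pos c x q).trans (P.weight_le q)
  · rw [WTree.gain, if_pos ⟨P.light q h1, h2⟩]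
    linarith [P.weight_le q]
  · rw [Nat.cast_zero, sub_zero, one_div_mul_eq_div]

theorem not_late_of_queried {rk : Fin n → ℕ} (hrk : P.IsRank rk) {x q : Fin n}
    (h : P.T.Queried rk x q) : P.lab q ≠ P.H := by
  by_cases hq : q = x
  · subst hq
    obtain ⟨u, hu, hlt⟩ := h.2 rfl
    intro hl
    refine P.not_late_of_adj hu hl ?_
    by_contra h'
    exact not_late_of_key_le (hrk.key_le _ _ hlt.le) h' hl
  · exact not_late_of_key_min hq fun y hy => hrk.key_le _ _ (h.1 y hy)

theorem rankCost_le {rk : Fin n → ℕ} (hrk : P.IsRank rk) (x : Fin n) :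
    P.T.rankCost rk ω c x ≤ P.H / (c * n) := by
  refine sum_gain_le hrk (.root x) (fun q hq => ?_) fun q _ hq _ h => ?_
  · rw [WTree.mem_querySet] at hq
    exact ⟨.root q, not_late_of_queried hrk hq, hq.1⟩
  · exact WTree.mem_querySet.2 ⟨h, fun e => absurd e hq⟩

end GoodLabeling


/-! ### Moving a subtree to the front. -/

open Schedule

namespace WTree

variable {n : ℕ}

/-- `rk'` orders the vertices below `y` first, and otherwise like `rk`. -/
structure Promotes (T : WTree n) (rk rk' : Fin n → ℕ) (y : Fin n) : Prop where
  lt : ∀ a b, T.InSubtree y a → ¬ T.InSubtree y b → rk' a < rk' b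
  iff : ∀ a b, (T.InSubtree y a ↔ T.InSubtree y b) → (rk' a ≤ rk' b ↔ rk a ≤ rk b)

/-- The vertex below which the order is promoted, for a heaviest vertex `z`. -/
def Pivot (T : WTree n) (rk : Fin n → ℕ) (z y : Fin n) : Prop :=
  (y = z ∧ ∃ u, T.graph.Adj z u ∧ rk z < rk u) ∨
    (y = T.parent z ∧ ∀ u, T.graph.Adj z u → rk u < rk z)

variable {T : WTree n} {rk rk' : Fin n → ℕ} {y : Fin n}

theorem Promotes.lt_iff (h : T.Promotes rk rk' y) {a b : Fin n}
    (hab : T.InSubtree y a ↔ T.InSubtree y b) : rk' a < rk' b ↔ rk a < rk b := by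
  rw [← not_le, ← not_le, h.iff b a hab.symm]

/-- Vertices below `y` come first, so a vertex outside is queried only if none of them is on its
path to the target. -/
theorem Promotes.not_btw (h : T.Promotes rk rk' y) {q x a : Fin n} (hq : T.RankMin rk' x q)
    (hqy : ¬ T.InSubtree y q) (ha : T.Btw q a x) : ¬ T.InSubtree y a := fun h' =>
  absurd (hq a ha) (not_le.2 (h.lt a q h' hqy))

theorem Promotes.rankMin_iff (h : T.Promotes rk rk' y) {q x : Fin n}
    (hqx : T.InSubtree y q ↔ T.InSubtree y x) : T.RankMin rk' x q ↔ T.RankMin rk x q := by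
  refine forall₂_congr fun a ha => h.iff q a ?_
  by_cases hq : T.InSubtree y q
  · exact iff_of_true hq (inSubtree_of_btw hq (hqx.1 hq) ha)
  · exact iff_of_false hq (not_inSubtree_of_btw hq (fun hx => hq (hqx.2 hx)) ha)

theorem Pivot.adj {z : Fin n} (h : T.Pivot rk z y) (hy : y ≠ T.root) :
    ∃ u, T.graph.Adj y u ∧ rk y < rk u := by
  rcases h with ⟨rfl, h⟩ | ⟨rfl, h⟩
  · exact h
  · have hz : z ≠ T.root := by
      rintro rfl
      exact hy parent_root
    exact ⟨z, (adj_parent hz).symm, h _ (adj_parent hz)⟩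

theorem Pivot.inSubtree {z : Fin n} (h : T.Pivot rk z y) : T.InSubtree y z := by
  rcases h with ⟨rfl, h⟩ | ⟨rfl, h⟩
  exacts [.refl _, parent_inSubtree z]

/-- The promoted order queries the vertex `z`, or all its neighbours. -/
theorem Promotes.one_le_sum (h : T.Promotes rk rk' y) (hS : T.StarCondition) {z : Fin n}
    (hz : T.weight z = 1) (hy : T.Pivot rk z y) :
    1 ≤ ∑ q ∈ T.querySet rk' z, T.weight q := by
  classical
  rcases hy with ⟨rfl, u, hu, hlt⟩ | ⟨rfl, hall⟩
  · rw [← hz]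
    refine Finset.single_le_sum (f := T.weight) (fun q _ => T.weight_nonneg q)
      (mem_querySet.2 ⟨fun a ha => ?_, fun _ => ⟨u, hu, ?_⟩⟩)
    · rw [btw_self_iff.1 ha]
    · by_cases huy : T.InSubtree y u
      · exact (h.lt_iff (iff_of_true (.refl _) huy)).2 hlt
      · exact h.lt _ _ (.refl _) huy
  · rw [← hz]
    refine (hS z).trans (Finset.sum_le_sum_of_subset_of_nonneg (fun u hu => ?_)
      fun q _ _ => T.weight_nonneg q)
    have hadj : T.graph.Adj z u := by simpa using hu
    refine mem_querySet.2 ⟨fun a ha => ?_, fun e => absurd e hadj.ne'⟩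
    rcases (btw_of_adj hadj.symm).1 ha with rfl | rfl
    · exact le_rfl
    · refine (h.iff _ _ (iff_of_true ?_ (parent_inSubtree a))).2 (hall u hadj).le
      rcases adj_iff_isChild.1 hadj with h1 | h1
      · rw [← h1.2]; exact .refl _
      · exact (parent_inSubtree a).trans h1.inSubtree

/-- An ancestor of `z` outside the subtree of `y` is not queried, since `z` lies in that subtree.
Inside it the only ancestors of `z` are `z` and `y`, and `z` is too heavy. -/
theorem Promotes.not_light (h : T.Promotes rk rk' y) {ω : ℝ} {c : ℕ} (hω : c * ω ≤ 1) {z : Fin n}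
    (hz : T.weight z = 1) (hy : T.Pivot rk z y) {q : Fin n} (hq : q ∈ T.querySet rk' z)
    (hqy : q ≠ y) (hqω : T.weight q < c * ω) : ¬ T.InSubtree q z := by
  intro hqz
  rw [mem_querySet] at hq
  have hqz' : q ≠ z := by
    rintro rfl
    linarith
  have h1 : T.InSubtree y q := by
    by_contra hn
    exact h.not_btw hq.1 hn (btw_right _ _) hy.inSubtree
  rcases hy with ⟨rfl, -⟩ | ⟨rfl, -⟩
  · exact hqz' (hqz.antisymm h1)
  · by_cases hr : z = T.root
    · subst hr
      exact hqz' (inSubtree_root_iff.1 hqz)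
    · exact hqy (((inSubtree_iff_parent hr).1 hqz).resolve_left hqz' |>.antisymm h1)

theorem Promotes.le_rankCost (h : T.Promotes rk rk' y) (hS : T.StarCondition) {ω : ℝ} (hω : 0 < ω)
    {c : ℕ} (hcω : c * ω ≤ 1) {z : Fin n} (hz : T.weight z = 1) (hy : T.Pivot rk z y) :
    1 - (2 * c + 1) * ω ≤ T.rankCost rk' ω c z :=
  (sub_le_sub_right (h.one_le_sum hS hz hy) _).trans
    (sum_gain_ge hω fun _ hq hqy hqω => h.not_light hcω hz hy hq hqy hqω)

/-- Below the parent `x` of `y`, where the search for `x` ends with the query to `y` only after the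
promotion, the cost is compared with that of `y`. -/
theorem Promotes.rankCost_parent_le (h : T.Promotes rk rk' y) {ω : ℝ} (hω : 0 < ω) {c : ℕ}
    {x : Fin n} (hxy : T.IsChild x y) (hlt : rk x < rk y)
    (hx : x ∉ T.querySet rk' x) (hadj : ∃ u, T.graph.Adj y u ∧ rk y < rk u) :
    T.rankCost rk' ω c x ≤ T.rankCost rk ω c y + 2 * ((2 * c + 1) * ω) := by
  classical
  have hxT : ¬ T.InSubtree y x := hxy.not_inSubtree
  have hne : x ≠ y := hxy.adj.ne
  -- The promoted search for `x` makes the queries that the old search makes for `y`, without `x`.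
  have hset : T.querySet rk' x = (T.querySet rk y).erase x := by
    ext q
    rw [Finset.mem_erase, mem_querySet, mem_querySet]
    constructor
    · intro hq
      have hqx : q ≠ x := by
        rintro rfl
        exact hx (mem_querySet.2 hq)
      refine ⟨hqx, ?_⟩
      by_cases hqT : T.InSubtree y q
      · have hyx : T.Btw q y x := btw_of_inSubtree hqT hxT
        refine ⟨fun a ha => ?_, ?_⟩
        · exact (h.iff _ _ (iff_of_true hqT (inSubtree_of_btw hqT (.refl _) ha))).1
            (hq.1 a (hyx.of_left ha))
        · rintro rfl
          exact hadj
      · have h1 := (h.rankMin_iff (iff_of_false hqT hxT)).1 hq.1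
        refine ⟨fun a ha => ?_, ?_⟩
        · rcases ha.or x with ha | ha
          · exact h1 a ha
          · rcases (btw_of_adj hxy.adj).1 ha with rfl | rfl
            · exact h1 _ (btw_right _ _)
            · exact (h1 _ (btw_right _ _)).trans hlt.le
        · rintro rfl
          exact absurd (.refl _) hqT
    · rintro ⟨hqx, hq⟩
      refine ⟨?_, fun e => absurd e hqx⟩
      by_cases hqT : T.InSubtree y q
      · intro a ha
        by_cases haT : T.InSubtree y a
        · refine (h.iff _ _ (iff_of_true hqT haT)).2 (hq.1 a ?_)
          rcases ha.or y with ha | ha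
          · exact ha
          · rcases (btw_of_adj hxy.adj.symm).1 ha with rfl | rfl
            · exact btw_right _ _
            · exact absurd haT hxT
        · exact (h.lt _ _ hqT haT).le
      · refine (h.rankMin_iff (iff_of_false hqT hxT)).2 fun a ha => hq.1 a ?_
        exact (hxy.btw_of_not (.refl _) hqT).of_left ha
  -- Two discounts can be lost: that of the omitted query to `x`, and that of `y`, which is a down
  -- query for the target `y` but not for `x`.
  have h1 : ∑ q ∈ T.querySet rk y, T.gain ω c y q ≥
      ∑ q ∈ (T.querySet rk y).erase x, T.gain ω c y q - (2 * c + 1) * ω := by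
    by_cases hxq : x ∈ T.querySet rk y
    · rw [← Finset.add_sum_erase _ _ hxq]
      linarith [le_gain (T := T) ω hω c y x]
    · rw [Finset.erase_eq_of_notMem hxq]
      have : (0 : ℝ) ≤ (2 * c + 1) * ω := by positivity
      linarith
  have h2 : ∑ q ∈ (T.querySet rk y).erase x, T.gain ω c x q ≤
      ∑ q ∈ (T.querySet rk y).erase x,
        (T.gain ω c y q + if q = y then (2 * c + 1) * ω else 0) := by
    refine Finset.sum_le_sum fun q hq => ?_
    by_cases hqy : q = y
    · subst hqy
      rw [if_pos rfl, gain_eq_of_not_inSubtree hxT, gain]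
      have : (0 : ℝ) ≤ (2 * c + 1) * ω := by positivity
      split_ifs <;> linarith
    · rw [if_neg hqy, add_zero, gain, gain]
      have : T.InSubtree q y ↔ T.InSubtree q x := by
        rw [hxy.inSubtree_iff]
        simp [hqy]
      simp only [this, le_refl]
  rw [rankCost, hset, rankCost]
  refine h2.trans ?_
  rw [Finset.sum_add_distrib, Finset.sum_ite_eq']
  have : (0 : ℝ) ≤ (2 * c + 1) * ω := by positivity
  split_ifs <;> linarith

end WTree

namespace GoodLabeling

open Labeling WTree

variable {n c : ℕ} {ω : ℝ} {P : GoodLabeling n c ω} {rk rk' : Fin n → ℕ} {y z : Fin n}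

theorem pivot_not_late (hrk : P.IsRank rk) (h : P.T.Pivot rk z y) (hy : y ≠ P.T.root) :
    P.lab y ≠ P.H := by
  obtain ⟨u, hu, hlt⟩ := h.adj hy
  intro hl
  refine P.not_late_of_adj hu hl ?_
  by_contra h'
  exact not_late_of_key_le (hrk.key_le _ _ hlt.le) h' hl

/-- For targets below `y` nothing outside the subtree is queried, and inside it the order is the old
one. So the search is one that starts at `y`, and `sum_gain_le` applies there. -/
theorem rankCost_promoted_le_of_inSubtree (hrk : P.IsRank rk) (h : P.T.Promotes rk rk' y)
    (hy : P.T.Pivot rk z y) {x : Fin n} (hx : P.T.InSubtree y x) :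
    P.T.rankCost rk' ω c x ≤ P.H / (c * n) := by
  refine sum_gain_le hrk hx (fun q hq => ?_) fun q hqx hne _ hqm => ?_
  · rw [mem_querySet] at hq
    have hqy : P.T.InSubtree y q := by
      by_contra hn
      exact h.not_btw hq.1 hn (btw_right _ _) hx
    have hqm := (h.rankMin_iff (iff_of_true hqy hx)).1 hq.1
    refine ⟨hqy, ?_, hqm⟩
    by_cases hqx : q = x
    · subst hqx
      obtain ⟨u, hu, hlt⟩ := hq.2 rfl
      by_cases huy : P.T.InSubtree y u
      · rw [h.lt_iff (iff_of_true hqy huy)] at hlt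
        intro hl
        refine P.not_late_of_adj hu hl ?_
        by_contra h'
        exact not_late_of_key_le (hrk.key_le _ _ hlt.le) h' hl
      · rcases adj_iff_isChild.1 hu with h1 | h1
        · have h2 := (h1.inSubtree_iff.1 hqy).resolve_right huy
          subst h2
          exact pivot_not_late hrk hy h1.1
        · exact absurd (hqy.trans h1.inSubtree) huy
    · exact not_late_of_key_min hqx fun a ha => hrk.key_le _ _ (hqm a ha)
  · have hqy : P.T.InSubtree y q := inSubtree_of_btw (.refl y) hx hqx
    exact mem_querySet.2 ⟨(h.rankMin_iff (iff_of_true hqy hx)).2 hqm, fun e => absurd e hne⟩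

/-- For a target `x` outside the subtree, the queries below `y` are visible from `y` and cost at
most `H / (c n)`. The remaining ones are old queries, and the old queries that disappear lie below
`y`, receive no discount for `x` and so have nonnegative gain. The exception is that `x` itself may
disappear together with its discount. Then the only larger neighbours of `x` are in the promoted
subtree, so `x` is the parent of `y`, and `rankCost_parent_le` compares `x` with `y`. -/
theorem rankCost_promoted_le (hrk : P.IsRank rk) (h : P.T.Promotes rk rk' y)
    (hy : P.T.Pivot rk z y) {B : ℝ} (hB0 : 0 ≤ B) (hB : ∀ x, P.T.rankCost rk ω c x ≤ B)
    (x : Fin n) :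
    P.T.rankCost rk' ω c x ≤ max (P.H / (c * n) + B) (B + 2 * ((2 * c + 1) * ω)) := by
  classical
  have hcn := P.cn_pos
  by_cases hx : P.T.InSubtree y x
  · refine (rankCost_promoted_le_of_inSubtree hrk h hy hx).trans (le_max_of_le_left ?_)
    linarith
  have hyr : y ≠ P.T.root := by
    rintro rfl
    exact hx (.root x)
  by_cases hsp : x ∈ P.T.querySet rk x ∧ x ∉ P.T.querySet rk' x
  · obtain ⟨h1, h2⟩ := hsp
    obtain ⟨u, hu, hlt⟩ := (mem_querySet.1 h1).2 rfl
    have h3 : ¬ rk' x < rk' u := fun h3 => h2 (mem_querySet.2 ⟨fun a ha => by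
      rw [btw_self_iff.1 ha], fun _ => ⟨u, hu, h3⟩⟩)
    have huy : P.T.InSubtree y u := by
      by_contra huy
      exact h3 ((h.lt_iff (iff_of_false hx huy)).2 hlt)
    have hxu : P.T.IsChild x u := by
      rcases adj_iff_isChild.1 hu with h4 | h4
      · exact absurd (huy.trans h4.inSubtree) hx
      · exact h4
    have := (hxu.inSubtree_iff.1 huy).resolve_right hx
    subst this
    refine le_max_of_le_right ((h.rankCost_parent_le P.ω_pos hxu hlt h2 (hy.adj hyr)).trans ?_)
    linarith [hB y]
  · refine le_max_of_le_left ?_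
    rw [rankCost, ← Finset.sum_filter_add_sum_filter_not _ fun q => P.T.InSubtree y q]
    refine add_le_add ?_ (le_trans ?_ (hB x))
    · have h1 : ∀ q ∈ (P.T.querySet rk' x).filter fun q => P.T.InSubtree y q,
          P.Vis y q ∧ P.lab q ≠ P.H := by
        intro q hq
        obtain ⟨hq, hqy⟩ := Finset.mem_filter.1 hq
        rw [mem_querySet] at hq
        have hyx : P.T.Btw q y x := btw_of_inSubtree hqy hx
        have hkey : ∀ a, P.T.Btw q a y → P.key q ≤ P.key a := fun a ha => hrk.key_le _ _
          ((h.iff _ _ (iff_of_true hqy (inSubtree_of_btw hqy (.refl _) ha))).1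
            (hq.1 a (hyx.of_left ha)))
        refine ⟨vis_of_le hqy hkey, ?_⟩
        by_cases hqy' : q = y
        · rw [hqy']
          exact pivot_not_late hrk hy hyr
        · exact not_late_of_key_min hqy' hkey
      have h2 := sum_le_load (P := P.toLabeling) (v := y) (j := 0) (j' := P.D) fun q hq =>
        ⟨(h1 q hq).1, (h1 q hq).2, Nat.zero_le _, by
          have := win_lt (h1 q hq).2
          omega⟩
      have h3 := (P.start y).2
      rw [zero_add] at h3
      calc _ ≤ ∑ q ∈ P.T.querySet rk' x with P.T.InSubtree y q, 1 / (c * n) * (P.d q : ℝ) :=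
            Finset.sum_le_sum fun q _ => (gain_le ω P.ω_pos c x q).trans (P.weight_le q)
        _ = 1 / (c * n) * ((∑ q ∈ P.T.querySet rk' x with P.T.InSubtree y q, P.d q : ℕ) : ℝ) := by
            rw [Nat.cast_sum, Finset.mul_sum]
        _ ≤ 1 / (c * n) * P.H :=
            mul_le_mul_of_nonneg_left (by exact_mod_cast h2.trans h3) (by positivity)
        _ = _ := one_div_mul_eq_div _ _
    · refine Finset.sum_le_sum_of_subset_of_nonneg (fun q hq => ?_) fun q hq hq' => ?_
      · obtain ⟨hq, hqy⟩ := Finset.mem_filter.1 hq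
        rw [mem_querySet] at hq ⊢
        refine ⟨(h.rankMin_iff (iff_of_false hqy hx)).1 hq.1, ?_⟩
        rintro rfl
        obtain ⟨u, hu, hlt⟩ := hq.2 rfl
        have huy : ¬ P.T.InSubtree y u := fun huy => absurd (h.lt _ _ huy hx) (by omega)
        exact ⟨u, hu, (h.lt_iff (iff_of_false hx huy)).1 hlt⟩
      · have hqy : P.T.InSubtree y q := by
          by_contra hqy
          have hqx : q ≠ x := by
            rintro rfl
            exact hsp ⟨hq, fun h1 => hq' (Finset.mem_filter.2 ⟨h1, hqy⟩)⟩
          rw [mem_querySet] at hq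
          exact hq' (Finset.mem_filter.2 ⟨mem_querySet.2
            ⟨(h.rankMin_iff (iff_of_false hqy hx)).2 hq.1, fun e => absurd e hqx⟩, hqy⟩)
        rw [gain_eq_of_not_inSubtree fun h1 => hx (hqy.trans h1)]
        exact P.T.weight_nonneg q

end GoodLabeling


/-! ### Putting a set of vertices first. -/

open Schedule

namespace WTree

variable {n : ℕ}

/-- `rk'` orders the vertices of `K` first, bottom-up, and otherwise like `rk`. -/
structure PutsFirst (T : WTree n) (rk rk' : Fin n → ℕ) (K : Finset (Fin n)) : Prop where
  lt : ∀ a b, a ∈ K → b ∉ K → rk' a < rk' b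
  depth : ∀ a b, a ∈ K → b ∈ K → T.depth b < T.depth a → rk' a < rk' b
  iff : ∀ a b, a ∉ K → b ∉ K → (rk' a ≤ rk' b ↔ rk a ≤ rk b)

variable {T : WTree n} {rk rk' : Fin n → ℕ} {K : Finset (Fin n)}

/-- Take the root as target. Going bottom-up, no earlier query separates a vertex of `K` from the
root, so all of `K` except possibly the root is queried. The root, of weight at most 1, is also the
only possible down query. -/
theorem PutsFirst.le_rankCost (h : T.PutsFirst rk rk' K) {ω : ℝ} (hω : 0 < ω) {c : ℕ}
    (h1 : T.weight T.root ≤ 1) :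
    ∑ q ∈ K, T.weight q - 1 - (2 * c + 1) * ω ≤ T.rankCost rk' ω c T.root := by
  classical
  refine (sub_le_sub_right ?_ _).trans (sum_gain_ge hω (y := T.root) fun q _ hq _ h' =>
    hq (inSubtree_root_iff.1 h'))
  have h2 : ∑ q ∈ K, T.weight q - 1 ≤ ∑ q ∈ K.erase T.root, T.weight q := by
    by_cases hr : T.root ∈ K
    · rw [← Finset.add_sum_erase _ _ hr]
      linarith
    · rw [Finset.erase_eq_of_notMem hr]
      linarith
  refine h2.trans (Finset.sum_le_sum_of_subset_of_nonneg (fun q hq => ?_)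
    fun q _ _ => T.weight_nonneg q)
  obtain ⟨hqr, hqK⟩ := Finset.mem_erase.1 hq
  refine mem_querySet.2 ⟨fun a ha => ?_, fun e => absurd e hqr⟩
  by_cases haq : a = q
  · rw [haq]
  by_cases haK : a ∈ K
  · exact (h.depth _ _ hqK haK (depth_lt ((btw_iff_of_inSubtree (.root q)).1 ha).1 haq)).le
  · exact (h.lt _ _ hqK haK).le

theorem PutsFirst.not_mem (h : T.PutsFirst rk rk' K) {x q a : Fin n} (hq : T.RankMin rk' x q)
    (hqK : q ∉ K) (ha : T.Btw q a x) : a ∉ K := fun haK =>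
  absurd (hq a ha) (not_le.2 (h.lt a q haK hqK))

theorem PutsFirst.rankMin (h : T.PutsFirst rk rk' K) {x q : Fin n} (hq : T.RankMin rk' x q)
    (hqK : q ∉ K) : T.RankMin rk x q := fun a ha =>
  (h.iff q a hqK (h.not_mem hq hqK ha)).1 (hq a ha)

theorem rankCost_le_add {ω : ℝ} (hω : 0 < ω) {c : ℕ} {x : Fin n}
    {B : ℝ} (hB : ∑ q ∈ T.querySet rk' x with q ∉ K, T.gain ω c x q ≤ B) :
    T.rankCost rk' ω c x ≤ ∑ q ∈ K, T.weight q + B := by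
  classical
  rw [rankCost, ← Finset.sum_filter_add_sum_filter_not _ fun q => q ∈ K]
  refine add_le_add ?_ hB
  refine (Finset.sum_le_sum fun q _ => gain_le ω hω c x q).trans
    (Finset.sum_le_sum_of_subset_of_nonneg (fun q hq => (Finset.mem_filter.1 hq).2)
      fun q _ _ => T.weight_nonneg q)

/-- If all vertices are light and the order is top-down, then only down queries are made. -/
theorem PutsFirst.rankCost_le_of_light (h : T.PutsFirst rk rk' K) {ω : ℝ} (hω : 0 < ω) {c : ℕ}
    (hrk : ∀ a b, T.depth a < T.depth b → rk a < rk b) (hw : ∀ v, T.weight v < c * ω)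
    (hw' : ∀ v, T.weight v ≤ (2 * c + 1) * ω) (x : Fin n) :
    T.rankCost rk' ω c x ≤ ∑ q ∈ K, T.weight q := by
  refine (rankCost_le_add (K := K) (B := 0) hω (Finset.sum_nonpos fun q hq => ?_)).trans (by rw [add_zero])
  obtain ⟨hq, hqK⟩ := Finset.mem_filter.1 hq
  rw [mem_querySet] at hq
  have hqx : T.InSubtree q x := by
    by_contra hqx
    have hqr : q ≠ T.root := by
      rintro rfl
      exact hqx (.root x)
    have hp : T.IsChild (T.parent q) q := ⟨hqr, rfl⟩
    have h1 := h.rankMin hq.1 hqK _ (hp.btw_of_not (.refl _) hqx).symm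
    exact absurd (hrk _ _ (depth_lt hp.inSubtree (parent_ne hqr))) (by omega)
  rw [gain, if_pos ⟨hw q, hqx⟩]
  linarith [hw' q]

end WTree

namespace GoodLabeling

open Labeling WTree

variable {n c : ℕ} {ω : ℝ} {P : GoodLabeling n c ω} {rk rk' : Fin n → ℕ} {K : Finset (Fin n)}

/-- The queries outside `K` take place, in the old order, in the component of `x` after removal of
`K`. Its highest vertex is `v`, and `sum_gain_le` applies from `v` on. -/
theorem rankCost_putsFirst_le (hrk : P.IsRank rk) (h : P.T.PutsFirst rk rk' K) (x : Fin n) :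
    P.T.rankCost rk' ω c x ≤ ∑ q ∈ K, P.T.weight q + P.H / (c * n) := by
  classical
  have hcn := P.cn_pos
  refine rankCost_le_add P.ω_pos ?_
  by_cases hxK : x ∈ K
  · rw [Finset.sum_eq_zero]
    · positivity
    · intro q hq
      obtain ⟨hq, hqK⟩ := Finset.mem_filter.1 hq
      exact absurd hxK (h.not_mem (mem_querySet.1 hq).1 hqK (btw_right _ _))
  obtain ⟨v, hv, hmin⟩ := Finset.exists_min_image
    (Finset.univ.filter fun v => P.T.InSubtree v x ∧ ∀ a, P.T.Btw v a x → a ∉ K) P.T.depth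
    ⟨x, by simp [InSubtree.refl, btw_self_iff, hxK]⟩
  simp only [Finset.mem_filter, Finset.mem_univ, true_and] at hv hmin
  obtain ⟨hvx, hvK⟩ := hv
  refine sum_gain_le hrk hvx (fun q hq => ?_) fun q hqx hne _ hqm => ?_
  · obtain ⟨hq, hqK⟩ := Finset.mem_filter.1 hq
    rw [mem_querySet] at hq
    have hqm := h.rankMin hq.1 hqK
    refine ⟨?_, ?_, hqm⟩
    · by_contra hvq
      have hvr : v ≠ P.T.root := by
        rintro rfl
        exact hvq (.root q)
      have hp : P.T.IsChild (P.T.parent v) v := ⟨hvr, rfl⟩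
      have h1 := h.not_mem hq.1 hqK (hp.btw_of_not hvx hvq)
      have h2 := hmin (P.T.parent v) ⟨hp.inSubtree.trans hvx, fun a ha => ?_⟩
      · rw [hp.depth_eq] at h2
        omega
      · rcases (hp.btw_iff hvx).1 ha.symm with rfl | h2
        exacts [h1, hvK a h2.symm]
    · by_cases hqx : q = x
      · subst hqx
        obtain ⟨u, hu, hlt⟩ := hq.2 rfl
        have huK : u ∉ K := fun huK => absurd (h.lt _ _ huK hqK) (by omega)
        have hle := (h.iff q u hqK huK).1 hlt.le
        intro hl
        refine P.not_late_of_adj hu hl ?_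
        by_contra h'
        exact not_late_of_key_le (hrk.key_le _ _ hle) h' hl
      · exact not_late_of_key_min hqx fun a ha => hrk.key_le _ _ (hqm a ha)
  · have hqK := hvK q hqx
    refine Finset.mem_filter.2 ⟨mem_querySet.2 ⟨fun a ha => ?_, fun e => absurd e hne⟩, hqK⟩
    exact (h.iff q a hqK (hvK a (hqx.of_right ha))).2 (hqm a ha)

end GoodLabeling


/-! ### The choice of ω and of the final order. -/

open Schedule

namespace Labeling

variable {n : ℕ} (P : Labeling n) (c L : ℕ)

/-- Order by the values of `k`, with ties broken by the index. -/
def rankOf (k : Fin n → ℕ) (v : Fin n) : ℕ := k v * n + v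

/-- The windows are short compared with the maximum weight. -/
def Short : Prop := 16 * (P.W - 1) ≤ c * n

open Classical in
/-- The numerator of `ω`. -/
noncomputable def num : ℕ := if P.Short c then 16 * L * (P.W - 1) + c * n else 2

open Classical in
/-- The denominator of `ω`. -/
noncomputable def den : ℕ := if P.Short c then 16 * L * c * n * c else c

open Classical in
/-- The number of light down queries for `x` in the order of the keys. -/
noncomputable def lightCount (x : Fin n) : ℕ :=
  {q ∈ P.T.querySet (rankOf P.key) x |
    P.T.weight q * P.den c L < (c * P.num c L : ℕ) ∧ P.T.InSubtree q x}.card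

/-- The order of the keys has a large modified cost. -/
def Test : Prop :=
  ∃ x, (L + (2 * c + 1) * P.lightCount c L x) * P.num c L ≤
    16 * L * c * ∑ q ∈ P.T.querySet (rankOf P.key) x, (P.d q - 1)

open Classical in
/-- The pivot for the heaviest vertex `z`. -/
noncomputable def pivot (z : Fin n) : Fin n :=
  if ∃ u, P.T.graph.Adj z u ∧ rankOf P.key z < rankOf P.key u then z else P.T.parent z

open Classical in
/-- The number of vertices that are put first to raise the cost. -/
noncomputable def prefixLength : ℕ :=
  RAM.least n fun k => c * n * ((L + 2 * c + 1) * P.num c L + P.den c L) ≤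
    P.den c L * ∑ v : Fin n with v.1 < k, (P.d v - 1)

open Classical in
/-- The key of the order that is used behind a prefix. -/
noncomputable def baseKey (v : Fin n) : ℕ := if P.Short c then P.key v else P.T.depth v

open Classical in
/-- The key of the final order. -/
noncomputable def finalKey (z v : Fin n) : ℕ :=
  if P.Short c ∧ 4 * L * P.num c L ≤ P.den c L then
    if P.Test c L ∨ P.T.InSubtree (P.pivot z) v then P.key v
    else (2 * P.D + 1) * (n + 1) + P.key v
  else
    if v.1 < P.prefixLength c L then n - P.T.depth v
    else n + 1 + P.baseKey c v

variable {P c L}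

theorem rankOf_injective (k : Fin n → ℕ) : Function.Injective (rankOf k) := by
  intro a b h
  have h1 : (rankOf k a) % n = (rankOf k b) % n := by rw [h]
  rw [rankOf, rankOf, Nat.mul_add_mod_self_right, Nat.mul_add_mod_self_right,
    Nat.mod_eq_of_lt a.2, Nat.mod_eq_of_lt b.2] at h1
  exact Fin.ext h1

theorem rankOf_lt {k : Fin n → ℕ} {a b : Fin n} (h : k a < k b) : rankOf k a < rankOf k b := by
  have : (k a + 1) * n ≤ k b * n := Nat.mul_le_mul_right n h
  rw [Nat.succ_mul] at this
  have := a.2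
  rw [rankOf, rankOf]
  omega

theorem le_of_rankOf_le {k : Fin n → ℕ} {a b : Fin n} (h : rankOf k a ≤ rankOf k b) :
    k a ≤ k b := by
  by_contra h'
  exact absurd (rankOf_lt (not_le.1 h')) (by omega)

theorem rankOf_le_iff {k k' : Fin n → ℕ} {a b : Fin n} {e : ℕ} (ha : k' a = e + k a)
    (hb : k' b = e + k b) : rankOf k' a ≤ rankOf k' b ↔ rankOf k a ≤ rankOf k b := by
  rw [rankOf, rankOf, rankOf, rankOf, ha, hb, add_mul, add_mul]
  omega

theorem isRank_rankOf : P.IsRank (rankOf P.key) := ⟨rankOf_injective _, fun _ _ => le_of_rankOf_le⟩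

theorem key_lt_big (v : Fin n) : P.key v < (2 * P.D + 1) * (n + 1) := by
  have h : P.pos v ≤ 2 * P.D := by
    by_cases h : P.lab v = P.H
    · rw [pos_of_late h]
    · exact (pos_lt h).le
  have h1 : P.pos v * (n + 1) ≤ 2 * P.D * (n + 1) := Nat.mul_le_mul_right _ h
  have h2 := P.T.depth_le v
  rw [key_eq, add_mul, one_mul]
  omega

theorem pivot_spec (z : Fin n) : P.T.Pivot (rankOf P.key) z (P.pivot z) := by
  rw [pivot]
  split_ifs with h
  · exact Or.inl ⟨rfl, h⟩
  · refine Or.inr ⟨rfl, fun u hu => lt_of_le_of_ne ?_ fun e => hu.ne' (rankOf_injective _ e)⟩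
    by_contra h'
    exact h ⟨u, hu, not_le.1 h'⟩

theorem promotes {z : Fin n} (h1 : P.Short c ∧ 4 * L * P.num c L ≤ P.den c L)
    (h2 : ¬ P.Test c L) :
    P.T.Promotes (rankOf P.key) (rankOf (P.finalKey c L z)) (P.pivot z) := by
  have e1 : ∀ v, P.T.InSubtree (P.pivot z) v → P.finalKey c L z v = P.key v := fun v hv => by
    rw [finalKey, if_pos h1, if_pos (Or.inr hv)]
  have e2 : ∀ v, ¬ P.T.InSubtree (P.pivot z) v →
      P.finalKey c L z v = (2 * P.D + 1) * (n + 1) + P.key v := fun v hv => by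
    rw [finalKey, if_pos h1, if_neg (by simp [h2, hv])]
  refine ⟨fun a b ha hb => rankOf_lt ?_, fun a b hab => ?_⟩
  · rw [e1 a ha, e2 b hb]
    have := P.key_lt_big a
    omega
  · by_cases ha : P.T.InSubtree (P.pivot z) a
    · exact rankOf_le_iff (e := 0) (by rw [e1 a ha, zero_add]) (by rw [e1 b (hab.1 ha), zero_add])
    · exact rankOf_le_iff (e2 a ha) (e2 b fun hb => ha (hab.2 hb))

theorem putsFirst {z : Fin n} (h1 : ¬ (P.Short c ∧ 4 * L * P.num c L ≤ P.den c L)) :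
    P.T.PutsFirst (rankOf (P.baseKey c)) (rankOf (P.finalKey c L z))
      (Finset.univ.filter fun v => v.1 < P.prefixLength c L) := by
  have e : ∀ v, P.finalKey c L z v =
      if v.1 < P.prefixLength c L then n - P.T.depth v else n + 1 + P.baseKey c v := fun v => by
    rw [finalKey, if_neg h1]
  refine ⟨fun a b ha hb => rankOf_lt ?_, fun a b ha hb hab => rankOf_lt ?_, fun a b ha hb => ?_⟩
  · simp only [Finset.mem_filter, Finset.mem_univ, true_and] at ha hb
    rw [e, e, if_pos ha, if_neg hb]
    omega
  · simp only [Finset.mem_filter, Finset.mem_univ, true_and] at ha hb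
    rw [e, e, if_pos ha, if_pos hb]
    have := P.T.depth_le a
    omega
  · simp only [Finset.mem_filter, Finset.mem_univ, true_and] at ha hb
    exact rankOf_le_iff (by rw [e, if_neg ha]) (by rw [e, if_neg hb])

variable (P c L) in
/-- The assumptions on the labeling under which the final order has the required cost. -/
structure IsOptimal : Prop where
  one_le_c : 1 ≤ c
  one_le_L : 1 ≤ L
  norm : P.T.Normalized
  star : P.T.StarCondition
  le_d : ∀ v, P.T.weight v * (c * n) ≤ P.d v
  d_le : ∀ v, (P.d v : ℝ) ≤ P.T.weight v * (c * n) + 1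
  good : P.IsGood
  D_eq : P.D = 192 * L
  W_pos : 1 ≤ P.W
  W_lt : P.D * (P.W - 1) < P.H
  H_le' : (P.H : ℝ) ≤ c * n * P.T.opt + n

theorem n_pos (P : Labeling n) : (0 : ℝ) < n := by
  have := P.T.root.pos
  positivity

namespace IsOptimal

theorem c_pos (h : P.IsOptimal c L) : (1 : ℝ) ≤ c := by exact_mod_cast h.one_le_c

theorem L_pos (h : P.IsOptimal c L) : (1 : ℝ) ≤ L := by exact_mod_cast h.one_le_L

theorem one_le_opt (h : P.IsOptimal c L) : 1 ≤ P.T.opt := P.T.one_le_opt h.norm h.star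

/-- The width is minimal, that is, windows shorter by one unit would not reach the horizon. This
bounds `L` times the width by a fraction of the optimum. -/
theorem window_lt (h : P.IsOptimal c L) : 192 * (L : ℝ) * (P.W - 1 : ℕ) < c * n * P.T.opt + n := by
  refine lt_of_lt_of_le ?_ h.H_le'
  have := h.W_lt
  rw [h.D_eq] at this
  exact_mod_cast this

theorem horizon_div_le (h : P.IsOptimal c L) : P.H / (c * n : ℝ) ≤ P.T.opt + 1 / c := by
  have := P.n_pos
  have := h.c_pos
  rw [div_le_iff₀ (by positivity)]
  refine h.H_le'.trans (le_of_eq ?_)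
  field_simp

theorem den_pos (h : P.IsOptimal c L) : 0 < P.den c L := by
  have h1 := P.T.root.pos
  have h2 := h.one_le_c
  have h3 := h.one_le_L
  rw [den]
  split_ifs <;> positivity

theorem num_pos (h : P.IsOptimal c L) : 0 < P.num c L := by
  have h1 := P.T.root.pos
  have h2 := h.one_le_c
  rw [num]
  split_ifs <;> positivity

theorem omega_pos (h : P.IsOptimal c L) : (0 : ℝ) < P.num c L / P.den c L := by
  have := h.den_pos
  have := h.num_pos
  positivity

/-- The form of ω: the first summand makes every vertex of duration below `W` light, and the second
one keeps ω positive when `W = 1` and makes the inequality strict. -/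
theorem c_mul_omega (h : P.IsOptimal c L) (hs : P.Short c) :
    (c : ℝ) * (P.num c L / P.den c L) = (P.W - 1 : ℕ) / (c * n) + 1 / (16 * L) := by
  have := P.n_pos
  have := h.c_pos
  have := h.L_pos
  rw [num, den, if_pos hs, if_pos hs]
  push_cast
  field_simp

theorem c_mul_omega_le (h : P.IsOptimal c L) (hs : P.Short c) : (c : ℝ) * (P.num c L / P.den c L) ≤ 1 / 8 := by
  have h1 := P.n_pos
  have h2 := h.c_pos
  have h3 := h.L_pos
  have h4 : (16 : ℝ) * (P.W - 1 : ℕ) ≤ c * n := by exact_mod_cast hs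
  rw [h.c_mul_omega hs]
  have h5 : ((P.W - 1 : ℕ) : ℝ) / (c * n) ≤ 1 / 16 := by
    rw [div_le_iff₀ (by positivity)]
    linarith
  have h6 : (1 : ℝ) / (16 * L) ≤ 1 / 16 := one_div_le_one_div_of_le (by norm_num) (by linarith)
  linarith

theorem delta_le (h : P.IsOptimal c L) (hs : P.Short c) : (2 * c + 1 : ℝ) * (P.num c L / P.den c L) ≤ 3 / 8 := by
  have h1 := h.c_mul_omega_le hs
  have h2 := h.c_pos
  have h3 := h.omega_pos
  nlinarith

/-- With 192 `L` windows, `192 L (W - 1) < c n OPT + n ≤ 2 c n OPT`, hence `L (W - 1) / (c n) ≤ OPT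
/ 96`. -/
theorem c_mul_L_omega_le (h : P.IsOptimal c L) (hs : P.Short c) :
    (c : ℝ) * (L * (P.num c L / P.den c L)) ≤ P.T.opt / 96 + 1 / 16 := by
  have h1 := P.n_pos
  have h2 := h.c_pos
  have h3 := h.L_pos
  have h4 := h.one_le_opt
  have h5 := h.window_lt
  have h6 : (L : ℝ) * ((P.W - 1 : ℕ) / (c * n)) ≤ P.T.opt / 96 := by
    rw [← mul_div_assoc, div_le_iff₀ (by positivity)]
    have : (n : ℝ) ≤ c * n * P.T.opt := by
      have : (1 : ℝ) * 1 ≤ c * P.T.opt := mul_le_mul h2 h4 (by norm_num) (by linarith)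
      nlinarith
    linarith
  have h7 : (L : ℝ) * (1 / (16 * L)) = 1 / 16 := by field_simp
  calc (c : ℝ) * (L * (P.num c L / P.den c L)) = L * (c * (P.num c L / P.den c L)) := by ring
    _ = L * ((P.W - 1 : ℕ) / (c * n)) + L * (1 / (16 * L)) := by
        rw [h.c_mul_omega hs, mul_add]
    _ ≤ _ := by rw [h7]; linarith

theorem one_div_le (h : P.IsOptimal c L) : (1 : ℝ) / c ≤ P.T.opt / c := by
  have h1 := h.c_pos
  have h2 := h.one_le_opt
  gcongr

theorem bound_eq (h : P.IsOptimal c L) : (1 + 12 / (c : ℝ)) * P.T.opt = P.T.opt + 12 * (P.T.opt / c) := by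
  have h1 := h.c_pos
  field_simp

theorem L_omega_le (h : P.IsOptimal c L) (hs : P.Short c) :
    (L : ℝ) * (P.num c L / P.den c L) ≤ (1 / 96 + 1 / 16) * (P.T.opt / c) := by
  have h1 := h.c_pos
  have h2 := h.c_mul_L_omega_le hs
  have h3 := h.one_le_opt
  rw [← mul_div_assoc (1 / 96 + 1 / 16 : ℝ), le_div_iff₀ (by linarith), mul_comm]
  linarith

/-- The labeling with its value of `ω`. -/
noncomputable def toGood (h : P.IsOptimal c L) (hs : P.Short c) : GoodLabeling n c (P.num c L / P.den c L) where
  toLabeling := P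
  one_le_c := h.one_le_c
  le_d := h.le_d
  good := h.good
  D_pos := by
    rw [h.D_eq]
    have := h.one_le_L
    omega
  ω_pos := h.omega_pos
  light v hv := by
    have h1 := P.n_pos
    have h2 := h.c_pos
    have h3 := h.L_pos
    have h4 : (P.d v : ℝ) ≤ (P.W - 1 : ℕ) := by exact_mod_cast Nat.le_sub_one_of_lt hv
    rw [h.c_mul_omega hs]
    have h5 : P.T.weight v ≤ (P.W - 1 : ℕ) / (c * n) := by
      rw [le_div_iff₀ (by positivity)]
      exact (h.le_d v).trans h4
    have : (0 : ℝ) < 1 / (16 * L) := by positivity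
    linarith
  window_le := by
    have h1 := P.n_pos
    have h2 := h.c_pos
    have h3 := h.L_pos
    have h4 : ((P.W - 1 : ℕ) : ℝ) = P.W - 1 := by
      rw [Nat.cast_sub h.W_pos, Nat.cast_one]
    have h5 := h.c_mul_omega hs
    have h6 := h.omega_pos
    rw [h4] at h5
    have h7 : (P.W - 1 : ℝ) = (P.W - 1 : ℝ) / (c * n) * (c * n) := by field_simp
    have h8 : (P.W - 1 : ℝ) / (c * n) ≤ c * (P.num c L / P.den c L) := by
      rw [h5]
      have : (0 : ℝ) < 1 / (16 * L) := by positivity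
      linarith
    rw [h7, ← mul_assoc]
    refine mul_le_mul_of_nonneg_right ?_ (by positivity)
    linarith

theorem light_iff (h : P.IsOptimal c L) (v : Fin n) : P.T.weight v < c * (P.num c L / P.den c L : ℝ) ↔
    P.T.weight v * P.den c L < (c * P.num c L : ℕ) := by
  have := h.den_pos
  rw [← mul_div_assoc, lt_div_iff₀ (by positivity)]
  push_cast
  rfl

theorem rankCost_eq (h : P.IsOptimal c L) (x : Fin n) :
    P.T.rankCost (rankOf P.key) (P.num c L / P.den c L) c x =
      ∑ q ∈ P.T.querySet (rankOf P.key) x, P.T.weight q -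
        P.lightCount c L x * ((2 * c + 1) * (P.num c L / P.den c L)) := by
  classical
  simp only [WTree.rankCost, WTree.gain]
  rw [Finset.sum_sub_distrib, ← Finset.sum_filter, Finset.sum_const, nsmul_eq_mul, lightCount]
  simp only [h.light_iff]

theorem sub_one_le (h : P.IsOptimal c L) (X : Finset (Fin n)) :
    (∑ q ∈ X, (P.d q - 1) : ℕ) / (c * n : ℝ) ≤ ∑ q ∈ X, P.T.weight q := by
  have h1 := P.n_pos
  have h2 := h.c_pos
  rw [div_le_iff₀ (by positivity), Nat.cast_sum, Finset.sum_mul]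
  refine Finset.sum_le_sum fun q _ => ?_
  rw [Nat.cast_sub (P.d_pos q), Nat.cast_one]
  linarith [h.d_le q]

/-- Rounding down loses less than one unit of `1 / (c n)` per vertex, altogether at most `1 / c`. -/
theorem le_sub_one (h : P.IsOptimal c L) (X : Finset (Fin n)) :
    ∑ q ∈ X, P.T.weight q ≤ (∑ q ∈ X, (P.d q - 1) : ℕ) / (c * n : ℝ) + 1 / c := by
  have h1 := P.n_pos
  have h2 := h.c_pos
  have h3 : (X.card : ℝ) ≤ n := by
    exact_mod_cast (Finset.card_le_univ X).trans (by simp)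
  have h4 : (1 : ℝ) / c = n / (c * n) := by field_simp
  rw [h4, ← add_div, le_div_iff₀ (by positivity), Finset.sum_mul, Nat.cast_sum]
  refine le_trans ?_ (add_le_add_right h3 _)
  rw [Finset.card_eq_sum_ones, Nat.cast_sum, ← Finset.sum_add_distrib]
  refine Finset.sum_le_sum fun q _ => ?_
  rw [Nat.cast_sub (P.d_pos q), Nat.cast_one]
  linarith [h.le_d q]

/-- The test uses `(d - 1) / (c n)`, which does not exceed the weight, so passing it proves that the
true cost is at least `L ω`. -/
theorem bounds_of_test (h : P.IsOptimal c L) (hs : P.Short c) (ht : P.Test c L) :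
    (∃ x, L * (P.num c L / P.den c L : ℝ) ≤
      P.T.rankCost (rankOf P.key) (P.num c L / P.den c L) c x) ∧
    ∀ x, P.T.rankCost (rankOf P.key) (P.num c L / P.den c L) c x ≤
      (1 + 12 / (c : ℝ)) * P.T.opt := by
  have h1 := P.n_pos
  have h2 := h.c_pos
  have h3 := h.L_pos
  constructor
  · obtain ⟨x, hx⟩ := ht
    refine ⟨x, ?_⟩
    rw [h.rankCost_eq]
    have h4 := h.sub_one_le (P.T.querySet (rankOf P.key) x)
    have h5 : ((L : ℝ) + (2 * c + 1) * P.lightCount c L x) * P.num c L ≤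
        16 * L * c * (∑ q ∈ P.T.querySet (rankOf P.key) x, (P.d q - 1) : ℕ) := by
      exact_mod_cast hx
    have h6 : ((L : ℝ) + (2 * c + 1) * P.lightCount c L x) * (P.num c L / P.den c L) ≤
        (∑ q ∈ P.T.querySet (rankOf P.key) x, (P.d q - 1) : ℕ) / (c * n : ℝ) := by
      have h7 : (P.den c L : ℝ) = 16 * L * c * (c * n) := by
        rw [den, if_pos hs]; push_cast; ring
      rw [h7, ← mul_div_assoc, div_le_div_iff₀ (by positivity) (by positivity)]
      nlinarith [mul_le_mul_of_nonneg_right h5 (by positivity : (0 : ℝ) ≤ c * n)]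
    linarith
  · intro x
    refine ((h.toGood hs).rankCost_le isRank_rankOf x).trans ?_
    have h4 := h.horizon_div_le
    have h5 := h.one_div_le
    have h6 : (0 : ℝ) ≤ P.T.opt / c := le_trans (by positivity) h5
    rw [h.bound_eq]
    change (P.H : ℝ) / (c * n) ≤ _
    linarith

/-- Failing the test bounds all costs in the old order by `L ω + 1 / c`. After the promotion, the
search for `z` costs at least `1 - (2c + 1) ω ≥ 5 / 8`, more than `L ω ≤ 1 / 4`. In
`rankCost_promoted_le` the first bound exceeds the optimum by `L ω + 2 / c` only, and the second is
at most `1 + 1 / c`. -/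
theorem bounds_of_not_test (h : P.IsOptimal c L) (hs : P.Short c) (hle : 4 * L * P.num c L ≤ P.den c L)
    (ht : ¬ P.Test c L) {z : Fin n} (hz : P.T.weight z = 1) :
    (∃ x, L * (P.num c L / P.den c L : ℝ) ≤
      P.T.rankCost (rankOf (P.finalKey c L z)) (P.num c L / P.den c L) c x) ∧
    ∀ x, P.T.rankCost (rankOf (P.finalKey c L z)) (P.num c L / P.den c L) c x ≤
      (1 + 12 / (c : ℝ)) * P.T.opt := by
  have h1 := P.n_pos
  have h2 := h.c_pos
  have h3 := h.L_pos
  have hden : (0 : ℝ) < P.den c L := by exact_mod_cast h.den_pos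
  have hL : (L : ℝ) * (P.num c L / P.den c L) ≤ 1 / 4 := by
    rw [← mul_div_assoc, div_le_iff₀ hden]
    have : (4 : ℝ) * L * P.num c L ≤ P.den c L := by exact_mod_cast hle
    linarith
  have hpr := promotes (z := z) ⟨hs, hle⟩ ht
  have hpv := P.pivot_spec z
  have hΔ := h.delta_le hs
  have hω := h.omega_pos
  refine ⟨⟨z, le_trans ?_ (hpr.le_rankCost h.star hω (by linarith [h.c_mul_omega_le hs]) hz hpv)⟩,
    fun x => ?_⟩
  · linarith
  have hB : ∀ x, P.T.rankCost (rankOf P.key) (P.num c L / P.den c L) c x ≤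
      L * (P.num c L / P.den c L) + 1 / c := by
    intro x
    rw [h.rankCost_eq]
    have h4 := h.le_sub_one (P.T.querySet (rankOf P.key) x)
    have h5 : 16 * L * c * (∑ q ∈ P.T.querySet (rankOf P.key) x, (P.d q - 1) : ℕ) <
        ((L : ℝ) + (2 * c + 1) * P.lightCount c L x) * P.num c L := by
      by_contra h'
      refine ht ⟨x, ?_⟩
      exact_mod_cast not_lt.1 h'
    have h6 : (∑ q ∈ P.T.querySet (rankOf P.key) x, (P.d q - 1) : ℕ) / (c * n : ℝ) ≤
        ((L : ℝ) + (2 * c + 1) * P.lightCount c L x) * (P.num c L / P.den c L) := by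
      have h7 : (P.den c L : ℝ) = 16 * L * c * (c * n) := by
        rw [den, if_pos hs]; push_cast; ring
      rw [h7, ← mul_div_assoc, div_le_div_iff₀ (by positivity) (by positivity)]
      nlinarith [mul_le_mul_of_nonneg_right h5.le (by positivity : (0 : ℝ) ≤ c * n)]
    linarith
  have h4 := h.horizon_div_le
  have h5 := h.one_div_le
  have h6 : (0 : ℝ) < 1 / (c : ℝ) := by positivity
  have h7 := h.L_omega_le hs
  have h8 := h.one_le_opt
  have h9 := (h.toGood hs).rankCost_promoted_le isRank_rankOf hpr hpv
    (B := L * (P.num c L / P.den c L) + 1 / c) (by positivity) hB x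
  refine h9.trans (max_le ?_ ?_)
  · rw [h.bound_eq]
    change (P.H : ℝ) / (c * n) + _ ≤ _
    linarith
  · rw [h.bound_eq]
    linarith

/-- The threshold is `L ω` plus what `PutsFirst.le_rankCost` may lose, namely the weight 1 of the
root and one discount `(2c + 1) ω`. The last vertex added contributes at most `c n` to the sum, so
the threshold is exceeded by at most 1. -/
theorem prefix_spec (h : P.IsOptimal c L)
    (hn : c * n * ((L + 2 * c + 1) * P.num c L + P.den c L) ≤ P.den c L * ∑ v, (P.d v - 1)) :
    ((L : ℝ) + 2 * c + 1) * (P.num c L / P.den c L) + 1 ≤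
      (∑ v : Fin n with v.1 < P.prefixLength c L, (P.d v - 1) : ℕ) / (c * n : ℝ) ∧
    (∑ v : Fin n with v.1 < P.prefixLength c L, (P.d v - 1) : ℕ) / (c * n : ℝ) ≤
      ((L : ℝ) + 2 * c + 1) * (P.num c L / P.den c L) + 2 := by
  classical
  have h1 := P.n_pos
  have h2 := h.c_pos
  have hcn : (0 : ℝ) < c * n := by positivity
  have hden : (0 : ℝ) < P.den c L := by exact_mod_cast h.den_pos
  set A := c * n * ((L + 2 * c + 1) * P.num c L + P.den c L) with hA
  set S : ℕ → ℕ := fun k => ∑ v : Fin n with v.1 < k, (P.d v - 1) with hS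
  have hSn : A ≤ P.den c L * S n := by
    refine hn.trans (le_of_eq ?_)
    simp [hS]
  have hle : P.prefixLength c L ≤ n := RAM.least_le _ _
  have hk : A ≤ P.den c L * S (P.prefixLength c L) ∧
      ∀ j < P.prefixLength c L, ¬ A ≤ P.den c L * S j := by
    by_cases hex : ∃ k < n, A ≤ P.den c L * S k
    · exact (RAM.least_spec hex).2
    · push Not at hex
      -- The search for the least index stops below `n`; its default value `n` is correct, since all
      -- vertices together reach the threshold.
      have : P.prefixLength c L = n := RAM.least_eq_bound fun i hi => not_le.2 (hex i hi)
      rw [this]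
      exact ⟨hSn, fun j hj => not_le.2 (hex j hj)⟩
  have hconv : ∀ e : ℝ, ((L : ℝ) + 2 * c + 1) * (P.num c L / P.den c L) + 1 + e =
      (A / (P.den c L) + e * (c * n)) / (c * n) := fun e => by
    rw [hA]
    push_cast
    field_simp
  obtain ⟨hk1, hk2⟩ := hk
  constructor
  · rw [← add_zero (_ + (1 : ℝ)), hconv, zero_mul, add_zero]
    refine div_le_div_of_nonneg_right ?_ hcn.le
    rw [div_le_iff₀ hden, mul_comm]
    exact_mod_cast hk1
  · have hpos : 0 < P.prefixLength c L := by
      by_contra h0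
      rw [Nat.eq_zero_of_not_pos h0] at hk1
      have : 0 < A := by
        have := h.den_pos
        have h3 : 0 < c * n := by exact_mod_cast hcn
        positivity
      simp [hS] at hk1
      omega
    obtain ⟨j, hj⟩ := Nat.exists_eq_add_of_lt hpos
    rw [zero_add] at hj
    have hjn : j < n := by omega
    have hsucc : S (P.prefixLength c L) ≤ S j + c * n := by
      have : (Finset.univ.filter fun v : Fin n => v.1 < P.prefixLength c L) =
          insert ⟨j, hjn⟩ (Finset.univ.filter fun v : Fin n => v.1 < j) := by
        ext v
        simp only [Finset.mem_filter, Finset.mem_univ, true_and, Finset.mem_insert, Fin.ext_iff]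
        omega
      simp only [hS]
      rw [this, Finset.sum_insert (by simp), add_comm]
      refine Nat.add_le_add_left (Nat.sub_le_of_le_add ?_) _
      have h3 := h.d_le ⟨j, hjn⟩
      have h4 := h.norm.1 ⟨j, hjn⟩
      have : (P.d ⟨j, hjn⟩ : ℝ) ≤ ((c * n + 1 : ℕ) : ℝ) := by
        push_cast
        nlinarith
      exact_mod_cast this
    have hj' : (S j : ℝ) ≤ A / P.den c L := by
      rw [le_div_iff₀ hden, mul_comm]
      exact_mod_cast (not_le.1 (hk2 j (by omega))).le
    have e := hconv 1
    rw [add_assoc, one_add_one_eq_two] at e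
    rw [e]
    refine div_le_div_of_nonneg_right ?_ hcn.le
    have : (S (P.prefixLength c L) : ℝ) ≤ S j + c * n := by exact_mod_cast hsucc
    linarith

/-- Querying all vertices is a strategy, so their total weight is at least the optimum. -/
theorem prefix_exists (h : P.IsOptimal c L)
    (hn : ((L : ℝ) + 2 * c + 1) * (P.num c L / P.den c L) + 1 ≤ P.T.opt - 1 / c) :
    c * n * ((L + 2 * c + 1) * P.num c L + P.den c L) ≤ P.den c L * ∑ v, (P.d v - 1) := by
  have h1 := P.n_pos
  have h2 := h.c_pos
  have hden : (0 : ℝ) < P.den c L := by exact_mod_cast h.den_pos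
  have h3 := h.le_sub_one Finset.univ
  have h4 := P.T.opt_le_sum
  have h5 : ((L : ℝ) + 2 * c + 1) * (P.num c L / P.den c L) + 1 ≤
      (∑ q, (P.d q - 1) : ℕ) / (c * n : ℝ) := by linarith
  have h6 : ((L : ℝ) + 2 * c + 1) * (P.num c L / P.den c L) + 1 =
      (((L : ℝ) + 2 * c + 1) * P.num c L + P.den c L) / P.den c L := by field_simp
  rw [h6, div_le_div_iff₀ hden (by positivity)] at h5
  have h7 : (c * n : ℝ) * (((L : ℝ) + 2 * c + 1) * P.num c L + P.den c L) ≤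
      P.den c L * (∑ q, (P.d q - 1) : ℕ) := by linarith
  exact_mod_cast h7

theorem le_rankCost_prefix (h : P.IsOptimal c L)
    (h1 : ¬ (P.Short c ∧ 4 * L * P.num c L ≤ P.den c L))
    (hn : ((L : ℝ) + 2 * c + 1) * (P.num c L / P.den c L) + 1 ≤ P.T.opt - 1 / c) (z : Fin n) :
    L * (P.num c L / P.den c L : ℝ) ≤
      P.T.rankCost (rankOf (P.finalKey c L z)) (P.num c L / P.den c L) c P.T.root := by
  refine le_trans ?_ ((putsFirst h1).le_rankCost h.omega_pos (h.norm.1 _))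
  have h2 := (h.prefix_spec (h.prefix_exists hn)).1
  have h3 := h.sub_one_le (Finset.univ.filter fun v : Fin n => v.1 < P.prefixLength c L)
  linarith

theorem prefix_sum_le (h : P.IsOptimal c L)
    (hn : ((L : ℝ) + 2 * c + 1) * (P.num c L / P.den c L) + 1 ≤ P.T.opt - 1 / c) :
    ∑ v : Fin n with v.1 < P.prefixLength c L, P.T.weight v ≤
      ((L : ℝ) + 2 * c + 1) * (P.num c L / P.den c L) + 2 + 1 / c := by
  have h2 := (h.prefix_spec (h.prefix_exists hn)).2
  have h3 := h.le_sub_one (Finset.univ.filter fun v : Fin n => v.1 < P.prefixLength c L)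
  linarith

/-- From `L ω > 1 / 4` and `c_mul_L_omega_le` the optimum exceeds `18 c`. So the prefix, of weight
at most `(L + 2c + 1) ω + 2 + 1 / c`, fits into `12 OPT / c`. -/
theorem bounds_of_short (h : P.IsOptimal c L) (hs : P.Short c)
    (hle : ¬ 4 * L * P.num c L ≤ P.den c L) (z : Fin n) :
    (∃ x, L * (P.num c L / P.den c L : ℝ) ≤
      P.T.rankCost (rankOf (P.finalKey c L z)) (P.num c L / P.den c L) c x) ∧
    ∀ x, P.T.rankCost (rankOf (P.finalKey c L z)) (P.num c L / P.den c L) c x ≤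
      (1 + 12 / (c : ℝ)) * P.T.opt := by
  have h2 := h.c_pos
  have hden : (0 : ℝ) < P.den c L := by exact_mod_cast h.den_pos
  have hL : 1 / 4 < (L : ℝ) * (P.num c L / P.den c L) := by
    rw [← mul_div_assoc, lt_div_iff₀ hden]
    have : (P.den c L : ℝ) < 4 * L * P.num c L := by exact_mod_cast not_le.1 hle
    linarith
  have h3 := h.c_mul_L_omega_le hs
  have h4 : 18 < P.T.opt / c := by
    rw [lt_div_iff₀ (by linarith)]
    nlinarith
  have h5 := h.L_omega_le hs
  have h6 := h.delta_le hs
  have h7 := h.one_div_le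
  have h8 : P.T.opt / c ≤ P.T.opt := div_le_self (by linarith [h.one_le_opt]) h2
  have h9 : (1 : ℝ) / c ≤ 1 := by
    rw [div_le_one (by linarith)]
    exact h2
  have hn : ((L : ℝ) + 2 * c + 1) * (P.num c L / P.den c L) + 1 ≤ P.T.opt - 1 / c := by
    linarith
  have h10 : ¬ (P.Short c ∧ 4 * L * P.num c L ≤ P.den c L) := fun h' => hle h'.2
  refine ⟨⟨_, h.le_rankCost_prefix h10 hn z⟩, fun x => ?_⟩
  have h11 := putsFirst (z := z) h10
  have e : P.baseKey c = P.key := funext fun v => if_pos hs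
  rw [e] at h11
  refine ((h.toGood hs).rankCost_putsFirst_le isRank_rankOf h11 x).trans ?_
  have h12 := h.prefix_sum_le hn
  have h13 := h.horizon_div_le
  rw [h.bound_eq]
  change ∑ v : Fin n with v.1 < P.prefixLength c L, P.T.weight v + (P.H : ℝ) / (c * n) ≤ _
  linarith

/-- Long windows imply `OPT > 12 L - 1 / c`. As `c ω = 2` exceeds all weights, every vertex is
light, and behind the prefix a top-down order makes only down queries, whose gain is not positive.
So only the prefix counts, and it weighs at most `2 L + 8 + 1 / c`, which is below the optimum. -/
theorem bounds_of_not_short (h : P.IsOptimal c L) (hs : ¬ P.Short c) (z : Fin n) :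
    (∃ x, L * (P.num c L / P.den c L : ℝ) ≤
      P.T.rankCost (rankOf (P.finalKey c L z)) (P.num c L / P.den c L) c x) ∧
    ∀ x, P.T.rankCost (rankOf (P.finalKey c L z)) (P.num c L / P.den c L) c x ≤
      (1 + 12 / (c : ℝ)) * P.T.opt := by
  have h1 := P.n_pos
  have h2 := h.c_pos
  have h3 := h.L_pos
  have hω : (P.num c L / P.den c L : ℝ) = 2 / c := by
    rw [num, den, if_neg hs, if_neg hs]
    norm_num
  have hcω : (c : ℝ) * (P.num c L / P.den c L) = 2 := by
    rw [hω]
    field_simp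
  have h4 : 12 * (L : ℝ) < P.T.opt + 1 / c := by
    have h5 := h.window_lt
    have h6 : (c * n : ℝ) < 16 * (P.W - 1 : ℕ) := by
      have : c * n < 16 * (P.W - 1) := not_le.1 hs
      exact_mod_cast this
    have h7 : (c * n : ℝ) * (12 * L) < (c * n) * (P.T.opt + 1 / c) := by
      have : (c * n : ℝ) * (1 / c) = n := by field_simp
      nlinarith
    exact lt_of_mul_lt_mul_left h7 (by positivity)
  have h9 : (1 : ℝ) / c ≤ 1 := by
    rw [div_le_one (by linarith)]
    exact h2
  have h10 : ((L : ℝ) + 2 * c + 1) * (P.num c L / P.den c L) ≤ 2 * L + 6 := by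
    have : ((L : ℝ) + 2 * c + 1) * (P.num c L / P.den c L) = 2 * L * (1 / c) + 4 + 2 * (1 / c) := by
      rw [hω]
      field_simp
      ring
    rw [this]
    nlinarith
  have hn : ((L : ℝ) + 2 * c + 1) * (P.num c L / P.den c L) + 1 ≤ P.T.opt - 1 / c := by
    linarith
  have h11 : ¬ (P.Short c ∧ 4 * L * P.num c L ≤ P.den c L) := fun h' => hs h'.1
  refine ⟨⟨_, h.le_rankCost_prefix h11 hn z⟩, fun x => ?_⟩
  have h12 := putsFirst (z := z) h11
  have e : P.baseKey c = P.T.depth := funext fun v => if_neg hs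
  rw [e] at h12
  have hω' := h.omega_pos
  refine (h12.rankCost_le_of_light h.omega_pos (fun a b => rankOf_lt) (fun v => ?_) (fun v => ?_)
    x).trans ?_
  · rw [hcω]
    linarith [h.norm.1 v]
  · have := h.norm.1 v
    linarith
  · have h13 := h.prefix_sum_le hn
    have h14 : 0 ≤ 12 * (P.T.opt / c) := by
      have := h.one_le_opt
      positivity
    rw [h.bound_eq]
    linarith

theorem bounds (h : P.IsOptimal c L) {z : Fin n} (hz : P.T.weight z = 1) :
    (∃ x, L * (P.num c L / P.den c L : ℝ) ≤
      P.T.rankCost (rankOf (P.finalKey c L z)) (P.num c L / P.den c L) c x) ∧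
    ∀ x, P.T.rankCost (rankOf (P.finalKey c L z)) (P.num c L / P.den c L) c x ≤
      (1 + 12 / (c : ℝ)) * P.T.opt := by
  by_cases hs : P.Short c
  · by_cases hle : 4 * L * P.num c L ≤ P.den c L
    · by_cases ht : P.Test c L
      · have : P.finalKey c L z = P.key := funext fun v => by
          rw [finalKey, if_pos ⟨hs, hle⟩, if_pos (Or.inl ht)]
        rw [this]
        exact h.bounds_of_test hs ht
      · exact h.bounds_of_not_test hs hle ht hz
    · exact h.bounds_of_short hs hle z
  · exact h.bounds_of_not_short hs z

/-- The final order yields a stable assignment with the required cost. -/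
theorem modCost_bounds (h : P.IsOptimal c L) {z : Fin n} (hz : P.T.weight z = 1)
    {l : List (Fin n)}
    (hl : l.Pairwise fun a b => rankOf (P.finalKey c L z) a < rankOf (P.finalKey c L z) b)
    (hmem : ∀ v, v ∈ l) :
    (P.num c L / P.den c L : ℝ) ≤ 1 / L * P.T.modCost (P.num c L / P.den c L) c
      (P.T.inducedQueries fun _ => l) ∧
    P.T.modCost (P.num c L / P.den c L) c (P.T.inducedQueries fun _ => l) ≤
      (1 + 12 / (c : ℝ)) * P.T.opt := by
  have : Nonempty (Fin n) := ⟨P.T.root⟩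
  have h1 := h.L_pos
  obtain ⟨⟨x, hx⟩, h2⟩ := h.bounds hz
  rw [WTree.modCost_const (rankOf_injective _) hl hmem]
  refine ⟨?_, ciSup_le h2⟩
  rw [one_div_mul_eq_div, le_div_iff₀ (by linarith), mul_comm]
  exact hx.trans (le_ciSup (f := fun x => P.T.rankCost (rankOf (P.finalKey c L z))
    (P.num c L / P.den c L) c x) (Set.finite_range _).bddAbove x)

end IsOptimal

end Labeling


/-! ### Sizes of codes and tables; computability of the schedule conditions. -/

namespace RAM

open Schedule

section Closure

variable {α : Type} [Ctx α]

/-- Computable functions that are bounded by `Mem.lim`. -/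
structure CmpB (f : Mem → α → ℕ) : Prop where
  cmp : Cmp f
  le : ∀ m a, m.WF → f m a ≤ m.lim

theorem Cmp.min {f g : Mem → α → ℕ} (hf : Cmp f) (hg : Cmp g) :
    Cmp fun m a => Min.min (f m a) (g m a) := by
  classical
  exact ((CmpP.le hf hg).ite hf hg).congr fun m a _ => by
    rw [min_def]

theorem CmpB.weaken {f : Mem → α → ℕ} (hf : CmpB f) : CmpB fun m (p : α × ℕ) => f m p.1 :=
  ⟨hf.cmp.weaken, fun m p h => hf.le m p.1 h⟩

theorem CmpB.of_le {f g : Mem → α → ℕ} (hg : CmpB g) (hf : Cmp f)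
    (h : ∀ m a, m.WF → f m a ≤ g m a) : CmpB f :=
  ⟨hf, fun m a hm => (h m a hm).trans (hg.le m a hm)⟩

/-- A loop index carries no bound of its own, while many operations need one. Truncating it at the
bound of the loop provides one and leaves the values inside the loop unchanged. -/
theorem CmpB.last {b : Mem → α → ℕ} (hb : CmpB b) :
    CmpB fun m (p : α × ℕ) => Min.min p.2 (b m p.1) :=
  hb.weaken.of_le (Cmp.last.min hb.cmp.weaken) fun _ _ _ => min_le_right _ _

theorem CmpP.forall {b : Mem → α → ℕ} {P : Mem → α → ℕ → Prop} (hb : CmpB b)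
    (hP : CmpP fun m (p : α × ℕ) => P m p.1 (min p.2 (b m p.1))) :
    CmpP fun m a => ∀ i < b m a, P m a i :=
  (CmpP.forall_lt (P := fun m a i => P m a (Min.min i (b m a))) hb.cmp hb.le hP).congr
    fun m a _ => forall₂_congr fun i hi => by rw [min_eq_left hi.le]

theorem CmpP.exists {b : Mem → α → ℕ} {P : Mem → α → ℕ → Prop} (hb : CmpB b)
    (hP : CmpP fun m (p : α × ℕ) => P m p.1 (min p.2 (b m p.1))) :
    CmpP fun m a => ∃ i < b m a, P m a i :=
  (CmpP.exists_lt (P := fun m a i => P m a (Min.min i (b m a))) hb.cmp hb.le hP).congr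
    fun m a _ => exists_congr fun i => and_congr_right fun hi => by rw [min_eq_left hi.le]

theorem Cmp.sum_range {b : Mem → α → ℕ} {f : Mem → α → ℕ → ℕ} (hb : CmpB b)
    (hf : Cmp fun m (p : α × ℕ) => f m p.1 (Min.min p.2 (b m p.1))) :
    Cmp fun m a => ∑ i ∈ Finset.range (b m a), f m a i :=
  (Cmp.sum (f := fun m a i => f m a (Min.min i (b m a))) hb.cmp hb.le hf).congr fun m a _ =>
    Finset.sum_congr rfl fun i hi => by rw [min_eq_left (Finset.mem_range.1 hi).le]

theorem least_congr {b : ℕ} {P Q : ℕ → Prop} (h : ∀ i < b, P i ↔ Q i) : least b P = least b Q := by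
  by_cases hex : ∃ i < b, Q i
  · obtain ⟨h1, h2, h3⟩ := least_spec hex
    exact least_eq h1.le (fun j hj hP => h3 j hj ((h j (hj.trans h1)).1 hP)) fun _ => (h _ h1).2 h2
  · push Not at hex
    rw [least_eq_bound hex, least_eq_bound fun i hi hP => hex i hi ((h i hi).1 hP)]

theorem CmpB.least {b : Mem → α → ℕ} {P : Mem → α → ℕ → Prop} (hb : CmpB b)
    (hP : CmpP fun m (p : α × ℕ) => P m p.1 (Min.min p.2 (b m p.1))) :
    CmpB fun m a => RAM.least (b m a) (P m a) :=
  hb.of_le ((Cmp.least (P := fun m a i => P m a (Min.min i (b m a))) hb.cmp hb.le hP).congr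
    fun m a _ => least_congr fun i hi => by rw [min_eq_left hi.le]) fun _ _ _ => least_le _ _

theorem Nat.div_eq_card {x y : ℕ} (hy : y ≠ 0) :
    x / y = least x fun k => x < y * (min k x + 1) := by
  symm
  apply least_eq (Nat.div_le_self x y)
  · intro j hj
    have h1 : j < x := hj.trans_le (Nat.div_le_self x y)
    rw [min_eq_left h1.le, not_lt, mul_comm]
    exact (Nat.le_div_iff_mul_le (Nat.pos_of_ne_zero hy)).1 hj
  · intro h
    rw [min_eq_left h.le]
    exact Nat.lt_mul_div_succ x (Nat.pos_of_ne_zero hy)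

/-- The machine has no division of naturals; the quotient is searched for as the least `k` with `x <
y * (k + 1)`. -/
theorem CmpB.div {x y : Mem → α → ℕ} (hx : CmpB x) (hy : Cmp y) :
    CmpB fun m a => x m a / y m a := by
  classical
  refine hx.of_le ?_ fun _ _ _ => Nat.div_le_self _ _
  have h1 : CmpB fun m a => RAM.least (x m a) fun k => x m a < y m a * (Min.min k (x m a)) + y m a := by
    refine CmpB.least hx (CmpP.lt hx.cmp.weaken ((Cmp.congr (f := fun m (p : α × ℕ) =>
      (Min.min (Min.min p.2 (x m p.1)) (x m p.1)) * y m p.1) ?_ fun _ _ _ => mul_comm _ _).add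
        hy.weaken))
    exact Cmp.mul (hx.last.cmp.min hx.cmp.weaken)
      (fun m a hm => (min_le_right _ _).trans (hx.le m a.1 hm)) hy.weaken
  refine ((CmpP.eq hy (Cmp.lit 0)).ite (Cmp.lit 0) h1.cmp).congr fun m a _ => ?_
  split_ifs with h
  · rw [h, Nat.div_zero]
  · rw [Nat.div_eq_card h]
    rfl

theorem CmpB.mod {x y : Mem → α → ℕ} (hx : CmpB x) (hy : Cmp y) :
    CmpB fun m a => x m a % y m a := by
  refine hx.of_le ?_ fun _ _ _ => Nat.mod_le _ _
  refine (hx.cmp.sub (Cmp.mul (hx.div hy).cmp (hx.div hy).le hy)).congr fun m a _ => ?_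
  rw [mul_comm]
  exact (Nat.mod_eq_sub_mul_div).symm

theorem Cmp.pow {x k : Mem → α → ℕ} (hx : CmpB x) (hk : CmpB k) :
    Cmp fun m a => x m a ^ k m a := by
  refine (Cmp.natRec (init := fun _ _ => 1) (step := fun m a _ acc => x m a * acc) hk.cmp hk.le
    (Cmp.lit 1) (Cmp.mul hx.cmp.weaken.weaken (fun m a hm => hx.le m a.1.1 hm) Cmp.last)).congr
    fun m a _ => ?_
  induction k m a with
  | zero => simp
  | succ i ih => rw [pow_succ, ← ih, mul_comm]

end Closure

namespace Mem

variable (m : Mem)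

/-- The number of windows. -/
def windows : ℕ := 192 * m.L

/-- An upper bound for the horizon. -/
def maxHorizon : ℕ := m.n * (m.c * m.n + 1)

/-- The base of the codes of the digits. -/
def base : ℕ := m.maxHorizon + 2

/-- The number of codes. -/
def codes : ℕ := m.base ^ (3 * m.windows)

/-- The digit `k` of the code `s`. -/
def digit (s k : ℕ) : ℕ := s / m.base ^ min k (3 * m.windows) % m.base

/-- The size of the table. -/
def tableSize : ℕ :=
  (m.maxHorizon + 1) * (m.n + 1) * (m.n + 1) * m.n * (m.maxHorizon + 1) * m.codes * (m.n + 1)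

/-- The number of candidates for a label and two codes. -/
def candidates : ℕ := (m.maxHorizon + 1) * m.codes * m.codes

end Mem

section Bounds

variable {m : Mem}

theorem Mem.WF.n_le (h : m.WF) : m.n ≤ m.c * m.n := Nat.le_mul_of_pos_left _ h.one_le_c

theorem Mem.WF.windows_le (h : m.WF) : m.windows + 2 ≤ (m.c * m.n) ^ (9 * m.L) := by
  have h1 : m.L < 2 ^ m.L := Nat.lt_two_pow_self
  have h2 := h.one_le_L
  have h3 : m.windows + 2 ≤ 2 ^ 8 * 2 ^ m.L := by
    rw [windows]
    omega
  rw [← pow_add] at h3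
  exact h3.trans ((Nat.pow_le_pow_left h.two_le _).trans
    (Nat.pow_le_pow_right (by have := h.two_le; omega) (by omega)))

theorem Mem.WF.base_le (h : m.WF) : m.base ≤ (m.c * m.n) ^ 4 := by
  have h1 := h.n_le
  have h2 := h.two_le
  rw [base, maxHorizon]
  set Q := m.c * m.n
  calc m.n * (Q + 1) + 2 ≤ Q * (Q + 1) + 2 := by
        exact Nat.add_le_add_right (Nat.mul_le_mul_right _ h1) _
    _ ≤ Q ^ 4 := by
        have h3 : 4 ≤ Q * Q := Nat.mul_le_mul h2 h2
        have h4 : Q * Q * 4 ≤ Q * Q * (Q * Q) := Nat.mul_le_mul_left _ h3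
        have h5 : Q * 1 ≤ Q * Q := Nat.mul_le_mul_left _ (by omega)
        have : Q ^ 4 = Q * Q * (Q * Q) := by ring
        rw [this, mul_add]
        omega

/-- There are `3 * 192 * L` digits in a base of at most `(c n) ^ 4`, and `4 * 3 * 192 = 2304`. The
dependence on `L` in the exponent of the running time originates here. -/
theorem Mem.WF.codes_le (h : m.WF) : m.codes ≤ (m.c * m.n) ^ (2304 * m.L) := by
  refine (Nat.pow_le_pow_left h.base_le _).trans (le_of_eq ?_)
  rw [← pow_mul, windows]
  ring_nf

theorem Mem.WF.maxHorizon_le (h : m.WF) : m.maxHorizon + 1 ≤ (m.c * m.n) ^ 4 :=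
  le_trans (by rw [base]; omega) h.base_le

theorem Mem.WF.n_add_one_le (h : m.WF) : m.n + 1 ≤ (m.c * m.n) ^ 2 := by
  have h1 := h.n_le
  have h2 := h.two_le
  nlinarith

theorem Mem.WF.tableSize_le (h : m.WF) : m.tableSize ≤ m.lim := by
  refine le_trans ?_ (h.pow_le_lim (a := 4 + 2 + 2 + 1 + 4 + 2304 * m.L + 2)
    (by have := h.one_le_L; omega))
  simp only [pow_add, tableSize]
  have h1 : m.n ≤ (m.c * m.n) ^ 1 := by rw [pow_one]; exact h.n_le
  gcongr
  exacts [h.maxHorizon_le, h.n_add_one_le, h.n_add_one_le, h.maxHorizon_le, h.codes_le,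
    h.n_add_one_le]

theorem Mem.WF.candidates_le (h : m.WF) : m.candidates ≤ m.lim := by
  refine le_trans ?_ (h.pow_le_lim (a := 4 + 2304 * m.L + 2304 * m.L)
    (by have := h.one_le_L; omega))
  simp only [pow_add, candidates]
  gcongr
  exacts [h.maxHorizon_le, h.codes_le, h.codes_le]

end Bounds

section Functions

variable {α : Type} [Ctx α]

theorem CmpB.n : CmpB fun m (_ : α) => m.n :=
  ⟨Cmp.n, fun m _ h => (h.n_le.trans (by rw [pow_one])).trans (h.pow_le_lim (a := 1)
    (by have := h.one_le_L; omega))⟩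

theorem CmpB.c : CmpB fun m (_ : α) => m.c :=
  ⟨Cmp.c, fun m _ h => le_trans (by
    rw [pow_one]
    exact Nat.le_mul_of_pos_right _ (by have := h.two_le_n; omega)) (h.pow_le_lim (a := 1) (by have := h.one_le_L; omega))⟩

theorem CmpB.mul_cn : CmpB fun m (_ : α) => m.c * m.n :=
  ⟨Cmp.mul CmpB.c.cmp CmpB.c.le Cmp.n, fun m _ h => le_trans (by rw [pow_one])
    (h.pow_le_lim (a := 1) (by have := h.one_le_L; omega))⟩

theorem CmpB.windows_add_two : CmpB fun m (_ : α) => m.windows + 2 := by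
  refine ⟨(Cmp.mul (Cmp.lit 192) (fun m _ h => ?_) Cmp.L).add (Cmp.lit 2),
    fun m _ h => h.windows_le.trans (h.pow_le_lim (by omega))⟩
  exact (le_trans (by norm_num : 192 ≤ 2 ^ 8) (Nat.pow_le_pow_left h.two_le 8)).trans
    (h.pow_le_lim (by have := h.one_le_L; omega))

theorem CmpB.windows : CmpB fun m (_ : α) => m.windows :=
  CmpB.windows_add_two.of_le ((CmpB.windows_add_two.cmp.sub (Cmp.lit 2)).congr
    fun _ _ _ => by rw [Nat.add_sub_cancel]) fun _ _ _ => by omega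

theorem CmpB.base : CmpB fun m (_ : α) => m.base :=
  ⟨(Cmp.mul CmpB.n.cmp CmpB.n.le (CmpB.mul_cn.cmp.add (Cmp.lit 1))).add (Cmp.lit 2),
    fun m _ h => h.base_le.trans (h.pow_le_lim (by have := h.one_le_L; omega))⟩

theorem CmpB.maxHorizon_add_one : CmpB fun m (_ : α) => m.maxHorizon + 1 :=
  CmpB.base.of_le ((CmpB.base.cmp.sub (Cmp.lit 1)).congr fun _ _ _ => by
    rw [Mem.base]; omega) fun _ _ _ => by rw [Mem.base]; omega

theorem CmpB.three_windows : CmpB fun m (_ : α) => 3 * m.windows :=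
  ⟨((CmpB.windows.cmp.add CmpB.windows.cmp).add CmpB.windows.cmp).congr fun _ _ _ => by ring,
    fun m _ h => by
      refine le_trans ?_ (h.pow_le_lim (a := 2 + 9 * m.L) (by have := h.one_le_L; omega))
      rw [pow_add]
      have h1 := h.windows_le
      have h2 : 4 ≤ (m.c * m.n) ^ 2 := Nat.pow_le_pow_left h.two_le 2
      nlinarith⟩

theorem CmpB.codes : CmpB fun m (_ : α) => m.codes :=
  ⟨Cmp.pow CmpB.base CmpB.three_windows, fun m _ h =>
    h.codes_le.trans (h.pow_le_lim (by omega))⟩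

theorem CmpB.n_add_one : CmpB fun m (_ : α) => m.n + 1 :=
  ⟨Cmp.n.add (Cmp.lit 1), fun m _ h => h.n_add_one_le.trans (h.pow_le_lim
    (by have := h.one_le_L; omega))⟩

theorem CmpB.candidates : CmpB fun m (_ : α) => m.candidates :=
  ⟨(Cmp.mul CmpB.codes.cmp CmpB.codes.le (Cmp.mul CmpB.codes.cmp CmpB.codes.le
    CmpB.maxHorizon_add_one.cmp)).congr fun _ _ _ => by rw [Mem.candidates]; ring,
    fun _ _ h => h.candidates_le⟩

theorem CmpB.tableSize : CmpB fun m (_ : α) => m.tableSize :=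
  ⟨(Cmp.mul CmpB.n_add_one.cmp CmpB.n_add_one.le (Cmp.mul CmpB.codes.cmp CmpB.codes.le
    (Cmp.mul CmpB.maxHorizon_add_one.cmp CmpB.maxHorizon_add_one.le (Cmp.mul CmpB.n.cmp CmpB.n.le
      (Cmp.mul CmpB.n_add_one.cmp CmpB.n_add_one.le (Cmp.mul CmpB.n_add_one.cmp CmpB.n_add_one.le
        CmpB.maxHorizon_add_one.cmp)))))).congr fun _ _ _ => by rw [Mem.tableSize]; ring,
    fun _ _ h => h.tableSize_le⟩

theorem CmpB.digit {s k : Mem → α → ℕ} (hs : CmpB s) (hk : Cmp k) :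
    CmpB fun m a => m.digit (s m a) (k m a) :=
  (hs.div (Cmp.pow CmpB.base (CmpB.three_windows.of_le (hk.min CmpB.three_windows.cmp)
    fun _ _ _ => min_le_right _ _))).mod CmpB.base.cmp

/-! ### The conditions on schedules are computable -/

/-- Computable sequences of digits. -/
def CmpF (g : Mem → α → ℕ → ℕ) : Prop := Cmp fun m (p : α × ℕ) => g m p.1 p.2

theorem CmpF.app {g : Mem → α → ℕ → ℕ} (hg : CmpF g) {e : Mem → α → ℕ} (he : Cmp e) :
    Cmp fun m a => g m a (e m a) := Cmp.comp hg (CmpT.id.pair he)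

theorem CmpF.weaken {g : Mem → α → ℕ → ℕ} (hg : CmpF g) :
    CmpF fun m (p : α × ℕ) => g m p.1 :=
  Cmp.comp hg (CmpT.pair (CmpT.weaken (CmpT.weaken CmpT.id)) Cmp.last)

theorem Cmp.three_mul {k : Mem → α → ℕ} (hk : Cmp k) : Cmp fun m a => 3 * k m a :=
  ((hk.add hk).add hk).congr fun _ _ _ => by ring

/-- The index of a digit has no bound, so it cannot be divided by 3; instead it is compared with `3
* (l / W)` plus 0, 1 and 2. -/
theorem CmpF.item {H W d l : Mem → α → ℕ} (hH : Cmp H) (hW : Cmp W) (hd : Cmp d) (hl : CmpB l) :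
    CmpF fun m a => Schedule.item (H m a) (W m a) (d m a) (l m a) := by
  classical
  have hq := (hl.div hW).cmp.three_mul.weaken
  refine ((CmpP.eq hl.cmp.weaken hH.weaken).ite (Cmp.lit 0)
    ((CmpP.eq Cmp.last hq).ite ((CmpP.lt hd.weaken hW.weaken).ite hd.weaken (Cmp.lit 0))
    ((CmpP.eq Cmp.last (hq.add (Cmp.lit 1))).ite ((CmpP.le hW.weaken hd.weaken).ite
      (hl.cmp.weaken.add (Cmp.lit 1)) (Cmp.lit 0))
    ((CmpP.eq Cmp.last (hq.add (Cmp.lit 2))).ite ((CmpP.le hW.weaken hd.weaken).ite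
      hd.weaken (Cmp.lit 0)) (Cmp.lit 0))))).congr fun m p _ => ?_
  change _ = Schedule.item (H m p.1) (W m p.1) (d m p.1) (l m p.1) p.2
  rw [Schedule.item]
  by_cases h1 : l m p.1 = H m p.1
  · simp [h1]
  by_cases h2 : l m p.1 / W m p.1 = p.2 / 3
  · simp only [h1, h2, ne_eq, not_true_eq_false, or_self, if_false]
    have h3 : p.2 % 3 < 3 := Nat.mod_lt _ (by norm_num)
    have h4 := Nat.div_add_mod p.2 3
    by_cases e0 : p.2 % 3 = 0
    · rw [if_pos (by omega), if_pos e0]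
    · rw [if_neg (by omega), if_neg e0]
      by_cases e1 : p.2 % 3 = 1
      · rw [if_pos (by omega), if_pos e1]
      · rw [if_neg (by omega), if_pos (by omega), if_neg e1]
  · rw [if_neg h1, if_neg (by omega), if_neg (by omega), if_neg (by omega), if_pos (Or.inr h2)]

/-- For `W = 0` the second alternative of `Keep` always holds; otherwise the products are turned
into a comparison with `l / W`. -/
theorem CmpP.keep {H W d l i : Mem → α → ℕ} (hH : Cmp H) (hW : Cmp W) (hd : Cmp d) (hl : CmpB l)
    (hi : Cmp i) : CmpP fun m a => Keep (H m a) (W m a) (d m a) (l m a) (i m a) := by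
  have hq := (hl.div hW).cmp.three_mul
  refine ((CmpP.eq hl.cmp hH).or ((CmpP.eq hW (Cmp.lit 0)).or ((CmpP.lt hi hq).or
    ((CmpP.le hW hd).and (CmpP.eq hi hq))))).congr fun m a _ => ?_
  rw [Keep]
  rcases Nat.eq_zero_or_pos (W m a) with h | h
  · simp [h]
  · rw [← Nat.le_div_iff_mul_le h, ← Nat.le_div_iff_mul_le h]
    omega

theorem CmpF.kept {H W d l : Mem → α → ℕ} {g : Mem → α → ℕ → ℕ} (hH : Cmp H) (hW : Cmp W)
    (hd : Cmp d) (hl : CmpB l) (hg : CmpF g) :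
    CmpF fun m a => Schedule.kept (H m a) (W m a) (d m a) (l m a) (g m a) := by
  classical
  refine ((CmpP.keep hH.weaken hW.weaken hd.weaken hl.weaken Cmp.last).ite hg (Cmp.lit 0)).congr
    fun m p _ => ?_
  change _ = Schedule.kept (H m p.1) (W m p.1) (d m p.1) (l m p.1) (g m p.1) p.2
  rw [Schedule.kept]

theorem Cmp.load {g : Mem → α → ℕ → ℕ} {j j' : Mem → α → ℕ} (hg : CmpF g) (hj : Cmp j)
    (hj' : Cmp j') : Cmp fun m a => Schedule.load m.windows (g m a) (j m a) (j' m a) := by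
  classical
  have hk := (CmpB.windows (α := α)).last.cmp
  exact Cmp.sum_range CmpB.windows ((((CmpP.le hj.weaken hk).and (CmpP.le hk hj'.weaken)).ite
    (hg.weaken.app hk.three_mul) (Cmp.lit 0)).add (((CmpP.le hj.weaken hk).and
      (CmpP.lt hk hj'.weaken)).ite (hg.weaken.app (hk.three_mul.add (Cmp.lit 2))) (Cmp.lit 0)))

theorem CmpP.start {H W τ j : Mem → α → ℕ} {g : Mem → α → ℕ → ℕ} (hH : Cmp H) (hW : Cmp W)
    (hg : CmpF g) (hτ : Cmp τ) (hj : Cmp j) :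
    CmpP fun m a => Start (H m a) (W m a) m.windows (g m a) (τ m a) (j m a) := by
  have hk := (CmpB.windows (α := α)).last.cmp
  have hl := hτ.weaken.add (Cmp.load hg.weaken hj.weaken hk)
  refine (CmpP.forall CmpB.windows ((CmpP.le hj.weaken hk).imp ((CmpP.imp (CmpP.not (CmpP.eq
    (hg.weaken.app (hk.three_mul.add (Cmp.lit 1))) (Cmp.lit 0))) (CmpP.le (hl.add (Cmp.lit 1))
      (hg.weaken.app (hk.three_mul.add (Cmp.lit 1))))).and (CmpP.imp (CmpP.not (CmpP.eq
    (hg.weaken.app hk.three_mul) (Cmp.lit 0))) (CmpP.le (hl.add (Cmp.lit 2))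
      (Cmp.mul (hk.add (Cmp.lit 2)) ?_ hW.weaken)))))).and (CmpP.le (hτ.add (Cmp.load hg hj
        CmpB.windows.cmp)) hH)
  exact fun m p hm => (Nat.add_le_add_right (min_le_right _ _) 2).trans
    (CmpB.windows_add_two.le m () hm)

theorem CmpP.node {H W d l : Mem → α → ℕ} {g : Mem → α → ℕ → ℕ} (hH : Cmp H) (hW : Cmp W)
    (hd : Cmp d) (hl : Cmp l) (hg : CmpF g) :
    CmpP fun m a => Node (H m a) (W m a) m.windows (d m a) (l m a) (g m a) := by
  have hk := (CmpB.windows (α := α)).last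
  have hkW := Cmp.mul hk.cmp hk.le hW.weaken
  exact ((CmpP.eq hl hH).or (CmpP.le (hl.add hd) hH)).and (CmpP.forall CmpB.windows
    ((CmpP.le hkW hH.weaken).imp (CmpP.start hH.weaken hW.weaken hg.weaken hkW hk.cmp)))

theorem CmpP.edge {H W dp lp l : Mem → α → ℕ} {g : Mem → α → ℕ → ℕ} (hH : Cmp H) (hW : Cmp W)
    (hdp : Cmp dp) (hlp : CmpB lp) (hl : Cmp l) (hg : CmpF g) :
    CmpP fun m a => Edge (H m a) (W m a) m.windows (dp m a) (lp m a) (l m a) (g m a) := by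
  have hq := (hlp.div hW).cmp
  have hne := (CmpP.eq hlp.cmp hH).not
  exact ((CmpP.eq hlp.cmp hH).imp (CmpP.eq hl hH).not).and (hne.imp ((CmpP.le hW hdp).imp
    ((CmpP.start hH hW hg (hlp.cmp.add hdp) (hq.add (Cmp.lit 1))).and
      (CmpP.eq (hg.app (hq.three_mul.add (Cmp.lit 1))) (Cmp.lit 0)))))

theorem CmpP.merge {g g' : Mem → α → ℕ → ℕ} (hg : CmpF g) (hg' : CmpF g') :
    CmpP fun m a => Merge m.windows (g m a) (g' m a) := by
  have hk := (CmpB.windows (α := α)).last.cmp.three_mul.add (Cmp.lit 1)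
  exact CmpP.forall CmpB.windows ((CmpP.eq (hg.weaken.app hk) (Cmp.lit 0)).or
    (CmpP.eq (hg'.weaken.app hk) (Cmp.lit 0)))

end Functions

end RAM


/-! ### The dynamic program for good labels. -/

namespace RAM

open Schedule

/-- The choice between two values according to a proposition. -/
noncomputable def pick (P : Prop) (x y : ℕ) : ℕ := @ite _ P (Classical.propDecidable P) x y

theorem pick_eq {P : Prop} [Decidable P] (x y : ℕ) : pick P x y = if P then x else y := by
  rw [pick]
  congr

theorem pick_pos {P : Prop} (h : P) (x y : ℕ) : pick P x y = x := if_pos h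

theorem pick_neg {P : Prop} (h : ¬ P) (x y : ℕ) : pick P x y = y := if_neg h

section Pick

variable {α : Type} [Ctx α]

theorem Cmp.pick {P : Mem → α → Prop} {f g : Mem → α → ℕ} (hP : CmpP P) (hf : Cmp f)
    (hg : Cmp g) : Cmp fun m a => RAM.pick (P m a) (f m a) (g m a) :=
  letI := fun m a => Classical.propDecidable (P m a)
  hP.ite hf hg

end Pick

namespace Mem

variable (m : Mem)

/-- The vertex `a` is an ancestor of `v`. -/
def Anc (a v : ℕ) : Prop := ∃ t < m.n, m.par^[t] v = a

/-- The number of ancestors. -/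
noncomputable def depth (v : ℕ) : ℕ := ∑ a ∈ Finset.range m.n, pick (m.Anc a v) 1 0

/-- The duration of a query. -/
noncomputable def dur (v : ℕ) : ℕ :=
  ∑ k ∈ Finset.range (m.c * m.n + 1), pick (m.w v * (m.c * m.n : ℕ) < (k : ℕ)) 0 1

/-- The width of the windows for the horizon `H`. -/
noncomputable def width (H : ℕ) : ℕ := least (m.maxHorizon + 1) fun W => H ≤ m.windows * W

/-- The digits of the vertices visible from `v`, if those below the children have code `b`. -/
noncomputable def full (H v l b k : ℕ) : ℕ :=
  m.digit b k + item H (m.width H) (m.dur v) l k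

/-- The candidate `x` consists of a label for the child `y` of `p`, a code for the vertices below
`y`, and a code for the vertices below the smaller children of `p`. -/
def IsCandidate (look : ℕ → ℕ → ℕ → ℕ → ℕ → ℕ → ℕ) (H r y p l a x : ℕ) : Prop :=
  r ≠ 0 ∧ look (r - 1) m.n y (x / m.codes / m.codes) (x / m.codes % m.codes) m.n ≠ 0 ∧
    look r y p l (x % m.codes) m.n ≠ 0 ∧
    Node H (m.width H) m.windows (m.dur y) (x / m.codes / m.codes)
      (m.full H y (x / m.codes / m.codes) (x / m.codes % m.codes)) ∧
    Edge H (m.width H) m.windows (m.dur p) l (x / m.codes / m.codes)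
      (m.full H y (x / m.codes / m.codes) (x / m.codes % m.codes)) ∧
    Merge m.windows (m.digit (x % m.codes)) (kept H (m.width H) (m.dur p) l
      (m.full H y (x / m.codes / m.codes) (x / m.codes % m.codes))) ∧
    ∀ k < 3 * m.windows, m.digit a k = m.digit (x % m.codes) k + kept H (m.width H) (m.dur p) l
      (m.full H y (x / m.codes / m.codes) (x / m.codes % m.codes)) k

/-- The entry for `u` if `x` is chosen for the child `y` of `p`. -/
noncomputable def branch (look : ℕ → ℕ → ℕ → ℕ → ℕ → ℕ → ℕ) (r y p l u x : ℕ) : ℕ :=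
  pick (x = m.candidates) 0 (pick (u = m.n) 1 (pick (u = y) (x / m.codes / m.codes + 1)
    (pick (m.Anc y u) (look (r - 1) m.n y (x / m.codes / m.codes) (x / m.codes % m.codes) u)
      (look r y p l (x % m.codes) u))))

/-- The recursion for the table. The entry with arguments `H`, `r`, `j`, `p`, `l`, `a` and `u`
concerns the subtrees at the children `y < j` of `p`, of height at most `r`, for the horizon `H`,
label `l` of `p` and code `a`. For `u = n` it tells whether there are good labels, otherwise it is
the label of `u` plus one. -/
noncomputable def step (look : ℕ → ℕ → ℕ → ℕ → ℕ → ℕ → ℕ) (H r j p l a u : ℕ) : ℕ :=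
  pick (j = 0) (pick (u = m.n ∧ ∀ k < 3 * m.windows, m.digit a k = 0) 1 0)
    (pick (m.par (j - 1) = p ∧ j - 1 ≠ m.root)
      (m.branch look r (j - 1) p l u (least m.candidates (m.IsCandidate look H r (j - 1) p l a)))
      (look r (j - 1) p l a u))

/-- The index of an entry. -/
def idx (H r j p l a u : ℕ) : ℕ :=
  (((((H * (m.n + 1) + r) * (m.n + 1) + j) * m.n + p) * (m.maxHorizon + 1) + l) * m.codes + a) *
    (m.n + 1) + u

/-- The entry with index `i`. -/
noncomputable def stepAt (look : ℕ → ℕ) (i : ℕ) : ℕ :=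
  m.step (fun r j p l a u => look (m.idx
      (i / (m.n + 1) / m.codes / (m.maxHorizon + 1) / m.n / (m.n + 1) / (m.n + 1)) r j p l a u))
    (i / (m.n + 1) / m.codes / (m.maxHorizon + 1) / m.n / (m.n + 1) / (m.n + 1))
    (i / (m.n + 1) / m.codes / (m.maxHorizon + 1) / m.n / (m.n + 1) % (m.n + 1))
    (i / (m.n + 1) / m.codes / (m.maxHorizon + 1) / m.n % (m.n + 1))
    (i / (m.n + 1) / m.codes / (m.maxHorizon + 1) % m.n)
    (i / (m.n + 1) / m.codes % (m.maxHorizon + 1))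
    (i / (m.n + 1) % m.codes)
    (i % (m.n + 1))

/-- The table. -/
noncomputable def table (i : ℕ) : ℕ := m.stepAt (fun k => if _h : k < i then table k else 0) i
termination_by i

/-- The entry of the table with given arguments. -/
noncomputable def entry (H r j p l a u : ℕ) : ℕ := m.table (m.idx H r j p l a u)

end Mem

section Functions

variable {α : Type} [Ctx α]

theorem cmpP_anc {a v : Mem → α → ℕ} (ha : Cmp a) (hv : Cmp v) :
    CmpP fun m x => m.Anc (a m x) (v m x) := by
  have h1 : Cmp fun m (p : α × ℕ) => m.par^[min p.2 m.n] (v m p.1) := by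
    refine (Cmp.natRec (init := fun m p => v m p.1) (step := fun m _ _ acc => m.par acc)
      (CmpB.n.last (α := α)).cmp (CmpB.n.last (α := α)).le hv.weaken
        (Cmp.last.par)).congr fun m p _ => ?_
    induction min p.2 m.n with
    | zero => rfl
    | succ t ih => rw [Function.iterate_succ_apply', ← ih]
  exact CmpP.exists CmpB.n (CmpP.eq h1 ha.weaken)

theorem cmp_depth {v : Mem → α → ℕ} (hv : Cmp v) : CmpB fun m a => m.depth (v m a) := by
  refine CmpB.n.of_le (Cmp.sum_range CmpB.n (Cmp.pick (cmpP_anc CmpB.n.last.cmp hv.weaken)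
    (Cmp.lit 1) (Cmp.lit 0))) fun m a _ => ?_
  classical
  refine (Finset.sum_le_card_nsmul _ _ 1 fun i _ => ?_).trans (by simp)
  rw [pick_eq]
  split_ifs <;> simp

theorem cmpB_mul_cn_add_one : CmpB fun m (_ : α) => m.c * m.n + 1 :=
  CmpB.base.of_le (CmpB.mul_cn.cmp.add (Cmp.lit 1)) fun m _ h => by
    have := h.two_le_n
    have h1 : 1 * (m.c * m.n + 1) ≤ m.n * (m.c * m.n + 1) := Nat.mul_le_mul_right _ (by omega)
    rw [Mem.base, Mem.maxHorizon]
    omega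

/-- Reals cannot be rounded, so `⌊w c n⌋ + 1` is obtained by counting the `k ≤ c n` that do not
exceed `w c n`; the weights are at most 1, so this range is sufficient. -/
theorem cmp_dur {v : Mem → α → ℕ} (hv : Cmp v) : CmpB fun m a => m.dur (v m a) := by
  refine cmpB_mul_cn_add_one.of_le (Cmp.sum_range cmpB_mul_cn_add_one (Cmp.pick
    (CmpP.weight_lt hv.weaken CmpB.mul_cn.cmp cmpB_mul_cn_add_one.last.cmp)
    (Cmp.lit 0) (Cmp.lit 1))) fun m a _ => ?_
  classical
  refine (Finset.sum_le_card_nsmul _ _ 1 fun i _ => ?_).trans (by simp)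
  rw [pick_eq]
  split_ifs <;> simp

theorem cmp_width {H : Mem → α → ℕ} (hH : Cmp H) : CmpB fun m a => m.width (H m a) :=
  CmpB.least CmpB.maxHorizon_add_one (CmpP.le hH.weaken (Cmp.mul CmpB.windows.cmp CmpB.windows.le
    CmpB.maxHorizon_add_one.last.cmp))

theorem cmp_full {H v l b : Mem → α → ℕ} (hH : Cmp H) (hv : Cmp v) (hl : CmpB l) (hb : CmpB b) :
    CmpF fun m a => m.full (H m a) (v m a) (l m a) (b m a) :=
  (CmpB.digit hb.weaken Cmp.last).cmp.add (CmpF.item hH (cmp_width hH).cmp (cmp_dur hv).cmp hl)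

theorem cmp_idx {H r j p l a u : Mem → α → ℕ} (hH : Cmp H) (hr : Cmp r) (hj : Cmp j) (hp : Cmp p)
    (hl : Cmp l) (ha : Cmp a) (hu : Cmp u) :
    Cmp fun m x => m.idx (H m x) (r m x) (j m x) (p m x) (l m x) (a m x) (u m x) := by
  have key : ∀ {f g h : Mem → α → ℕ}, CmpB g → Cmp f → Cmp h →
      Cmp fun m x => f m x * g m x + h m x := fun hg hf hh =>
    ((Cmp.mul hg.cmp hg.le hf).congr fun _ _ _ => mul_comm _ _).add hh
  exact key CmpB.n_add_one (key CmpB.codes (key CmpB.maxHorizon_add_one (key CmpB.n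
    (key CmpB.n_add_one (key CmpB.n_add_one hH hr) hj) hp) hl) ha) hu

theorem cmpP_isCandidate {look : Mem → α → ℕ → ℕ → ℕ → ℕ → ℕ → ℕ → ℕ}
    (hlook : ∀ {r j p l a u : Mem → α → ℕ}, Cmp r → Cmp j → Cmp p → Cmp l → Cmp a → Cmp u →
      Cmp fun m x => look m x (r m x) (j m x) (p m x) (l m x) (a m x) (u m x))
    {H r y p l a c : Mem → α → ℕ} (hH : Cmp H) (hr : Cmp r) (hy : Cmp y) (hp : Cmp p)
    (hl : CmpB l) (ha : CmpB a) (hc : CmpB c) :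
    CmpP fun m x => m.IsCandidate (look m x) (H m x) (r m x) (y m x) (p m x) (l m x) (a m x)
      (c m x) := by
  have hN := CmpB.codes (α := α)
  have h1 := (hc.div hN.cmp).div hN.cmp
  have h2 := (hc.div hN.cmp).mod hN.cmp
  have h3 := hc.mod hN.cmp
  have h0 : Cmp fun _ (_ : α) => 0 := Cmp.lit 0
  have hW := (cmp_width hH).cmp
  have hf := cmp_full hH hy h1 h2
  have hk := CmpF.kept hH hW (cmp_dur hp).cmp hl hf
  have hd : CmpF fun m x => m.digit (c m x % m.codes) := (CmpB.digit h3.weaken Cmp.last).cmp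
  exact (CmpP.eq hr h0).not.and ((CmpP.eq (hlook (hr.sub (Cmp.lit 1)) Cmp.n hy h1.cmp h2.cmp Cmp.n)
    h0).not.and ((CmpP.eq (hlook hr hy hp hl.cmp h3.cmp Cmp.n) h0).not.and
    ((CmpP.node hH hW (cmp_dur hy).cmp h1.cmp hf).and ((CmpP.edge hH hW (cmp_dur hp).cmp hl h1.cmp
      hf).and ((CmpP.merge hd hk).and (CmpP.forall CmpB.three_windows (CmpP.eq
        (CmpB.digit ha.weaken CmpB.three_windows.last.cmp).cmp
        ((hd.weaken.app CmpB.three_windows.last.cmp).add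
          (hk.weaken.app CmpB.three_windows.last.cmp)))))))))

theorem cmp_branch {look : Mem → α → ℕ → ℕ → ℕ → ℕ → ℕ → ℕ → ℕ}
    (hlook : ∀ {r j p l a u : Mem → α → ℕ}, Cmp r → Cmp j → Cmp p → Cmp l → Cmp a → Cmp u →
      Cmp fun m x => look m x (r m x) (j m x) (p m x) (l m x) (a m x) (u m x))
    {r y p l u c : Mem → α → ℕ} (hr : Cmp r) (hy : Cmp y) (hp : Cmp p)
    (hl : CmpB l) (hu : Cmp u) (hc : CmpB c) :
    Cmp fun m x => m.branch (look m x) (r m x) (y m x) (p m x) (l m x) (u m x) (c m x) := by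
  have hN := CmpB.codes (α := α)
  have h1 := (hc.div hN.cmp).div hN.cmp
  have h2 := (hc.div hN.cmp).mod hN.cmp
  have h3 := hc.mod hN.cmp
  exact Cmp.pick (CmpP.eq hc.cmp CmpB.candidates.cmp) (Cmp.lit 0) (Cmp.pick (CmpP.eq hu Cmp.n)
    (Cmp.lit 1) (Cmp.pick (CmpP.eq hu hy) (h1.cmp.add (Cmp.lit 1)) (Cmp.pick (cmpP_anc hy hu)
      (hlook (hr.sub (Cmp.lit 1)) Cmp.n hy h1.cmp h2.cmp hu) (hlook hr hy hp hl.cmp h3.cmp hu))))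

/-- Entries not yet filled are read as 0, exactly as in the recursive definition of `table`. -/
theorem cmp_read {i k : Mem → α → ℕ} (hi : Cmp i) (hk : Cmp k) :
    Cmp fun m a => pick (k m a < i m a) (m.arr 0 (k m a)) 0 :=
  Cmp.pick (CmpP.lt hk hi) (Cmp.arr hk 0 (by norm_num)) (Cmp.lit 0)

/-- The table is also read inside the search for a candidate, where the context is extended by the
loop index; therefore two versions of the reading hypothesis occur. -/
theorem cmp_step {look : Mem → α → ℕ → ℕ → ℕ → ℕ → ℕ → ℕ → ℕ}
    (hlook : ∀ {r j p l a u : Mem → α → ℕ}, Cmp r → Cmp j → Cmp p → Cmp l → Cmp a → Cmp u →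
      Cmp fun m x => look m x (r m x) (j m x) (p m x) (l m x) (a m x) (u m x))
    (hlook' : ∀ {r j p l a u : Mem → α × ℕ → ℕ}, Cmp r → Cmp j → Cmp p → Cmp l → Cmp a → Cmp u →
      Cmp fun m x => look m x.1 (r m x) (j m x) (p m x) (l m x) (a m x) (u m x))
    {H r j p l a u : Mem → α → ℕ} (hH : Cmp H) (hr : Cmp r) (hj : Cmp j) (hp : Cmp p)
    (hl : CmpB l) (ha : CmpB a) (hu : Cmp u) :
    Cmp fun m x => m.step (look m x) (H m x) (r m x) (j m x) (p m x) (l m x) (a m x) (u m x) := by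
  have hy := hj.sub (Cmp.lit 1)
  have hc := CmpB.least (P := fun m x => m.IsCandidate (look m x) (H m x) (r m x) (j m x - 1)
    (p m x) (l m x) (a m x)) (CmpB.candidates (α := α)) (cmpP_isCandidate hlook' hH.weaken hr.weaken
      hy.weaken hp.weaken hl.weaken ha.weaken CmpB.candidates.last)
  exact Cmp.pick (CmpP.eq hj (Cmp.lit 0)) (Cmp.pick ((CmpP.eq hu Cmp.n).and (CmpP.forall
    CmpB.three_windows (CmpP.eq (CmpB.digit ha.weaken CmpB.three_windows.last.cmp).cmp
      (Cmp.lit 0)))) (Cmp.lit 1) (Cmp.lit 0)) (Cmp.pick ((CmpP.eq hy.par hp).and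
        (CmpP.eq hy Cmp.root).not) (cmp_branch hlook hr hy hp hl hu hc)
      (hlook hr hy hp hl.cmp ha.cmp hu))

theorem cmp_stepAt {i : Mem → α → ℕ} (hi : CmpB i) :
    Cmp fun m a => m.stepAt (fun k => pick (k < i m a) (m.arr 0 k) 0) (i m a) := by
  have h1 := hi.div (CmpB.n_add_one (α := α)).cmp
  have h2 := h1.div (CmpB.codes (α := α)).cmp
  have h3 := h2.div (CmpB.maxHorizon_add_one (α := α)).cmp
  have h4 := h3.div (CmpB.n (α := α)).cmp
  have h5 := h4.div (CmpB.n_add_one (α := α)).cmp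
  have hH := (h5.div (CmpB.n_add_one (α := α)).cmp).cmp
  exact cmp_step (look := fun m a r j p l a' u => pick (m.idx (i m a / (m.n + 1) / m.codes /
      (m.maxHorizon + 1) / m.n / (m.n + 1) / (m.n + 1)) r j p l a' u < i m a)
        (m.arr 0 (m.idx (i m a / (m.n + 1) / m.codes / (m.maxHorizon + 1) / m.n / (m.n + 1) /
          (m.n + 1)) r j p l a' u)) 0)
    (fun hr hj hp hl ha hu => cmp_read hi.cmp (cmp_idx hH hr hj hp hl ha hu))
    (fun hr hj hp hl ha hu => cmp_read hi.weaken.cmp (cmp_idx hH.weaken hr hj hp hl ha hu))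
    hH (h5.mod CmpB.n_add_one.cmp).cmp (h4.mod CmpB.n_add_one.cmp).cmp (h3.mod CmpB.n.cmp).cmp
    (h2.mod CmpB.maxHorizon_add_one.cmp) (h1.mod CmpB.codes.cmp) (hi.mod CmpB.n_add_one.cmp).cmp

/-- There is a program that fills the array `0` with the table. -/
theorem exists_fill_table : ∃ p K, ∀ m ρ s, m.WF → Rep m ρ s → Ends p s (m.lim ^ K) fun s' =>
    ∃ ρ' a, Rep (m.setArr 0 a) ρ' s' ∧ ∀ k < m.tableSize, a k = m.table k := by
  refine exists_fill (j := 0) (by norm_num) CmpB.tableSize.cmp (fun m h => CmpB.tableSize.le m () h)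
    (cmp_stepAt (CmpB.tableSize (α := Unit)).last) fun m hm i hi a ha => ?_
  have e : (fun k => pick (k < i) (a k) 0) = fun k => if _h : k < i then m.table k else 0 := by
    funext k
    rw [pick_eq, dite_eq_ite]
    split_ifs with h
    exacts [ha k h, rfl]
  rw [Mem.table, ← e]
  have hi' : min i (m.setArr 0 a).tableSize = i := min_eq_left hi.le
  dsimp only
  rw [hi']
  rfl

end Functions

end RAM


/-! ### Codes of digits and the order of the table entries. -/

open Schedule

namespace Schedule

variable {H W D : ℕ} {g g' h h' : ℕ → ℕ}

theorem load_congr (hg : ∀ k < 3 * D, g k = g' k) (j j' : ℕ) : load D g j j' = load D g' j j' :=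
  Finset.sum_congr rfl fun k hk => by
    rw [Finset.mem_range] at hk
    rw [hg _ (by omega), hg _ (by omega)]

theorem Start.congr {τ j : ℕ} (hg : ∀ k < 3 * D, g k = g' k) (hs : Start H W D g τ j) :
    Start H W D g' τ j := by
  refine ⟨fun j' h1 h2 => ?_, ?_⟩
  · rw [← load_congr hg, ← hg _ (by omega), ← hg _ (by omega)]
    exact hs.1 j' h1 h2
  · rw [← load_congr hg]
    exact hs.2

theorem Node.congr {d l : ℕ} (hg : ∀ k < 3 * D, g k = g' k) (hn : Node H W D d l g) :
    Node H W D d l g' :=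
  ⟨hn.1, fun i h1 h2 => (hn.2 i h1 h2).congr hg⟩

theorem Edge.congr {dp lp l : ℕ} (hg : ∀ k < 3 * D, g k = g' k) (hl : lp ≤ H) (hH : H ≤ D * W)
    (he : Edge H W D dp lp l g) : Edge H W D dp lp l g' := by
  refine ⟨he.1, fun h1 h2 => ⟨((he.2 h1 h2).1).congr hg, ?_⟩⟩
  have hW : 0 < W := by
    rcases Nat.eq_zero_or_pos W with h | h
    · rw [h, mul_zero] at hH
      omega
    · exact h
  have : lp / W < D := (Nat.div_lt_iff_lt_mul hW).2 (by omega)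
  rw [← hg _ (by omega)]
  exact (he.2 h1 h2).2

theorem Merge.congr (hg : ∀ k < 3 * D, g k = g' k) (hh : ∀ k < 3 * D, h k = h' k)
    (hm : Merge D g h) : Merge D g' h' := fun k hk => by
  rw [← hg _ (by omega), ← hh _ (by omega)]
  exact hm k hk

end Schedule

namespace Labeling

variable {n : ℕ} {P : Labeling n}

theorem acc_zero (p : Fin n) (i : ℕ) : P.acc p 0 i = 0 := by
  simp [acc]

theorem acc_succ {p y : Fin n} (h : P.T.IsChild p y) (i : ℕ) :
    P.acc p (y + 1) i = P.acc p y i + kept P.H P.W (P.d p) (P.lab p) (P.dg y) i := by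
  classical
  have : (Finset.univ.filter fun z : Fin n => P.T.IsChild p z ∧ z.1 < y + 1) =
      insert y (Finset.univ.filter fun z : Fin n => P.T.IsChild p z ∧ z.1 < y) := by
    ext z
    simp only [Finset.mem_filter, Finset.mem_univ, true_and, Finset.mem_insert, Fin.ext_iff]
    constructor
    · rintro ⟨h1, h2⟩
      by_cases hzy : z.1 = y
      · exact Or.inl hzy
      · exact Or.inr ⟨h1, by omega⟩
    · rintro (h1 | ⟨h1, h2⟩)
      · rw [Fin.ext h1]
        exact ⟨h, by omega⟩
      · exact ⟨h1, by omega⟩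
  rw [acc, this, Finset.sum_insert (by simp), add_comm, acc]

theorem acc_succ_of_not {p y : Fin n} (h : ¬ P.T.IsChild p y) (i : ℕ) :
    P.acc p (y + 1) i = P.acc p y i := by
  classical
  rw [acc, acc]
  congr 1
  ext z
  simp only [Finset.mem_filter, Finset.mem_univ, true_and]
  refine and_congr_right fun h1 => ⟨fun h2 => ?_, fun h2 => by omega⟩
  have : z.1 ≠ y := fun e => h (Fin.ext e ▸ h1)
  omega

theorem acc_le (p : Fin n) (j i : ℕ) : P.acc p j i ≤ P.dg p i := by
  classical
  rw [dg_eq]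
  refine le_trans (Finset.sum_le_sum_of_subset fun z hz => ?_) (Nat.le_add_right _ _)
  simp only [Finset.mem_filter, Finset.mem_univ, true_and] at hz ⊢
  exact ⟨hz.1, z.2⟩

/-- Durations are bounded by the load before the horizon, and a head digit is a single label plus
one. So the base `maxHorizon + 2` is large enough for all digits. -/
theorem IsGood.dg_le (hP : P.IsGood) (v : Fin n) {k : ℕ} (hk : k < 3 * P.D) :
    P.dg v k ≤ P.H + 1 := by
  have h1 := ((hP.node v).2 0 (by omega) (by simp)).2
  rw [zero_mul, zero_add] at h1
  have h2 : (if 0 ≤ k / 3 ∧ k / 3 ≤ P.D then P.dg v (3 * (k / 3)) else 0) +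
      (if 0 ≤ k / 3 ∧ k / 3 < P.D then P.dg v (3 * (k / 3) + 2) else 0) ≤ P.H :=
    le_trans (Finset.single_le_sum (f := fun k => (if 0 ≤ k ∧ k ≤ P.D then P.dg v (3 * k) else 0) +
      (if 0 ≤ k ∧ k < P.D then P.dg v (3 * k + 2) else 0)) (fun _ _ => Nat.zero_le _)
        (Finset.mem_range.2 (by omega : k / 3 < P.D))) h1
  rw [if_pos ⟨Nat.zero_le _, by omega⟩, if_pos ⟨Nat.zero_le _, by omega⟩] at h2
  have h3 := Nat.div_add_mod k 3
  have h4 : k % 3 < 3 := Nat.mod_lt _ (by norm_num)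
  rcases Nat.lt_or_ge (k % 3) 1 with h5 | h5
  · rw [show k = 3 * (k / 3) by omega]
    omega
  rcases Nat.lt_or_ge 1 (k % 3) with h6 | h6
  · rw [show k = 3 * (k / 3) + 2 by omega]
    omega
  have e : k = 3 * (k / 3) + 1 := by omega
  by_cases h0 : P.dg v k = 0
  · omega
  obtain ⟨u, hu, -, hi⟩ := exists_of_dg_ne_zero h0
  by_cases hl : P.lab u = P.H
  · rw [item_eq_zero_of_late hl] at hi
    exact absurd rfl hi
  rw [e, item_head hl] at hi
  obtain ⟨h7, h8⟩ : P.win u = k / 3 ∧ P.W ≤ P.d u := by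
    by_contra h
    exact hi (if_neg h)
  rw [e, ← h7, hP.head_eq hu hl h8]
  exact Nat.add_le_add_right (P.lab_le u) 1

end Labeling

namespace RAM

theorem mul_add_div_mod {b c : ℕ} (x : ℕ) (h : c < b) : (x * b + c) / b = x ∧ (x * b + c) % b = c := by
  rw [mul_comm]
  exact ⟨by rw [Nat.mul_add_div (by omega), Nat.div_eq_of_lt h, add_zero],
    by rw [Nat.mul_add_mod, Nat.mod_eq_of_lt h]⟩

theorem mul_add_lt_mul_add {b c x y : ℕ} (c' : ℕ) (h : x < y) (hc : c < b) :
    x * b + c < y * b + c' := by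
  have : (x + 1) * b ≤ y * b := Nat.mul_le_mul_right _ h
  rw [Nat.succ_mul] at this
  omega

theorem mul_add_lt_mul {b c x y : ℕ} (h : x < y) (hc : c < b) : x * b + c < y * b :=
  mul_add_lt_mul_add 0 h hc

theorem exists_code {B : ℕ} {f : ℕ → ℕ} (K : ℕ) (h : ∀ k < K, f k < B) :
    ∃ s < B ^ K, ∀ k < K, s / B ^ k % B = f k := by
  induction K with
  | zero => exact ⟨0, by simp, fun k hk => absurd hk (Nat.not_lt_zero k)⟩
  | succ K ih =>
    obtain ⟨s, h1, h2⟩ := ih fun k hk => h k (by omega)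
    have hB : 0 < B := (Nat.zero_le _).trans_lt (h K (by omega))
    refine ⟨f K * B ^ K + s, ?_, fun k hk => ?_⟩
    · have : (f K + 1) * B ^ K ≤ B * B ^ K := Nat.mul_le_mul_right _ (h K (by omega))
      rw [Nat.succ_mul] at this
      rw [pow_succ, mul_comm _ B]
      omega
    · rcases Nat.lt_succ_iff_lt_or_eq.1 hk with hk | rfl
      · rw [← h2 k hk]
        obtain ⟨i, rfl⟩ := Nat.exists_eq_add_of_lt hk
        have e : f (k + i + 1) * B ^ (k + i + 1) + s = B ^ k * (B * (f (k + i + 1) * B ^ i)) + s := by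
          ring
        rw [e, Nat.mul_add_div (by positivity), Nat.mul_add_mod]
      · rw [(mul_add_div_mod _ h1).1, Nat.mod_eq_of_lt (h k (by omega))]

namespace Mem

variable {m : Mem}

theorem one_le_codes : 1 ≤ m.codes := Nat.one_le_pow _ _ (by rw [base]; omega)

theorem exists_digits {f : ℕ → ℕ} (h : ∀ k < 3 * m.windows, f k < m.base) :
    ∃ s < m.codes, ∀ k < 3 * m.windows, m.digit s k = f k := by
  obtain ⟨s, h1, h2⟩ := exists_code (3 * m.windows) h
  exact ⟨s, h1, fun k hk => by rw [digit, min_eq_left hk.le, h2 k hk]⟩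

theorem idx_lt_tableSize {H r j p l a u : ℕ} (hH : H ≤ m.maxHorizon) (hr : r ≤ m.n) (hj : j ≤ m.n)
    (hp : p < m.n) (hl : l ≤ m.maxHorizon) (ha : a < m.codes) (hu : u ≤ m.n) :
    m.idx H r j p l a u < m.tableSize := by
  refine mul_add_lt_mul ?_ (by omega)
  refine mul_add_lt_mul ?_ ha
  refine mul_add_lt_mul ?_ (by omega)
  refine mul_add_lt_mul ?_ hp
  refine mul_add_lt_mul ?_ (by omega)
  exact mul_add_lt_mul (by omega) (by omega)

/-- `idx` is a mixed-radix number in which, after `H`, the height is most significant, followed by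
the bound on the children. Hence a smaller height wins regardless of the other arguments, and every
recursive reading goes to a smaller index. -/
theorem idx_lt_idx_of_height {H r j p l a u : ℕ} {r' j' p' l' a' u' : ℕ} (hr : r < r')
    (hj : j ≤ m.n) (hp : p < m.n) (hl : l ≤ m.maxHorizon) (ha : a < m.codes) (hu : u ≤ m.n) :
    m.idx H r j p l a u < m.idx H r' j' p' l' a' u' := by
  refine mul_add_lt_mul_add _ ?_ (by omega)
  refine mul_add_lt_mul_add _ ?_ ha
  refine mul_add_lt_mul_add _ ?_ (by omega)
  refine mul_add_lt_mul_add _ ?_ hp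
  exact mul_add_lt_mul_add _ (by omega) (by omega)

theorem idx_lt_idx {H r j p l a u : ℕ} {j' p' l' a' u' : ℕ} (hj : j < j')
    (hp : p < m.n) (hl : l ≤ m.maxHorizon) (ha : a < m.codes) (hu : u ≤ m.n) :
    m.idx H r j p l a u < m.idx H r j' p' l' a' u' := by
  refine mul_add_lt_mul_add _ ?_ (by omega)
  refine mul_add_lt_mul_add _ ?_ ha
  refine mul_add_lt_mul_add _ ?_ (by omega)
  exact mul_add_lt_mul_add _ (by omega) hp

theorem stepAt_idx (look : ℕ → ℕ) {H r j p l a u : ℕ} (hr : r ≤ m.n) (hj : j ≤ m.n)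
    (hp : p < m.n) (hl : l ≤ m.maxHorizon) (ha : a < m.codes) (hu : u ≤ m.n) :
    m.stepAt look (m.idx H r j p l a u) =
      m.step (fun r' j' p' l' a' u' => look (m.idx H r' j' p' l' a' u')) H r j p l a u := by
  have e1 := mul_add_div_mod (((((H * (m.n + 1) + r) * (m.n + 1) + j) * m.n + p) *
    (m.maxHorizon + 1) + l) * m.codes + a) (by omega : u < m.n + 1)
  have e2 := mul_add_div_mod ((((H * (m.n + 1) + r) * (m.n + 1) + j) * m.n + p) *
    (m.maxHorizon + 1) + l) ha
  have e3 := mul_add_div_mod (((H * (m.n + 1) + r) * (m.n + 1) + j) * m.n + p)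
    (by omega : l < m.maxHorizon + 1)
  have e4 := mul_add_div_mod ((H * (m.n + 1) + r) * (m.n + 1) + j) hp
  have e5 := mul_add_div_mod (H * (m.n + 1) + r) (by omega : j < m.n + 1)
  have e6 := mul_add_div_mod H (by omega : r < m.n + 1)
  rw [stepAt, show m.idx H r j p l a u = (((((H * (m.n + 1) + r) * (m.n + 1) + j) * m.n + p) *
    (m.maxHorizon + 1) + l) * m.codes + a) * (m.n + 1) + u from rfl]
  rw [e1.1, e1.2, e2.1, e2.2, e3.1, e3.2, e4.1, e4.2, e5.1, e5.2, e6.1, e6.2]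

theorem lt_candidates {x : ℕ} (h : x < m.candidates) : x / m.codes / m.codes ≤ m.maxHorizon := by
  have h1 : 0 < m.codes := one_le_codes
  have := (Nat.div_lt_iff_lt_mul h1).2 ((Nat.div_lt_iff_lt_mul h1).2 h)
  omega

theorem isCandidate_congr {look look' : ℕ → ℕ → ℕ → ℕ → ℕ → ℕ → ℕ} {H r y p l a x : ℕ}
    (h1 : r ≠ 0 → ∀ l' ≤ m.maxHorizon, ∀ b < m.codes, ∀ u ≤ m.n,
      look (r - 1) m.n y l' b u = look' (r - 1) m.n y l' b u)
    (h2 : ∀ b < m.codes, ∀ u ≤ m.n, look r y p l b u = look' r y p l b u)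
    (hx : x < m.candidates) :
    m.IsCandidate look H r y p l a x ↔ m.IsCandidate look' H r y p l a x := by
  have h3 : ∀ k, k % m.codes < m.codes := fun k => Nat.mod_lt _ one_le_codes
  refine and_congr_right fun hr => ?_
  rw [h1 hr _ (lt_candidates hx) _ (h3 _) _ le_rfl, h2 _ (h3 _) _ le_rfl]

/-- One step reads only height `r - 1` and, at height `r`, the bound `j - 1`, with labels and codes
in range. These entries have smaller indices, so the guard in `table` is never active and `entry_eq`
follows. -/
theorem step_congr {look look' : ℕ → ℕ → ℕ → ℕ → ℕ → ℕ → ℕ} {H r j p l a u : ℕ}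
    (h1 : j ≠ 0 → r ≠ 0 → ∀ l' ≤ m.maxHorizon, ∀ b < m.codes, ∀ u ≤ m.n,
      look (r - 1) m.n (j - 1) l' b u = look' (r - 1) m.n (j - 1) l' b u)
    (h2 : j ≠ 0 → ∀ b < m.codes, ∀ u ≤ m.n, look r (j - 1) p l b u = look' r (j - 1) p l b u)
    (ha : a < m.codes) (hu : u ≤ m.n) :
    m.step look H r j p l a u = m.step look' H r j p l a u := by
  have h3 : ∀ k, k % m.codes < m.codes := fun k => Nat.mod_lt _ one_le_codes
  rw [step, step]
  by_cases hj : j = 0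
  · rw [pick_pos hj, pick_pos hj]
  rw [pick_neg hj, pick_neg hj, h2 hj a ha u hu, least_congr fun x hx =>
    isCandidate_congr (h1 hj) (h2 hj) hx]
  congr 1
  set x := least m.candidates (m.IsCandidate look' H r (j - 1) p l a) with hx
  rw [branch, branch]
  by_cases h4 : x = m.candidates
  · rw [pick_pos h4, pick_pos h4]
  · have h5 : ∃ i < m.candidates, m.IsCandidate look' H r (j - 1) p l a i := by
      by_contra! h
      exact h4 (least_eq_bound h)
    obtain ⟨h6, h7, -⟩ := least_spec h5
    rw [h1 hj h7.1 _ (lt_candidates h6) _ (h3 _) _ hu, h2 hj _ (h3 _) _ hu]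

theorem entry_eq {H r j p l a u : ℕ} (hr : r ≤ m.n) (hj : j ≤ m.n)
    (hp : p < m.n) (hl : l ≤ m.maxHorizon) (ha : a < m.codes) (hu : u ≤ m.n) :
    m.entry H r j p l a u = m.step (m.entry H) H r j p l a u := by
  rw [entry, table, stepAt_idx _ hr hj hp hl ha hu]
  refine step_congr (fun h1 h2 l' hl' b hb u' hu' => ?_) (fun h1 b hb u' hu' => ?_) ha hu
  · exact dif_pos (idx_lt_idx_of_height (by omega) le_rfl (by omega) hl' hb hu')
  · exact dif_pos (idx_lt_idx (by omega) hp hl hb hu')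

end Mem

end RAM


/-! ### Correctness of the table. -/

open Schedule

namespace RAM

/-- The memory `m` contains the tree `T`. -/
structure Mem.Stores (m : Mem) {n : ℕ} (T : WTree n) : Prop where
  wf : m.WF
  n_eq : m.n = n
  root_eq : m.root = T.root
  par_eq : ∀ v : Fin n, m.par v = T.parent v
  w_eq : ∀ v : Fin n, m.w v = T.weight v

namespace Mem.Stores

variable {m : Mem} {n : ℕ} {T : WTree n}

theorem iterate_par (h : m.Stores T) (t : ℕ) (v : Fin n) : m.par^[t] v = T.parent^[t] v := by
  induction t generalizing v with
  | zero => rfl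
  | succ t ih => rw [Function.iterate_succ_apply, h.par_eq, ih, Function.iterate_succ_apply]

theorem anc_iff (h : m.Stores T) {a v : Fin n} : m.Anc a v ↔ T.InSubtree a v := by
  constructor
  · rintro ⟨t, -, ht⟩
    rw [h.iterate_par] at ht
    rw [← Fin.ext ht]
    clear ht
    induction t with
    | zero => exact .refl _
    | succ t ih =>
      rw [Function.iterate_succ_apply']
      exact (T.parent_inSubtree _).trans ih
  · intro hav
    have : ∃ t < T.depth v, T.parent^[t] v = a := by
      obtain ⟨k, hk⟩ : ∃ k, T.depth v ≤ k := ⟨_, le_rfl⟩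
      induction k generalizing v with
      | zero => have := T.depth_pos v; omega
      | succ k ih =>
        by_cases hv : a = v
        · exact ⟨0, T.depth_pos v, hv.symm⟩
        · have hr : v ≠ T.root := fun e => hv (by
            rw [e] at hav ⊢
            exact WTree.inSubtree_root_iff.1 hav)
          have hc : T.IsChild (T.parent v) v := ⟨hr, rfl⟩
          have hd := hc.depth_eq
          obtain ⟨t, h1, h2⟩ := ih (((WTree.inSubtree_iff_parent hr).1 hav).resolve_left hv)
            (by omega)
          exact ⟨t + 1, by omega, by rw [Function.iterate_succ_apply, h2]⟩
    obtain ⟨t, h1, h2⟩ := this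
    refine ⟨t, ?_, by rw [h.iterate_par, h2]⟩
    rw [h.n_eq]
    exact h1.trans_le (T.depth_le v)

theorem sum_range (h : m.Stores T) (f : ℕ → ℕ) : ∑ k ∈ Finset.range m.n, f k = ∑ v : Fin n, f v := by
  rw [h.n_eq, Finset.sum_range]

theorem depth_eq (h : m.Stores T) (v : Fin n) : m.depth v = T.depth v := by
  classical
  rw [Mem.depth, h.sum_range, WTree.depth, Finset.card_filter]
  refine Finset.sum_congr rfl fun a _ => ?_
  simp only [pick_eq, h.anc_iff]

theorem dur_eq (h : m.Stores T) (hN : T.Normalized) (v : Fin n) :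
    m.dur v = ⌊T.weight v * (m.c * n : ℕ)⌋₊ + 1 := by
  classical
  have h0 : 0 ≤ T.weight v * (m.c * n : ℕ) := mul_nonneg (T.weight_nonneg v) (Nat.cast_nonneg _)
  have h1 : ⌊T.weight v * (m.c * n : ℕ)⌋₊ ≤ m.c * n := Nat.floor_le_of_le
    (mul_le_of_le_one_left (Nat.cast_nonneg _) (hN.1 v))
  have h2 : ∀ k, pick (m.w v * (m.c * m.n : ℕ) < (k : ℕ)) 0 1 =
      if k < ⌊T.weight v * (m.c * n : ℕ)⌋₊ + 1 then 1 else 0 := fun k => by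
    have e : m.w v * (m.c * m.n : ℕ) < (k : ℕ) ↔ ⌊T.weight v * (m.c * n : ℕ)⌋₊ < k := by
      rw [h.w_eq, h.n_eq, Nat.floor_lt h0]
    by_cases hk : ⌊T.weight v * (m.c * n : ℕ)⌋₊ < k
    · rw [pick_pos (e.2 hk), if_neg (by omega)]
    · rw [pick_neg (mt e.1 hk), if_pos (by omega)]
  rw [Mem.dur, Finset.sum_congr rfl fun k _ => h2 k, h.n_eq, ← Finset.card_filter]
  have h3 : ((Finset.range (m.c * n + 1)).filter fun k => k < ⌊T.weight v * (m.c * n : ℕ)⌋₊ + 1) =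
      Finset.range (⌊T.weight v * (m.c * n : ℕ)⌋₊ + 1) := by
    ext k
    simp only [Finset.mem_filter, Finset.mem_range]
    omega
  rw [h3, Finset.card_range]

theorem le_dur (h : m.Stores T) (hN : T.Normalized) (v : Fin n) :
    T.weight v * (m.c * n) ≤ m.dur v := by
  rw [h.dur_eq hN]
  push_cast
  exact (Nat.lt_floor_add_one _).le

theorem dur_le (h : m.Stores T) (hN : T.Normalized) (v : Fin n) :
    (m.dur v : ℝ) ≤ T.weight v * (m.c * n) + 1 := by
  rw [h.dur_eq hN]
  push_cast
  gcongr
  exact Nat.floor_le (mul_nonneg (T.weight_nonneg v) (by positivity))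

theorem dur_pos (h : m.Stores T) (hN : T.Normalized) (v : Fin n) : 1 ≤ m.dur v := by
  rw [h.dur_eq hN]
  omega

theorem sum_dur_le (h : m.Stores T) (hN : T.Normalized) : ∑ v : Fin n, m.dur v ≤ m.maxHorizon := by
  refine (Finset.sum_le_card_nsmul _ _ (m.c * n + 1) fun v _ => ?_).trans ?_
  · rw [h.dur_eq hN]
    exact Nat.add_le_add_right (Nat.floor_le_of_le
      (mul_le_of_le_one_left (Nat.cast_nonneg _) (hN.1 v))) 1
  · rw [Mem.maxHorizon, h.n_eq]
    simp

theorem entry_zero (h : m.Stores T) {H r l a : ℕ} {p : Fin n} (hr : r ≤ n) (hl : l ≤ m.maxHorizon)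
    (ha : a < m.codes) :
    m.entry H r 0 p l a n ≠ 0 ↔ ∀ k < 3 * m.windows, m.digit a k = 0 := by
  have hn := h.n_eq
  classical
  rw [Mem.entry_eq (by omega) (by omega) (by omega) hl ha (by omega), Mem.step, pick_pos rfl,
    pick_eq, hn]
  simp

theorem isChild_iff (h : m.Stores T) {p y : Fin n} :
    (m.par y = p ∧ (y : ℕ) ≠ m.root) ↔ T.IsChild p y := by
  rw [h.par_eq, h.root_eq, WTree.IsChild, Fin.val_inj, Ne, Fin.val_inj, and_comm]

theorem entry_succ (h : m.Stores T) {H r l a u : ℕ} {p y : Fin n} (hr : r ≤ n)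
    (hl : l ≤ m.maxHorizon) (ha : a < m.codes) (hu : u ≤ n) (hy : T.IsChild p y) :
    m.entry H r (y + 1) p l a u = m.branch (m.entry H) r y p l u
      (least m.candidates (m.IsCandidate (m.entry H) H r y p l a)) := by
  have hn := h.n_eq
  rw [Mem.entry_eq (by omega) (by omega) (by omega) hl ha (by omega), Mem.step,
    pick_neg (by omega), Nat.add_sub_cancel, pick_pos (h.isChild_iff.2 hy)]

theorem entry_succ_of_not (h : m.Stores T) {H r l a u : ℕ} {p y : Fin n} (hr : r ≤ n)
    (hl : l ≤ m.maxHorizon) (ha : a < m.codes) (hu : u ≤ n) (hy : ¬ T.IsChild p y) :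
    m.entry H r (y + 1) p l a u = m.entry H r y p l a u := by
  have hn := h.n_eq
  rw [Mem.entry_eq (by omega) (by omega) (by omega) hl ha (by omega), Mem.step,
    pick_neg (by omega), Nat.add_sub_cancel, pick_neg fun hc => hy (h.isChild_iff.1 hc)]

end Mem.Stores

/-- The labeling `P` has the parameters that the program uses for the memory `m`. -/
structure Mem.Fits (m : Mem) {n : ℕ} (P : Labeling n) : Prop extends m.Stores P.T where
  d_eq : ∀ v, P.d v = m.dur v
  W_eq : P.W = m.width P.H
  D_eq : P.D = m.windows
  H_le : P.H ≤ m.maxHorizon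

namespace Mem.Fits

variable {m : Mem} {n : ℕ} {P : Labeling n}

theorem lab_le (h : m.Fits P) (v : Fin n) : P.lab v ≤ m.maxHorizon := (P.lab_le v).trans h.H_le

theorem full_eq (h : m.Fits P) {y : Fin n} {b : ℕ}
    (hb : ∀ k < 3 * m.windows, P.acc y n k = m.digit b k) :
    ∀ k < 3 * P.D, m.full P.H y (P.lab y) b k = P.dg y k := fun k hk => by
  rw [h.D_eq] at hk
  rw [Mem.full, Labeling.dg_eq, hb k hk, h.W_eq, h.d_eq]

theorem kept_eq (h : m.Fits P) {p y : Fin n} {b : ℕ}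
    (hb : ∀ k < 3 * m.windows, P.acc y n k = m.digit b k) :
    ∀ k < 3 * P.D, kept P.H (m.width P.H) (m.dur p) (P.lab p) (m.full P.H y (P.lab y) b) k =
      kept P.H P.W (P.d p) (P.lab p) (P.dg y) k := fun k hk => by
  rw [kept, kept, h.full_eq hb k hk, h.W_eq, h.d_eq]

/-- The labels read off from the table satisfy the conditions. -/
theorem of_entry (h : m.Fits P) {r j a : ℕ} {p : Fin n} (hr : r ≤ n) (hj : j ≤ n) (ha : a < m.codes)
    (hne : m.entry P.H r j p (P.lab p) a n ≠ 0)
    (hlab : ∀ y, P.T.IsChild p y → y.1 < j → ∀ u, P.T.InSubtree y u →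
      P.lab u = min (m.entry P.H r j p (P.lab p) a u - 1) P.H) :
    (∀ k < 3 * m.windows, P.acc p j k = m.digit a k) ∧
      ∀ y, P.T.IsChild p y → y.1 < j →
        (Edge P.H P.W P.D (P.d p) (P.lab p) (P.lab y) (P.dg y) ∧
          Merge P.D (P.acc p y) (kept P.H P.W (P.d p) (P.lab p) (P.dg y))) ∧
        ∀ u, P.T.InSubtree y u → Node P.H P.W P.D (P.d u) (P.lab u) (P.dg u) ∧
          ∀ z, P.T.IsChild u z → Edge P.H P.W P.D (P.d u) (P.lab u) (P.lab z) (P.dg z) ∧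
            Merge P.D (P.acc u z) (kept P.H P.W (P.d u) (P.lab u) (P.dg z)) := by
  induction r using Nat.strong_induction_on generalizing p j a with
  | _ r ihr =>
  induction j generalizing a with
  | zero =>
    rw [h.entry_zero hr (h.lab_le p) ha] at hne
    exact ⟨fun k hk => by rw [Labeling.acc_zero, hne k hk], fun y _ hy => absurd hy (Nat.not_lt_zero _)⟩
  | succ j ihj =>
  lift j to Fin n using hj
  by_cases hc : P.T.IsChild p j
  · have hent := fun u (hu : u ≤ n) => h.entry_succ (H := P.H) hr (h.lab_le p) ha hu hc
    set x := least m.candidates (m.IsCandidate (m.entry P.H) P.H r j p (P.lab p) a) with hx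
    have hex : ∃ i < m.candidates, m.IsCandidate (m.entry P.H) P.H r j p (P.lab p) a i := by
      by_contra! hno
      rw [hent n le_rfl, hx, least_eq_bound hno, Mem.branch, pick_pos rfl] at hne
      exact hne rfl
    obtain ⟨hx1, ⟨hr0, h1, h2, hnode, hedge, hmerge, hdig⟩, -⟩ := least_spec hex
    rw [← hx] at hx1 h1 h2 hnode hedge hmerge hdig
    have h3 : ∀ k, k % m.codes < m.codes := fun k => Nat.mod_lt _ Mem.one_le_codes
    set lv := x / m.codes / m.codes
    set b := x / m.codes % m.codes
    set a' := x % m.codes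
    rw [h.n_eq] at h1 h2
    have hent' : ∀ u : Fin n, m.entry P.H r (j + 1) p (P.lab p) a u =
        pick (u = j) (lv + 1) (pick (P.T.InSubtree j u) (m.entry P.H (r - 1) n j lv b u)
          (m.entry P.H r j p (P.lab p) a' u)) := fun u => by
      rw [hent u u.2.le, Mem.branch, pick_neg hx1.ne, pick_neg (by rw [h.n_eq]; exact u.2.ne), h.n_eq]
      simp only [Fin.val_inj, h.anc_iff]
      rfl
    have hlj : P.lab j = lv := by
      have := hlab j hc (Nat.lt_succ_self _) j (.refl _)
      rw [hent' j, pick_pos rfl, Nat.add_sub_cancel] at this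
      rw [this, min_eq_left]
      -- The truncation at `H` is inactive, because the chosen candidate satisfies `Node`, which
      -- bounds its label.
      rcases hnode.1 with h4 | h4 <;> omega
    rw [← hlj] at h1 hnode hedge hmerge hdig
    -- The whole subtree of the child `j`: its height allowance is one less, and all its children
    -- are included.
    obtain ⟨i1, i2⟩ := ihr (r - 1) (by omega) (by omega) le_rfl (h3 _) h1 fun y hy _ u hu => by
      have hju : P.T.InSubtree j u := hy.inSubtree.trans hu
      have hne : u ≠ j := fun e => hy.not_inSubtree (e ▸ hu)
      rw [hlab j hc (Nat.lt_succ_self _) u hju, hent' u, pick_neg hne, pick_pos hju, hlj]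
    obtain ⟨j1, j2⟩ := ihj j.2.le (h3 _) h2 fun y hy hyj u hu => by
      have hju : ¬ P.T.InSubtree j u := fun hju => by
        have := hy.eq_of_inSubtree hc hu hju
        rw [this] at hyj
        exact lt_irrefl _ hyj
      rw [hlab y hy (by omega) u hu, hent' u, pick_neg fun e : u = j => hju (e ▸ .refl _), pick_neg hju]
    have e1 := h.full_eq i1
    have e2 := h.kept_eq (p := p) i1
    have hD := h.D_eq
    rw [← h.W_eq, ← h.d_eq, ← h.D_eq] at hnode hedge
    rw [← h.D_eq] at hmerge
    refine ⟨fun k hk => ?_, fun y hy hyj => ?_⟩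
    · rw [Labeling.acc_succ hc, j1 k hk, hdig k hk, e2 k (by rwa [hD])]
    · rcases Nat.lt_succ_iff_lt_or_eq.1 hyj with hyj | hyj
      · exact j2 y hy hyj
      · obtain rfl : y = j := Fin.ext hyj
        refine ⟨⟨hedge.congr e1 (P.lab_le p) P.H_le,
          hmerge.congr (fun k hk => (j1 k (by rwa [← hD])).symm) e2⟩, fun u hu => ?_⟩
        by_cases huy : y = u
        · subst huy
          exact ⟨hnode.congr e1, fun z hz => (i2 z hz z.2).1⟩
        · obtain ⟨z, hz, hzu⟩ := WTree.exists_child hu huy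
          exact (i2 z hz z.2).2 u hzu
  · have hent := fun u (hu : u ≤ n) => h.entry_succ_of_not (H := P.H) hr (h.lab_le p) ha hu hc
    rw [hent n le_rfl] at hne
    have hlt : ∀ y, P.T.IsChild p y → y.1 < j + 1 → y.1 < j := fun y hy hyj => by
      have : y.1 ≠ j := fun e => hc (Fin.ext e ▸ hy)
      omega
    obtain ⟨j1, j2⟩ := ihj j.2.le ha hne fun y hy hyj u hu => by
      rw [hlab y hy (by omega) u hu, hent u u.2.le]
    exact ⟨fun k hk => by rw [Labeling.acc_succ_of_not hc, j1 k hk],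
      fun y hy hyj => j2 y hy (hlt y hy hyj)⟩

theorem exists_code (h : m.Fits P) (hP : P.IsGood) (p : Fin n) (j : ℕ) :
    ∃ s < m.codes, ∀ k < 3 * m.windows, m.digit s k = P.acc p j k :=
  Mem.exists_digits fun k hk => by
    have h1 := P.acc_le p j k
    have h2 := hP.dg_le p (k := k) (by rwa [h.D_eq])
    have h3 := h.H_le
    rw [Mem.base]
    omega

/-- If there are good labels, then the table shows it. -/
theorem entry_ne_zero (h : m.Fits P) (hP : P.IsGood) {r j a : ℕ} {p : Fin n} (hr : r ≤ n)
    (hj : j ≤ n) (ha : a < m.codes) (hdepth : n ≤ r + P.T.depth p)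
    (hdig : ∀ k < 3 * m.windows, m.digit a k = P.acc p j k) :
    m.entry P.H r j p (P.lab p) a n ≠ 0 := by
  induction r using Nat.strong_induction_on generalizing p j a with
  | _ r ihr =>
  induction j generalizing a with
  | zero =>
    rw [h.entry_zero hr (h.lab_le p) ha]
    exact fun k hk => by rw [hdig k hk, Labeling.acc_zero]
  | succ j ihj =>
  lift j to Fin n using hj
  by_cases hc : P.T.IsChild p j
  · rw [h.entry_succ hr (h.lab_le p) ha le_rfl hc]
    obtain ⟨b, hb, hb'⟩ := h.exists_code hP j n
    obtain ⟨a', ha', ha''⟩ := h.exists_code hP p j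
    have hD := h.D_eq
    have e1 := h.full_eq fun k hk => (hb' k hk).symm
    have e2 := h.kept_eq (p := p) fun k hk => (hb' k hk).symm
    have hd := hc.depth_eq
    have hd' := P.T.depth_le j
    have hx1 := mul_add_div_mod (P.lab j * m.codes + b) ha'
    have hx2 := mul_add_div_mod (P.lab j) hb
    -- The actual label of `j` and the codes of the actual digits form a candidate. As `depth p + 1
    -- = depth j ≤ n ≤ r + depth p`, the height allowance is positive and remains sufficient for
    -- `j`.
    have hex : ∃ i < m.candidates, m.IsCandidate (m.entry P.H) P.H r j p (P.lab p) a i := by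
      refine ⟨(P.lab j * m.codes + b) * m.codes + a', ?_, ?_⟩
      · refine mul_add_lt_mul (mul_add_lt_mul ?_ hb) ha'
        have := h.lab_le j
        omega
      · rw [Mem.IsCandidate, hx1.1, hx1.2, hx2.1, hx2.2, h.n_eq, ← h.W_eq, ← hD, ← h.d_eq,
          ← h.d_eq]
        refine ⟨by omega, ihr (r - 1) (by omega) (by omega) le_rfl hb (by omega) hb',
          ihj j.2.le ha' ha'', (hP.node j).congr fun k hk => (e1 k hk).symm,
          (hP.edge p j hc).congr (fun k hk => (e1 k hk).symm) (P.lab_le p) P.H_le, ?_, ?_⟩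
        · refine (hP.merge p j hc).congr (fun k hk => (ha'' k (by rwa [← hD])).symm) fun k hk => ?_
          rw [← e2 k hk, h.W_eq, h.d_eq]
        · intro k hk
          rw [hdig k (by rwa [← hD]), Labeling.acc_succ hc, ha'' k (by rwa [← hD]), ← e2 k hk,
            h.W_eq, h.d_eq]
    rw [Mem.branch, pick_neg (least_spec hex).1.ne, pick_pos h.n_eq.symm]
    exact one_ne_zero
  · rw [h.entry_succ_of_not hr (h.lab_le p) ha le_rfl hc]
    exact ihj j.2.le ha fun k hk => by rw [hdig k hk, Labeling.acc_succ_of_not hc]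

end Mem.Fits

end RAM


/-! ### The quantities computed from the table. -/

namespace RAM

open Schedule

namespace Mem

variable (m : Mem)

/-- The stored entry of the table. -/
def val (H r j p l a u : ℕ) : ℕ := m.arr 0 (m.idx H r j p l a u)

/-- The candidate `x` consists of a label for the root and a code for the other vertices. -/
def IsFeasible (H x : ℕ) : Prop :=
  m.val H m.n m.n m.root (x / m.codes) (x % m.codes) m.n ≠ 0 ∧
    Node H (m.width H) m.windows (m.dur m.root) (x / m.codes)
      (m.full H m.root (x / m.codes) (x % m.codes))

/-- The least feasible horizon. -/
noncomputable def horizon : ℕ :=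
  least (m.maxHorizon + 1) fun H => ∃ x < (m.maxHorizon + 1) * m.codes, m.IsFeasible H x

/-- The label of the root and the code of the other vertices. -/
noncomputable def choice : ℕ := least ((m.maxHorizon + 1) * m.codes) (m.IsFeasible m.horizon)

/-- The label of a vertex. -/
noncomputable def lab (v : ℕ) : ℕ :=
  min (pick (v = m.root) (m.choice / m.codes) (m.val m.horizon m.n m.n m.root
    (m.choice / m.codes) (m.choice % m.codes) v - 1)) m.horizon

/-- This and the following definitions repeat those for labelings on plain numbers in the memory;
`Mem.Computes` provides the translation. -/
noncomputable def key (v : ℕ) : ℕ :=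
  Schedule.key m.n m.horizon (m.width m.horizon) m.windows (m.dur v) (m.lab v) (m.depth v)

noncomputable def rank (v : ℕ) : ℕ := m.key v * m.n + v

/-- `y` lies between `u` and `x`. -/
def IsBtw (u y x : ℕ) : Prop :=
  (m.Anc y u ∨ m.Anc y x) ∧ ∀ z < m.n, m.Anc z u → m.Anc z x → m.Anc z y

def IsAdj (u v : ℕ) : Prop := (u ≠ m.root ∧ m.par u = v) ∨ (v ≠ m.root ∧ m.par v = u)

def IsQueried (x q : ℕ) : Prop :=
  (∀ y < m.n, m.IsBtw q y x → m.rank q ≤ m.rank y) ∧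
    (q = x → ∃ u < m.n, m.IsAdj x u ∧ m.rank x < m.rank u)

def IsShort : Prop := 16 * (m.width m.horizon - 1) ≤ m.c * m.n

noncomputable def num : ℕ :=
  pick m.IsShort (16 * m.L * (m.width m.horizon - 1) + m.c * m.n) 2

noncomputable def den : ℕ := pick m.IsShort (16 * m.L * m.c * m.n * m.c) m.c

noncomputable def lightCount (x : ℕ) : ℕ :=
  ∑ q ∈ Finset.range m.n, pick (m.IsQueried x q ∧ m.w q * (m.den : ℕ) < (m.c * m.num : ℕ) ∧
    m.Anc q x) 1 0

noncomputable def queriedSum (x : ℕ) : ℕ :=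
  ∑ q ∈ Finset.range m.n, pick (m.IsQueried x q) (m.dur q - 1) 0

def IsCostly : Prop := ∃ x < m.n, (m.L + (2 * m.c + 1) * m.lightCount x) * m.num ≤
  16 * m.L * m.c * m.queriedSum x

/-- A vertex of maximum weight. -/
noncomputable def heaviest : ℕ := least m.n fun v => ¬ m.w v * (1 : ℕ) < (1 : ℕ)

noncomputable def pivot : ℕ :=
  pick (∃ u < m.n, m.IsAdj m.heaviest u ∧ m.rank m.heaviest < m.rank u) m.heaviest
    (m.par m.heaviest)

noncomputable def prefixSum (k : ℕ) : ℕ :=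
  ∑ v ∈ Finset.range m.n, pick (v < k) (m.dur v - 1) 0

noncomputable def prefixLength : ℕ :=
  least m.n fun k => m.c * m.n * ((m.L + 2 * m.c + 1) * m.num + m.den) ≤ m.den * m.prefixSum k

noncomputable def finalKey (v : ℕ) : ℕ :=
  pick (m.IsShort ∧ 4 * m.L * m.num ≤ m.den)
    (pick (m.IsCostly ∨ m.Anc m.pivot v) (m.key v) ((2 * m.windows + 1) * (m.n + 1) + m.key v))
    (pick (v < m.prefixLength) (m.n - m.depth v)
      (m.n + 1 + pick m.IsShort (m.key v) (m.depth v)))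

noncomputable def finalRank (v : ℕ) : ℕ := m.finalKey v * m.n + v

/-- The number of vertices of smaller rank. -/
noncomputable def position (v : ℕ) : ℕ :=
  ∑ u ∈ Finset.range m.n, pick (m.finalRank u < m.finalRank v) 1 0

/-- The vertex at position `i` of the final order. -/
noncomputable def order (i : ℕ) : ℕ := least m.n fun v => m.position v = i

/-- Multiplication is repeated addition, so one factor of each product must be at most `lim`. Here
shortness bounds the width of the windows. -/
theorem num_le (h : m.WF) : m.num ≤ m.lim := by
  have h1 : m.L < 2 ^ m.L := Nat.lt_two_pow_self
  have h2 := h.one_le_L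
  have h3 : (m.L + 1) * (m.c * m.n) ≤ m.lim := by
    refine le_trans ?_ (h.pow_le_lim (a := m.L + 1) (by omega))
    rw [pow_succ]
    exact Nat.mul_le_mul_right _ (h1.trans_le (Nat.pow_le_pow_left h.two_le _))
  classical
  rw [num, pick_eq]
  split_ifs with hs
  · refine le_trans ?_ h3
    have : m.L * (16 * (m.width m.horizon - 1)) ≤ m.L * (m.c * m.n) := Nat.mul_le_mul_left _ hs
    linarith
  · exact h.two_le_lim

theorem den_le (h : m.WF) : m.den ≤ m.lim := by
  have h1 : m.L ≤ 2 ^ m.L := Nat.lt_two_pow_self.le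
  have h2 := h.one_le_L
  have h4 := h.two_le_n
  have h5 : m.c ≤ m.c * m.n := Nat.le_mul_of_pos_right _ (by omega)
  classical
  rw [den, pick_eq]
  split_ifs with hs
  · refine le_trans ?_ (h.pow_le_lim (a := 4 + m.L + 1 + 1) (by omega))
    rw [pow_succ, pow_succ, pow_add, mul_assoc (16 * m.L)]
    refine Nat.mul_le_mul (Nat.mul_le_mul_right _ (Nat.mul_le_mul ?_ ?_)) h5
    · exact (by norm_num : 16 ≤ 2 ^ 4).trans (Nat.pow_le_pow_left h.two_le _)
    · exact h1.trans (Nat.pow_le_pow_left h.two_le _)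
  · exact (h5.trans (by rw [pow_one])).trans (h.pow_le_lim (a := 1) (by omega))

end Mem

section Functions

variable {α : Type} [Ctx α]

theorem CmpB.lit {a : ℕ} (ha : a ≤ 2 ^ 10) : CmpB fun _ (_ : α) => a :=
  ⟨Cmp.lit a, fun m _ h => (ha.trans (Nat.pow_le_pow_left h.two_le _)).trans (h.pow_le_lim (by
    have := h.one_le_L
    omega))⟩

theorem CmpB.L : CmpB fun m (_ : α) => m.L :=
  ⟨Cmp.L, fun m _ h => (Nat.lt_two_pow_self.le.trans (Nat.pow_le_pow_left h.two_le _)).trans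
    (h.pow_le_lim (by omega))⟩

theorem Cmp.mul_bounded {f g : Mem → α → ℕ} (hf : Cmp f) (hg : CmpB g) :
    Cmp fun m a => f m a * g m a :=
  (Cmp.mul hg.cmp hg.le hf).congr fun _ _ _ => mul_comm _ _

theorem CmpB.mul {f g : Mem → α → ℕ} (hf : CmpB f) (hg : Cmp g) :
    Cmp fun m a => f m a * g m a :=
  Cmp.mul hf.cmp hf.le hg

theorem cmp_val {H r j p l a u : Mem → α → ℕ} (hH : Cmp H) (hr : Cmp r) (hj : Cmp j) (hp : Cmp p)
    (hl : Cmp l) (ha : Cmp a) (hu : Cmp u) :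
    Cmp fun m x => m.val (H m x) (r m x) (j m x) (p m x) (l m x) (a m x) (u m x) :=
  Cmp.arr (cmp_idx hH hr hj hp hl ha hu) 0 (by norm_num)

theorem cmpP_isFeasible {H x : Mem → α → ℕ} (hH : Cmp H) (hx : CmpB x) :
    CmpP fun m a => m.IsFeasible (H m a) (x m a) := by
  have h1 := hx.div (CmpB.codes (α := α)).cmp
  have h2 := hx.mod (CmpB.codes (α := α)).cmp
  exact (CmpP.eq (cmp_val hH Cmp.n Cmp.n Cmp.root h1.cmp h2.cmp Cmp.n) (Cmp.lit 0)).not.and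
    (CmpP.node hH (cmp_width hH).cmp (cmp_dur Cmp.root).cmp h1.cmp (cmp_full hH Cmp.root h1 h2))

theorem cmpB_pairs : CmpB fun m (_ : α) => (m.maxHorizon + 1) * m.codes :=
  CmpB.candidates.of_le (CmpB.maxHorizon_add_one.mul CmpB.codes.cmp) fun _ _ _ =>
    Nat.le_mul_of_pos_right _ Mem.one_le_codes

theorem cmp_horizon : CmpB fun m (_ : α) => m.horizon :=
  CmpB.least CmpB.maxHorizon_add_one (CmpP.exists cmpB_pairs (cmpP_isFeasible
    CmpB.maxHorizon_add_one.last.weaken.cmp cmpB_pairs.last))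

theorem cmp_choice : CmpB fun m (_ : α) => m.choice :=
  CmpB.least cmpB_pairs (cmpP_isFeasible cmp_horizon.cmp cmpB_pairs.last)

theorem cmp_lab {v : Mem → α → ℕ} (hv : Cmp v) : CmpB fun m a => m.lab (v m a) :=
  cmp_horizon.of_le ((Cmp.pick (CmpP.eq hv Cmp.root) (cmp_choice.div CmpB.codes.cmp).cmp
    ((cmp_val cmp_horizon.cmp Cmp.n Cmp.n Cmp.root (cmp_choice.div CmpB.codes.cmp).cmp
      (cmp_choice.mod CmpB.codes.cmp).cmp hv).sub (Cmp.lit 1))).min cmp_horizon.cmp)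
    fun _ _ _ => min_le_right _ _

theorem cmp_key {v : Mem → α → ℕ} (hv : Cmp v) : Cmp fun m a => m.key (v m a) := by
  classical
  have hl := cmp_lab hv
  have hW := (cmp_width (cmp_horizon (α := α)).cmp).cmp
  have h2 : CmpB fun _ (_ : α) => 2 := CmpB.lit (by norm_num)
  refine (Cmp.pick (CmpP.eq hl.cmp cmp_horizon.cmp) (((h2.mul CmpB.windows.cmp).mul_bounded
    CmpB.n_add_one).add (cmp_depth hv).cmp) ((Cmp.mul_bounded ((h2.mul (hl.div hW).cmp).add
      (Cmp.pick (CmpP.le hW (cmp_dur hv).cmp) (Cmp.lit 1) (Cmp.lit 0))) CmpB.n_add_one).add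
        (cmp_depth hv).cmp)).congr fun m a _ => ?_
  rw [Mem.key, Schedule.key, pick_eq, pick_eq]

theorem cmp_rank {v : Mem → α → ℕ} (hv : Cmp v) : Cmp fun m a => m.rank (v m a) :=
  ((cmp_key hv).mul_bounded CmpB.n).add hv

theorem cmpP_isBtw {u y x : Mem → α → ℕ} (hu : Cmp u) (hy : Cmp y) (hx : Cmp x) :
    CmpP fun m a => m.IsBtw (u m a) (y m a) (x m a) := by
  have hz := (CmpB.n (α := α)).last.cmp
  exact ((cmpP_anc hy hu).or (cmpP_anc hy hx)).and (CmpP.forall CmpB.n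
    ((cmpP_anc hz hu.weaken).imp ((cmpP_anc hz hx.weaken).imp (cmpP_anc hz hy.weaken))))

theorem cmpP_isAdj {u v : Mem → α → ℕ} (hu : Cmp u) (hv : Cmp v) :
    CmpP fun m a => m.IsAdj (u m a) (v m a) :=
  ((CmpP.eq hu Cmp.root).not.and (CmpP.eq hu.par hv)).or
    ((CmpP.eq hv Cmp.root).not.and (CmpP.eq hv.par hu))

theorem cmpP_isQueried {x q : Mem → α → ℕ} (hx : Cmp x) (hq : Cmp q) :
    CmpP fun m a => m.IsQueried (x m a) (q m a) := by
  have hy := (CmpB.n (α := α)).last.cmp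
  exact (CmpP.forall CmpB.n ((cmpP_isBtw hq.weaken hy hx.weaken).imp
    (CmpP.le (cmp_rank hq.weaken) (cmp_rank hy)))).and ((CmpP.eq hq hx).imp
      (CmpP.exists CmpB.n ((cmpP_isAdj hx.weaken hy).and
        (CmpP.lt (cmp_rank hx.weaken) (cmp_rank hy)))))

theorem cmp_width_sub : Cmp fun m (_ : α) => m.width m.horizon - 1 :=
  (cmp_width cmp_horizon.cmp).cmp.sub (Cmp.lit 1)

theorem cmpP_isShort : CmpP fun m (_ : α) => m.IsShort :=
  CmpP.le ((CmpB.lit (by norm_num)).mul cmp_width_sub) CmpB.mul_cn.cmp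

theorem cmpB_sixteen_mul : CmpB fun m (_ : α) => 16 * m.L :=
  ⟨(CmpB.lit (by norm_num)).mul Cmp.L, fun m _ h => by
    refine le_trans ?_ (h.pow_le_lim (a := 4 + m.L) (by have := h.one_le_L; omega))
    rw [pow_add]
    exact Nat.mul_le_mul ((by norm_num : 16 ≤ 2 ^ 4).trans (Nat.pow_le_pow_left h.two_le _))
      (Nat.lt_two_pow_self.le.trans (Nat.pow_le_pow_left h.two_le _))⟩

theorem cmp_num : CmpB fun m (_ : α) => m.num :=
  ⟨Cmp.pick cmpP_isShort ((cmpB_sixteen_mul.mul cmp_width_sub).add CmpB.mul_cn.cmp) (Cmp.lit 2),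
    fun m _ h => m.num_le h⟩

theorem cmp_den : CmpB fun m (_ : α) => m.den :=
  ⟨Cmp.pick cmpP_isShort (((cmpB_sixteen_mul.mul Cmp.c).mul_bounded CmpB.n).mul_bounded CmpB.c)
    Cmp.c, fun m _ h => m.den_le h⟩

theorem cmp_lightCount {x : Mem → α → ℕ} (hx : Cmp x) :
    CmpB fun m a => m.lightCount (x m a) := by
  have hq := (CmpB.n (α := α)).last.cmp
  refine CmpB.n.of_le (Cmp.sum_range CmpB.n (Cmp.pick ((cmpP_isQueried hx.weaken hq).and
    ((CmpP.weight_lt hq cmp_den.cmp (CmpB.c.mul cmp_num.cmp)).and (cmpP_anc hq hx.weaken)))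
      (Cmp.lit 1) (Cmp.lit 0))) fun m a _ => ?_
  classical
  refine (Finset.sum_le_card_nsmul _ _ 1 fun i _ => ?_).trans (by simp)
  rw [pick_eq]
  split_ifs <;> simp

theorem cmp_queriedSum {x : Mem → α → ℕ} (hx : Cmp x) : Cmp fun m a => m.queriedSum (x m a) := by
  have hq := (CmpB.n (α := α)).last.cmp
  exact Cmp.sum_range CmpB.n (Cmp.pick (cmpP_isQueried hx.weaken hq) ((cmp_dur hq).cmp.sub
    (Cmp.lit 1)) (Cmp.lit 0))

theorem cmp_two_mul_c : Cmp fun m (_ : α) => 2 * m.c := (CmpB.lit (by norm_num)).mul Cmp.c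

theorem cmpP_isCostly : CmpP fun m (_ : α) => m.IsCostly := by
  have hx := (CmpB.n (α := α)).last.cmp
  exact CmpP.exists CmpB.n (CmpP.le (Cmp.mul_bounded (CmpB.L.cmp.add (Cmp.mul_bounded
    (cmp_two_mul_c.add (Cmp.lit 1)) (cmp_lightCount hx))) cmp_num)
      (((cmp_queriedSum hx).mul_bounded CmpB.c |>.mul_bounded cmpB_sixteen_mul).congr
        fun m p _ => by ring))

theorem cmp_heaviest : CmpB fun m (_ : α) => m.heaviest :=
  CmpB.least CmpB.n (CmpP.weight_lt CmpB.n.last.cmp (Cmp.lit 1) (Cmp.lit 1)).not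

theorem cmp_pivot : Cmp fun m (_ : α) => m.pivot :=
  Cmp.pick (CmpP.exists CmpB.n ((cmpP_isAdj cmp_heaviest.cmp CmpB.n.last.cmp).and
    (CmpP.lt (cmp_rank cmp_heaviest.cmp) (cmp_rank CmpB.n.last.cmp)))) cmp_heaviest.cmp
      cmp_heaviest.cmp.par

theorem cmp_prefixSum {k : Mem → α → ℕ} (hk : Cmp k) : Cmp fun m a => m.prefixSum (k m a) := by
  have hq := (CmpB.n (α := α)).last.cmp
  exact Cmp.sum_range CmpB.n (Cmp.pick (CmpP.lt hq hk.weaken) ((cmp_dur hq).cmp.sub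
    (Cmp.lit 1)) (Cmp.lit 0))

theorem cmp_prefixLength : CmpB fun m (_ : α) => m.prefixLength :=
  CmpB.least CmpB.n (CmpP.le (CmpB.mul_cn.mul ((Cmp.mul_bounded ((CmpB.L.cmp.add
    cmp_two_mul_c).add (Cmp.lit 1)) cmp_num).add cmp_den.cmp)) (cmp_den.mul
      (cmp_prefixSum CmpB.n.last.cmp)))

theorem cmp_finalKey {v : Mem → α → ℕ} (hv : Cmp v) : Cmp fun m a => m.finalKey (v m a) :=
  Cmp.pick (cmpP_isShort.and (CmpP.le (Cmp.mul_bounded ((CmpB.lit (by norm_num)).mul Cmp.L) cmp_num)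
    cmp_den.cmp)) (Cmp.pick (cmpP_isCostly.or (cmpP_anc cmp_pivot hv)) (cmp_key hv)
      ((Cmp.mul_bounded (((CmpB.lit (by norm_num)).mul CmpB.windows.cmp).add (Cmp.lit 1))
        CmpB.n_add_one).add (cmp_key hv)))
    (Cmp.pick (CmpP.lt hv cmp_prefixLength.cmp) (Cmp.n.sub (cmp_depth hv).cmp)
      ((Cmp.n.add (Cmp.lit 1)).add (Cmp.pick cmpP_isShort (cmp_key hv) (cmp_depth hv).cmp)))

theorem cmp_finalRank {v : Mem → α → ℕ} (hv : Cmp v) : Cmp fun m a => m.finalRank (v m a) :=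
  ((cmp_finalKey hv).mul_bounded CmpB.n).add hv

theorem cmp_position {v : Mem → α → ℕ} (hv : Cmp v) : Cmp fun m a => m.position (v m a) :=
  Cmp.sum_range CmpB.n (Cmp.pick (CmpP.lt (cmp_finalRank CmpB.n.last.cmp) (cmp_finalRank hv.weaken))
    (Cmp.lit 1) (Cmp.lit 0))

theorem cmp_order {i : Mem → α → ℕ} (hi : Cmp i) : CmpB fun m a => m.order (i m a) :=
  CmpB.least CmpB.n (CmpP.eq (cmp_position CmpB.n.last.cmp) hi.weaken)

end Functions

section SetArr

variable (m : Mem) (a : ℕ → ℕ)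

namespace Mem

-- Nothing that determines the final order reads array `1`. So these quantities are unchanged while
-- that array is being filled, and afterwards when the output is written.
@[simp] theorem setArr_n : (m.setArr 1 a).n = m.n := rfl

@[simp] theorem setArr_c : (m.setArr 1 a).c = m.c := rfl

@[simp] theorem setArr_L : (m.setArr 1 a).L = m.L := rfl

@[simp] theorem setArr_root : (m.setArr 1 a).root = m.root := rfl

@[simp] theorem setArr_par : (m.setArr 1 a).par = m.par := rfl

@[simp] theorem setArr_w : (m.setArr 1 a).w = m.w := rfl

@[simp] theorem setArr_maxHorizon : (m.setArr 1 a).maxHorizon = m.maxHorizon := rfl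

@[simp] theorem setArr_codes : (m.setArr 1 a).codes = m.codes := rfl

@[simp] theorem setArr_windows : (m.setArr 1 a).windows = m.windows := rfl

@[simp] theorem setArr_digit : (m.setArr 1 a).digit = m.digit := rfl

@[simp] theorem setArr_idx : (m.setArr 1 a).idx = m.idx := rfl

@[simp] theorem setArr_anc : (m.setArr 1 a).Anc = m.Anc := rfl

@[simp] theorem setArr_depth : (m.setArr 1 a).depth = m.depth := rfl

@[simp] theorem setArr_dur : (m.setArr 1 a).dur = m.dur := rfl

@[simp] theorem setArr_width : (m.setArr 1 a).width = m.width := rfl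

@[simp] theorem setArr_full : (m.setArr 1 a).full = m.full := rfl

@[simp] theorem setArr_val : (m.setArr 1 a).val = m.val := rfl

@[simp] theorem setArr_isFeasible : (m.setArr 1 a).IsFeasible = m.IsFeasible := by
  funext H x
  simp [IsFeasible]

@[simp] theorem setArr_horizon : (m.setArr 1 a).horizon = m.horizon := by
  simp [horizon]

@[simp] theorem setArr_choice : (m.setArr 1 a).choice = m.choice := by
  simp [choice]

@[simp] theorem setArr_lab : (m.setArr 1 a).lab = m.lab := by
  funext v
  simp [lab]

@[simp] theorem setArr_key : (m.setArr 1 a).key = m.key := by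
  funext v
  simp [key]

@[simp] theorem setArr_rank : (m.setArr 1 a).rank = m.rank := by
  funext v
  simp [rank]

@[simp] theorem setArr_isBtw : (m.setArr 1 a).IsBtw = m.IsBtw := by
  funext u y x
  simp [IsBtw]

@[simp] theorem setArr_isAdj : (m.setArr 1 a).IsAdj = m.IsAdj := by
  funext u v
  simp [IsAdj]

@[simp] theorem setArr_isQueried : (m.setArr 1 a).IsQueried = m.IsQueried := by
  funext x q
  simp [IsQueried]

@[simp] theorem setArr_isShort : (m.setArr 1 a).IsShort = m.IsShort := by
  simp [IsShort]

@[simp] theorem setArr_num : (m.setArr 1 a).num = m.num := by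
  simp [num]

@[simp] theorem setArr_den : (m.setArr 1 a).den = m.den := by
  simp [den]

@[simp] theorem setArr_lightCount : (m.setArr 1 a).lightCount = m.lightCount := by
  funext x
  simp [lightCount]

@[simp] theorem setArr_queriedSum : (m.setArr 1 a).queriedSum = m.queriedSum := by
  funext x
  simp [queriedSum]

@[simp] theorem setArr_isCostly : (m.setArr 1 a).IsCostly = m.IsCostly := by
  simp [IsCostly]

@[simp] theorem setArr_heaviest : (m.setArr 1 a).heaviest = m.heaviest := by
  simp [heaviest]

@[simp] theorem setArr_pivot : (m.setArr 1 a).pivot = m.pivot := by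
  simp [pivot]

@[simp] theorem setArr_prefixSum : (m.setArr 1 a).prefixSum = m.prefixSum := by
  funext k
  simp [prefixSum]

@[simp] theorem setArr_prefixLength : (m.setArr 1 a).prefixLength = m.prefixLength := by
  simp [prefixLength]

@[simp] theorem setArr_finalKey : (m.setArr 1 a).finalKey = m.finalKey := by
  funext v
  simp [finalKey]

@[simp] theorem setArr_finalRank : (m.setArr 1 a).finalRank = m.finalRank := by
  funext v
  simp [finalRank]

@[simp] theorem setArr_position : (m.setArr 1 a).position = m.position := by
  funext v
  simp [position]

@[simp] theorem setArr_order : (m.setArr 1 a).order = m.order := by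
  funext i
  simp [order]

end Mem

end SetArr

/-- There is a program that fills the array `1` with the final order. -/
theorem exists_fill_order : ∃ p K, ∀ m ρ s, m.WF → Rep m ρ s → Ends p s (m.lim ^ K) fun s' =>
    ∃ ρ' a, Rep (m.setArr 1 a) ρ' s' ∧ ∀ k < m.n, a k = m.order k :=
  exists_fill (j := 1) (by norm_num) CmpB.n.cmp (fun m h => CmpB.n.le m () h)
    (cmp_order Cmp.last).cmp fun m _ i _ a _ => by simp

end RAM


/-! ### The computed labeling has the required properties. -/

open Schedule

namespace WTree

variable {n : ℕ} {T : WTree n}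

theorem two_le (hN : T.Normalized) (hS : T.StarCondition) : 2 ≤ n := by
  classical
  obtain ⟨v, hv⟩ := hN.2
  have h := hS v
  rw [hv] at h
  by_contra hn
  have : Subsingleton (Fin n) := Fin.subsingleton_iff_le_one.2 (by omega)
  rw [Finset.sum_eq_zero fun u hu => ?_] at h
  · linarith
  · rw [Finset.mem_filter, Subsingleton.elim u v] at hu
    exact absurd hu.2 (T.graph.irrefl)

end WTree

namespace RAM

namespace Mem

variable {m : Mem}

theorem le_windows_mul_width (hm : m.WF) {H : ℕ} (hH : H ≤ m.maxHorizon) :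
    H ≤ m.windows * m.width H := by
  have h1 := hm.one_le_L
  refine (least_spec (b := m.maxHorizon + 1) (P := fun W => H ≤ m.windows * W)
    ⟨H, by omega, ?_⟩).2.1
  refine Nat.le_mul_of_pos_left _ ?_
  rw [windows]
  omega

theorem windows_mul_width_sub_lt (hm : m.WF) {H : ℕ} (hH : H ≤ m.maxHorizon) (h : 1 ≤ m.width H) :
    m.windows * (m.width H - 1) < H := by
  have h1 := hm.one_le_L
  refine not_le.1 ((least_spec (b := m.maxHorizon + 1) (P := fun W => H ≤ m.windows * W)
    ⟨H, by omega, ?_⟩).2.2 (m.width H - 1) (by rw [width] at h ⊢; omega))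
  refine Nat.le_mul_of_pos_left _ ?_
  rw [windows]
  omega

theorem val_eq (ht : ∀ k < m.tableSize, m.arr 0 k = m.table k) {H r j p l a u : ℕ}
    (hH : H ≤ m.maxHorizon) (hr : r ≤ m.n) (hj : j ≤ m.n)
    (hp : p < m.n) (hl : l ≤ m.maxHorizon) (ha : a < m.codes) (hu : u ≤ m.n) :
    m.val H r j p l a u = m.entry H r j p l a u :=
  ht _ (idx_lt_tableSize hH hr hj hp hl ha hu)

variable {n : ℕ} {P : Labeling n}

theorem Fits.exists_isFeasible (h : m.Fits P) (ht : ∀ k < m.tableSize, m.arr 0 k = m.table k)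
    (hP : P.IsGood) : ∃ x < (m.maxHorizon + 1) * m.codes, m.IsFeasible P.H x := by
  obtain ⟨b, hb, hb'⟩ := h.exists_code hP P.T.root n
  have hl := h.lab_le P.T.root
  have e := mul_add_div_mod (P.lab P.T.root) hb
  refine ⟨P.lab P.T.root * m.codes + b, mul_add_lt_mul (by omega) hb, ?_, ?_⟩
  · rw [e.1, e.2, h.root_eq, val_eq ht h.H_le le_rfl le_rfl (by rw [h.n_eq]; exact P.T.root.2)
      hl hb le_rfl, h.n_eq]
    exact h.entry_ne_zero hP le_rfl le_rfl hb (by omega) hb'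
  · rw [e.1, e.2, h.root_eq, ← h.W_eq, ← h.D_eq, ← h.d_eq]
    exact (hP.node _).congr fun k hk => (h.full_eq (fun k hk => (hb' k hk).symm) k hk).symm

variable {T : WTree n}

/-- The query times of `A` form good labels for its duration as horizon. By completeness of the
table this horizon is recognized as feasible, and the program takes the least feasible one. -/
theorem Stores.horizon_le (h : m.Stores T) (hN : T.Normalized)
    (ht : ∀ k < m.tableSize, m.arr 0 k = m.table k) {A : Strategy n} (hA : T.IsSearchStrategy A)
    {H : ℕ} (hH : ∀ x, WTree.duration (fun v => m.dur v) (A.queries T x) ≤ H) : m.horizon ≤ H := by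
  -- Only horizons up to `maxHorizon` are tried; the sum of all durations never exceeds it, so `H`
  -- may be truncated.
  set H' := min H m.maxHorizon with hH'
  have h1 : H' ≤ m.maxHorizon := min_le_right _ _
  have h2 : ∀ x, WTree.duration (fun v : Fin n => m.dur v) (A.queries T x) ≤ H' := fun x =>
    le_min (hH x) ((Finset.sum_le_sum_of_subset (Finset.subset_univ _)).trans (h.sum_dur_le hN))
  have h3 := le_windows_mul_width h.wf h1
  have hf : m.Fits (T.timingLabeling (fun v => m.dur v) (h.dur_pos hN) A h2 h3) :=
    { toStores := h, d_eq := fun _ => rfl, W_eq := rfl, D_eq := rfl, H_le := h1 }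
  obtain hx := hf.exists_isFeasible ht (WTree.isTiming hA (h.dur_pos hN) h2 h3).isGood
  by_contra hlt
  have h4 : H' < m.horizon := (min_le_left _ _).trans_lt (not_le.1 hlt)
  have h5 := (least_spec (b := m.maxHorizon + 1) (P := fun H => ∃ x < (m.maxHorizon + 1) * m.codes,
    m.IsFeasible H x) ⟨H', by omega, hx⟩).2.2 H' h4
  exact h5 hx

theorem Stores.horizon_le_max (h : m.Stores T) (hN : T.Normalized)
    (ht : ∀ k < m.tableSize, m.arr 0 k = m.table k) : m.horizon ≤ m.maxHorizon :=
  h.horizon_le hN ht (T.isSearchStrategy_list (l := List.finRange n) (by simp)) fun x =>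
    (Finset.sum_le_sum_of_subset (Finset.subset_univ _)).trans (h.sum_dur_le hN)

/-- The labeling that is computed by the program. -/
noncomputable def Stores.labeling (h : m.Stores T) (hN : T.Normalized)
    (ht : ∀ k < m.tableSize, m.arr 0 k = m.table k) : Labeling n where
  T := T
  d v := m.dur v
  H := m.horizon
  W := m.width m.horizon
  D := m.windows
  lab v := m.lab v
  d_pos := h.dur_pos hN
  lab_le _ := min_le_right _ _
  H_le := le_windows_mul_width h.wf (h.horizon_le_max hN ht)

namespace Stores

theorem fits_labeling (h : m.Stores T) (hN : T.Normalized)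
    (ht : ∀ k < m.tableSize, m.arr 0 k = m.table k) : m.Fits (h.labeling hN ht) :=
  { toStores := h, d_eq := fun _ => rfl, W_eq := rfl, D_eq := rfl, H_le := h.horizon_le_max hN ht }

theorem exists_isFeasible (h : m.Stores T) (hN : T.Normalized)
    (ht : ∀ k < m.tableSize, m.arr 0 k = m.table k) : ∃ x < (m.maxHorizon + 1) * m.codes, m.IsFeasible m.horizon x := by
  have hlt := h.horizon_le_max hN ht
  by_contra! hno
  have : m.horizon = m.maxHorizon + 1 ∨ ∃ H < m.maxHorizon + 1, ∃ x < (m.maxHorizon + 1) * m.codes,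
      m.IsFeasible H x := by
    by_cases hex : ∃ H < m.maxHorizon + 1, ∃ x < (m.maxHorizon + 1) * m.codes, m.IsFeasible H x
    · exact Or.inr hex
    · push Not at hex
      exact Or.inl (least_eq_bound fun H hH hx => by
        obtain ⟨x, h1, h2⟩ := hx
        exact hex H hH x h1 h2)
  rcases this with h1 | h1
  · omega
  · obtain ⟨x, h2, h3⟩ := (least_spec h1).2.1
    exact hno x h2 h3

/-- The chosen candidate gives the conditions at the root. The table entry for all children of the
root, with full height allowance, gives them everywhere below by `of_entry`. -/
theorem isGood_labeling (h : m.Stores T) (hN : T.Normalized)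
    (ht : ∀ k < m.tableSize, m.arr 0 k = m.table k) : (h.labeling hN ht).IsGood := by
  have hf := h.fits_labeling hN ht
  obtain ⟨h1, ⟨h2, h3⟩, -⟩ := least_spec (h.exists_isFeasible hN ht)
  change m.choice < _ at h1
  change m.val _ _ _ _ (m.choice / m.codes) (m.choice % m.codes) _ ≠ 0 at h2
  change Node _ _ _ _ (m.choice / m.codes) (m.full _ _ (m.choice / m.codes)
    (m.choice % m.codes)) at h3
  have hc : m.choice % m.codes < m.codes := Nat.mod_lt _ one_le_codes
  have hl : m.choice / m.codes ≤ m.maxHorizon :=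
    Nat.lt_succ_iff.1 ((Nat.div_lt_iff_lt_mul one_le_codes).2 h1)
  have hp : m.root < m.n := by rw [h.root_eq, h.n_eq]; exact T.root.2
  have hH := h.horizon_le_max hN ht
  have hroot : m.lab T.root = m.choice / m.codes := by
    rw [lab, pick_pos h.root_eq.symm, min_eq_left]
    rcases h3.1 with h4 | h4 <;> omega
  rw [val_eq ht hH le_rfl le_rfl hp hl hc le_rfl, h.n_eq, h.root_eq, ← hroot] at h2
  obtain ⟨i1, i2⟩ := hf.of_entry (p := T.root) le_rfl le_rfl hc h2 fun y hy _ u hu => by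
    have hne : u ≠ T.root := fun e => hy.not_inSubtree (e ▸ hu)
    change m.lab u = min (m.entry m.horizon n n T.root (m.lab T.root) _ u - 1) m.horizon
    rw [hroot, lab, pick_neg (by rw [h.root_eq, Fin.val_inj]; exact hne), val_eq ht hH le_rfl le_rfl
      hp hl hc (by rw [h.n_eq]; exact u.2.le), h.root_eq, h.n_eq]
  rw [h.root_eq, ← hroot] at h3
  have hr := h3.congr (hf.full_eq (y := T.root) i1)
  refine ⟨fun v => ?_, fun p y hy => ?_, fun p y hy => ?_⟩
  · by_cases hv : T.root = v
    · rw [← hv]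
      exact hr
    · obtain ⟨z, hz, hzv⟩ := WTree.exists_child (WTree.InSubtree.root v) hv
      exact ((i2 z hz z.2).2 v hzv).1
  · by_cases hp : T.root = p
    · subst hp
      exact (i2 y hy y.2).1.1
    · obtain ⟨z, hz, hzv⟩ := WTree.exists_child (WTree.InSubtree.root p) hp
      exact (((i2 z hz z.2).2 p hzv).2 y hy).1
  · by_cases hp : T.root = p
    · subst hp
      exact (i2 y hy y.2).1.2
    · obtain ⟨z, hz, hzv⟩ := WTree.exists_child (WTree.InSubtree.root p) hp
      exact (((i2 z hz z.2).2 p hzv).2 y hy).2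

/-- With horizon 0 every vertex would be late, which `edge` forbids for a parent and its child. -/
theorem horizon_pos (h : m.Stores T) (hN : T.Normalized)
    (ht : ∀ k < m.tableSize, m.arr 0 k = m.table k) : 1 ≤ m.horizon := by
  by_contra hH
  have hg := h.isGood_labeling hN ht
  have hlate : ∀ v, (h.labeling hN ht).lab v = (h.labeling hN ht).H := fun v => by
    have h1 := (h.labeling hN ht).lab_le v
    have h2 : (h.labeling hN ht).H = m.horizon := rfl
    omega
  have h2 := h.wf.two_le_n
  rw [h.n_eq] at h2
  have : Nontrivial (Fin n) := Fin.nontrivial_iff_two_le.2 h2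
  obtain ⟨v, hv⟩ := exists_ne T.root
  obtain ⟨z, hz, -⟩ := WTree.exists_child (WTree.InSubtree.root v) hv.symm
  exact (hg.edge T.root z hz).1 (hlate _) (hlate _)

theorem isOptimal_labeling (h : m.Stores T) (hN : T.Normalized)
    (ht : ∀ k < m.tableSize, m.arr 0 k = m.table k)
    (hS : T.StarCondition) : (h.labeling hN ht).IsOptimal m.c m.L := by
  have hH := h.horizon_le_max hN ht
  have h1 := h.horizon_pos hN ht
  have hW : 1 ≤ m.width m.horizon := by
    by_contra hW
    have := le_windows_mul_width h.wf hH
    rw [show m.width m.horizon = 0 by omega] at this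
    omega
  refine ⟨h.wf.one_le_c, h.wf.one_le_L, hN, hS, h.le_dur hN, h.dur_le hN,
    h.isGood_labeling hN ht, rfl, hW, windows_mul_width_sub_lt h.wf hH hW, ?_⟩
  exact WTree.horizon_le (d := fun v => m.dur v) (h.dur_le hN) h.wf.one_le_c
    fun A hA H' hH' => h.horizon_le hN ht hA hH'

end Stores

end Mem

end RAM


/-! ### Agreement of the program with the labeling, and the conclusion. -/

open Schedule

namespace RAM

namespace Mem

namespace Stores

variable {m : Mem} {n : ℕ} {T : WTree n}

theorem exists_lt_iff (h : m.Stores T) {Q : ℕ → Prop} : (∃ u < m.n, Q u) ↔ ∃ u : Fin n, Q u := by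
  rw [h.n_eq]
  exact ⟨fun ⟨u, h1, h2⟩ => ⟨⟨u, h1⟩, h2⟩, fun ⟨u, h1⟩ => ⟨u, u.2, h1⟩⟩

theorem forall_lt_iff (h : m.Stores T) {Q : ℕ → Prop} : (∀ u < m.n, Q u) ↔ ∀ u : Fin n, Q u := by
  rw [h.n_eq]
  exact ⟨fun h u => h u u.2, fun h u hu => h ⟨u, hu⟩⟩

theorem isBtw_iff (h : m.Stores T) {u y x : Fin n} : m.IsBtw u y x ↔ T.Btw u y x := by
  simp only [IsBtw, WTree.btw_iff, h.forall_lt_iff, h.anc_iff]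

theorem isAdj_iff (h : m.Stores T) {u v : Fin n} : m.IsAdj u v ↔ T.graph.Adj u v := by
  simp only [IsAdj, WTree.adj_iff, h.par_eq, h.root_eq, ne_eq, Fin.val_inj]

end Stores

/-- The labeling `P` is the one that the program computes. -/
structure Computes (m : Mem) {n : ℕ} (P : Labeling n) : Prop extends m.Stores P.T where
  d_eq : ∀ v, P.d v = m.dur v
  H_eq : P.H = m.horizon
  W_eq : P.W = m.width m.horizon
  D_eq : P.D = m.windows
  lab_eq : ∀ v, P.lab v = m.lab v

namespace Computes

open Labeling

variable {m : Mem} {n : ℕ} {P : Labeling n}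

theorem key_eq (h : m.Computes P) (v : Fin n) : m.key v = P.key v := by
  rw [Mem.key, Labeling.key, h.d_eq, h.H_eq, h.W_eq, h.D_eq, h.lab_eq, h.depth_eq, h.n_eq]

theorem rank_eq (h : m.Computes P) (v : Fin n) : m.rank v = rankOf P.key v := by
  rw [Mem.rank, h.key_eq, h.n_eq, rankOf]

theorem isQueried_iff (h : m.Computes P) {x q : Fin n} :
    m.IsQueried x q ↔ P.T.Queried (rankOf P.key) x q := by
  simp only [IsQueried, WTree.Queried, WTree.RankMin, h.forall_lt_iff, h.exists_lt_iff, h.isBtw_iff,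
    h.isAdj_iff, h.rank_eq, Fin.val_inj]

theorem isShort_iff (h : m.Computes P) : m.IsShort ↔ P.Short m.c := by
  rw [IsShort, Short, h.W_eq, h.n_eq]

theorem num_eq (h : m.Computes P) : m.num = P.num m.c m.L := by
  classical
  rw [Mem.num, Labeling.num, pick_eq, h.W_eq, h.n_eq]
  exact if_congr h.isShort_iff rfl rfl

theorem den_eq (h : m.Computes P) : m.den = P.den m.c m.L := by
  classical
  rw [Mem.den, Labeling.den, pick_eq, h.n_eq]
  exact if_congr h.isShort_iff rfl rfl

theorem lightCount_eq (h : m.Computes P) (x : Fin n) :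
    m.lightCount x = P.lightCount m.c m.L x := by
  classical
  rw [Mem.lightCount, Labeling.lightCount, h.sum_range, Finset.card_filter, WTree.querySet,
    Finset.sum_filter]
  refine Finset.sum_congr rfl fun q _ => ?_
  rw [pick_eq, ← ite_and]
  refine if_congr ?_ rfl rfl
  rw [h.isQueried_iff, h.w_eq, h.anc_iff, h.num_eq, h.den_eq]

theorem queriedSum_eq (h : m.Computes P) (x : Fin n) :
    m.queriedSum x = ∑ q ∈ P.T.querySet (rankOf P.key) x, (P.d q - 1) := by
  classical
  rw [Mem.queriedSum, h.sum_range, WTree.querySet, Finset.sum_filter]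
  refine Finset.sum_congr rfl fun q _ => ?_
  rw [pick_eq, h.d_eq]
  exact if_congr h.isQueried_iff rfl rfl

theorem isCostly_iff (h : m.Computes P) : m.IsCostly ↔ P.Test m.c m.L := by
  simp only [IsCostly, Test, h.exists_lt_iff, h.lightCount_eq, h.queriedSum_eq, h.num_eq]

theorem exists_heaviest (h : m.Computes P) (hN : P.T.Normalized) :
    ∃ z : Fin n, m.heaviest = z ∧ P.T.weight z = 1 := by
  obtain ⟨v, hv⟩ := hN.2
  obtain ⟨h1, h2, -⟩ := least_spec (b := m.n) (P := fun v => ¬ m.w v * (1 : ℕ) < (1 : ℕ))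
    ⟨v, by rw [h.n_eq]; exact v.2, by rw [h.w_eq, hv]; simp⟩
  change m.heaviest < m.n at h1
  change ¬ m.w m.heaviest * (1 : ℕ) < (1 : ℕ) at h2
  rw [h.n_eq] at h1
  refine ⟨⟨m.heaviest, h1⟩, rfl, le_antisymm (hN.1 _) ?_⟩
  rw [← h.w_eq]
  simpa using h2

theorem pivot_eq (h : m.Computes P) {z : Fin n} (hz : m.heaviest = z) : m.pivot = P.pivot z := by
  classical
  rw [Mem.pivot, Labeling.pivot, hz, pick_eq, h.par_eq]
  simp only [h.exists_lt_iff, h.isAdj_iff, h.rank_eq]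
  split_ifs <;> rfl

theorem prefixLength_eq (h : m.Computes P) : m.prefixLength = P.prefixLength m.c m.L := by
  classical
  rw [Mem.prefixLength, Labeling.prefixLength, h.num_eq, h.den_eq]
  have e : ∀ k, m.prefixSum k = ∑ v : Fin n with v.1 < k, (P.d v - 1) := fun k => by
    rw [Mem.prefixSum, h.sum_range, Finset.sum_filter]
    exact Finset.sum_congr rfl fun v _ => by rw [pick_eq, h.d_eq]
  simp only [e, h.n_eq]

theorem finalKey_eq (h : m.Computes P) {z : Fin n} (hz : m.heaviest = z) (v : Fin n) :
    m.finalKey v = P.finalKey m.c m.L z v := by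
  classical
  rw [Mem.finalKey, Labeling.finalKey, Labeling.baseKey, h.pivot_eq hz, h.num_eq, h.den_eq,
    h.prefixLength_eq, h.key_eq, h.depth_eq, h.D_eq, h.n_eq]
  simp only [pick_eq, h.isShort_iff, h.isCostly_iff, h.anc_iff]

theorem finalRank_eq (h : m.Computes P) {z : Fin n} (hz : m.heaviest = z) (v : Fin n) :
    m.finalRank v = rankOf (P.finalKey m.c m.L z) v := by
  rw [Mem.finalRank, h.finalKey_eq hz, h.n_eq, rankOf]

/-- The array `1` holds the vertices in the final order. -/
theorem exists_list (h : m.Computes P) {z : Fin n} (hz : m.heaviest = z) :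
    ∃ l : List (Fin n), l.map Fin.val = (List.range m.n).map m.order ∧
      (l.Pairwise fun a b => rankOf (P.finalKey m.c m.L z) a < rankOf (P.finalKey m.c m.L z) b) ∧
      ∀ v, v ∈ l := by
  classical
  set rk := rankOf (P.finalKey m.c m.L z)
  have hpos : ∀ v : Fin n, m.position v = (Finset.univ.filter fun u => rk u < rk v).card := by
    intro v
    rw [Mem.position, h.sum_range, Finset.card_filter]
    exact Finset.sum_congr rfl fun u _ => by rw [pick_eq, h.finalRank_eq hz, h.finalRank_eq hz]
  have hmono : ∀ u v : Fin n, rk u < rk v → m.position u < m.position v := by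
    intro u v huv
    rw [hpos, hpos]
    refine Finset.card_lt_card (Finset.ssubset_iff_of_subset (fun a ha => ?_) |>.2 ⟨u, ?_, ?_⟩)
    · simp only [Finset.mem_filter, Finset.mem_univ, true_and] at ha ⊢
      omega
    · simpa using huv
    · simp
  have hlt : ∀ v : Fin n, m.position v < n := fun v => by
    rw [hpos]
    refine (Finset.card_lt_card (Finset.filter_ssubset.2 ⟨v, Finset.mem_univ _, ?_⟩)).trans_eq
      (by simp)
    exact lt_irrefl _
  -- Ranks are distinct, so counting smaller ranks is a permutation; `order` is its inverse.
  let f : Fin n → Fin n := fun v => ⟨m.position v, hlt v⟩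
  have hinj : Function.Injective f := fun u v huv => by
    have e : m.position u = m.position v := congrArg Fin.val huv
    rcases lt_trichotomy (rk u) (rk v) with h1 | h1 | h1
    · exact absurd e (hmono _ _ h1).ne
    · exact rankOf_injective _ h1
    · exact absurd e (hmono _ _ h1).ne'
  let e := Equiv.ofBijective f (Finite.injective_iff_bijective.1 hinj)
  have he : ∀ i, m.position (e.symm i) = i := fun i => congrArg Fin.val (e.apply_symm_apply i)
  refine ⟨List.ofFn e.symm, ?_, ?_, fun v => ?_⟩
  · rw [h.n_eq]
    refine List.ext_getElem (by simp) fun i h1 h2 => ?_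
    simp only [List.getElem_map, List.getElem_ofFn, List.getElem_range]
    have hi : i < n := by simpa using h1
    symm
    refine least_eq (by rw [h.n_eq]; exact (e.symm ⟨i, hi⟩).2.le) (fun j hj hji => ?_)
      fun _ => he ⟨i, hi⟩
    have hjn : j < n := hj.trans (e.symm ⟨i, hi⟩).2
    have : e ⟨j, hjn⟩ = ⟨i, hi⟩ := Fin.ext hji
    rw [← this, Equiv.symm_apply_apply] at hj
    exact lt_irrefl _ hj
  · rw [List.pairwise_ofFn]
    intro i j hij
    by_contra hle
    rcases (not_lt.1 hle).lt_or_eq with h1 | h1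
    · have := hmono _ _ h1
      rw [he, he] at this
      exact absurd this (by rw [not_lt]; exact hij.le)
    · exact hij.ne' (e.symm.injective (rankOf_injective _ h1))
  · rw [List.mem_ofFn]
    exact ⟨e v, e.symm_apply_apply v⟩

end Computes

/-- The memory that contains the input. -/
noncomputable def ofTree (c L : ℕ) {n : ℕ} (T : WTree n) : Mem where
  n := n
  c := c
  L := L
  root := T.root
  par v := if h : v < n then T.parent ⟨v, h⟩ else 0
  w v := if h : v < n then T.weight ⟨v, h⟩ else 0
  arr _ _ := 0

theorem rep_ofTree (c L : ℕ) {n : ℕ} (T : WTree n) :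
    Rep (ofTree c L T) (fun _ => 0) (input c L T) where
  n := rfl
  c := rfl
  L := rfl
  root := rfl
  par _ _ := rfl
  var i := by
    rw [show (ofTree c L T).n + (4 + 2 * i) = (n + 2 * i) + 4 by rw [ofTree]; ring]
    exact dif_neg (by omega)
  arr j _ i := by
    rw [show (ofTree c L T).n + (5 + 2 * j) + 4 * i = (n + 1 + 2 * j + 4 * i) + 4 by
      rw [ofTree]; ring]
    exact dif_neg (by omega)
  w _ := rfl

theorem stores_ofTree {c L : ℕ} (hc : 1 ≤ c) (hL : 1 ≤ L) {n : ℕ} {T : WTree n}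
    (hN : T.Normalized) (hS : T.StarCondition) : (ofTree c L T).Stores T where
  wf := ⟨hc, hL, WTree.two_le hN hS, fun _ hv => dif_neg (not_lt.2 hv)⟩
  n_eq := rfl
  root_eq := rfl
  par_eq v := dif_pos v.2
  w_eq v := dif_pos v.2

theorem Stores.setArr {m : Mem} {n : ℕ} {T : WTree n} (h : m.Stores T) (j : ℕ) (a : ℕ → ℕ) :
    (m.setArr j a).Stores T :=
  ⟨h.wf.setArr j a, h.n_eq, h.root_eq, h.par_eq, h.w_eq⟩

theorem Stores.computes_labeling {m : Mem} {n : ℕ} {T : WTree n} (h : m.Stores T)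
    (hN : T.Normalized) (ht : ∀ k < m.tableSize, m.arr 0 k = m.table k) :
    m.Computes (h.labeling hN ht) :=
  { toStores := h, d_eq := fun _ => rfl, H_eq := rfl, W_eq := rfl, D_eq := rfl,
    lab_eq := fun _ => rfl }

/-- The recursion for `table` starts from the input and never looks at the arrays, so storing the
table does not change it. -/
theorem table_setArr (m : Mem) (a : ℕ → ℕ) (k : ℕ) : (m.setArr 0 a).table k = m.table k := by
  induction k using Nat.strong_induction_on with
  | _ k ih =>
  have e : (fun i => if _h : i < k then (m.setArr 0 a).table i else 0) =
      fun i => if _h : i < k then m.table i else 0 := by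
    funext i
    split_ifs with h
    exacts [ih i h, rfl]
  rw [table, table, e]
  rfl

end Mem

end RAM

theorem mainTheorem3 :
    ∃ (P : RAM.Cmd) (γ : ℕ), ∀ c L : ℕ, 1 ≤ c → 1 ≤ L →
      ∀ (n : ℕ) (T : WTree n), T.Normalized → T.StarCondition →
        ∃ (t : ℕ) (s : RAM.State) (S : Fin n → List (Fin n)) (ω : ℝ),
          RAM.Runs P (RAM.input c L T) t s ∧
          t ≤ (c * n) ^ (γ * L) ∧
          s.Outputs S ω ∧
          T.IsStable S ∧
          0 < ω ∧
          ω ≤ (1 / (L : ℝ)) * T.modCost ω c (T.inducedQueries S) ∧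
          T.modCost ω c (T.inducedQueries S) ≤ (1 + 12 / (c : ℝ)) * T.opt := by
  obtain ⟨p1, K1, hp1⟩ := RAM.exists_fill_table
  obtain ⟨p2, K2, hp2⟩ := RAM.exists_fill_order
  obtain ⟨p3, K3, hp3⟩ := RAM.exists_output RAM.cmp_num.cmp RAM.cmp_den.cmp
  -- The running time is a fixed power of `lim`, and `lim = (c n) ^ (20000 * L)`; the factor 20000
  -- therefore becomes part of `γ`.
  refine ⟨.seq p1 (.seq p2 p3), 20000 * (K1 + (K2 + K3 + 1) + 1), fun c L hc hL n T hN hS => ?_⟩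
  have h0 := RAM.Mem.stores_ofTree hc hL hN hS
  set m := RAM.Mem.ofTree c L T
  have hB := h0.wf.two_le_lim
  have hrun : RAM.Ends (.seq p1 (.seq p2 p3)) (RAM.input c L T)
      (m.lim ^ (K1 + (K2 + K3 + 1) + 1)) fun s => ∃ a b : ℕ → ℕ,
        (∀ k < m.tableSize, a k = m.table k) ∧ (∀ k < m.n, b k = (m.setArr 0 a).order k) ∧
        s.reals 0 = ((m.setArr 0 a).num : ℝ) / (m.setArr 0 a).den ∧
        ∀ v < m.n, s.ListAt (s.nats v) ((List.range m.n).map b) := by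
    refine ((hp1 m _ _ h0.wf (RAM.Mem.rep_ofTree c L T)).seq fun s1 h1 => ?_).mono
      (RAM.pow_add_pow_le hB) fun _ h => h
    obtain ⟨ρ1, a, hr1, ha⟩ := h1
    refine ((hp2 _ _ _ (h0.wf.setArr 0 a) hr1).seq fun s2 h2 => ?_).mono
      (RAM.pow_add_pow_le hB) fun _ h => h
    obtain ⟨ρ2, b, hr2, hb⟩ := h2
    refine (hp3 _ _ _ ((h0.wf.setArr 0 a).setArr 1 b) hr2).mono le_rfl fun s h3 =>
      ⟨a, b, ha, hb, ?_, ?_⟩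
    · simpa using h3.1
    · exact h3.2
  obtain ⟨t, s, hruns, ht, a, b, ha, hb, hω, hlist⟩ := hrun
  have h1 := h0.setArr 0 a
  have htab : ∀ k < (m.setArr 0 a).tableSize, (m.setArr 0 a).arr 0 k = (m.setArr 0 a).table k :=
    fun k hk => by
      rw [RAM.Mem.table_setArr]
      exact ha k hk
  have hcomp := h1.computes_labeling hN htab
  have hopt := h1.isOptimal_labeling hN htab hS
  obtain ⟨z, hz, hz1⟩ := hcomp.exists_heaviest hN
  obtain ⟨l, hl1, hl2, hl3⟩ := hcomp.exists_list hz
  have hbounds := hopt.modCost_bounds hz1 hl2 hl3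
  have hpos := hopt.omega_pos
  rw [← hcomp.num_eq, ← hcomp.den_eq] at hbounds hpos
  refine ⟨t, s, fun _ => l, _, hruns, ht.trans_eq ?_, ⟨hω, fun v => ?_⟩,
    WTree.isStable_const (Labeling.rankOf_injective _) hl2 hl3, hpos, hbounds⟩
  · change ((c * n) ^ (20000 * L)) ^ _ = _
    rw [← pow_mul]
    congr 1
    ring
  · rw [hl1]
    have e : (List.range m.n).map b = (List.range m.n).map (m.setArr 0 a).order :=
      List.map_congr_left fun k hk => hb k (List.mem_range.1 hk)
    have h2 := hlist v v.2
    rw [e] at h2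
    exact h2
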